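/- **Setting.** Fix an integer $d\ge 1$. Let $Y_d=\{(l_1,l_2)\in\mathbb Z^2:0\le l_2<l_1\le d\}$ and let $\mathbb G_0^\#=\mathbb R^{Y_d}$ carry the group law $[x\cdot y]_{l_10}=x_{l_10}+y_{l_10}$ and $[x\cdot y]_{l_1l_2}=x_{l_1l_2}+y_{l_1l_2}+x_{l_10}y_{l_20}$ if $l_2\ge 1$; let $\mathbb G_0=\mathbb G_0^\#\cap\mathbb Z^{Y_d}$, with counting measure. Let $A_0:\mathbb R\to\mathbb G_0^\#$, $[A_0(x)]_{l_10}=x^{l_1}$, $[A_0(x)]_{l_1l_2}=0$ if $l_2\ge 1$. For $x,y\in\mathbb R^r$ put $$D(x,y)=A_0(x_1)^{-1}A_0(y_1)\cdots A_0(x_r)^{-1}A_0(y_r),\qquad \widetilde D(x,y)=A_0(x_1)A_0(y_1)^{-1}\cdots A_0(x_r)A_0(y_r)^{-1}.$$ Let $\eta_0:\mathbb R\to[0,1]$ be smooth and even, supported in $[-2,2]$ and equal to $1$ on $[-1,1]$; let $\eta_j(t)=\eta_0(2^{-j}t)-\eta_0(2^{-j+1}t)$ for $j\ge 1$. Let $K:\mathbb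 R\to\mathbb R$ be a Calderón–Zygmund kernel: $K\in C^1$, $\sup_t[(1+|t|)|K(t)|+(1+|t|)^2|K'(t)|]\le 1$ and $\sup_{N\ge 0}|\int_{-N}^NK|\le 1$. For $j\ge 1$ let $$K_j(t)=K(t)\eta_j(t)+c_j2^{-j}\eta_j(t)-c_{j+1}2^{-j-1}\eta_{j+1}(t),\qquad c_j=2\Big(\int_{\mathbb R} K(t)\sum_{k=0}^{j-1}\eta_k(t)\,dt\Big)\Big(\int_{\mathbb R}\eta_0(t)\,dt\Big)^{-1},$$ and let $H_j$ be the operator on $L^2(\mathbb G_0)$ given by $(H_jf)(g)=\sum_{n\in\mathbb Z}K_j(n)f(A_0(n)^{-1}\cdot g)$, with adjoint $H_j^*$. For $1\le q<\infty$ let $Z_q=\{1,\dots,q\}$. For $R\ge 1$ let $\mathcal S_R$ be the set of fractions $a/q=(a_{l_1l_2}/q)_{(l_1,l_2)\in Y_d}$ with $1\le q\le R$, $a\in Z_q^{Y_d}$, such that $q$ and the entries of $a$ have no common factor $>1$. Let $$S(a/q)=q^{-2r}\sum_{v,w\in Z_q^r}e^{-2\pi iD(v,w)\cdot a/q},\qquad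 \widetilde S(a/q)=q^{-2r}\sum_{v,w\in Z_q^r}e^{-2\pi i\widetilde D(v,w)\cdot a/q}.$$ **Proposition.** There is $\overline C_0=\overline C_0(d)>0$ such that the following holds for every $\overline C\ge\overline C_0$ and all $\epsilon$, $\kappa\in\mathbb R$, $r\in\{2^s:s=0,1,2,\dots\}$ with $$\epsilon=\overline C^{-1}(10d)^{-10},\qquad -2\overline C+r\epsilon/(2\overline C)\ge(10d)^{10},\qquad \kappa r^2=1.$$ For every $\eta_0$ as above there are constants $C_1,C_2$, depending only on $d,\overline C,r,\eta_0$ (hence not on $K$, $J$, $j_i$, $k_i$), such that for every Calderón–Zygmund kernel $K$ as above, every real $J\ge C_1$ and all integers $j_1,k_1,\dots,j_r,k_r\in[(1-\kappa)J,J]$ there are functions $E,\widetilde E:\mathbb G_0\to\mathbb C$ with $$\|E\|_{L^1(\mathbb G_0)}+\|\widetilde E\|_{L^1(\mathbb G_0)}\le C_2\,2^{-J/4}$$ and, for all $F\in L^2(\mathbb G_0)$ and $g\in\mathbb G_0$, $$(H_{j_1}^*H_{k_1}\cdots H_{j_r}^*H_{k_r}F)(g)=\sum_{h\in\mathbb G_0}[\mathcal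 K(h)+E(h)]F(h^{-1}\cdot g),$$ $$(H_{j_1}H_{k_1}^*\cdots H_{j_r}H_{k_r}^*F)(g)=\sum_{h\in\mathbb G_0}[\widetilde{\mathcal K}(h)+\widetilde E(h)]F(h^{-1}\cdot g).$$ Here, with $G(x,y)=\prod_{i=1}^rK_{j_i}(x_i)K_{k_i}(y_i)$ and $\widetilde\eta_{\le\lambda}(h)=\prod_{(l_1,l_2)\in Y_d}\eta_0(h_{l_1l_2}/2^{\lambda(l_1+l_2)})$, $$\mathcal K(h)=\widetilde\eta_{\le J+\epsilon J}(h)\sum_{a/q\in\mathcal S_{2^{3d^2\epsilon J}}}e^{2\pi ih\cdot a/q}S(a/q)\int_{\mathbb R^{Y_d}}\int_{\mathbb R^r\times\mathbb R^r}\prod_{(l_1,l_2)\in Y_d}\eta_0(2^{J(l_1+l_2-2\epsilon)}\beta_{l_1l_2})\,G(x,y)\,e^{2\pi i(h-D(x,y))\cdot\beta}\,dx\,dy\,d\beta,$$ and $\widetilde{\mathcal K}$ is given by the same formula with $\widetilde S,\widetilde D$ in place of $S,D$; in $(h-D(x,y))\cdot\beta$ and $h\cdot a/q$ the points are regarded as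 vectors of $\mathbb R^{Y_d}$. -/

import Mathlib

open scoped ContDiff

noncomputable section

namespace DiscreteRadon

/-- The pairs `(l₁, l₂)` of integers with `0 ≤ l₂ < l₁ ≤ d`. -/
def pairs (d : ℕ) : Finset (ℕ × ℕ) :=
  (Finset.range (d + 1) ×ˢ Finset.range (d + 1)).filter fun l => l.2 < l.1

theorem mem_pairs {d : ℕ} {l : ℕ × ℕ} : l ∈ pairs d ↔ l.2 < l.1 ∧ l.1 ≤ d := by
  simp only [pairs, Finset.mem_filter, Finset.mem_product, Finset.mem_range]
  omega

/-- The index set `Y_d`. -/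
abbrev Y (d : ℕ) : Type := {l : ℕ × ℕ // l ∈ pairs d}

/-- The homogeneous degree `l₁ + l₂` of the coordinate `(l₁, l₂)`. -/
def deg {d : ℕ} (l : Y d) : ℕ := l.1.1 + l.1.2

/-- The index `(l₁, 0)`. -/
def Y.left {d : ℕ} (l : Y d) : Y d :=
  ⟨(l.1.1, 0), by have := mem_pairs.1 l.2; exact mem_pairs.2 ⟨by simp; omega, this.2⟩⟩

/-- The index `(l₂, 0)`, for `l₂ ≠ 0`. -/
def Y.right {d : ℕ} (l : Y d) (h : l.1.2 ≠ 0) : Y d :=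
  ⟨(l.1.2, 0), by have := mem_pairs.1 l.2; exact mem_pairs.2 ⟨by simp; omega, by simp; omega⟩⟩

/-- The universal step two nilpotent group with coordinates in `R`: for `R = ℝ` it is
`𝔾₀^#(d)`, for `R = ℤ` it is its discrete subgroup `𝔾₀(d)` of points with integer coordinates. -/
@[ext] structure G0 (d : ℕ) (R : Type*) where
  coord : Y d → R

namespace G0

variable {d : ℕ} {R : Type*} [CommRing R]

instance : Mul (G0 d R) where
  mul x y := ⟨fun l =>
    if h : l.1.2 = 0 then x.coord l + y.coord l
    else x.coord l + y.coord l + x.coord l.left * y.coord (l.right h)⟩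

instance : One (G0 d R) where
  one := ⟨fun _ => 0⟩

instance : Inv (G0 d R) where
  inv x := ⟨fun l =>
    if h : l.1.2 = 0 then - x.coord l
    else - x.coord l + x.coord l.left * x.coord (l.right h)⟩

theorem mul_coord (x y : G0 d R) (l : Y d) : (x * y).coord l =
    if h : l.1.2 = 0 then x.coord l + y.coord l
    else x.coord l + y.coord l + x.coord l.left * y.coord (l.right h) := rfl

theorem one_coord (l : Y d) : (1 : G0 d R).coord l = 0 := rfl

theorem inv_coord (x : G0 d R) (l : Y d) : (x⁻¹).coord l =
    if h : l.1.2 = 0 then - x.coord l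
    else - x.coord l + x.coord l.left * x.coord (l.right h) := rfl

instance : Group (G0 d R) :=
  Group.ofLeftAxioms
    (by
      intro x y z
      ext l
      by_cases h : l.1.2 = 0
      · simp [mul_coord, h, add_assoc]
      · simp [mul_coord, h, Y.left, Y.right]
        ring)
    (by
      intro x
      ext l
      by_cases h : l.1.2 = 0
      · simp [mul_coord, one_coord, h]
      · simp [mul_coord, one_coord, h])
    (by
      intro x
      ext l
      by_cases h : l.1.2 = 0
      · simp [mul_coord, one_coord, inv_coord, h]
      · simp [mul_coord, one_coord, inv_coord, h, Y.left, Y.right])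

end G0

/-- The polynomial map `A₀`. -/
def A0 (d : ℕ) {R : Type*} [CommRing R] (x : R) : G0 d R :=
  ⟨fun l => if l.1.2 = 0 then x ^ l.1.1 else 0⟩

/-- `D(x, y) = A₀(x₁)⁻¹ A₀(y₁) ⋯ A₀(x_r)⁻¹ A₀(y_r)`. -/
def D (d : ℕ) {R : Type*} [CommRing R] {r : ℕ} (x y : Fin r → R) : G0 d R :=
  (List.ofFn fun i => (A0 d (x i))⁻¹ * A0 d (y i)).prod

/-- `D̃(x, y) = A₀(x₁) A₀(y₁)⁻¹ ⋯ A₀(x_r) A₀(y_r)⁻¹`. -/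
def Dtilde (d : ℕ) {R : Type*} [CommRing R] {r : ℕ} (x y : Fin r → R) : G0 d R :=
  (List.ofFn fun i => A0 d (x i) * (A0 d (y i))⁻¹).prod

/-- Calderón–Zygmund kernels, normalized with constant `1`. -/
structure IsCalderonZygmund (K : ℝ → ℝ) : Prop where
  contDiff : ContDiff ℝ 1 K
  bound : ∀ t : ℝ, (1 + |t|) * |K t| + (1 + |t|) ^ 2 * |deriv K t| ≤ 1
  cancel : ∀ N : ℝ, 0 ≤ N → |∫ t in (-N)..N, K t| ≤ 1

/-- Smooth even functions `ℝ → [0, 1]`, supported in `[-2, 2]` and equal to `1` on `[-1, 1]`. -/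
structure IsCutoff (η₀ : ℝ → ℝ) : Prop where
  contDiff : ContDiff ℝ ∞ η₀
  even : ∀ t, η₀ (-t) = η₀ t
  mem_Icc : ∀ t, η₀ t ∈ Set.Icc (0 : ℝ) 1
  eq_one : ∀ t, |t| ≤ 1 → η₀ t = 1
  eq_zero : ∀ t, 2 < |t| → η₀ t = 0

/-- The dyadic pieces `η_j` of the partition of unity; `η₀` is the cutoff itself. -/
def eta (η₀ : ℝ → ℝ) : ℕ → ℝ → ℝ
  | 0, t => η₀ t
  | j + 1, t => η₀ (t / 2 ^ (j + 1)) - η₀ (t / 2 ^ j)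

/-- The constants `c_j`. -/
def cconst (η₀ K : ℝ → ℝ) (j : ℕ) : ℝ :=
  2 * (∫ t, K t * ∑ k ∈ Finset.range j, eta η₀ k t) * (∫ t, η₀ t)⁻¹

/-- The dyadic kernels `K_j`, for `j ≥ 1`. -/
def dyadicKernel (η₀ K : ℝ → ℝ) (j : ℕ) (t : ℝ) : ℝ :=
  K t * eta η₀ j t + cconst η₀ K j * ((2 : ℝ) ^ j)⁻¹ * eta η₀ j t
    - cconst η₀ K (j + 1) * ((2 : ℝ) ^ (j + 1))⁻¹ * eta η₀ (j + 1) t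

theorem eta_eq_zero {η₀ : ℝ → ℝ} (hη : IsCutoff η₀) (j : ℕ) {t : ℝ}
    (ht : (2 : ℝ) ^ (j + 1) < |t|) : eta η₀ j t = 0 := by
  cases j with
  | zero => exact hη.eq_zero t (by simpa using ht)
  | succ j =>
    have h1 : (2 : ℝ) < |t / 2 ^ (j + 1)| := by
      rw [abs_div, abs_of_pos (by positivity : (0 : ℝ) < 2 ^ (j + 1)), lt_div_iff₀ (by positivity)]
      calc (2 : ℝ) * 2 ^ (j + 1) = 2 ^ (j + 1 + 1) := by ring
        _ < |t| := ht
    have h2 : (2 : ℝ) < |t / 2 ^ j| := by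
      refine h1.trans_le ?_
      rw [abs_div, abs_div, abs_of_pos (by positivity : (0 : ℝ) < 2 ^ (j + 1)),
        abs_of_pos (by positivity : (0 : ℝ) < 2 ^ j)]
      gcongr
      · norm_num
      · omega
    simp [eta, hη.eq_zero _ h1, hη.eq_zero _ h2]

theorem dyadicKernel_eq_zero {η₀ : ℝ → ℝ} (hη : IsCutoff η₀) (K : ℝ → ℝ) (j : ℕ) {t : ℝ}
    (ht : (2 : ℝ) ^ (j + 2) < |t|) : dyadicKernel η₀ K j t = 0 := by
  have h : (2 : ℝ) ^ (j + 1) < |t| :=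
    lt_of_le_of_lt (pow_le_pow_right₀ (by norm_num) (by omega)) ht
  simp [dyadicKernel, eta_eq_zero hη j h, eta_eq_zero hη (j + 1) ht]

/-- The complex Hilbert space `L²(𝔾₀)`, with respect to counting measure. -/
abbrev L2 (d : ℕ) : Type := lp (fun _ : G0 d ℤ => ℂ) 2

/-- The translation `F ↦ F(a⁻¹ · )` as an isometry of `L²(𝔾₀)`. -/
def translate {d : ℕ} (a : G0 d ℤ) : L2 d →ₗᵢ[ℂ] L2 d where
  toFun F := ⟨fun g => F (a⁻¹ * g), by
    have hF := (memℓp_gen_iff (p := 2) (by norm_num)).1 (lp.memℓp F)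
    exact memℓp_gen ((Equiv.mulLeft a⁻¹).summable_iff.2 hF)⟩
  map_add' F G := by ext g; rfl
  map_smul' c F := by ext g; rfl
  norm_map' F := by
    rw [lp.norm_eq_tsum_rpow (by norm_num), lp.norm_eq_tsum_rpow (by norm_num)]
    congr 1
    exact (Equiv.mulLeft a⁻¹).tsum_eq fun g => ‖F g‖ ^ (2 : ENNReal).toReal

theorem translate_apply {d : ℕ} (a : G0 d ℤ) (F : L2 d) (g : G0 d ℤ) :
    translate a F g = F (a⁻¹ * g) := rfl

/-- The operator `H_j` on `L²(𝔾₀)`. The sum has finite support, see `H_apply`. -/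
def H (d : ℕ) (η₀ K : ℝ → ℝ) (j : ℕ) : L2 d →L[ℂ] L2 d :=
  ∑ᶠ n : ℤ, (dyadicKernel η₀ K j n : ℂ) • (translate (A0 d n)).toContinuousLinearMap

theorem finite_support_dyadicKernel {η₀ : ℝ → ℝ} (hη : IsCutoff η₀) (K : ℝ → ℝ) (j : ℕ) :
    {n : ℤ | dyadicKernel η₀ K j n ≠ 0}.Finite := by
  refine (Set.finite_Icc (-(2 : ℤ) ^ (j + 2)) (2 ^ (j + 2))).subset fun n hn => ?_
  by_contra h
  refine hn (dyadicKernel_eq_zero hη K j ?_)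
  rw [Set.mem_Icc, ← abs_le, not_le] at h
  exact_mod_cast h

theorem H_apply {d : ℕ} {η₀ : ℝ → ℝ} (hη : IsCutoff η₀) (K : ℝ → ℝ) (j : ℕ) (F : L2 d)
    (g : G0 d ℤ) :
    HasSum (fun n : ℤ => (dyadicKernel η₀ K j n : ℂ) * F ((A0 d n)⁻¹ * g))
      (H d η₀ K j F g) := by
  have hfin := finite_support_dyadicKernel hη K j
  have h1 : H d η₀ K j = ∑ n ∈ hfin.toFinset,
      (dyadicKernel η₀ K j n : ℂ) • (translate (A0 d n)).toContinuousLinearMap := by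
    refine finsum_eq_sum_of_support_subset _ fun n hn => ?_
    simp only [Set.Finite.coe_toFinset, Set.mem_ofPred_eq]
    intro h0
    exact hn (by simp [h0])
  have h2 : H d η₀ K j F g = ∑ n ∈ hfin.toFinset,
      (dyadicKernel η₀ K j n : ℂ) * F ((A0 d n)⁻¹ * g) := by
    rw [h1, _root_.sum_apply, lp.coeFn_sum, Finset.sum_apply]
    rfl
  rw [h2]
  refine hasSum_sum_of_ne_finset_zero fun n hn => ?_
  have : dyadicKernel η₀ K j n = 0 := by simpa using hn
  simp [this]

/-- `H_{j₁}^* H_{k₁} ⋯ H_{j_r}^* H_{k_r}`. -/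
def prodHstarH (d : ℕ) (η₀ K : ℝ → ℝ) {r : ℕ} (j k : Fin r → ℕ) : L2 d →L[ℂ] L2 d :=
  (List.ofFn fun i => ContinuousLinearMap.adjoint (H d η₀ K (j i)) * H d η₀ K (k i)).prod

/-- `H_{j₁} H_{k₁}^* ⋯ H_{j_r} H_{k_r}^*`. -/
def prodHHstar (d : ℕ) (η₀ K : ℝ → ℝ) {r : ℕ} (j k : Fin r → ℕ) : L2 d →L[ℂ] L2 d :=
  (List.ofFn fun i => H d η₀ K (j i) * ContinuousLinearMap.adjoint (H d η₀ K (k i))).prod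

/-- `e(t) = e^{2πit}`. -/
def e (t : ℝ) : ℂ := Complex.exp (2 * Real.pi * Complex.I * t)

/-- The numerators `a ∈ {1, …, q}^{Y_d}` of the irreducible fractions `a/q` with denominator `q`
in `(ℚ ∩ (0, 1])^{Y_d}`; irreducibility means that the entries of `a` have no common factor
with `q`. -/
def numerators (d q : ℕ) : Finset (Y d → ℕ) :=
  (Fintype.piFinset fun _ => Finset.Icc 1 q).filter fun a => Nat.gcd (Finset.univ.gcd a) q = 1

/-- The normalized exponential sum `q^{-2r} ∑_{v, w ∈ {1, …, q}^r} e(-Δ(v, w) · a/q)`. -/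
def expSum {d r : ℕ} (Δ : (Fin r → ℤ) → (Fin r → ℤ) → G0 d ℤ) (q : ℕ) (a : Y d → ℕ) : ℂ :=
  ((q : ℂ) ^ (2 * r))⁻¹ *
    ∑ v ∈ Fintype.piFinset (fun _ : Fin r => Finset.Icc (1 : ℤ) q),
      ∑ w ∈ Fintype.piFinset (fun _ : Fin r => Finset.Icc (1 : ℤ) q),
        e (-∑ l, ((Δ v w).coord l : ℝ) * ((a l : ℝ) / q))

/-- The cutoff `η̃_{≤ λ}(h) = ∏ η₀(h_{l₁l₂} / 2^{λ(l₁+l₂)})`. -/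
def cutoffTilde {d : ℕ} (η₀ : ℝ → ℝ) (lam : ℝ) (h : G0 d ℤ) : ℝ :=
  ∏ l : Y d, η₀ ((h.coord l : ℝ) / (2 : ℝ) ^ (lam * deg l))

/-- `G(x, y) = K_{j₁}(x₁) K_{k₁}(y₁) ⋯ K_{j_r}(x_r) K_{k_r}(y_r)`. -/
def Gfun (η₀ K : ℝ → ℝ) {r : ℕ} (j k : Fin r → ℕ) (x y : Fin r → ℝ) : ℝ :=
  ∏ i, dyadicKernel η₀ K (j i) (x i) * dyadicKernel η₀ K (k i) (y i)

/-- The oscillatory integral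
`∫_{ℝ^{Y_d}} ∫_{ℝ^r × ℝ^r} ∏ η₀(2^{J(l₁+l₂-2ε)} β_{l₁l₂}) G(x, y) e((h - Δ(x, y)) · β) dx dy dβ`. -/
def oscIntegral {d r : ℕ} (Δ : (Fin r → ℝ) → (Fin r → ℝ) → G0 d ℝ) (η₀ K : ℝ → ℝ) (ε J : ℝ)
    (j k : Fin r → ℕ) (h : G0 d ℤ) : ℂ :=
  ∫ β : Y d → ℝ, ∫ p : (Fin r → ℝ) × (Fin r → ℝ),
    ((∏ l, η₀ ((2 : ℝ) ^ (J * (deg l - 2 * ε)) * β l) : ℝ) : ℂ) * (Gfun η₀ K j k p.1 p.2 : ℂ) *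
      e (∑ l, ((h.coord l : ℝ) - (Δ p.1 p.2).coord l) * β l)

/-- The common form of the two major arc kernels, built from the polynomial map `Δ` over `ℤ` and
over `ℝ`. -/
def majorArc {d r : ℕ} (ΔZ : (Fin r → ℤ) → (Fin r → ℤ) → G0 d ℤ)
    (ΔR : (Fin r → ℝ) → (Fin r → ℝ) → G0 d ℝ) (η₀ K : ℝ → ℝ) (ε J : ℝ)
    (j k : Fin r → ℕ) (h : G0 d ℤ) : ℂ :=
  (cutoffTilde η₀ (J + ε * J) h : ℂ) *
    (∑ q ∈ Finset.Icc 1 ⌊(2 : ℝ) ^ (3 * (d : ℝ) ^ 2 * ε * J)⌋₊, ∑ a ∈ numerators d q,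
      e (∑ l, (h.coord l : ℝ) * ((a l : ℝ) / q)) * expSum ΔZ q a) *
    oscIntegral ΔR η₀ K ε J j k h

/-- The kernel `K_{j₁,k₁,…,j_r,k_r}`. -/
def majorKernel (d : ℕ) (η₀ K : ℝ → ℝ) (ε J : ℝ) {r : ℕ} (j k : Fin r → ℕ) : G0 d ℤ → ℂ :=
  majorArc (D d) (D d) η₀ K ε J j k

/-- The kernel `K̃_{j₁,k₁,…,j_r,k_r}`. -/
def majorKernelTilde (d : ℕ) (η₀ K : ℝ → ℝ) (ε J : ℝ) {r : ℕ} (j k : Fin r → ℕ) : G0 d ℤ → ℂ :=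
  majorArc (Dtilde d) (Dtilde d) η₀ K ε J j k

end DiscreteRadon

end

noncomputable section
namespace DiscreteRadon

theorem e_add (s t : ℝ) : e (s + t) = e s * e t := by
  simp only [e, ← Complex.exp_add]; congr 1; push_cast; ring

theorem e_zero : e 0 = 1 := by simp [e]

theorem e_int (n : ℤ) : e n = 1 := by
  rw [e, Complex.exp_eq_one_iff]; exact ⟨n, by push_cast; ring⟩

theorem e_add_int (t : ℝ) (n : ℤ) : e (t + n) = e t := by rw [e_add, e_int, mul_one]

theorem norm_e (t : ℝ) : ‖e t‖ = 1 := by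
  have : (2 * Real.pi * Complex.I * t : ℂ) = ((2 * Real.pi * t : ℝ) : ℂ) * Complex.I := by
    push_cast; ring
  rw [e, this, Complex.norm_exp_ofReal_mul_I]

theorem conj_e (t : ℝ) : (starRingEnd ℂ) (e t) = e (-t) := by
  simp only [e, ← Complex.exp_conj]; congr 1
  rw [map_mul, map_mul, map_mul, Complex.conj_I, Complex.conj_ofReal, Complex.conj_ofReal,
    Complex.conj_ofNat]
  push_cast; ring

theorem e_sum {ι : Type*} (s : Finset ι) (f : ι → ℝ) : e (∑ i ∈ s, f i) = ∏ i ∈ s, e (f i) := by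
  simp only [e, ← Complex.exp_sum]; congr 1; push_cast; rw [Finset.mul_sum]

theorem continuous_e : Continuous e := by unfold e; fun_prop

theorem e_eq_exp (t : ℝ) : e t = Complex.exp (((2 * Real.pi * t : ℝ) : ℂ) * Complex.I) := by
  rw [e]; congr 1; push_cast; ring

theorem norm_e_sub_one_eq (t : ℝ) : ‖e t - 1‖ = 2 * |Real.sin (Real.pi * t)| := by
  rw [e_eq_exp, mul_comm, Complex.norm_exp_I_mul_ofReal_sub_one, norm_mul, Real.norm_eq_abs,
    Real.norm_eq_abs, abs_of_pos (by norm_num : (0 : ℝ) < 2)]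
  congr 3; ring

theorem norm_e_sub_le (s t : ℝ) : ‖e s - e t‖ ≤ 2 * Real.pi * |s - t| := by
  have h : e s - e t = e t * (e (s - t) - 1) := by
    rw [mul_sub, ← e_add]; ring_nf
  rw [h, norm_mul, norm_e, one_mul, e_eq_exp, mul_comm]
  refine (Real.norm_exp_I_mul_ofReal_sub_one_le).trans ?_
  rw [Real.norm_eq_abs, abs_mul, abs_of_pos (by positivity)]

theorem four_mul_le_norm_e_sub_one {t : ℝ} (a : ℤ) (ht : |t - a| ≤ 1 / 2) :
    4 * |t - a| ≤ ‖e t - 1‖ := by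
  have h1 : e t = e (t - a) := by
    rw [← e_add_int (t - a) a]; ring_nf
  rw [h1, norm_e_sub_one_eq]
  have h2 : 2 * |t - a| ≤ |Real.sin (Real.pi * (t - a))| := by
    have := Real.mul_abs_le_abs_sin (x := Real.pi * (t - a)) (by
      rw [abs_mul, abs_of_pos Real.pi_pos]; nlinarith [Real.pi_pos])
    rw [abs_mul, abs_of_pos Real.pi_pos] at this
    calc 2 * |t - a| = 2 / Real.pi * (Real.pi * |t - a|) := by field_simp
      _ ≤ _ := this
  linarith

/-- Geometric sums. -/
theorem norm_sum_e_linear_le {α η : ℝ} (hη : 0 < η) (h : ∀ a : ℤ, η < |α - a|) (u v : ℤ) (c : ℝ) :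
    ‖∑ n ∈ Finset.Ico u v, e (α * n + c)‖ ≤ 1 / (2 * η) := by
  have hne : e α - 1 ≠ 0 := by
    intro h0
    have h1 := four_mul_le_norm_e_sub_one (t := α) (round α) (abs_sub_round α)
    rw [h0, norm_zero] at h1
    have := h (round α); linarith
  have hlow : 4 * η ≤ ‖e α - 1‖ :=
    (by have := h (round α); linarith : 4 * η ≤ 4 * |α - round α|).trans
      (four_mul_le_norm_e_sub_one (t := α) (round α) (abs_sub_round α))
  rcases le_or_gt v u with huv | huv
  · rw [Finset.Ico_eq_empty (by simpa using huv)]; simp; positivity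
  have key : (e α - 1) * ∑ n ∈ Finset.Ico u v, e (α * n + c) = e (α * v + c) - e (α * u + c) := by
    rw [Finset.mul_sum]
    have : ∀ n : ℤ, (e α - 1) * e (α * n + c) = e (α * (n + 1 : ℤ) + c) - e (α * n + c) := by
      intro n
      rw [show α * ((n + 1 : ℤ) : ℝ) + c = α + (α * n + c) by push_cast; ring, e_add α]; ring
    simp_rw [this]
    refine Int.leInduction (motive := fun v _ => ∑ n ∈ Finset.Ico u v,
      (e (α * (n + 1 : ℤ) + c) - e (α * n + c)) = e (α * v + c) - e (α * u + c)) (by simp) ?_ v huv.le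
    intro k hk ih
    have hI : Finset.Ico u (k + 1) = insert k (Finset.Ico u k) := by
      ext x; simp only [Finset.mem_Ico, Finset.mem_insert]; omega
    rw [hI, Finset.sum_insert (by simp), ih]; ring
  have h2 : ‖e α - 1‖ * ‖∑ n ∈ Finset.Ico u v, e (α * n + c)‖ ≤ 2 := by
    rw [← norm_mul, key]
    refine (norm_sub_le _ _).trans ?_
    rw [norm_e, norm_e]; norm_num
  rw [le_div_iff₀ (by positivity)]
  nlinarith [norm_nonneg (∑ n ∈ Finset.Ico u v, e (α * n + c))]

/-! ### Polynomially bounded quantities -/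

/-- Functions on `[1, ∞)` of polynomial growth. -/
def PolyBdd (F : ℝ → ℝ) : Prop := ∃ C : ℕ, 1 ≤ C ∧ ∀ K : ℝ, 1 ≤ K → |F K| ≤ C * K ^ C

theorem PolyBdd.const (c : ℝ) : PolyBdd fun _ => c := by
  refine ⟨⌈|c|⌉₊ + 1, by omega, fun K hK => ?_⟩
  have h1 : |c| ≤ ((⌈|c|⌉₊ + 1 : ℕ) : ℝ) := by push_cast; linarith [Nat.le_ceil |c|]
  have h2 : 1 ≤ K ^ (⌈|c|⌉₊ + 1) := one_le_pow₀ hK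
  nlinarith

theorem PolyBdd.id : PolyBdd fun K => K :=
  ⟨1, le_rfl, fun K hK => by simp [abs_of_pos (by linarith : (0 : ℝ) < K)]⟩

theorem PolyBdd.mul {F G : ℝ → ℝ} (hF : PolyBdd F) (hG : PolyBdd G) :
    PolyBdd fun K => F K * G K := by
  obtain ⟨C, hC, h⟩ := hF
  obtain ⟨C', hC', h'⟩ := hG
  refine ⟨C * C' + C + C', by omega, fun K hK => ?_⟩
  rw [abs_mul]
  calc |F K| * |G K| ≤ (C * K ^ C) * (C' * K ^ C') := by
        gcongr
        · exact h K hK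
        · exact h' K hK
    _ = ((C * C' : ℕ) : ℝ) * K ^ (C + C') := by push_cast; ring
    _ ≤ _ := by
      have : K ^ (C + C') ≤ K ^ (C * C' + C + C') := pow_le_pow_right₀ hK (by omega)
      have : ((C * C' : ℕ) : ℝ) ≤ ((C * C' + C + C' : ℕ) : ℝ) := by exact_mod_cast (by omega)
      gcongr

theorem PolyBdd.add {F G : ℝ → ℝ} (hF : PolyBdd F) (hG : PolyBdd G) :
    PolyBdd fun K => F K + G K := by
  obtain ⟨C, hC, h⟩ := hF
  obtain ⟨C', hC', h'⟩ := hG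
  refine ⟨C + C', by omega, fun K hK => ?_⟩
  refine (abs_add_le _ _).trans ?_
  have h1 := h K hK
  have h2 := h' K hK
  have h3 : K ^ C ≤ K ^ (C + C') := pow_le_pow_right₀ hK (by omega)
  have h4 : K ^ C' ≤ K ^ (C + C') := pow_le_pow_right₀ hK (by omega)
  push_cast
  nlinarith [mul_le_mul_of_nonneg_left h3 (Nat.cast_nonneg (α := ℝ) C),
    mul_le_mul_of_nonneg_left h4 (Nat.cast_nonneg (α := ℝ) C')]

theorem PolyBdd.pow {F : ℝ → ℝ} (hF : PolyBdd F) (n : ℕ) : PolyBdd fun K => F K ^ n := by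
  induction n with
  | zero => simpa using PolyBdd.const 1
  | succ n ih => simpa only [pow_succ] using ih.mul hF

theorem PolyBdd.exists_le {F : ℝ → ℝ} (hF : PolyBdd F) :
    ∃ C : ℕ, 1 ≤ C ∧ ∀ K : ℝ, 1 ≤ K → F K ≤ C * K ^ C := by
  obtain ⟨C, hC, h⟩ := hF
  exact ⟨C, hC, fun K hK => (le_abs_self _).trans (h K hK)⟩

/-! ### Vinogradov's lemma -/

theorem card_le_of_forall_mem_Icc {S : Finset ℤ} {x y : ℝ} (hxy : x ≤ y)
    (h : ∀ n ∈ S, x ≤ n ∧ (n : ℝ) ≤ y) : (S.card : ℝ) ≤ y - x + 1 := by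
  have hsub : S ⊆ Finset.Icc ⌈x⌉ ⌊y⌋ := fun n hn => by
    rw [Finset.mem_Icc]; exact ⟨Int.ceil_le.2 (h n hn).1, Int.le_floor.2 (h n hn).2⟩
  have h1 : (S.card : ℝ) ≤ ((Finset.Icc ⌈x⌉ ⌊y⌋).card : ℝ) := by
    exact_mod_cast Finset.card_le_card hsub
  refine h1.trans ?_
  rw [Int.card_Icc]
  rcases le_or_gt 0 (⌊y⌋ + 1 - ⌈x⌉) with h0 | h0
  · have : (((⌊y⌋ + 1 - ⌈x⌉).toNat : ℕ) : ℝ) = ((⌊y⌋ + 1 - ⌈x⌉ : ℤ) : ℝ) := by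
      exact_mod_cast Int.toNat_of_nonneg h0
    rw [this]; push_cast
    linarith [Int.floor_le y, Int.le_ceil x]
  · rw [Int.toNat_of_nonpos h0.le]; push_cast; linarith

theorem card_near_int_le_of_pos {S : Finset ℤ} {τ η R : ℝ} (hτ : 0 < τ) (hη : 0 ≤ η) (hR : 0 ≤ R)
    (hS : ∀ m ∈ S, 0 ≤ m ∧ (m : ℝ) ≤ R) (h : ∀ m ∈ S, ∃ a : ℤ, |m * τ - a| ≤ η) :
    (S.card : ℝ) ≤ (R * τ + 2 * η + 1) * (2 * η / τ + 1) := by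
  choose! f hf using h
  have hfib : ∀ a ∈ S.image f, ((S.filter fun m => f m = a).card : ℝ) ≤ 2 * η / τ + 1 := by
    intro a _
    have := card_le_of_forall_mem_Icc (S := S.filter fun m => f m = a)
      (x := (a - η) / τ) (y := (a + η) / τ) (by gcongr; linarith) (fun m hm => by
        rw [Finset.mem_filter] at hm
        have := hf m hm.1
        rw [hm.2, abs_le] at this
        rw [div_le_iff₀ hτ, le_div_iff₀ hτ]
        constructor <;> linarith)
    refine this.trans (le_of_eq ?_)
    field_simp; ring
  have himg : ((S.image f).card : ℝ) ≤ R * τ + 2 * η + 1 := by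
    have := card_le_of_forall_mem_Icc (S := S.image f) (x := -η) (y := R * τ + η)
      (by nlinarith [mul_nonneg hR hτ.le]) (fun a ha => by
        obtain ⟨m, hm, rfl⟩ := Finset.mem_image.1 ha
        have h1 := hf m hm
        rw [abs_le] at h1
        have h2 : (0 : ℝ) ≤ m := by exact_mod_cast (hS m hm).1
        have h3 := mul_le_mul_of_nonneg_right (hS m hm).2 hτ.le
        constructor <;> nlinarith [mul_nonneg h2 hτ.le])
    linarith
  have hcard : S.card = ∑ a ∈ S.image f, (S.filter fun m => f m = a).card :=
    Finset.card_eq_sum_card_fiberwise fun m hm => Finset.mem_image_of_mem f hm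
  rw [hcard]; push_cast
  refine (Finset.sum_le_sum hfib).trans ?_
  rw [Finset.sum_const, nsmul_eq_mul]
  gcongr

theorem card_near_int_le {S : Finset ℤ} {τ η R : ℝ} (hτ : τ ≠ 0) (hη : 0 ≤ η) (hR : 0 ≤ R)
    (hS : ∀ m ∈ S, 0 ≤ m ∧ (m : ℝ) ≤ R) (h : ∀ m ∈ S, ∃ a : ℤ, |m * τ - a| ≤ η) :
    (S.card : ℝ) ≤ (R * |τ| + 2 * η + 1) * (2 * η / |τ| + 1) := by
  rcases lt_or_gt_of_ne hτ with h0 | h0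
  · rw [abs_of_neg h0]
    refine card_near_int_le_of_pos (by linarith) hη hR hS fun m hm => ?_
    obtain ⟨a, ha⟩ := h m hm
    refine ⟨-a, ?_⟩
    rw [← abs_neg]; convert ha using 2; push_cast; ring
  · rw [abs_of_pos h0]
    exact card_near_int_le_of_pos h0 hη hR hS h

theorem exists_small_difference {P : ℕ} {H : Finset ℤ} (hH : ∀ h ∈ H, |h| ≤ P) {ρ : ℝ}
    (hρ : 0 < ρ) (hρ1 : ρ ≤ 1) (hcard : ρ * P ≤ H.card) (hP : 40 ≤ ρ ^ 2 * P) :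
    ∃ h ∈ H, ∃ h' ∈ H, ∃ q : ℕ, 1 ≤ q ∧ (q : ℝ) ≤ 5 / ρ ∧ h - h' = q := by
  set B : ℕ := ⌈4 / ρ⌉₊ with hB
  have hB0 : 4 / ρ ≤ B := Nat.le_ceil _
  have hB1 : (B : ℝ) < 4 / ρ + 1 := Nat.ceil_lt_add_one (by positivity)
  have hBpos : (0 : ℝ) < B := lt_of_lt_of_le (by positivity) hB0
  have hBn : 0 < B := by exact_mod_cast hBpos
  have hρP : 40 ≤ ρ * P := by nlinarith [mul_nonneg hρ.le (Nat.cast_nonneg (α := ℝ) P)]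
  have hmaps : ∀ h ∈ H, (h + P) / B ∈ Finset.Icc (0 : ℤ) (2 * P / B) := fun h hh => by
    have := abs_le.1 (hH h hh)
    rw [Finset.mem_Icc]
    exact ⟨Int.ediv_nonneg (by linarith) (by positivity),
      Int.ediv_le_ediv (by exact_mod_cast hBn) (by linarith)⟩
  have hlt : (Finset.Icc (0 : ℤ) (2 * P / B)).card < H.card := by
    have h1 : ((Finset.Icc (0 : ℤ) (2 * P / B)).card : ℝ) ≤ 2 * P / B - 0 + 1 := by
      refine card_le_of_forall_mem_Icc (by positivity) fun n hn => ?_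
      rw [Finset.mem_Icc] at hn
      refine ⟨by exact_mod_cast hn.1, ?_⟩
      rw [le_div_iff₀ hBpos]
      have := (Int.le_ediv_iff_mul_le (by exact_mod_cast hBn)).1 hn.2
      exact_mod_cast this
    have h2 : 2 * (P : ℝ) / B ≤ ρ * P / 2 := by
      rw [div_le_iff₀ hBpos]
      have : 4 ≤ B * ρ := by rwa [div_le_iff₀ hρ] at hB0
      nlinarith [mul_le_mul_of_nonneg_right this (Nat.cast_nonneg (α := ℝ) P)]
    have : ((Finset.Icc (0 : ℤ) (2 * P / B)).card : ℝ) < H.card := by linarith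
    exact_mod_cast this
  obtain ⟨h, hh, h', hh', hne, heq⟩ := Finset.exists_ne_map_eq_of_card_lt_of_maps_to hlt hmaps
  have main : ∀ h ∈ H, ∀ h' ∈ H, h' < h → (h + P) / B = (h' + P) / B →
      ∃ h ∈ H, ∃ h' ∈ H, ∃ q : ℕ, 1 ≤ q ∧ (q : ℝ) ≤ 5 / ρ ∧ h - h' = q := by
    intro h hh h' hh' hlt heq
    have hBz : (0 : ℤ) < B := by exact_mod_cast hBn
    have h1 := Int.emod_add_mul_ediv (h + P) B
    have h2 := Int.emod_add_mul_ediv (h' + P) B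
    have h3 := Int.emod_lt_of_pos (h + P) hBz
    have h4 := Int.emod_nonneg (h' + P) hBz.ne'
    rw [heq] at h1
    have h5 : h - h' < B := by linarith
    refine ⟨h, hh, h', hh', (h - h').toNat, by omega, ?_, by omega⟩
    have h6 : (((h - h').toNat : ℕ) : ℝ) ≤ B := by exact_mod_cast (by omega)
    have h7 : (1 : ℝ) ≤ 1 / ρ := by rw [le_div_iff₀ hρ]; linarith
    have : 5 / ρ = 4 / ρ + 1 / ρ := by ring
    linarith
  rcases lt_or_gt_of_ne hne with h0 | h0
  · exact main h' hh' h hh h0 heq.symm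
  · exact main h hh h' hh' h0 heq

/-- Vinogradov's lemma: if `β h` is close to an integer for many `h`, then `β` is close to a
rational with small denominator. -/
theorem vinogradov {P : ℕ} {H : Finset ℤ} (hH : ∀ h ∈ H, |h| ≤ P) {ρ η β : ℝ}
    (hρ : 0 < ρ) (hρ1 : ρ ≤ 1) (hcard : ρ * P ≤ H.card) (hη : 0 ≤ η) (hηρ : η ≤ ρ / 48)
    (hP : 40 ≤ ρ ^ 2 * P) (h : ∀ h ∈ H, ∃ a : ℤ, |β * h - a| ≤ η) :
    ∃ q : ℕ, ∃ a : ℤ, 1 ≤ q ∧ (q : ℝ) ≤ 5 / ρ ∧ |q * β - a| ≤ 80 * η / (ρ ^ 2 * P) := by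
  obtain ⟨h₁, hh₁, h₂, hh₂, q, hq1, hq, hqe⟩ := exists_small_difference hH hρ hρ1 hcard hP
  have hq0 : (0 : ℝ) < q := by exact_mod_cast hq1
  have hqz : (0 : ℤ) < q := by exact_mod_cast hq1
  have hP0 : (0 : ℝ) < P := by
    by_contra h0
    have : (P : ℝ) = 0 := le_antisymm (not_lt.1 h0) (Nat.cast_nonneg _)
    rw [this] at hP; linarith
  obtain ⟨a₁, ha₁⟩ := h h₁ hh₁
  obtain ⟨a₂, ha₂⟩ := h h₂ hh₂
  have hqR : (h₁ : ℝ) - h₂ = q := by exact_mod_cast hqe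
  set τ : ℝ := q * β - (a₁ - a₂ : ℤ) with hτ
  have hτη : |τ| ≤ 2 * η := by
    have : τ = (β * h₁ - a₁) - (β * h₂ - a₂) := by rw [hτ, ← hqR]; push_cast; ring
    rw [this]; exact (abs_sub _ _).trans (by linarith)
  refine ⟨q, a₁ - a₂, hq1, hq, ?_⟩
  change |τ| ≤ _
  by_cases hτ0 : τ = 0
  · rw [hτ0, abs_zero]; positivity
  have hne : (Finset.Ico (0 : ℤ) q).Nonempty := ⟨0, by simp; omega⟩
  obtain ⟨b, _, hb⟩ := Finset.exists_le_card_fiber_of_nsmul_le_card_of_maps_to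
    (s := H) (t := Finset.Ico (0 : ℤ) q) (f := fun n => n % q) (b := ρ * P / q)
    (fun n _ => by
      rw [Finset.mem_Ico]; exact ⟨Int.emod_nonneg _ hqz.ne', Int.emod_lt_of_pos _ hqz⟩) hne (by
      rw [Int.card_Ico, nsmul_eq_mul]; simp only [sub_zero, Int.toNat_natCast]
      rw [mul_div_cancel₀ _ hq0.ne']; exact hcard)
  set T := H.filter fun n => n % q = b with hT
  have hTpos : 0 < T.card := by
    have : (0 : ℝ) < T.card := lt_of_lt_of_le (by positivity) hb
    exact_mod_cast this
  have hTne : T.Nonempty := Finset.card_pos.1 hTpos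
  set h₀ := T.min' hTne with hh₀
  have hh₀T : h₀ ∈ T := T.min'_mem hTne
  have hdiv : ∀ n ∈ T, n = h₀ + q * ((n - h₀) / q) := fun n hn => by
    have h1 : n % q = h₀ % q := by
      rw [(Finset.mem_filter.1 hn).2, (Finset.mem_filter.1 hh₀T).2]
    have : (q : ℤ) ∣ n - h₀ := Int.dvd_of_emod_eq_zero (Int.emod_eq_emod_iff_emod_sub_eq_zero.1 h1)
    rw [Int.mul_ediv_cancel' this]; ring
  set S := T.image fun n => (n - h₀) / q with hS
  have hScard : S.card = T.card := Finset.card_image_of_injOn fun n hn n' hn' hnn => by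
    rw [hdiv n hn, hdiv n' hn']; exact congrArg (fun t => h₀ + q * t) hnn
  have hη1 : η ≤ 1 / 48 := by linarith
  have hbound := card_near_int_le (S := S) (τ := τ) (η := 2 * η) (R := 2 * P / q) hτ0 (by linarith)
    (by positivity) (fun m hm => by
      obtain ⟨n, hn, rfl⟩ := Finset.mem_image.1 hm
      have h1 : h₀ ≤ n := T.min'_le n hn
      refine ⟨Int.ediv_nonneg (by linarith) hqz.le, ?_⟩
      rw [le_div_iff₀ hq0]
      have h2 := Int.ediv_mul_le (n - h₀) hqz.ne'
      have h3 := abs_le.1 (hH n (Finset.mem_filter.1 hn).1)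
      have h4 := abs_le.1 (hH h₀ (Finset.mem_filter.1 hh₀T).1)
      have h5 : (n - h₀) / q * q ≤ 2 * (P : ℤ) := by linarith
      exact_mod_cast h5) (fun m hm => by
      obtain ⟨n, hn, rfl⟩ := Finset.mem_image.1 hm
      obtain ⟨a, ha⟩ := h n (Finset.mem_filter.1 hn).1
      obtain ⟨a', ha'⟩ := h h₀ (Finset.mem_filter.1 hh₀T).1
      refine ⟨a - a' - (n - h₀) / q * (a₁ - a₂), ?_⟩
      have h1 : (n : ℝ) = h₀ + q * ((n - h₀) / q : ℤ) := by exact_mod_cast hdiv n hn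
      have : (((n - h₀) / q : ℤ) : ℝ) * τ - ((a - a' - (n - h₀) / q * (a₁ - a₂) : ℤ) : ℝ)
          = (β * n - a) - (β * h₀ - a') := by
        rw [hτ, h1]; push_cast; ring
      rw [this]; exact (abs_sub _ _).trans (by linarith))
  rw [hScard] at hbound
  have hτpos : 0 < |τ| := abs_pos.2 hτ0
  have hfin : ρ * P / q ≤ (2 * P / q * |τ| + 2 * (2 * η) + 1) * (2 * (2 * η) / |τ| + 1) :=
    hb.trans hbound
  have e1 : (2 * P / q * |τ| + 2 * (2 * η) + 1) * (2 * (2 * η) / |τ| + 1)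
      = 8 * η * (P / q) + 2 * (P / q) * |τ| + (4 * η + 1) * (4 * η / |τ|) + (4 * η + 1) := by
    field_simp; ring
  rw [e1] at hfin
  have hPq : 0 < (P : ℝ) / q := by positivity
  have hX : 8 ≤ ρ * P / q := by
    rw [le_div_iff₀ hq0]
    have : q * ρ ≤ 5 := by rwa [le_div_iff₀ hρ] at hq
    nlinarith
  have e2 : ρ * P / q = ρ * (P / q) := by ring
  have h6 : 8 * η * (P / q) + 2 * (P / q) * |τ| ≤ (ρ * (P / q)) / 4 := by nlinarith
  have h7 : (4 * η + 1) * (4 * η / |τ|) ≤ 2 * (4 * η / |τ|) := by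
    gcongr; linarith
  have h8 : (ρ * (P / q)) / 2 ≤ 8 * η / |τ| := by
    have : 2 * (4 * η / |τ|) = 8 * η / |τ| := by ring
    rw [e2] at hfin hX
    linarith
  rw [le_div_iff₀ hτpos] at h8
  have h9 : |τ| ≤ 16 * η * q / (ρ * P) := by
    rw [le_div_iff₀ (by positivity)]
    have : ρ * (P / q) / 2 * |τ| * (2 * q) = |τ| * (ρ * P) := by field_simp
    nlinarith [mul_le_mul_of_nonneg_right h8 (by positivity : (0:ℝ) ≤ 2 * q)]
  refine h9.trans ?_
  rw [div_le_div_iff₀ (by positivity) (by positivity)]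
  have : q * ρ ≤ 5 := by rwa [le_div_iff₀ hρ] at hq
  nlinarith [mul_le_mul_of_nonneg_left this (by positivity : (0:ℝ) ≤ 16 * η * (ρ * P))]

end DiscreteRadon
end

noncomputable section
namespace DiscreteRadon

theorem norm_sum_sq_le_differences (F : ℤ → ℂ) {u v : ℤ} {P : ℕ} (huv : v - u ≤ P) :
    ‖∑ n ∈ Finset.Ico u v, F n‖ ^ 2 ≤ ∑ h ∈ Finset.Icc (-(P : ℤ)) P,
      ‖∑ n ∈ Finset.Ico (max u (u - h)) (min v (v - h)), F (n + h) * (starRingEnd ℂ) (F n)‖ := by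
  have h1 : ((‖∑ n ∈ Finset.Ico u v, F n‖ ^ 2 : ℝ) : ℂ) = ∑ h ∈ Finset.Icc (-(P : ℤ)) P,
      ∑ n ∈ Finset.Ico (max u (u - h)) (min v (v - h)), F (n + h) * (starRingEnd ℂ) (F n) := by
    rw [← Complex.normSq_eq_norm_sq, Complex.normSq_eq_conj_mul_self, map_sum, Finset.sum_mul_sum,
      Finset.sum_sigma', Finset.sum_sigma']
    refine Finset.sum_nbij' (fun x => ⟨x.2 - x.1, x.1⟩) (fun y => ⟨y.2, y.2 + y.1⟩) ?_ ?_ ?_ ?_ ?_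
    · rintro ⟨n, m⟩ h
      simp only [Finset.mem_sigma, Finset.mem_Ico, Finset.mem_Icc] at h ⊢
      omega
    · rintro ⟨h, n⟩ hh
      simp only [Finset.mem_sigma, Finset.mem_Ico, Finset.mem_Icc] at hh ⊢
      omega
    · rintro ⟨n, m⟩ _; simp
    · rintro ⟨h, n⟩ _; simp
    · rintro ⟨n, m⟩ _
      simp only [add_sub_cancel]; ring
  have h2 : ‖∑ n ∈ Finset.Ico u v, F n‖ ^ 2 = ‖((‖∑ n ∈ Finset.Ico u v, F n‖ ^ 2 : ℝ) : ℂ)‖ := by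
    rw [Complex.norm_real, Real.norm_eq_abs, abs_of_nonneg (by positivity)]
  rw [h2, h1]
  exact norm_sum_le _ _

open Polynomial in
theorem taylor_sub_self {f : ℝ[X]} {d : ℕ} (hf : f.natDegree ≤ d + 2) (h : ℝ) :
    (taylor h f - f).natDegree ≤ d + 1 ∧
      (taylor h f - f).coeff (d + 1) = (d + 2) * h * f.coeff (d + 2) := by
  constructor
  · rw [natDegree_le_iff_coeff_eq_zero]
    intro n hn
    rw [coeff_sub, taylor_coeff]
    have h1 : (hasseDeriv n f).natDegree ≤ 0 := (natDegree_hasseDeriv_le f n).trans (by omega)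
    rw [eq_C_of_natDegree_le_zero h1, eval_C, hasseDeriv_coeff]
    simp
  · rw [coeff_sub, taylor_coeff]
    have h1 : (hasseDeriv (d + 1) f).natDegree ≤ 1 :=
      (natDegree_hasseDeriv_le f (d + 1)).trans (by omega)
    have h2 := eval_eq_sum_range' (p := hasseDeriv (d + 1) f) (n := 2) (by omega) h
    rw [h2, Finset.sum_range_succ, Finset.sum_range_one, hasseDeriv_coeff, hasseDeriv_coeff]
    have h3 : (1 + (d + 1)).choose (d + 1) = d + 2 := by
      rw [add_comm 1, Nat.choose_succ_self_right]
    rw [h3, add_comm 1 (d + 1)]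
    simp only [zero_add, Nat.choose_self, pow_zero, pow_one]
    push_cast; ring

theorem norm_sum_Ico_e_le {u v : ℤ} {P : ℕ} (huv : v - u ≤ P) (f : ℤ → ℝ) :
    ‖∑ n ∈ Finset.Ico u v, e (f n)‖ ≤ P := by
  refine (norm_sum_le _ _).trans ?_
  simp only [norm_e, Finset.sum_const, Int.card_Ico, nsmul_eq_mul, mul_one]
  exact_mod_cast (by omega : (v - u).toNat ≤ P)

set_option maxHeartbeats 800000 in
/-- The inverse form of Weyl's inequality for the leading coefficient. -/
theorem weyl_leading (d : ℕ) : ∃ C : ℕ, 1 ≤ C ∧ ∀ (P : ℕ), 1 ≤ P → ∀ K : ℝ, 1 ≤ K →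
    ∀ f : Polynomial ℝ, f.natDegree ≤ d + 1 → ∀ u v : ℤ, v - u ≤ P →
    P / K ≤ ‖∑ n ∈ Finset.Ico u v, e (f.eval (n : ℝ))‖ →
    ∃ q : ℕ, ∃ a : ℤ, 1 ≤ q ∧ (q : ℝ) ≤ C * K ^ C ∧
      |q * f.coeff (d + 1) - a| ≤ C * K ^ C / (P : ℝ) ^ (d + 1) := by
  induction d with
  | zero =>
    refine ⟨1, le_rfl, fun P hP K hK f hf u v huv hs => ?_⟩
    have hP0 : (0 : ℝ) < P := by exact_mod_cast hP
    obtain ⟨a, b, rfl⟩ := Polynomial.exists_eq_X_add_C_of_natDegree_le_one hf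
    by_contra hcon
    push Not at hcon
    have h1 : ∀ m : ℤ, K / P < |a - m| := fun m => by
      have := hcon 1 m le_rfl (by simpa using hK)
      simpa using this
    have h2 := norm_sum_e_linear_le (by positivity) h1 u v b
    have h3 : 1 / (2 * (K / P)) = P / K / 2 := by field_simp
    rw [h3] at h2
    have h4 : 0 < P / K := by positivity
    simp only [Polynomial.eval_add, Polynomial.eval_mul, Polynomial.eval_C, Polynomial.eval_X] at hs
    linarith
  | succ d ih =>
    obtain ⟨C, hC1, ih⟩ := ih
    have hpoly : PolyBdd fun K => 10 * K ^ 2 * (C * (6 * K ^ 2) ^ C) ^ 2 * (d + 2)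
        + 320 * K ^ 4 * (C * (6 * K ^ 2) ^ C) ^ 3
        + (160 * K ^ 4 * (C * (6 * K ^ 2) ^ C) ^ 2) ^ (d + 2) := by
      have hQ : PolyBdd fun K => (C * (6 * K ^ 2) ^ C : ℝ) :=
        (PolyBdd.const C).mul (((PolyBdd.const 6).mul (PolyBdd.id.pow 2)).pow C)
      exact (((((PolyBdd.const 10).mul (PolyBdd.id.pow 2)).mul (hQ.pow 2)).mul
        (PolyBdd.const _)).add (((PolyBdd.const 320).mul (PolyBdd.id.pow 4)).mul (hQ.pow 3))).add
        ((((PolyBdd.const 160).mul (PolyBdd.id.pow 4)).mul (hQ.pow 2)).pow _)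
    obtain ⟨C', hC', hbd⟩ := hpoly.exists_le
    refine ⟨C', hC', fun P hP K hK f hf u v huv hs => ?_⟩
    have hb := hbd K hK
    have hP0 : (0 : ℝ) < P := by exact_mod_cast hP
    have hP1 : (1 : ℝ) ≤ P := by exact_mod_cast hP
    have hK0 : 0 < K := by linarith
    set Q : ℝ := C * (6 * K ^ 2) ^ C with hQ
    have hK2 : 1 ≤ K ^ 2 := one_le_pow₀ hK
    have hQ1 : 1 ≤ Q := by
      have h1 : (1 : ℝ) ≤ C := by exact_mod_cast hC1
      have h2 : 1 ≤ (6 * K ^ 2) ^ C := one_le_pow₀ (by linarith)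
      nlinarith
    have hQ0 : 0 < Q := by linarith
    rcases lt_or_ge (P : ℝ) (160 * K ^ 4 * Q ^ 2) with hPs | hPl
    · refine ⟨1, round (f.coeff (d + 1 + 1)), le_rfl, ?_, ?_⟩
      · have h1 : (1 : ℝ) ≤ C' := by exact_mod_cast hC'
        have h2 : 1 ≤ K ^ C' := one_le_pow₀ hK
        push_cast; nlinarith
      · rw [Nat.cast_one, one_mul]
        refine (abs_sub_round _).trans ?_
        rw [le_div_iff₀ (by positivity)]
        have h1 : (P : ℝ) ^ (d + 1 + 1) ≤ (160 * K ^ 4 * Q ^ 2) ^ (d + 2) := by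
          gcongr
        have h2 : 0 ≤ 10 * K ^ 2 * Q ^ 2 * (d + 2) + 320 * K ^ 4 * Q ^ 3 := by positivity
        have h3 : 0 ≤ (P : ℝ) ^ (d + 1 + 1) := by positivity
        linarith
    set c := f.coeff (d + 2) with hc
    set inner : ℤ → ℂ := fun h => ∑ n ∈ Finset.Ico (max u (u - h)) (min v (v - h)),
      e ((Polynomial.taylor (h : ℝ) f - f).eval (n : ℝ)) with hinner
    have hsum : (P / K) ^ 2 ≤ ∑ h ∈ Finset.Icc (-(P : ℤ)) P, ‖inner h‖ := by
      have h1 := norm_sum_sq_le_differences (fun n => e (f.eval (n : ℝ))) huv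
      refine (pow_le_pow_left₀ (by positivity) hs 2).trans (h1.trans (le_of_eq ?_))
      refine Finset.sum_congr rfl fun h _ => ?_
      congr 1
      refine Finset.sum_congr rfl fun n _ => ?_
      rw [conj_e, ← e_add, Polynomial.eval_sub, Polynomial.taylor_eval, ← sub_eq_add_neg]
      push_cast; rfl
    set H := (Finset.Icc (-(P : ℤ)) P).filter fun h => P / (6 * K ^ 2) ≤ ‖inner h‖ with hH
    have hle : ∀ h : ℤ, ‖inner h‖ ≤ P := fun h => norm_sum_Ico_e_le (by omega) _
    have hHcard : 1 / (2 * K ^ 2) * P ≤ H.card := by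
      rw [← Finset.sum_filter_add_sum_filter_not _ (fun h => P / (6 * K ^ 2) ≤ ‖inner h‖)] at hsum
      have h1 : ∑ h ∈ H, ‖inner h‖ ≤ H.card * P := by
        rw [← nsmul_eq_mul]; exact Finset.sum_le_card_nsmul _ _ _ fun h _ => hle h
      have h2 : ∑ h ∈ (Finset.Icc (-(P : ℤ)) P).filter (fun h => ¬ P / (6 * K ^ 2) ≤ ‖inner h‖),
          ‖inner h‖ ≤ (3 * P) * (P / (6 * K ^ 2)) := by
        refine (Finset.sum_le_card_nsmul _ _ (P / (6 * K ^ 2)) fun h hh =>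
          (not_le.1 (Finset.mem_filter.1 hh).2).le).trans ?_
        rw [nsmul_eq_mul]
        gcongr
        have h3 := Finset.card_filter_le (Finset.Icc (-(P : ℤ)) P)
          (fun h => ¬ P / (6 * K ^ 2) ≤ ‖inner h‖)
        rw [Int.card_Icc] at h3
        have h4 : ((P : ℤ) + 1 - -P).toNat ≤ 3 * P := by omega
        exact_mod_cast h3.trans h4
      have h3 : (P / K) ^ 2 ≤ H.card * P + (3 * P) * (P / (6 * K ^ 2)) := by linarith
      have h4 : (P / K) ^ 2 - (3 * P) * (P / (6 * K ^ 2)) = 1 / (2 * K ^ 2) * P * P := by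
        field_simp; ring
      have h5 : 1 / (2 * K ^ 2) * P * P ≤ H.card * P := by linarith
      exact le_of_mul_le_mul_right h5 hP0
    have hex : ∀ h ∈ H, ∃ q : ℕ, ∃ a : ℤ, 1 ≤ q ∧ (q : ℝ) ≤ Q ∧
        |q * ((d + 2) * h * c) - a| ≤ Q / (P : ℝ) ^ (d + 1) := by
      intro h hh
      obtain ⟨h1, h2⟩ := taylor_sub_self (f := f) (d := d) hf (h : ℝ)
      have h3 := ih P hP (6 * K ^ 2) (by linarith) (Polynomial.taylor (h : ℝ) f - f) h1
        (max u (u - h)) (min v (v - h)) (by omega) (Finset.mem_filter.1 hh).2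
      rw [h2] at h3
      exact h3
    choose! qf hqf using hex
    obtain ⟨q, hqmem, hq⟩ := Finset.exists_le_card_fiber_of_nsmul_le_card_of_maps_to
      (s := H) (t := Finset.Icc 1 ⌊Q⌋₊) (f := qf) (b := 1 / (2 * K ^ 2) * P / Q)
      (fun h hh => by
        obtain ⟨a, h1, h2, _⟩ := hqf h hh
        rw [Finset.mem_Icc]; exact ⟨h1, Nat.le_floor h2⟩)
      ⟨1, by rw [Finset.mem_Icc]; exact ⟨le_rfl, Nat.le_floor (by simpa using hQ1)⟩⟩ (by
        rw [Nat.card_Icc, nsmul_eq_mul]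
        refine le_trans ?_ hHcard
        have : ((⌊Q⌋₊ + 1 - 1 : ℕ) : ℝ) ≤ Q := by simpa using Nat.floor_le hQ0.le
        calc ((⌊Q⌋₊ + 1 - 1 : ℕ) : ℝ) * (1 / (2 * K ^ 2) * P / Q)
            ≤ Q * (1 / (2 * K ^ 2) * P / Q) := by gcongr
          _ = _ := by field_simp)
    rw [Finset.mem_Icc] at hqmem
    have hqQ : (q : ℝ) ≤ Q := (Nat.le_floor_iff hQ0.le).1 hqmem.2
    set ρ : ℝ := 1 / (2 * K ^ 2 * Q) with hρ
    have hρ0 : 0 < ρ := by positivity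
    have hKQ : 1 ≤ K ^ 2 * Q := by nlinarith
    have hρ1 : ρ ≤ 1 := by
      rw [hρ, div_le_one (by positivity)]; linarith
    have hPd : (P : ℝ) ≤ (P : ℝ) ^ (d + 1) := le_self_pow₀ hP1 (by omega)
    obtain ⟨q', a, hq'1, hq', hqa⟩ := vinogradov (P := P) (H := H.filter fun h => qf h = q)
      (ρ := ρ) (η := Q / (P : ℝ) ^ (d + 1)) (β := q * ((d + 2) * c)) (fun h hh => by
        have := (Finset.mem_filter.1 (Finset.mem_filter.1 hh).1).1
        rw [Finset.mem_Icc] at this; exact abs_le.2 this) hρ0 hρ1 (by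
        refine le_trans (le_of_eq ?_) hq
        rw [hρ]; field_simp) (by positivity) (by
        rw [hρ, div_div, div_le_div_iff₀ (by positivity) (by positivity)]
        have : K ^ 2 * 96 ≤ 160 * K ^ 4 := by nlinarith
        have : (K ^ 2 * 96) * Q ^ 2 ≤ 160 * K ^ 4 * Q ^ 2 := by gcongr
        nlinarith) (by
        rw [hρ, div_pow, one_pow, one_div, ← div_eq_inv_mul, le_div_iff₀ (by positivity)]
        nlinarith) (fun h hh => by
        rw [Finset.mem_filter] at hh
        obtain ⟨a, h1, h2, h3⟩ := hqf h hh.1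
        refine ⟨a, ?_⟩
        rw [hh.2] at h3
        convert h3 using 2
        ring)
    refine ⟨q' * q * (d + 2), a, ?_, ?_, ?_⟩
    · exact Nat.mul_pos (Nat.mul_pos hq'1 hqmem.1) (by omega)
    · have h1 : (q' : ℝ) ≤ 10 * K ^ 2 * Q := by
        refine hq'.trans (le_of_eq ?_)
        rw [hρ]; field_simp; norm_num
      push_cast
      have h2 : (q' : ℝ) * q * (d + 2) ≤ (10 * K ^ 2 * Q) * Q * (d + 2) := by gcongr
      have h3 : 0 ≤ 320 * K ^ 4 * Q ^ 3 + (160 * K ^ 4 * Q ^ 2) ^ (d + 2) := by positivity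
      have h4 : 10 * K ^ 2 * Q * Q * (d + 2) = 10 * K ^ 2 * Q ^ 2 * (d + 2) := by ring
      linarith
    · have h1 : 80 * (Q / (P : ℝ) ^ (d + 1)) / (ρ ^ 2 * P)
          = 320 * K ^ 4 * Q ^ 3 / (P : ℝ) ^ (d + 1 + 1) := by
        rw [hρ]; field_simp; ring
      rw [h1] at hqa
      have h2 : ((q' * q * (d + 2) : ℕ) : ℝ) * f.coeff (d + 1 + 1) - a
          = q' * (q * ((d + 2) * c)) - a := by rw [hc]; push_cast; ring
      rw [h2]
      refine hqa.trans ?_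
      have h3 : 0 ≤ 10 * K ^ 2 * Q ^ 2 * (d + 2) + (160 * K ^ 4 * Q ^ 2) ^ (d + 2) := by positivity
      exact div_le_div_of_nonneg_right (by linarith) (by positivity)

end DiscreteRadon
end

noncomputable section
namespace DiscreteRadon

theorem e_eq_one_iff (t : ℝ) : e t = 1 ↔ ∃ n : ℤ, t = n := by
  constructor
  · intro h
    rw [e, Complex.exp_eq_one_iff] at h
    obtain ⟨n, hn⟩ := h
    refine ⟨n, ?_⟩
    have h2 : (2 * Real.pi * Complex.I : ℂ) ≠ 0 := Complex.two_pi_I_ne_zero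
    have : (2 * Real.pi * Complex.I : ℂ) * (t - n) = 0 := by linear_combination hn
    rcases mul_eq_zero.1 this with h | h
    · exact absurd h h2
    · exact_mod_cast sub_eq_zero.1 h
  · rintro ⟨n, rfl⟩; exact e_int n

theorem e_nat_mul (n : ℕ) (t : ℝ) : e (n * t) = e t ^ n := by
  rw [e, e, ← Complex.exp_nat_mul]; congr 1; push_cast; ring

theorem sum_e_div {q : ℕ} (hq : 1 ≤ q) (m : ℤ) :
    ∑ c ∈ Finset.range q, e (c * (m / q : ℝ)) = if (q : ℤ) ∣ m then (q : ℂ) else 0 := by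
  have hq0 : (q : ℝ) ≠ 0 := by positivity
  simp_rw [e_nat_mul]
  split_ifs with h
  · obtain ⟨k, rfl⟩ := h
    have : e (((q * k : ℤ) : ℝ) / q) = 1 := by
      rw [e_eq_one_iff]; exact ⟨k, by push_cast; field_simp⟩
    rw [Finset.sum_congr rfl fun c _ => by rw [this, one_pow]]
    simp
  · have h1 : e (m / q : ℝ) ≠ 1 := by
      rw [Ne, e_eq_one_iff]
      rintro ⟨k, hk⟩
      rw [div_eq_iff hq0] at hk
      exact h ⟨k, by rw [mul_comm]; exact_mod_cast hk⟩
    have h2 : e (m / q : ℝ) ^ q = 1 := by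
      rw [← e_nat_mul, e_eq_one_iff]; exact ⟨m, by field_simp⟩
    rw [geom_sum_eq h1, h2]; simp

/-- A sum over a residue class is dominated by a twist of the full sum. -/
theorem exists_norm_residue_le (F : ℤ → ℂ) (I : Finset ℤ) {q : ℕ} (hq : 1 ≤ q) (b : ℤ) :
    ∃ c : ℤ, ‖∑ n ∈ I.filter (fun n => (q : ℤ) ∣ n - b), F n‖
      ≤ ‖∑ n ∈ I, F n * e (c * n / q)‖ := by
  have hq0 : (0 : ℝ) < q := by exact_mod_cast hq
  by_contra! hcon
  have h1 : (q : ℂ) * ∑ n ∈ I.filter (fun n => (q : ℤ) ∣ n - b), F n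
      = ∑ c ∈ Finset.range q, e (-(c * b / q)) * ∑ n ∈ I, F n * e ((c : ℤ) * n / q) := by
    simp_rw [Finset.mul_sum]
    rw [Finset.sum_comm, Finset.sum_filter]
    refine Finset.sum_congr rfl fun n _ => ?_
    have h2 : ∀ c : ℕ, e (-(c * b / q)) * (F n * e ((c : ℤ) * n / q))
        = F n * e (c * ((n - b : ℤ) / q : ℝ)) := by
      intro c
      rw [mul_left_comm, ← e_add]; congr 2; push_cast; field_simp; ring
    simp_rw [h2]
    rw [← Finset.mul_sum, sum_e_div hq]
    split_ifs <;> ring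
  have h3 : (q : ℝ) * ‖∑ n ∈ I.filter (fun n => (q : ℤ) ∣ n - b), F n‖
      < q * ‖∑ n ∈ I.filter (fun n => (q : ℤ) ∣ n - b), F n‖ := by
    calc (q : ℝ) * ‖∑ n ∈ I.filter (fun n => (q : ℤ) ∣ n - b), F n‖
        = ‖(q : ℂ) * ∑ n ∈ I.filter (fun n => (q : ℤ) ∣ n - b), F n‖ := by
          rw [norm_mul, Complex.norm_natCast]
      _ ≤ ∑ c ∈ Finset.range q, ‖∑ n ∈ I, F n * e ((c : ℤ) * n / q)‖ := by
          rw [h1]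
          refine (norm_sum_le _ _).trans (le_of_eq ?_)
          refine Finset.sum_congr rfl fun c _ => ?_
          rw [norm_mul, norm_e, one_mul]
      _ < ∑ c ∈ Finset.range q, ‖∑ n ∈ I.filter (fun n => (q : ℤ) ∣ n - b), F n‖ :=
          Finset.sum_lt_sum_of_nonempty (by simpa using by omega) fun c _ => hcon c
      _ = _ := by simp
  exact lt_irrefl _ h3

theorem norm_e_sub_le_of_near (s t : ℝ) (m : ℤ) : ‖e s - e t‖ ≤ 2 * Real.pi * |s - t - m| := by
  have : e s = e (s - m) := by rw [← e_add_int (s - m) m]; ring_nf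
  rw [this]
  refine (norm_e_sub_le _ _).trans (le_of_eq ?_)
  congr 2; ring

theorem exists_near_int_monomial {α : ℝ} {q : ℕ} (hq : 1 ≤ q) {a : ℤ} {Q P L : ℝ}
    (hP : 1 ≤ P) {l : ℕ} (hl : 1 ≤ l) (hα : |q * α - a| ≤ Q / P ^ l) {n n' : ℤ}
    (hn : |(n : ℝ)| ≤ P) (hn' : |(n' : ℝ)| ≤ P) (hd : |(n : ℝ) - n'| ≤ L) (hqd : (q : ℤ) ∣ n - n') :
    ∃ m : ℤ, |α * n ^ l - α * n' ^ l - m| ≤ Q * l * (L / P) := by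
  obtain ⟨k, hk⟩ := hqd.trans (sub_dvd_pow_sub_pow n n' l)
  have hq0 : (1 : ℝ) ≤ q := by exact_mod_cast hq
  have hP0 : 0 < P := by linarith
  have hQ : 0 ≤ Q := by
    have := (abs_nonneg _).trans hα
    rw [le_div_iff₀ (by positivity)] at this; linarith
  have hkR : (n : ℝ) ^ l - n' ^ l = q * k := by exact_mod_cast hk
  refine ⟨a * k, ?_⟩
  have h1 : α * n ^ l - α * n' ^ l - (a * k : ℤ) = (q * α - a) * k := by
    rw [← mul_sub, hkR]; push_cast; ring
  have hk2 : |(k : ℝ)| ≤ l * P ^ (l - 1) * L := by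
    have h2 : |(n : ℝ) ^ l - n' ^ l| ≤ l * P ^ (l - 1) * L := by
      refine (abs_pow_sub_pow_le _ _ _).trans ?_
      have h3 : max |(n : ℝ)| |(n' : ℝ)| ^ (l - 1) ≤ P ^ (l - 1) :=
        pow_le_pow_left₀ (le_max_of_le_left (abs_nonneg _)) (max_le hn hn') _
      have hL : 0 ≤ L := (abs_nonneg _).trans hd
      calc |(n : ℝ) - n'| * l * max |(n : ℝ)| |(n' : ℝ)| ^ (l - 1) ≤ L * l * P ^ (l - 1) := by gcongr
        _ = _ := by ring
    rw [hkR, abs_mul, abs_of_pos (by linarith)] at h2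
    nlinarith [abs_nonneg (k : ℝ)]
  rw [h1, abs_mul]
  calc |q * α - a| * |(k : ℝ)| ≤ Q / P ^ l * (l * P ^ (l - 1) * L) := by gcongr
    _ = Q * l * (L / P) := by
      obtain ⟨l, rfl⟩ := Nat.exists_eq_add_of_le' hl
      simp only [Nat.add_sub_cancel]
      field_simp
      ring

theorem exists_near_int_sum {ι : Type*} (s : Finset ι) (g : ι → ℝ) (B : ι → ℝ)
    (h : ∀ i ∈ s, ∃ m : ℤ, |g i - m| ≤ B i) : ∃ m : ℤ, |∑ i ∈ s, g i - m| ≤ ∑ i ∈ s, B i := by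
  choose! m hm using h
  refine ⟨∑ i ∈ s, m i, ?_⟩
  push_cast
  rw [← Finset.sum_sub_distrib]
  exact (Finset.abs_sum_le_sum_abs _ _).trans (Finset.sum_le_sum hm)

/-- If the higher order terms of `f` are close to rational, a large exponential sum gives a large
sum of the lower order terms over an interval. -/
theorem exists_large_lower_sum {P q L : ℕ} (hL : 1 ≤ L) (hLP : L ≤ P) (hq : 1 ≤ q)
    {lo hi : ℤ → ℝ} {u v : ℤ} (hu : -(P : ℤ) ≤ u) (hv : v ≤ P + 1) {K : ℝ} (hK : 1 ≤ K)
    (hconst : ∀ n n' : ℤ, |n| ≤ P → |n'| ≤ P → |n - n'| ≤ L → (q : ℤ) ∣ n - n' →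
      ‖e (hi n) - e (hi n')‖ ≤ 1 / (6 * K))
    (hs : P / K ≤ ‖∑ n ∈ Finset.Ico u v, e (lo n + hi n)‖) :
    ∃ c u' v' : ℤ, v' - u' ≤ P ∧
      P / (2 * K * (q * (2 * P / L + 1))) ≤ ‖∑ n ∈ Finset.Ico u' v', e (lo n + c * n / q)‖ := by
  have hL0 : (0 : ℝ) < L := by exact_mod_cast hL
  have hLz : (0 : ℤ) < L := by exact_mod_cast hL
  have hq0 : (0 : ℝ) < q := by exact_mod_cast hq
  have hqz : (0 : ℤ) < q := by exact_mod_cast hq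
  have hP0 : (1 : ℝ) ≤ P := by exact_mod_cast hL.trans hLP
  set cell : ℤ → ℤ × ℤ := fun n => ((n + P) / L, n % q) with hcell
  set T : Finset (ℤ × ℤ) := Finset.Icc (0 : ℤ) (2 * P / L) ×ˢ Finset.Ico (0 : ℤ) q with hT
  have hmaps : ∀ n ∈ Finset.Ico u v, cell n ∈ T := fun n hn => by
    rw [Finset.mem_Ico] at hn
    simp only [hT, hcell, Finset.mem_product, Finset.mem_Icc, Finset.mem_Ico]
    exact ⟨⟨Int.ediv_nonneg (by omega) hLz.le, Int.ediv_le_ediv hLz (by omega)⟩,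
      Int.emod_nonneg _ hqz.ne', Int.emod_lt_of_pos _ hqz⟩
  have hTcard : (T.card : ℝ) ≤ q * (2 * P / L + 1) := by
    rw [hT, Finset.card_product, Int.card_Ico]
    have h1 : ((Finset.Icc (0 : ℤ) (2 * P / L)).card : ℝ) ≤ 2 * P / L - 0 + 1 := by
      refine card_le_of_forall_mem_Icc (by positivity) fun n hn => ?_
      rw [Finset.mem_Icc] at hn
      refine ⟨by exact_mod_cast hn.1, ?_⟩
      rw [le_div_iff₀ hL0]
      have := (Int.le_ediv_iff_mul_le hLz).1 hn.2
      exact_mod_cast this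
    simp only [sub_zero, Int.toNat_natCast] at h1 ⊢
    push_cast
    nlinarith
  have hfiber : ∀ t ∈ T, ‖∑ n ∈ (Finset.Ico u v).filter (fun n => cell n = t), e (lo n + hi n)‖
      ≤ ‖∑ n ∈ (Finset.Ico u v).filter (fun n => cell n = t), e (lo n)‖
        + ((Finset.Ico u v).filter (fun n => cell n = t)).card * (1 / (6 * K)) := by
    intro t _
    set S := (Finset.Ico u v).filter (fun n => cell n = t) with hS
    rcases S.eq_empty_or_nonempty with h0 | ⟨n₀, hn₀⟩
    · rw [h0]; simp
    have habs : ∀ n ∈ S, |n| ≤ P := fun n hn => by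
      have := Finset.mem_Ico.1 (Finset.mem_filter.1 hn).1
      rw [abs_le]; omega
    have h1 : ∀ n ∈ S, ‖e (hi n) - e (hi n₀)‖ ≤ 1 / (6 * K) := fun n hn => by
      have e1 : cell n = cell n₀ := by
        rw [(Finset.mem_filter.1 hn).2, (Finset.mem_filter.1 hn₀).2]
      simp only [hcell, Prod.mk.injEq] at e1
      refine hconst n n₀ (habs n hn) (habs n₀ hn₀) ?_ ?_
      · have h2 := Int.emod_add_mul_ediv (n + P) L
        have h3 := Int.emod_add_mul_ediv (n₀ + P) L
        have h4 := Int.emod_lt_of_pos (n + P) hLz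
        have h5 := Int.emod_lt_of_pos (n₀ + P) hLz
        have h6 := Int.emod_nonneg (n + P) hLz.ne'
        have h7 := Int.emod_nonneg (n₀ + P) hLz.ne'
        rw [e1.1] at h2
        rw [abs_le]; constructor <;> linarith
      · exact Int.dvd_of_emod_eq_zero (Int.emod_eq_emod_iff_emod_sub_eq_zero.1 e1.2)
    have h2 : ∑ n ∈ S, e (lo n + hi n)
        = e (hi n₀) * ∑ n ∈ S, e (lo n) + ∑ n ∈ S, e (lo n) * (e (hi n) - e (hi n₀)) := by
      rw [Finset.mul_sum, ← Finset.sum_add_distrib]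
      refine Finset.sum_congr rfl fun n _ => ?_
      rw [e_add]; ring
    rw [h2]
    refine (norm_add_le _ _).trans ?_
    rw [norm_mul, norm_e, one_mul]
    gcongr
    refine (norm_sum_le _ _).trans ?_
    rw [← nsmul_eq_mul]
    refine Finset.sum_le_card_nsmul _ _ _ fun n hn => ?_
    rw [norm_mul, norm_e, one_mul]; exact h1 n hn
  have htot : P / K / 2 ≤ ∑ t ∈ T,
      ‖∑ n ∈ (Finset.Ico u v).filter (fun n => cell n = t), e (lo n)‖ := by
    rw [← Finset.sum_fiberwise_of_maps_to hmaps] at hs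
    have h1 := hs.trans ((norm_sum_le _ _).trans (Finset.sum_le_sum hfiber))
    rw [Finset.sum_add_distrib, ← Finset.sum_mul] at h1
    have h2 : ∑ t ∈ T, (((Finset.Ico u v).filter (fun n => cell n = t)).card : ℝ) ≤ 3 * P := by
      have h3 := Finset.card_eq_sum_card_fiberwise (f := cell) (s := Finset.Ico u v) (t := T) hmaps
      have h4 : (Finset.Ico u v).card ≤ 3 * P := by
        rw [Int.card_Ico]; omega
      exact_mod_cast h3 ▸ h4
    have h5 : (∑ t ∈ T, (((Finset.Ico u v).filter (fun n => cell n = t)).card : ℝ)) * (1 / (6 * K))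
        ≤ 3 * P * (1 / (6 * K)) := by gcongr
    have h6 : 3 * P * (1 / (6 * K)) = P / K / 2 := by field_simp; norm_num
    linarith
  have hTne : T.Nonempty := by
    by_contra h0
    rw [Finset.not_nonempty_iff_eq_empty] at h0
    rw [h0, Finset.sum_empty] at htot
    have : 0 < P / K / 2 := by positivity
    linarith
  obtain ⟨t, htT, ht⟩ := Finset.exists_le_of_sum_le (s := T)
    (f := fun _ => P / (2 * K * (q * (2 * P / L + 1))))
    (g := fun t => ‖∑ n ∈ (Finset.Ico u v).filter (fun n => cell n = t), e (lo n)‖) hTne (by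
      rw [Finset.sum_const, nsmul_eq_mul]
      refine le_trans ?_ htot
      calc (T.card : ℝ) * (P / (2 * K * (q * (2 * P / L + 1))))
          ≤ (q * (2 * P / L + 1)) * (P / (2 * K * (q * (2 * P / L + 1)))) := by gcongr
        _ = P / K / 2 := by field_simp)
  have hfe : (Finset.Ico u v).filter (fun n => cell n = t)
      = (Finset.Ico (max u (t.1 * L - P)) (min v ((t.1 + 1) * L - P))).filter
        (fun n => (q : ℤ) ∣ n - t.2) := by
    have htq := Finset.mem_Ico.1 (Finset.mem_product.1 htT).2
    ext n
    simp only [Finset.mem_filter, Finset.mem_Ico, hcell, Prod.ext_iff, max_le_iff, lt_min_iff]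
    have h1 : (n + P) / L = t.1 ↔ t.1 * L - P ≤ n ∧ n < (t.1 + 1) * L - P := by
      rw [Int.ediv_eq_iff_of_pos hLz]
      constructor <;> rintro ⟨h1, h2⟩ <;> constructor <;> linarith
    have h2 : n % q = t.2 ↔ (q : ℤ) ∣ n - t.2 := by
      rw [Int.dvd_iff_emod_eq_zero, ← Int.emod_eq_emod_iff_emod_sub_eq_zero,
        Int.emod_eq_of_lt htq.1 htq.2]
    rw [h1, h2]; tauto
  rw [hfe] at ht
  obtain ⟨c, hc⟩ := exists_norm_residue_le (fun n => e (lo n))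
    (Finset.Ico (max u (t.1 * L - P)) (min v ((t.1 + 1) * L - P))) hq t.2
  refine ⟨c, max u (t.1 * L - P), min v ((t.1 + 1) * L - P), ?_,
    ht.trans (hc.trans (le_of_eq ?_))⟩
  · have : (t.1 + 1) * L - P - (t.1 * L - P) = (L : ℤ) := by ring
    have h2 := min_le_right v ((t.1 + 1) * L - P)
    have h3 := le_max_right u (t.1 * L - P)
    have h4 : (L : ℤ) ≤ P := by exact_mod_cast hLP
    linarith
  · congr 1
    refine Finset.sum_congr rfl fun n _ => ?_
    rw [e_add]

end DiscreteRadon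
end

noncomputable section
namespace DiscreteRadon

open Polynomial in
theorem exists_lower_polynomial (f : ℝ[X]) {d k : ℕ} (hf : f.natDegree ≤ d) (hk : k + 1 ≤ d) (b : ℝ) :
    ∃ g : ℝ[X], g.natDegree ≤ k + 1 ∧
      g.coeff (k + 1) = f.coeff (k + 1) + (if k = 0 then b else 0) ∧
      (∀ x : ℝ, g.eval x = ∑ l ∈ Finset.range (k + 2), f.coeff l * x ^ l + b * x) ∧
      ∀ x : ℝ, f.eval x = ∑ l ∈ Finset.range (k + 2), f.coeff l * x ^ l
        + ∑ l ∈ Finset.Ico (k + 2) (d + 1), f.coeff l * x ^ l := by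
  refine ⟨∑ l ∈ Finset.range (k + 2), C (f.coeff l) * X ^ l + C b * X, ?_, ?_, ?_, ?_⟩
  · refine natDegree_add_le_of_degree_le (natDegree_sum_le_of_forall_le _ _ fun l hl => ?_) ?_
    · exact (natDegree_C_mul_X_pow_le _ _).trans (by simp at hl; omega)
    · exact (natDegree_C_mul_le _ _).trans (natDegree_X_le.trans (by omega))
  · rw [coeff_add, finsetSum_coeff]
    simp only [coeff_C_mul, coeff_X_pow, mul_ite, mul_one, mul_zero, coeff_X]
    rw [Finset.sum_ite_eq]
    simp only [Finset.mem_range, show k + 1 < k + 2 by omega, if_true]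
    congr 1
    rcases Nat.eq_zero_or_pos k with h | h
    · simp [h]
    · rw [if_neg (by omega), if_neg (by omega)]
  · intro x
    simp [eval_finsetSum]
  · intro x
    rw [eval_eq_sum_range' (n := d + 1) (by omega), Finset.sum_range_add_sum_Ico _ (by omega)]

set_option maxHeartbeats 1000000 in
theorem weyl_upper_coeffs (d j : ℕ) : j ≤ d → ∃ C : ℕ, 1 ≤ C ∧ ∀ (P : ℕ), 1 ≤ P → ∀ K : ℝ, 1 ≤ K →
    ∀ f : Polynomial ℝ, f.natDegree ≤ d → ∀ u v : ℤ, -(P : ℤ) ≤ u → v ≤ P + 1 →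
    P / K ≤ ‖∑ n ∈ Finset.Ico u v, e (f.eval (n : ℝ))‖ →
    ∃ q : ℕ, 1 ≤ q ∧ (q : ℝ) ≤ C * K ^ C ∧ ∀ l : ℕ, d < l + j → l ≤ d →
      ∃ a : ℤ, |q * f.coeff l - a| ≤ C * K ^ C / (P : ℝ) ^ l := by
  induction j with
  | zero =>
    refine fun _ => ⟨1, le_rfl, fun P hP K hK f hf u v hu hv hs => ⟨1, le_rfl, by simpa using hK, ?_⟩⟩
    intro l h1 h2; omega
  | succ j ih =>
    intro hjd
    obtain ⟨C, hC1, ih⟩ := ih (by omega)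
    obtain ⟨k, hk⟩ : ∃ k, d = k + 1 + j := ⟨d - (j + 1), by omega⟩
    obtain ⟨C₀, hC01, hlead⟩ := weyl_leading k
    have hpoly : PolyBdd fun K =>
        (C₀ * (2 * K * ((C * K ^ C) * (4 * (42 * d ^ 2 * (C * K ^ C) * K) + 1))) ^ C₀) * (C * K ^ C)
        + (42 * d ^ 2 * (C * K ^ C) * K) ^ d := by
      have hQ : PolyBdd fun K => (C * K ^ C : ℝ) := (PolyBdd.const C).mul (PolyBdd.id.pow C)
      have hX : PolyBdd fun K => (42 * (d : ℝ) ^ 2 * (C * K ^ C) * K : ℝ) :=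
        ((PolyBdd.const _).mul hQ).mul PolyBdd.id
      exact (((PolyBdd.const C₀).mul ((((PolyBdd.const 2).mul PolyBdd.id).mul
        (hQ.mul (((PolyBdd.const 4).mul hX).add (PolyBdd.const 1)))).pow C₀)).mul hQ).add (hX.pow d)
    obtain ⟨C', hC', hbd⟩ := hpoly.exists_le
    refine ⟨C', hC', fun P hP K hK f hf u v hu hv hs => ?_⟩
    have hb := hbd K hK
    have hd1 : (1 : ℝ) ≤ d := by exact_mod_cast (by omega : 1 ≤ d)
    have hP0 : (0 : ℝ) < P := by exact_mod_cast hP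
    have hP1 : (1 : ℝ) ≤ P := by exact_mod_cast hP
    have hK0 : 0 < K := by linarith
    obtain ⟨q, hq1, hqQ, hqa⟩ := ih P hP K hK f hf u v hu hv hs
    set Q : ℝ := C * K ^ C with hQ
    have hq0 : (1 : ℝ) ≤ q := by exact_mod_cast hq1
    have hQ1 : 1 ≤ Q := hq0.trans hqQ
    set X : ℝ := 42 * d ^ 2 * Q * K with hX
    have hX1 : 1 ≤ X := by
      have : 1 ≤ (d : ℝ) ^ 2 * Q * K :=
        one_le_mul_of_one_le_of_one_le (one_le_mul_of_one_le_of_one_le (one_le_pow₀ hd1) hQ1) hK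
      rw [hX]; linarith
    have hX0 : 0 < X := by linarith
    set K' : ℝ := 2 * K * (Q * (4 * X + 1)) with hK'
    set Q' : ℝ := C₀ * K' ^ C₀ with hQ'
    have hQ'0 : 0 ≤ Q' := by positivity
    rcases lt_or_ge (P : ℝ) X with hPs | hPl
    · refine ⟨1, le_rfl, ?_, fun l hl1 hl2 => ⟨round (f.coeff l), ?_⟩⟩
      · have h1 : (1 : ℝ) ≤ C' := by exact_mod_cast hC'
        have h2 : 1 ≤ K ^ C' := one_le_pow₀ hK
        push_cast; nlinarith
      · rw [Nat.cast_one, one_mul]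
        refine (abs_sub_round _).trans ?_
        rw [le_div_iff₀ (by positivity)]
        have h1 : (P : ℝ) ^ l ≤ X ^ l := by gcongr
        have h2 : X ^ l ≤ X ^ d := pow_le_pow_right₀ hX1 hl2
        have h3 : 0 ≤ Q' * Q := by positivity
        have h4 : 0 ≤ (P : ℝ) ^ l := by positivity
        linarith
    set L : ℕ := ⌊P / X⌋₊ with hL
    have hPX : 1 ≤ P / X := by rwa [le_div_iff₀ hX0, one_mul]
    have hL1 : 1 ≤ L := Nat.le_floor (by simpa using hPX)
    have hLle : (L : ℝ) ≤ P / X := Nat.floor_le (by positivity)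
    have hLge : P / X ≤ 2 * L := by
      have h1 := (Nat.lt_floor_add_one (P / X)).le
      have h2 : (1 : ℝ) ≤ L := by exact_mod_cast hL1
      rw [← hL] at h1; linarith
    have hL0 : (0 : ℝ) < L := by exact_mod_cast hL1
    have hLP : L ≤ P := by
      have : (L : ℝ) ≤ P := hLle.trans (div_le_self hP0.le hX1)
      exact_mod_cast this
    obtain ⟨-, -, -, -, hsplit⟩ := exists_lower_polynomial f hf (by omega : k + 1 ≤ d) 0
    have hhi : ∀ n n' : ℤ, |n| ≤ P → |n'| ≤ P → |n - n'| ≤ L → (q : ℤ) ∣ n - n' →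
        ‖e (∑ l ∈ Finset.Ico (k + 2) (d + 1), f.coeff l * (n : ℝ) ^ l)
          - e (∑ l ∈ Finset.Ico (k + 2) (d + 1), f.coeff l * (n' : ℝ) ^ l)‖ ≤ 1 / (6 * K) := by
      intro n n' hn hn' hnn hdvd
      obtain ⟨m, hm⟩ := exists_near_int_sum (Finset.Ico (k + 2) (d + 1))
        (fun l => f.coeff l * (n : ℝ) ^ l - f.coeff l * (n' : ℝ) ^ l)
        (fun _ => Q * d * (L / P)) (fun l hl => by
          rw [Finset.mem_Ico] at hl
          obtain ⟨a, ha⟩ := hqa l (by omega) (by omega)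
          obtain ⟨m, hm⟩ := exists_near_int_monomial (L := L) hq1 hP1 (by omega : 1 ≤ l) ha
            (n := n) (n' := n') (by exact_mod_cast hn) (by exact_mod_cast hn')
            (by exact_mod_cast hnn) hdvd
          refine ⟨m, hm.trans ?_⟩
          have : (l : ℝ) ≤ d := by exact_mod_cast (by omega : l ≤ d)
          gcongr)
      rw [Finset.sum_sub_distrib] at hm
      refine (norm_e_sub_le_of_near _ _ m).trans ?_
      have h1 : ∑ l ∈ Finset.Ico (k + 2) (d + 1), Q * d * ((L : ℝ) / P) ≤ d * (Q * d * (L / P)) := by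
        rw [Finset.sum_const, nsmul_eq_mul, Nat.card_Ico]
        gcongr; omega
      have h2 : (L : ℝ) / P ≤ 1 / X := by
        rw [div_le_div_iff₀ hP0 hX0, one_mul]
        rwa [le_div_iff₀ hX0] at hLle
      have h3 : d * (Q * d * ((L : ℝ) / P)) ≤ 1 / (42 * K) := by
        calc d * (Q * d * ((L : ℝ) / P)) ≤ d * (Q * d * (1 / X)) := by gcongr
          _ = _ := by rw [hX]; field_simp
      calc 2 * Real.pi * _ ≤ 2 * Real.pi * (1 / (42 * K)) := by
            gcongr; exact hm.trans (h1.trans h3)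
        _ ≤ 7 * (1 / (42 * K)) := by
          gcongr; linarith [Real.pi_lt_d2]
        _ = 1 / (6 * K) := by field_simp; norm_num
    obtain ⟨c, u', v', huv', hs'⟩ := exists_large_lower_sum (P := P) (q := q) (L := L) hL1 hLP hq1
      (lo := fun n => ∑ l ∈ Finset.range (k + 2), f.coeff l * (n : ℝ) ^ l)
      (hi := fun n => ∑ l ∈ Finset.Ico (k + 2) (d + 1), f.coeff l * (n : ℝ) ^ l)
      hu hv hK hhi (by simpa only [hsplit] using hs)
    obtain ⟨g, hgdeg, hgc, hge, -⟩ := exists_lower_polynomial f hf (by omega : k + 1 ≤ d) (c / q)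
    have hK'1 : 1 ≤ K' := by
      rw [hK']
      have : 1 ≤ Q * (4 * X + 1) := one_le_mul_of_one_le_of_one_le hQ1 (by linarith)
      nlinarith
    obtain ⟨q', a, hq'1, hq', hqa'⟩ := hlead P hP K' hK'1 g hgdeg u' v' huv' (by
      have h1 : P / K' ≤ P / (2 * K * (q * (2 * P / L + 1))) := by
        rw [hK']
        have : 2 * (P : ℝ) / L ≤ 4 * X := by
          rw [div_le_iff₀ hL0]
          rw [div_le_iff₀ hX0] at hLge
          linarith
        gcongr
      refine h1.trans (hs'.trans (le_of_eq ?_))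
      congr 1
      refine Finset.sum_congr rfl fun n _ => ?_
      rw [hge]; congr 2; ring)
    rw [← hQ'] at hq' hqa'
    have hQ'1 : 1 ≤ Q' := le_trans (by exact_mod_cast hq'1) hq'
    have hle : Q' * Q ≤ C' * K ^ C' := by
      have : 0 ≤ X ^ d := by positivity
      linarith
    refine ⟨q * q', Nat.mul_pos hq1 hq'1, ?_, fun l hl1 hl2 => ?_⟩
    · push_cast
      calc (q : ℝ) * q' ≤ Q * Q' := by gcongr
        _ ≤ _ := by linarith
    · rcases eq_or_ne l (k + 1) with rfl | hne
      · rw [hgc] at hqa'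
        refine ⟨q * a - (if k = 0 then q' * c else 0), ?_⟩
        have h1 : ((q * q' : ℕ) : ℝ) * f.coeff (k + 1)
            - ((q * a - (if k = 0 then q' * c else 0) : ℤ) : ℝ)
            = q * (q' * (f.coeff (k + 1) + if k = 0 then (c : ℝ) / q else 0) - a) := by
          have hqne : (q : ℝ) ≠ 0 := by positivity
          split_ifs <;> push_cast <;> field_simp <;> ring
        rw [h1, abs_mul, abs_of_pos (by linarith : (0 : ℝ) < q)]
        calc (q : ℝ) * _ ≤ Q * (Q' / (P : ℝ) ^ (k + 1)) := by gcongr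
          _ = Q' * Q / (P : ℝ) ^ (k + 1) := by ring
          _ ≤ _ := by gcongr
      · obtain ⟨b, hb'⟩ := hqa l (by omega) hl2
        refine ⟨q' * b, ?_⟩
        have h1 : ((q * q' : ℕ) : ℝ) * f.coeff l - ((q' * b : ℤ) : ℝ) = q' * (q * f.coeff l - b) := by
          push_cast; ring
        rw [h1, abs_mul, abs_of_nonneg (by positivity)]
        calc (q' : ℝ) * _ ≤ Q' * (Q / (P : ℝ) ^ l) := by gcongr
          _ = Q' * Q / (P : ℝ) ^ l := by ring
          _ ≤ _ := by gcongr

/-- The inverse form of Weyl's inequality for all coefficients. -/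
theorem weyl_coeffs (d : ℕ) : ∃ C : ℕ, 1 ≤ C ∧ ∀ (P : ℕ), 1 ≤ P → ∀ K : ℝ, 1 ≤ K →
    ∀ f : Polynomial ℝ, f.natDegree ≤ d → ∀ u v : ℤ, -(P : ℤ) ≤ u → v ≤ P + 1 →
    P / K ≤ ‖∑ n ∈ Finset.Ico u v, e (f.eval (n : ℝ))‖ →
    ∃ q : ℕ, 1 ≤ q ∧ (q : ℝ) ≤ C * K ^ C ∧ ∀ l : ℕ, 1 ≤ l → l ≤ d →
      ∃ a : ℤ, |q * f.coeff l - a| ≤ C * K ^ C / (P : ℝ) ^ l := by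
  obtain ⟨C, hC, h⟩ := weyl_upper_coeffs d d le_rfl
  refine ⟨C, hC, fun P hP K hK f hf u v hu hv hs => ?_⟩
  obtain ⟨q, h1, h2, h3⟩ := h P hP K hK f hf u v hu hv hs
  exact ⟨q, h1, h2, fun l hl hld => h3 l (by omega) hld⟩

end DiscreteRadon
end

noncomputable section
namespace DiscreteRadon

/-! ### Words in the group -/

/-- `A₀(x)⁻¹` or `A₀(x)`. -/
def signedA0 (d : ℕ) {R : Type*} [CommRing R] (s : Bool) (x : R) : G0 d R :=
  if s then (A0 d x)⁻¹ else A0 d x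

/-- The common form of `D` (for `s = true`) and `D̃` (for `s = false`). -/
def word (d : ℕ) {R : Type*} [CommRing R] (s : Bool) {r : ℕ} (x y : Fin r → R) : G0 d R :=
  (List.ofFn fun i => signedA0 d s (x i) * signedA0 d (!s) (y i)).prod

/-- The homomorphism induced by a ring homomorphism on coordinates. -/
def G0.map {d : ℕ} {R S : Type*} [CommRing R] [CommRing S] (f : R →+* S) : G0 d R →* G0 d S where
  toFun g := ⟨fun l => f (g.coord l)⟩
  map_one' := by ext l; simp [G0.one_coord]
  map_mul' g h := by
    ext l
    by_cases hl : l.1.2 = 0 <;> simp [G0.mul_coord, hl]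

theorem G0.map_coord {d : ℕ} {R S : Type*} [CommRing R] [CommRing S] (f : R →+* S) (g : G0 d R)
    (l : Y d) : (G0.map f g).coord l = f (g.coord l) := rfl

theorem map_signedA0 {d : ℕ} {R S : Type*} [CommRing R] [CommRing S] (f : R →+* S) (s : Bool)
    (x : R) : G0.map f (signedA0 d s x) = signedA0 d s (f x) := by
  have h : G0.map f (A0 d x) = A0 d (f x) := by
    ext l
    simp only [G0.map_coord, A0]
    split_ifs <;> simp
  cases s <;> simp [signedA0, h]

theorem map_word {d : ℕ} {R S : Type*} [CommRing R] [CommRing S] (f : R →+* S) (s : Bool) {r : ℕ}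
    (x y : Fin r → R) : G0.map f (word d s x y) = word d s (fun i => f (x i)) fun i => f (y i) := by
  simp only [word, map_list_prod, List.map_ofFn, Function.comp_def, map_mul, map_signedA0]

theorem word_coord_map {d : ℕ} {R S : Type*} [CommRing R] [CommRing S] (f : R →+* S) (s : Bool)
    {r : ℕ} (x y : Fin r → R) (l : Y d) :
    (word d s (fun i => f (x i)) fun i => f (y i)).coord l = f ((word d s x y).coord l) := by
  rw [← map_word, G0.map_coord]

/-! ### Sizes -/

/-- A submultiplicative notion of size on a ring. -/
structure IsSize {R : Type} [CommRing R] (Bd : R → ℝ → Prop) : Prop where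
  nonneg : ∀ {f A}, Bd f A → 0 ≤ A
  mono : ∀ {f A A'}, Bd f A → A ≤ A' → Bd f A'
  zero : Bd 0 0
  one : Bd 1 1
  neg : ∀ {f A}, Bd f A → Bd (-f) A
  add : ∀ {f g A B}, Bd f A → Bd g B → Bd (f + g) (A + B)
  mul : ∀ {f g A B}, Bd f A → Bd g B → Bd (f * g) (A * B)

/-- `f` and `f₀` have size `c P ^ m` and differ by `c P ^ m lam`. -/
def Near {R : Type} [CommRing R] (Bd : R → ℝ → Prop) (P lam : ℝ) (m : ℕ) (c : ℝ) (f f₀ : R) : Prop :=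
  Bd f (c * P ^ m) ∧ Bd f₀ (c * P ^ m) ∧ Bd (f - f₀) (c * P ^ m * lam)

section Near

variable {R : Type} [CommRing R] {Bd : R → ℝ → Prop} (hB : IsSize Bd) {P lam : ℝ} (hP : 0 ≤ P)
  (hlam : 0 ≤ lam)

include hB hP hlam

theorem Near.mono {m : ℕ} {c c' : ℝ} {f f₀ : R} (h : Near Bd P lam m c f f₀) (hc : c ≤ c') :
    Near Bd P lam m c' f f₀ := by
  have h1 : c * P ^ m ≤ c' * P ^ m := by gcongr
  exact ⟨hB.mono h.1 h1, hB.mono h.2.1 h1, hB.mono h.2.2 (by gcongr)⟩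

theorem Near.zero {m : ℕ} {c : ℝ} (hc : 0 ≤ c) : Near Bd P lam m c 0 0 :=
  ⟨hB.mono hB.zero (by positivity), hB.mono hB.zero (by positivity), by
    rw [sub_zero]; exact hB.mono hB.zero (by positivity)⟩

omit hP hlam in
theorem Near.neg {m : ℕ} {c : ℝ} {f f₀ : R} (h : Near Bd P lam m c f f₀) :
    Near Bd P lam m c (-f) (-f₀) :=
  ⟨hB.neg h.1, hB.neg h.2.1, by
    have := hB.neg h.2.2
    rwa [neg_sub, sub_eq_neg_add, ← sub_neg_eq_add, sub_eq_add_neg, neg_neg, ← sub_neg_eq_add] at this⟩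

omit hP hlam in
theorem Near.add {m : ℕ} {c c' : ℝ} {f f₀ g g₀ : R} (h : Near Bd P lam m c f f₀)
    (h' : Near Bd P lam m c' g g₀) : Near Bd P lam m (c + c') (f + g) (f₀ + g₀) := by
  refine ⟨?_, ?_, ?_⟩
  · rw [add_mul]; exact hB.add h.1 h'.1
  · rw [add_mul]; exact hB.add h.2.1 h'.2.1
  · rw [add_mul, add_mul, add_sub_add_comm]; exact hB.add h.2.2 h'.2.2

omit hP hlam in
theorem Near.mul {m m' : ℕ} {c c' : ℝ} {f f₀ g g₀ : R} (h : Near Bd P lam m c f f₀)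
    (h' : Near Bd P lam m' c' g g₀) : Near Bd P lam (m + m') (2 * c * c') (f * g) (f₀ * g₀) := by
  have e1 : 2 * c * c' * P ^ (m + m') = 2 * ((c * P ^ m) * (c' * P ^ m')) := by rw [pow_add]; ring
  have h0 : 0 ≤ (c * P ^ m) * (c' * P ^ m') := mul_nonneg (hB.nonneg h.1) (hB.nonneg h'.1)
  refine ⟨?_, ?_, ?_⟩
  · rw [e1]; exact hB.mono (hB.mul h.1 h'.1) (by linarith)
  · rw [e1]; exact hB.mono (hB.mul h.2.1 h'.2.1) (by linarith)
  · have : f * g - f₀ * g₀ = (f - f₀) * g + f₀ * (g - g₀) := by ring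
    rw [this, e1]
    exact hB.mono (hB.add (hB.mul h.2.2 h'.1) (hB.mul h.2.1 h'.2.2)) (le_of_eq (by ring))

theorem Near.pow {f f₀ : R} (h : Near Bd P lam 1 1 f f₀) (n : ℕ) :
    Near Bd P lam n (2 ^ n) (f ^ n) (f₀ ^ n) := by
  induction n with
  | zero =>
    simp only [pow_zero]
    exact ⟨by simpa using hB.one, by simpa using hB.one, by
      rw [sub_self]; exact hB.mono hB.zero (by simpa using hlam)⟩
  | succ n ih =>
    rw [pow_succ f, pow_succ f₀]
    refine Near.mono hB hP hlam (ih.mul hB h) (le_of_eq ?_)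
    rw [pow_succ]; ring

/-- Coordinatewise nearness with the homogeneous degrees. -/
def GNear {R : Type} [CommRing R] {d : ℕ} (Bd : R → ℝ → Prop) (P lam c : ℝ) (g g₀ : G0 d R) : Prop :=
  ∀ l, Near Bd P lam (deg l) c (g.coord l) (g₀.coord l)

variable {d : ℕ}

theorem GNear.mul {c c' : ℝ} (hc : 0 ≤ c) (hc' : 0 ≤ c') {g g₀ h h₀ : G0 d R}
    (hg : GNear Bd P lam c g g₀) (hh : GNear Bd P lam c' h h₀) :
    GNear Bd P lam (c + c' + 2 * c * c') (g * h) (g₀ * h₀) := by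
  intro l
  rw [G0.mul_coord, G0.mul_coord]
  split_ifs with hl
  · exact ((hg l).add hB (hh l)).mono hB hP hlam (by nlinarith)
  · exact ((hg l).add hB (hh l)).add hB ((hg l.left).mul hB (hh (l.right hl)))

theorem GNear.inv {c : ℝ} (hc : 0 ≤ c) {g g₀ : G0 d R} (hg : GNear Bd P lam c g g₀) :
    GNear Bd P lam (c + 2 * c * c) g⁻¹ g₀⁻¹ := by
  intro l
  rw [G0.inv_coord, G0.inv_coord]
  split_ifs with hl
  · exact ((hg l).neg hB).mono hB hP hlam (by nlinarith)
  · exact ((hg l).neg hB).add hB ((hg l.left).mul hB (hg (l.right hl)))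

theorem GNear.A0 {x x₀ : R} (h : Near Bd P lam 1 1 x x₀) :
    GNear Bd P lam (2 ^ d) (A0 d x) (A0 d x₀) := by
  intro l
  have hl := mem_pairs.1 l.2
  simp only [DiscreteRadon.A0]
  split_ifs with h0
  · have h1 : deg l = l.1.1 := by simp [deg, h0]
    rw [h1]
    exact (h.pow hB hP hlam _).mono hB hP hlam (pow_le_pow_right₀ (by norm_num) hl.2)
  · exact Near.zero hB hP hlam (by positivity)

theorem GNear.signedA0 {x x₀ : R} (h : Near Bd P lam 1 1 x x₀) (s : Bool) :
    GNear Bd P lam (2 ^ d + 2 * 2 ^ d * 2 ^ d) (signedA0 d s x) (signedA0 d s x₀) := by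
  cases s
  · simp only [DiscreteRadon.signedA0]
    intro l
    exact (GNear.A0 hB hP hlam h l).mono hB hP hlam (by
      have : (0 : ℝ) < 2 ^ d := by positivity
      nlinarith)
  · simp only [DiscreteRadon.signedA0]
    exact GNear.inv hB hP hlam (by positivity) (GNear.A0 hB hP hlam h)

end Near

theorem exists_word_near (d r : ℕ) : ∃ c : ℝ, 0 ≤ c ∧ ∀ (s : Bool) {R : Type} [CommRing R]
    {Bd : R → ℝ → Prop}, IsSize Bd → ∀ {P lam : ℝ}, 0 ≤ P → 0 ≤ lam → ∀ x y x₀ y₀ : Fin r → R,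
    (∀ i, Near Bd P lam 1 1 (x i) (x₀ i)) → (∀ i, Near Bd P lam 1 1 (y i) (y₀ i)) →
    GNear Bd P lam c (word d s x y) (word d s x₀ y₀) := by
  induction r with
  | zero =>
    refine ⟨0, le_rfl, fun s R _ Bd hB P lam hP hlam x y x₀ y₀ _ _ l => ?_⟩
    simp only [word, List.ofFn_zero, List.prod_nil, G0.one_coord]
    exact Near.zero hB hP hlam le_rfl
  | succ r ih =>
    obtain ⟨c, hc, ih⟩ := ih
    set c₁ : ℝ := 2 ^ d + 2 * 2 ^ d * 2 ^ d with hc₁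
    have hc₁0 : 0 ≤ c₁ := by positivity
    refine ⟨(c₁ + c₁ + 2 * c₁ * c₁) + c + 2 * (c₁ + c₁ + 2 * c₁ * c₁) * c, by positivity,
      fun s R _ Bd hB P lam hP hlam x y x₀ y₀ hx hy => ?_⟩
    simp only [word, List.ofFn_succ, List.prod_cons]
    refine GNear.mul hB hP hlam (by positivity) hc (GNear.mul hB hP hlam hc₁0 hc₁0
      (GNear.signedA0 hB hP hlam (hx 0) s) (GNear.signedA0 hB hP hlam (hy 0) _)) ?_
    exact ih s hB hP hlam _ _ _ _ (fun i => hx i.succ) fun i => hy i.succ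

theorem isSize_abs : IsSize fun (x : ℝ) (A : ℝ) => |x| ≤ A where
  nonneg h := (abs_nonneg _).trans h
  mono h h' := h.trans h'
  zero := by simp
  one := by simp
  neg h := by rwa [abs_neg]
  add h h' := (abs_add_le _ _).trans (add_le_add h h')
  mul h h' := by
    rw [abs_mul]; exact mul_le_mul h h' (abs_nonneg _) ((abs_nonneg _).trans h)

theorem exists_abs_word_sub_le (d r : ℕ) : ∃ c : ℝ, 0 ≤ c ∧ ∀ (s : Bool) {P lam : ℝ},
    0 ≤ P → 0 ≤ lam → ∀ x y x₀ y₀ : Fin r → ℝ, (∀ i, |x i| ≤ P) → (∀ i, |y i| ≤ P) →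
    (∀ i, |x₀ i| ≤ P) → (∀ i, |y₀ i| ≤ P) → (∀ i, |x i - x₀ i| ≤ P * lam) →
    (∀ i, |y i - y₀ i| ≤ P * lam) → ∀ l, |(word d s x y).coord l| ≤ c * P ^ deg l ∧
      |(word d s x y).coord l - (word d s x₀ y₀).coord l| ≤ c * P ^ deg l * lam := by
  obtain ⟨c, hc, h⟩ := exists_word_near d r
  refine ⟨c, hc, fun s P lam hP hlam x y x₀ y₀ hx hy hx₀ hy₀ hxx hyy l => ?_⟩
  have := h s isSize_abs hP hlam x y x₀ y₀
    (fun i => ⟨by simpa using hx i, by simpa using hx₀ i, by simpa using hxx i⟩)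
    (fun i => ⟨by simpa using hy i, by simpa using hy₀ i, by simpa using hyy i⟩) l
  exact ⟨this.1, this.2.2⟩

end DiscreteRadon
end

noncomputable section
namespace DiscreteRadon
open MeasureTheory

/-! ### Fourier analysis on the unit cube -/

/-- The half open unit cube. -/
def unitCube (ι : Type*) : Set (ι → ℝ) := Set.pi Set.univ fun _ => Set.Ico (0 : ℝ) 1

section Cube

theorem unitCube_subset_Icc {ι : Type} : unitCube ι ⊆ Set.Icc 0 1 := fun _ hx =>
  ⟨fun i => (hx i trivial).1, fun i => (hx i trivial).2.le⟩

variable {ι : Type} [Fintype ι]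

theorem measurableSet_unitCube : MeasurableSet (unitCube ι) :=
  MeasurableSet.univ_pi fun _ => measurableSet_Ico

theorem volume_unitCube : volume (unitCube ι) = 1 := by
  rw [unitCube, volume_pi_pi]; simp

theorem measureReal_unitCube : volume.real (unitCube ι) = 1 := by
  simp [Measure.real, volume_unitCube]

theorem integrableOn_unitCube {f : (ι → ℝ) → ℂ} (hf : Continuous f) :
    IntegrableOn f (unitCube ι) :=
  (hf.continuousOn.integrableOn_compact isCompact_Icc).mono_set unitCube_subset_Icc

theorem integral_e_int (n : ℤ) : ∫ t in Set.Ico (0 : ℝ) 1, e (n * t) = if n = 0 then 1 else 0 := by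
  rw [integral_Ico_eq_integral_Ioc, ← intervalIntegral.integral_of_le zero_le_one]
  split_ifs with h
  · subst h; simp [e_zero]
  · have hc : (2 * Real.pi * Complex.I * n : ℂ) ≠ 0 := by
      simp [Real.pi_ne_zero, h]
    have : ∀ t : ℝ, e (n * t) = Complex.exp ((2 * Real.pi * Complex.I * n) * t) := fun t => by
      rw [e]; congr 1; push_cast; ring
    simp_rw [this]
    rw [integral_exp_mul_complex hc, ← this, ← this, mul_one, mul_zero, e_int, e_zero]
    simp

theorem integral_unitCube_e (n : ι → ℤ) :
    ∫ θ in unitCube ι, e (∑ i, n i * θ i) = if n = 0 then 1 else 0 := by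
  simp_rw [e_sum]
  rw [unitCube, volume_pi, Measure.restrict_pi_pi,
    integral_fintype_prod_eq_prod fun i t => e (n i * t)]
  simp_rw [integral_e_int]
  split_ifs with h
  · simp [h]
  · obtain ⟨i, hi⟩ := Function.ne_iff.1 h
    exact Finset.prod_eq_zero (Finset.mem_univ i) (if_neg hi)

/-- Decomposition of an integral over the cubes of the integer lattice. -/
theorem hasSum_integral_unitCube {f : (ι → ℝ) → ℂ} (hf : Integrable f) :
    HasSum (fun m : ι → ℤ => ∫ x in unitCube ι, f (fun i => x i + m i)) (∫ x, f x) := by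
  set Q : (ι → ℤ) → Set (ι → ℝ) := fun m => {x | ∀ i, ⌊x i⌋ = m i} with hQ
  have hmeas : ∀ m, MeasurableSet (Q m) := fun m => by
    have : Q m = ⋂ i, (fun x : ι → ℝ => ⌊x i⌋) ⁻¹' {m i} := by ext x; simp [hQ]
    rw [this]
    exact MeasurableSet.iInter fun i =>
      (Int.measurable_floor.comp (measurable_pi_apply i)) (measurableSet_singleton _)
  have hdisj : Pairwise (Function.onFun Disjoint Q) := fun m m' hmm => by
    rw [Function.onFun, Set.disjoint_left]
    intro x hx hx'
    exact hmm (funext fun i => (hx i).symm.trans (hx' i))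
  have hun : ⋃ m, Q m = Set.univ := by
    ext x; simp only [Set.mem_iUnion, Set.mem_univ, iff_true]
    exact ⟨fun i => ⌊x i⌋, fun i => rfl⟩
  have h1 := hasSum_integral_iUnion hmeas hdisj (f := f) (μ := volume)
    (by rw [hun]; exact hf.integrableOn)
  rw [hun, setIntegral_univ] at h1
  suffices key : ∀ m : ι → ℤ, ∫ x in unitCube ι, f (fun i => x i + m i) = ∫ x in Q m, f x by
    simpa only [key] using h1
  intro m
  set v : ι → ℝ := fun i => (m i : ℝ) with hv
  have h2 := (measurePreserving_add_right (volume : Measure (ι → ℝ)) v).setIntegral_preimage_emb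
    (measurableEmbedding_addRight v) f (Q m)
  rw [← h2]
  have h3 : (fun x => x + v) ⁻¹' (Q m) = unitCube ι := by
    ext x
    simp only [hQ, hv, Set.mem_preimage, Set.mem_ofPred_eq, Pi.add_apply, unitCube, Set.mem_pi,
      Set.mem_univ, true_implies, Set.mem_Ico]
    refine forall_congr' fun i => ?_
    rw [Int.floor_add_intCast, add_eq_right, Int.floor_eq_zero_iff, Set.mem_Ico]
  rw [h3]; rfl

theorem norm_setIntegral_unitCube_le {f : (ι → ℝ) → ℂ} {B : ℝ} (h : ∀ θ ∈ unitCube ι, ‖f θ‖ ≤ B) :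
    ‖∫ θ in unitCube ι, f θ‖ ≤ B := by
  have := norm_setIntegral_le_of_norm_le_const (μ := volume) (s := unitCube ι) (f := f)
    (by rw [volume_unitCube]; exact ENNReal.one_lt_top) h
  rwa [measureReal_unitCube, mul_one] at this

theorem card_filter_eq_integral {Z : Type*} (S : Finset Z) (X : Z → ι → ℤ) (X₀ : ι → ℤ)
    [DecidablePred fun z => X z = X₀] :
    ((S.filter fun z => X z = X₀).card : ℂ)
      = ∫ θ in unitCube ι, e (-∑ i, X₀ i * θ i) * ∑ z ∈ S, e (∑ i, X z i * θ i) := by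
  have h1 : ∀ θ : ι → ℝ, e (-∑ i, X₀ i * θ i) * ∑ z ∈ S, e (∑ i, X z i * θ i)
      = ∑ z ∈ S, e (∑ i, ((X z - X₀) i : ℤ) * θ i) := fun θ => by
    rw [Finset.mul_sum]
    refine Finset.sum_congr rfl fun z _ => ?_
    rw [← e_add, ← Finset.sum_neg_distrib, ← Finset.sum_add_distrib]
    congr 1
    refine Finset.sum_congr rfl fun i _ => ?_
    simp only [Pi.sub_apply]; push_cast; ring
  simp_rw [h1]
  rw [integral_finsetSum _ fun z _ => integrableOn_unitCube (by
    unfold e; fun_prop)]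
  simp_rw [integral_unitCube_e, sub_eq_zero]
  rw [Finset.card_filter]; push_cast; rfl

end Cube

/-! ### The mean value estimate -/

/-- The indices `(l, 0)`. -/
abbrev Z (d : ℕ) : Type := {l : Y d // l.1.2 = 0}

/-- The sum of the degrees of the indices `(l, 0)`. -/
def degZ (d : ℕ) : ℕ := ∑ l : Z d, deg l.1

theorem deg_Z {d : ℕ} (l : Z d) : deg l.1 = l.1.1.1 := by simp [deg, l.2]

theorem Z_bounds {d : ℕ} (l : Z d) : 1 ≤ l.1.1.1 ∧ l.1.1.1 ≤ d := by
  have := mem_pairs.1 l.1.2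
  omega

/-- The polynomial `∑ θ_{l0} X ^ l`. -/
def phasePoly {d : ℕ} (θ : Z d → ℝ) : Polynomial ℝ :=
  ∑ l : Z d, Polynomial.C (θ l) * Polynomial.X ^ l.1.1.1

theorem phasePoly_eval {d : ℕ} (θ : Z d → ℝ) (x : ℝ) :
    (phasePoly θ).eval x = ∑ l : Z d, θ l * x ^ l.1.1.1 := by
  simp [phasePoly, Polynomial.eval_finsetSum]

theorem phasePoly_natDegree {d : ℕ} (θ : Z d → ℝ) : (phasePoly θ).natDegree ≤ d :=
  Polynomial.natDegree_sum_le_of_forall_le _ _ fun l _ =>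
    (Polynomial.natDegree_C_mul_X_pow_le _ _).trans (Z_bounds l).2

theorem phasePoly_coeff {d : ℕ} (θ : Z d → ℝ) (l : Z d) :
    (phasePoly θ).coeff l.1.1.1 = θ l := by
  rw [phasePoly, Polynomial.finsetSum_coeff, Finset.sum_eq_single l]
  · simp
  · intro l' _ hne
    rw [Polynomial.coeff_C_mul, Polynomial.coeff_X_pow, if_neg, mul_zero]
    intro h
    exact hne (Subtype.ext (Subtype.ext (Prod.ext h.symm (l'.2.trans l.2.symm))))
  · simp

/-- The Weyl sum `∑_{|n| ≤ P} e(∑ θ_{l0} n ^ l)`. -/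
def weylSum {d : ℕ} (P : ℕ) (θ : Z d → ℝ) : ℂ :=
  ∑ n ∈ Finset.Icc (-(P : ℤ)) P, e (∑ l : Z d, θ l * (n : ℝ) ^ l.1.1.1)

theorem continuous_weylSum {d : ℕ} (P : ℕ) : Continuous (weylSum (d := d) P) := by
  unfold weylSum e; fun_prop

theorem card_Icc_le {P : ℕ} (hP : 1 ≤ P) : ((Finset.Icc (-(P : ℤ)) P).card : ℝ) ≤ 3 * P := by
  rw [Int.card_Icc]; exact_mod_cast (by omega : ((P : ℤ) + 1 - -P).toNat ≤ 3 * P)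

theorem norm_weylSum_le {d P : ℕ} (hP : 1 ≤ P) (θ : Z d → ℝ) : ‖weylSum P θ‖ ≤ 3 * P := by
  refine (norm_sum_le _ _).trans ?_
  simp only [norm_e, Finset.sum_const, nsmul_eq_mul, mul_one]
  exact card_Icc_le hP

theorem measure_weylSum_large (d : ℕ) : ∃ C : ℕ, 1 ≤ C ∧ ∀ (P : ℕ), 1 ≤ P → ∀ K : ℝ, 1 ≤ K →
    volume.real (unitCube (Z d) ∩ {θ | P / K ≤ ‖weylSum P θ‖}) ≤ C * K ^ C / (P : ℝ) ^ degZ d := by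
  classical
  obtain ⟨C, hC1, hC⟩ := weyl_coeffs d
  have hpoly : PolyBdd fun K => (C * K ^ C) * (7 * (C * K ^ C)) ^ Fintype.card (Z d)
      * (2 * (C * K ^ C)) ^ Fintype.card (Z d) := by
    have hQ : PolyBdd fun K => (C * K ^ C : ℝ) := (PolyBdd.const C).mul (PolyBdd.id.pow C)
    exact (hQ.mul (((PolyBdd.const 7).mul hQ).pow _)).mul (((PolyBdd.const 2).mul hQ).pow _)
  obtain ⟨C', hC', hbd⟩ := hpoly.exists_le
  refine ⟨C', hC', fun P hP K hK => ?_⟩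
  have hP0 : (0 : ℝ) < P := by exact_mod_cast hP
  set Q : ℝ := C * K ^ C with hQ
  have hQ1 : 1 ≤ Q :=
    one_le_mul_of_one_le_of_one_le (by exact_mod_cast hC1) (one_le_pow₀ hK)
  have hQ0 : 0 < Q := by linarith
  set T : Finset (ℕ × (Z d → ℤ)) :=
    Finset.Icc 1 ⌊Q⌋₊ ×ˢ Fintype.piFinset fun _ => Finset.Icc (-(⌈2 * Q⌉₊ : ℤ)) ⌈2 * Q⌉₊ with hT
  set box : ℕ × (Z d → ℤ) → Set (Z d → ℝ) := fun t =>
    Set.Icc (fun l => t.2 l / t.1 - Q / (P : ℝ) ^ deg l.1) fun l => t.2 l / t.1 + Q / (P : ℝ) ^ deg l.1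
    with hbox
  have hsub : unitCube (Z d) ∩ {θ | P / K ≤ ‖weylSum P θ‖} ⊆ ⋃ t ∈ T, box t := by
    rintro θ ⟨hθ, hW⟩
    obtain ⟨q, hq1, hqQ, hqa⟩ := hC P hP K hK (phasePoly θ) (phasePoly_natDegree θ) (-P) (P + 1)
      le_rfl le_rfl (by
        have : Finset.Ico (-(P : ℤ)) (P + 1) = Finset.Icc (-(P : ℤ)) P := by
          ext x; simp only [Finset.mem_Ico, Finset.mem_Icc]; omega
        rw [this]
        simp only [phasePoly_eval]
        exact hW)
    choose! a ha using hqa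
    have hq0 : (1 : ℝ) ≤ q := by exact_mod_cast hq1
    simp only [Set.mem_iUnion]
    refine ⟨(q, fun l => a l.1.1.1), ?_, ?_⟩
    · rw [hT, Finset.mem_product, Finset.mem_Icc, Fintype.mem_piFinset]
      refine ⟨⟨hq1, Nat.le_floor hqQ⟩, fun l => ?_⟩
      have h1 := ha _ (Z_bounds l).1 (Z_bounds l).2
      rw [phasePoly_coeff] at h1
      have h2 : Q / (P : ℝ) ^ l.1.1.1 ≤ Q :=
        div_le_self hQ0.le (one_le_pow₀ (by exact_mod_cast hP))
      have h3 := hθ l trivial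
      have h4 := abs_le.1 (h1.trans h2)
      have h5 : q * θ l ≤ Q := by nlinarith [h3.1, h3.2]
      have h6 : 0 ≤ q * θ l := mul_nonneg (by linarith) h3.1
      have h7 := Nat.le_ceil (2 * Q)
      rw [Finset.mem_Icc]
      constructor
      · have : (-(⌈2 * Q⌉₊ : ℝ)) ≤ a l.1.1.1 := by linarith
        exact_mod_cast this
      · have : (a l.1.1.1 : ℝ) ≤ ⌈2 * Q⌉₊ := by linarith
        exact_mod_cast this
    · have h0 : ∀ l : Z d, |θ l - a l.1.1.1 / q| ≤ Q / (P : ℝ) ^ deg l.1 := fun l => by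
        have h1 := ha _ (Z_bounds l).1 (Z_bounds l).2
        rw [phasePoly_coeff, ← deg_Z] at h1
        have h2 : θ l - a l.1.1.1 / q = (q * θ l - a l.1.1.1) / q := by
          field_simp
        rw [h2, abs_div, abs_of_pos (by linarith : (0 : ℝ) < q)]
        rw [deg_Z] at h1
        rw [deg_Z]
        exact (div_le_self (abs_nonneg _) hq0).trans h1
      exact ⟨fun l => by have := abs_le.1 (h0 l); simp only; linarith,
        fun l => by have := abs_le.1 (h0 l); simp only; linarith⟩
  have hvol : ∀ t : ℕ × (Z d → ℤ), volume.real (box t) = ∏ l : Z d, 2 * (Q / (P : ℝ) ^ deg l.1) := by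
    intro t
    rw [Measure.real, Real.volume_Icc_pi_toReal]
    · refine Finset.prod_congr rfl fun l _ => ?_
      ring
    · intro l
      have : 0 ≤ Q / (P : ℝ) ^ deg l.1 := by positivity
      simp only; linarith
  have hprod : ∏ l : Z d, 2 * (Q / (P : ℝ) ^ deg l.1)
      = (2 * Q) ^ Fintype.card (Z d) / (P : ℝ) ^ degZ d := by
    rw [degZ, ← Finset.prod_pow_eq_pow_sum, ← Finset.card_univ, ← Finset.prod_const,
      ← Finset.prod_div_distrib]
    refine Finset.prod_congr rfl fun l _ => ?_
    ring
  have hTcard : (T.card : ℝ) ≤ Q * (7 * Q) ^ Fintype.card (Z d) := by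
    rw [hT, Finset.card_product, Fintype.card_piFinset]
    simp only [Finset.prod_const, Nat.card_Icc, Int.card_Icc, Nat.add_sub_cancel, Finset.card_univ]
    push_cast
    have h1 : (((⌈2 * Q⌉₊ : ℤ) + 1 - -(⌈2 * Q⌉₊ : ℤ)).toNat : ℝ) ≤ 7 * Q := by
      have h2 : (((⌈2 * Q⌉₊ : ℤ) + 1 - -(⌈2 * Q⌉₊ : ℤ)).toNat : ℝ) = 2 * ⌈2 * Q⌉₊ + 1 := by
        have : (((⌈2 * Q⌉₊ : ℤ) + 1 - -(⌈2 * Q⌉₊ : ℤ)).toNat) = 2 * ⌈2 * Q⌉₊ + 1 := by omega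
        rw [this]; push_cast; ring
      have := Nat.ceil_lt_add_one (a := 2 * Q) (by positivity)
      linarith
    gcongr
    exact Nat.floor_le hQ0.le
  have hfin : volume (⋃ t ∈ T, box t) ≠ ⊤ := by
    refine ((measure_biUnion_finset_le T box).trans_lt ?_).ne
    exact ENNReal.sum_lt_top.2 fun t _ => isCompact_Icc.measure_lt_top
  calc volume.real (unitCube (Z d) ∩ {θ | P / K ≤ ‖weylSum P θ‖})
      ≤ volume.real (⋃ t ∈ T, box t) := measureReal_mono hsub hfin
    _ ≤ ∑ t ∈ T, volume.real (box t) := measureReal_biUnion_finset_le _ _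
    _ = T.card * ((2 * Q) ^ Fintype.card (Z d) / (P : ℝ) ^ degZ d) := by
        simp_rw [hvol, hprod]; rw [Finset.sum_const, nsmul_eq_mul]
    _ ≤ (Q * (7 * Q) ^ Fintype.card (Z d)) * ((2 * Q) ^ Fintype.card (Z d) / (P : ℝ) ^ degZ d) := by
        gcongr
    _ = Q * (7 * Q) ^ Fintype.card (Z d) * (2 * Q) ^ Fintype.card (Z d) / (P : ℝ) ^ degZ d := by ring
    _ ≤ _ := div_le_div_of_nonneg_right (hbd K hK) (by positivity)

theorem integral_weylSum_pow_le (d : ℕ) : ∃ C : ℕ, 1 ≤ C ∧ ∀ (N P : ℕ), 1 ≤ P → ∀ K : ℝ, 1 ≤ K →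
    ∫ θ in unitCube (Z d), ‖weylSum P θ‖ ^ (2 * N)
      ≤ (3 * P) ^ (2 * N) * (C * K ^ C / (P : ℝ) ^ degZ d + (K ^ (2 * N))⁻¹) := by
  obtain ⟨C, hC1, hC⟩ := measure_weylSum_large d
  refine ⟨C, hC1, fun N P hP K hK => ?_⟩
  have hP0 : (0 : ℝ) < P := by exact_mod_cast hP
  have hcont : Continuous fun θ : Z d → ℝ => ‖weylSum P θ‖ := (continuous_weylSum P).norm
  set A : Set (Z d → ℝ) := {θ | P / K ≤ ‖weylSum P θ‖} with hA
  have hAm : MeasurableSet A := (isClosed_le continuous_const hcont).measurableSet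
  have hfinQ : volume (unitCube (Z d)) ≠ ⊤ := by rw [volume_unitCube]; exact ENNReal.one_ne_top
  have hint : IntegrableOn (fun θ => ‖weylSum P θ‖ ^ (2 * N)) (unitCube (Z d)) :=
    ((hcont.pow _).continuousOn.integrableOn_compact isCompact_Icc).mono_set unitCube_subset_Icc
  have hint2 : IntegrableOn (fun θ => (3 * (P : ℝ)) ^ (2 * N) * A.indicator (fun _ => (1 : ℝ)) θ
      + (3 * (P : ℝ)) ^ (2 * N) * (K ^ (2 * N))⁻¹) (unitCube (Z d)) := by
    refine Integrable.add (Integrable.const_mul ?_ _) (integrableOn_const hfinQ)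
    exact (integrableOn_const (C := (1 : ℝ)) hfinQ).indicator hAm
  calc ∫ θ in unitCube (Z d), ‖weylSum P θ‖ ^ (2 * N)
      ≤ ∫ θ in unitCube (Z d), ((3 * (P : ℝ)) ^ (2 * N) * A.indicator (fun _ => (1 : ℝ)) θ
        + (3 * (P : ℝ)) ^ (2 * N) * (K ^ (2 * N))⁻¹) := by
        refine setIntegral_mono_on hint hint2 measurableSet_unitCube fun θ _ => ?_
        by_cases hθ : θ ∈ A
        · rw [Set.indicator_of_mem hθ, mul_one]
          have h1 : ‖weylSum P θ‖ ^ (2 * N) ≤ (3 * (P : ℝ)) ^ (2 * N) := by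
            gcongr; exact norm_weylSum_le hP θ
          have : 0 ≤ (3 * (P : ℝ)) ^ (2 * N) * (K ^ (2 * N))⁻¹ := by positivity
          linarith
        · rw [Set.indicator_of_notMem hθ, mul_zero, zero_add, ← div_eq_mul_inv, ← div_pow]
          have : ‖weylSum P θ‖ < P / K := not_le.1 hθ
          gcongr
          refine this.le.trans ?_
          gcongr; linarith
    _ = (3 * (P : ℝ)) ^ (2 * N) * volume.real (unitCube (Z d) ∩ A)
        + (3 * (P : ℝ)) ^ (2 * N) * (K ^ (2 * N))⁻¹ := by
        rw [integral_add (Integrable.const_mul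
          ((integrableOn_const (C := (1 : ℝ)) hfinQ).indicator hAm) _) (integrableOn_const hfinQ),
          integral_const_mul, setIntegral_const, measureReal_unitCube, one_smul,
          setIntegral_indicator hAm]
        simp
    _ ≤ _ := by
        rw [mul_add]
        gcongr
        exact hC P hP K hK

/-! ### The abelian coordinates of words -/

/-- The sign `1` or `-1`. -/
def sgn (s : Bool) : ℤ := if s then 1 else -1

theorem signedA0_coord_Z {d : ℕ} {R : Type*} [CommRing R] (s : Bool) (x : R) (l : Z d) :
    (signedA0 d s x).coord l.1 = -(sgn s : R) * x ^ l.1.1.1 := by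
  cases s <;> simp [signedA0, sgn, G0.inv_coord, A0, l.2]

theorem word_coord_Z {d : ℕ} {R : Type*} [CommRing R] (s : Bool) {r : ℕ} (x y : Fin r → R) (l : Z d) :
    (word d s x y).coord l.1 = ∑ i, (sgn s : R) * (y i ^ l.1.1.1 - x i ^ l.1.1.1) := by
  induction r with
  | zero => simp [word, G0.one_coord]
  | succ r ih =>
    rw [Fin.sum_univ_succ, ← ih (fun i => x i.succ) fun i => y i.succ]
    simp only [word, List.ofFn_succ, List.prod_cons]
    rw [G0.mul_coord, dif_pos l.2, G0.mul_coord, dif_pos l.2, signedA0_coord_Z, signedA0_coord_Z]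
    congr 1
    cases s <;> simp [sgn] <;> ring

/-- The number of words with prescribed abelian coordinates. -/
theorem card_word_fiber_le {d : ℕ} (s : Bool) (N P : ℕ) (X : Z d → ℤ) :
    (((Fintype.piFinset (fun _ : Fin N => Finset.Icc (-(P : ℤ)) P) ×ˢ
      Fintype.piFinset (fun _ : Fin N => Finset.Icc (-(P : ℤ)) P)).filter fun z =>
        (fun l : Z d => (word d s z.1 z.2).coord l.1) = X).card : ℝ)
      ≤ ∫ θ in unitCube (Z d), ‖weylSum P θ‖ ^ (2 * N) := by
  have h := card_filter_eq_integral (Fintype.piFinset (fun _ : Fin N => Finset.Icc (-(P : ℤ)) P) ×ˢ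
      Fintype.piFinset (fun _ : Fin N => Finset.Icc (-(P : ℤ)) P))
      (fun z => fun l : Z d => (word d s z.1 z.2).coord l.1) X
  have h1 : ∀ θ : Z d → ℝ, ‖e (-∑ i, X i * θ i) * ∑ z ∈
      Fintype.piFinset (fun _ : Fin N => Finset.Icc (-(P : ℤ)) P) ×ˢ
      Fintype.piFinset (fun _ : Fin N => Finset.Icc (-(P : ℤ)) P),
      e (∑ l : Z d, ((word d s z.1 z.2).coord l.1 : ℝ) * θ l)‖ = ‖weylSum P θ‖ ^ (2 * N) := by
    intro θ
    rw [norm_mul, norm_e, one_mul, Finset.sum_product]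
    set f : ℤ → ℝ := fun n => ∑ l : Z d, θ l * (n : ℝ) ^ l.1.1.1 with hf
    have h2 : ∀ x y : Fin N → ℤ, e (∑ l : Z d, ((word d s x y).coord l.1 : ℝ) * θ l)
        = (∏ i, e (-sgn s * f (x i))) * ∏ i, e (sgn s * f (y i)) := by
      intro x y
      rw [← e_sum, ← e_sum, ← e_add, ← Finset.sum_add_distrib]
      congr 1
      simp_rw [word_coord_Z, hf]
      push_cast
      simp_rw [Finset.sum_mul, Finset.mul_sum]
      rw [Finset.sum_comm]
      refine Finset.sum_congr rfl fun i _ => ?_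
      rw [← Finset.sum_add_distrib]
      refine Finset.sum_congr rfl fun l _ => ?_
      ring
    simp_rw [h2]
    simp_rw [← Finset.mul_sum]
    rw [← Finset.sum_mul,
      ← Finset.prod_univ_sum (fun _ => Finset.Icc (-(P : ℤ)) P) (fun _ n => e (-sgn s * f n)),
      ← Finset.prod_univ_sum (fun _ => Finset.Icc (-(P : ℤ)) P) (fun _ n => e (sgn s * f n))]
    simp only [Finset.prod_const, Finset.card_univ, Fintype.card_fin]
    have h3 : ∀ σ : ℝ, σ = 1 ∨ σ = -1 →
        ‖∑ n ∈ Finset.Icc (-(P : ℤ)) P, e (σ * f n)‖ = ‖weylSum P θ‖ := by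
      rintro σ (rfl | rfl)
      · simp only [one_mul]; rfl
      · have : ∑ n ∈ Finset.Icc (-(P : ℤ)) P, e (-1 * f n)
            = (starRingEnd ℂ) (weylSum P θ) := by
          rw [weylSum, map_sum]
          refine Finset.sum_congr rfl fun n _ => ?_
          rw [conj_e, neg_one_mul]
        rw [this, RCLike.norm_conj]
    rw [norm_mul, norm_pow, norm_pow, h3, h3, two_mul, pow_add]
    · cases s <;> simp [sgn]
    · cases s <;> simp [sgn]
  have h4 := norm_integral_le_integral_norm (μ := volume.restrict (unitCube (Z d)))
    (fun θ : Z d → ℝ => e (-∑ i, X i * θ i) * ∑ z ∈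
      Fintype.piFinset (fun _ : Fin N => Finset.Icc (-(P : ℤ)) P) ×ˢ
      Fintype.piFinset (fun _ : Fin N => Finset.Icc (-(P : ℤ)) P),
      e (∑ l : Z d, ((word d s z.1 z.2).coord l.1 : ℝ) * θ l))
  simp only [h1] at h4
  rw [← h, Complex.norm_natCast] at h4
  convert h4

end DiscreteRadon
end

noncomputable section
namespace DiscreteRadon

/-! ### The large sieve step -/

/-- `θ` is not close to any rational with denominator at most `5 K`, at scale `K ^ 3 / (L A)`. -/
def FarFromRationals (θ K : ℝ) (A L : ℕ) : Prop :=
  ∀ q : ℕ, ∀ a : ℤ, 1 ≤ q → (q : ℝ) ≤ 5 * K → 40 * K ^ 3 / (L * A) < |q * θ - a|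

theorem sum_norm_geometric_le {θ K : ℝ} {A L : ℕ} (hK : 1 ≤ K) (hA : 20 * K ^ 2 ≤ A)
    (hL : 48 * K ^ 2 ≤ L) (hθ : FarFromRationals θ K A L) (t : ℤ) :
    ∑ c ∈ Finset.Icc (-(2 * A : ℤ)) (2 * A), ‖∑ z ∈ Finset.Ico t (t + L), e (θ * c * z)‖
      ≤ 9 / 2 * A * L / K := by
  classical
  have hK0 : 0 < K := by linarith
  have hA0 : (0 : ℝ) < A := lt_of_lt_of_le (by positivity) hA
  have hL0 : (0 : ℝ) < L := lt_of_lt_of_le (by positivity) hL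
  set B := Finset.Icc (-(2 * A : ℤ)) (2 * A) with hB
  set H := B.filter fun c : ℤ => ∃ a : ℤ, |θ * c - a| ≤ K / L with hH
  have hcard : (H.card : ℝ) ≤ 2 * A / K := by
    by_contra! hcon
    obtain ⟨q, a, hq1, hq, hqa⟩ := vinogradov (P := 2 * A) (H := H) (ρ := 1 / K) (η := K / L)
      (β := θ) (fun h hh => by
        have := Finset.mem_Icc.1 (Finset.mem_filter.1 hh).1
        rw [abs_le]; push_cast; exact this) (by positivity)
      (by rw [div_le_one hK0]; exact hK) (by push_cast; refine le_trans (le_of_eq ?_) hcon.le; ring)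
      (by positivity) (by
        rw [div_div, div_le_div_iff₀ hL0 (by positivity)]; nlinarith) (by
        push_cast
        rw [div_pow, one_pow, one_div, ← div_eq_inv_mul, le_div_iff₀ (by positivity)]
        nlinarith) (fun h hh => (Finset.mem_filter.1 hh).2)
    have h1 := hθ q a hq1 (by rwa [div_div_eq_mul_div, div_one] at hq)
    have h2 : 80 * (K / L) / ((1 / K) ^ 2 * ((2 * A : ℕ) : ℝ)) = 40 * K ^ 3 / (L * A) := by
      push_cast; field_simp; norm_num
    rw [h2] at hqa
    linarith
  have h1 : ∀ c ∈ H, ‖∑ z ∈ Finset.Ico t (t + L), e (θ * c * z)‖ ≤ L := fun c _ =>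
    norm_sum_Ico_e_le (by simp) _
  have h2 : ∀ c ∈ B.filter (fun c : ℤ => ¬ ∃ a : ℤ, |θ * c - a| ≤ K / L),
      ‖∑ z ∈ Finset.Ico t (t + L), e (θ * c * z)‖ ≤ L / (2 * K) := by
    intro c hc
    have h3 := (Finset.mem_filter.1 hc).2
    push Not at h3
    have h4 := norm_sum_e_linear_le (by positivity) h3 t (t + L) 0
    simp only [add_zero] at h4
    refine h4.trans (le_of_eq ?_)
    field_simp
  rw [← Finset.sum_filter_add_sum_filter_not _ (fun c : ℤ => ∃ a : ℤ, |θ * c - a| ≤ K / L)]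
  have h5 := Finset.sum_le_card_nsmul _ _ _ h1
  have h6 := Finset.sum_le_card_nsmul _ _ _ h2
  rw [nsmul_eq_mul] at h5 h6
  have h7 : ((B.filter (fun c : ℤ => ¬ ∃ a : ℤ, |θ * c - a| ≤ K / L)).card : ℝ) ≤ 5 * A := by
    have h8 := Finset.card_filter_le B (fun c : ℤ => ¬ ∃ a : ℤ, |θ * c - a| ≤ K / L)
    have h9 : B.card ≤ 5 * A := by
      rw [hB, Int.card_Icc]
      have : 1 ≤ A := by exact_mod_cast hA0
      omega
    exact_mod_cast h8.trans h9
  calc _ ≤ (H.card : ℝ) * L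
        + ((B.filter (fun c : ℤ => ¬ ∃ a : ℤ, |θ * c - a| ≤ K / L)).card : ℝ) * (L / (2 * K)) :=
        add_le_add h5 h6
    _ ≤ (2 * A / K) * L + (5 * A) * (L / (2 * K)) := by gcongr
    _ = _ := by field_simp; norm_num

theorem sum_norm_sq_linear_le {θ K : ℝ} {A L : ℕ} (hK : 1 ≤ K) (hA : 20 * K ^ 2 ≤ A)
    (hL : 48 * K ^ 2 ≤ L) (hθ : FarFromRationals θ K A L) {α : ℤ → ℂ} {B : ℝ}
    (hα : ∀ a, ‖α a‖ ≤ B) (t : ℤ) :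
    ∑ z ∈ Finset.Ico t (t + L), ‖∑ a ∈ Finset.Icc (-(A : ℤ)) A, α a * e (-(θ * a * z))‖ ^ 2
      ≤ 14 * B ^ 2 * A ^ 2 * L / K := by
  have hK0 : 0 < K := by linarith
  have hA0 : (0 : ℝ) < A := lt_of_lt_of_le (by positivity) hA
  have hB : 0 ≤ B := (norm_nonneg _).trans (hα 0)
  set I := Finset.Icc (-(A : ℤ)) A with hI
  have h1 : ((∑ z ∈ Finset.Ico t (t + L), ‖∑ a ∈ I, α a * e (-(θ * a * z))‖ ^ 2 : ℝ) : ℂ)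
      = ∑ a ∈ I, ∑ a' ∈ I, (starRingEnd ℂ (α a) * α a')
        * ∑ z ∈ Finset.Ico t (t + L), e (θ * ((a - a' : ℤ) : ℝ) * z) := by
    push_cast
    simp_rw [← Complex.ofReal_pow, ← Complex.normSq_eq_norm_sq, Complex.normSq_eq_conj_mul_self,
      map_sum, Finset.sum_mul_sum, map_mul, conj_e]
    rw [Finset.sum_comm]
    refine Finset.sum_congr rfl fun a _ => ?_
    rw [Finset.sum_comm]
    refine Finset.sum_congr rfl fun a' _ => ?_
    rw [Finset.mul_sum]
    refine Finset.sum_congr rfl fun z _ => ?_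
    rw [mul_mul_mul_comm, ← e_add]
    congr 2; ring
  have h2 : ∑ z ∈ Finset.Ico t (t + L), ‖∑ a ∈ I, α a * e (-(θ * a * z))‖ ^ 2
      = ‖((∑ z ∈ Finset.Ico t (t + L), ‖∑ a ∈ I, α a * e (-(θ * a * z))‖ ^ 2 : ℝ) : ℂ)‖ := by
    rw [Complex.norm_real, Real.norm_eq_abs, abs_of_nonneg (Finset.sum_nonneg fun _ _ => by positivity)]
  rw [h2, h1]
  have h3 : ∀ a ∈ I, ‖∑ a' ∈ I, (starRingEnd ℂ (α a) * α a')
        * ∑ z ∈ Finset.Ico t (t + L), e (θ * ((a - a' : ℤ) : ℝ) * z)‖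
      ≤ B ^ 2 * (9 / 2 * A * L / K) := by
    intro a ha
    rw [hI, Finset.mem_Icc] at ha
    calc _ ≤ ∑ a' ∈ I, B ^ 2 * ‖∑ z ∈ Finset.Ico t (t + L), e (θ * ((a - a' : ℤ) : ℝ) * z)‖ := by
          refine (norm_sum_le _ _).trans (Finset.sum_le_sum fun a' _ => ?_)
          rw [norm_mul, norm_mul, RCLike.norm_conj, sq]
          gcongr
          · exact hα a
          · exact hα a'
      _ = B ^ 2 * ∑ c ∈ I.image (fun a' => a - a'),
          ‖∑ z ∈ Finset.Ico t (t + L), e (θ * (c : ℝ) * z)‖ := by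
          rw [← Finset.mul_sum, Finset.sum_image fun x _ y _ h => by simpa using h]
      _ ≤ B ^ 2 * ∑ c ∈ Finset.Icc (-(2 * A : ℤ)) (2 * A),
          ‖∑ z ∈ Finset.Ico t (t + L), e (θ * (c : ℝ) * z)‖ := by
          refine mul_le_mul_of_nonneg_left ?_ (by positivity)
          refine Finset.sum_le_sum_of_subset_of_nonneg
            (f := fun c : ℤ => ‖∑ z ∈ Finset.Ico t (t + L), e (θ * (c : ℝ) * z)‖)
            (fun c hc => ?_) fun _ _ _ => norm_nonneg _
          obtain ⟨a', ha', rfl⟩ := Finset.mem_image.1 hc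
          rw [hI, Finset.mem_Icc] at ha'
          rw [Finset.mem_Icc]; omega
      _ ≤ _ := by
          gcongr
          exact sum_norm_geometric_le hK hA hL hθ t
  calc _ ≤ ∑ a ∈ I, B ^ 2 * (9 / 2 * A * L / K) :=
        (norm_sum_le _ _).trans (Finset.sum_le_sum h3)
    _ ≤ (3 * A) * (B ^ 2 * (9 / 2 * A * L / K)) := by
        rw [Finset.sum_const, nsmul_eq_mul]
        gcongr
        exact card_Icc_le (by exact_mod_cast hA0)
    _ ≤ _ := by
        rw [div_eq_mul_inv, div_eq_mul_inv]
        have : 0 ≤ B ^ 2 * A ^ 2 * L * K⁻¹ := by positivity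
        calc 3 * A * (B ^ 2 * (9 / 2 * A * L * K⁻¹)) = 27 / 2 * (B ^ 2 * A ^ 2 * L * K⁻¹) := by ring
          _ ≤ 14 * (B ^ 2 * A ^ 2 * L * K⁻¹) := by linarith
          _ = _ := by ring

theorem sum_norm_sq_step_le {θ K : ℝ} {A S : ℕ} (hK : 1 ≤ K) (hA : 20 * K ^ 2 ≤ A)
    (hL : 48 * K ^ 2 ≤ (2 * S + 1 : ℕ)) (hθ : FarFromRationals θ K A (2 * S + 1)) {α : ℤ → ℤ → ℂ}
    {B : ℝ} (hα : ∀ a b, ‖α a b‖ ≤ B) {f : ℤ → ℂ} {β : ℝ}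
    (hf : ∀ t : ℤ, ∑ z ∈ Finset.Ico t (t + (2 * S + 1 : ℕ)), ‖f z‖ ^ 2 ≤ β ^ 2) (t : ℤ) :
    ∑ z ∈ Finset.Ico t (t + (2 * S + 1 : ℕ)), ‖∑ b ∈ Finset.Icc (-(S : ℤ)) S,
      (∑ a ∈ Finset.Icc (-(A : ℤ)) A, α a b * e (-(θ * a * z))) * f (z + b)‖ ^ 2
      ≤ 14 * B ^ 2 * A ^ 2 * (2 * S + 1) ^ 2 / K * β ^ 2 := by
  have hK0 : 0 < K := by linarith
  set L : ℕ := 2 * S + 1 with hLdef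
  set c : ℤ → ℤ → ℂ := fun b z => ∑ a ∈ Finset.Icc (-(A : ℤ)) A, α a b * e (-(θ * a * z)) with hc
  have h1 : ∀ z : ℤ, ‖∑ b ∈ Finset.Icc (-(S : ℤ)) S, c b z * f (z + b)‖ ^ 2
      ≤ (∑ b ∈ Finset.Icc (-(S : ℤ)) S, ‖c b z‖ ^ 2) * β ^ 2 := by
    intro z
    have h2 : ∑ b ∈ Finset.Icc (-(S : ℤ)) S, ‖f (z + b)‖ ^ 2 ≤ β ^ 2 := by
      refine le_trans (le_of_eq ?_) (hf (z - S))
      refine Finset.sum_nbij' (fun b => z + b) (fun y => y - z) ?_ ?_ ?_ ?_ ?_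
      · intro b hb; simp only [Finset.mem_Icc, Finset.mem_Ico] at hb ⊢; omega
      · intro b hb; simp only [Finset.mem_Icc, Finset.mem_Ico] at hb ⊢; omega
      · intro b _; simp
      · intro b _; simp
      · intro b _; rfl
    calc _ ≤ (∑ b ∈ Finset.Icc (-(S : ℤ)) S, ‖c b z‖ * ‖f (z + b)‖) ^ 2 := by
          gcongr
          refine (norm_sum_le _ _).trans (le_of_eq ?_)
          simp only [norm_mul]
      _ ≤ (∑ b ∈ Finset.Icc (-(S : ℤ)) S, ‖c b z‖ ^ 2)
          * ∑ b ∈ Finset.Icc (-(S : ℤ)) S, ‖f (z + b)‖ ^ 2 := Finset.sum_mul_sq_le_sq_mul_sq _ _ _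
      _ ≤ _ := by gcongr
  calc _ ≤ ∑ z ∈ Finset.Ico t (t + L), (∑ b ∈ Finset.Icc (-(S : ℤ)) S, ‖c b z‖ ^ 2) * β ^ 2 :=
        Finset.sum_le_sum fun z _ => h1 z
    _ = (∑ b ∈ Finset.Icc (-(S : ℤ)) S, ∑ z ∈ Finset.Ico t (t + L), ‖c b z‖ ^ 2) * β ^ 2 := by
        rw [← Finset.sum_mul, Finset.sum_comm]
    _ ≤ (∑ b ∈ Finset.Icc (-(S : ℤ)) S, 14 * B ^ 2 * A ^ 2 * L / K) * β ^ 2 := by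
        gcongr with b _
        exact sum_norm_sq_linear_le hK hA hL hθ (fun a => hα a b) t
    _ = _ := by
        rw [Finset.sum_const, nsmul_eq_mul, Int.card_Icc]
        have : ((S : ℤ) + 1 - -(S : ℤ)).toNat = L := by omega
        rw [this, hLdef]; push_cast; ring

/-! ### Superpositions of characters in one variable -/

/-- `F (z, w)` is a superposition of functions `e (κ w) f (z)`, with total local `L²` size `b` in
windows of length `L`. -/
def Atomic (L : ℕ) (F : ℤ → ℤ → ℂ) (b : ℝ) : Prop :=
  ∃ (Ω : Type) (_ : Fintype Ω) (κ : Ω → ℝ) (f : Ω → ℤ → ℂ) (β : Ω → ℝ),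
    (∀ z w, F z w = ∑ o, e (κ o * w) * f o z) ∧
    (∀ o t, ∑ z ∈ Finset.Ico t (t + (L : ℤ)), ‖f o z‖ ^ 2 ≤ β o ^ 2) ∧ (∀ o, 0 ≤ β o) ∧
    ∑ o, β o ≤ b

theorem Atomic.mono {L : ℕ} {F : ℤ → ℤ → ℂ} {b b' : ℝ} (h : Atomic L F b) (hb : b ≤ b') :
    Atomic L F b' := by
  obtain ⟨Ω, i, κ, f, β, h1, h2, h3, h4⟩ := h
  exact ⟨Ω, i, κ, f, β, h1, h2, h3, h4.trans hb⟩

theorem Atomic.sum {T : Type} (O : Finset T) {L : ℕ} {F : T → ℤ → ℤ → ℂ} {b : T → ℝ}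
    (h : ∀ c ∈ O, Atomic L (F c) (b c)) :
    Atomic L (fun z w => ∑ c ∈ O, F c z w) (∑ c ∈ O, b c) := by
  have h' : ∀ c : O, Atomic L (F c) (b c) := fun c => h c c.2
  choose Ω fΩ κ f β h1 h2 h3 h4 using h'
  refine ⟨Σ c : O, Ω c, inferInstance, fun o => κ o.1 o.2, fun o => f o.1 o.2, fun o => β o.1 o.2,
    fun z w => ?_, fun o => h2 o.1 o.2, fun o => h3 o.1 o.2, ?_⟩
  · rw [Fintype.sum_sigma]
    change ∑ c ∈ O, F c z w = _
    rw [← Finset.sum_coe_sort O]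
    exact Finset.sum_congr rfl fun c _ => h1 c z w
  · rw [Fintype.sum_sigma, ← Finset.sum_coe_sort O]
    exact Finset.sum_le_sum fun c _ => h4 c

theorem Atomic.norm_le {L : ℕ} (hL : 1 ≤ L) {F : ℤ → ℤ → ℂ} {b : ℝ} (h : Atomic L F b) (z w : ℤ) :
    ‖F z w‖ ≤ b := by
  obtain ⟨Ω, _, κ, f, β, h1, h2, h3, h4⟩ := h
  rw [h1]
  refine (norm_sum_le _ _).trans ((Finset.sum_le_sum fun o _ => ?_).trans h4)
  rw [norm_mul, norm_e, one_mul]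
  refine abs_le_of_sq_le_sq' ?_ (h3 o) |>.2
  refine le_trans ?_ (h2 o z)
  exact Finset.single_le_sum (f := fun z => ‖f o z‖ ^ 2) (fun _ _ => by positivity)
    (by rw [Finset.mem_Ico]; omega)

theorem Atomic.step {θ K : ℝ} {A S : ℕ} (hK : 1 ≤ K) (hA : 20 * K ^ 2 ≤ A)
    (hL : 48 * K ^ 2 ≤ (2 * S + 1 : ℕ)) (hθ : FarFromRationals θ K A (2 * S + 1)) {α : ℤ → ℤ → ℂ}
    {B : ℝ} (hα : ∀ a b, ‖α a b‖ ≤ B) {F : ℤ → ℤ → ℂ} {b₀ : ℝ} (hF : Atomic (2 * S + 1) F b₀)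
    (lam₁ lam₂ : ℝ) :
    Atomic (2 * S + 1) (fun z w => ∑ b ∈ Finset.Icc (-(S : ℤ)) S, ∑ a ∈ Finset.Icc (-(A : ℤ)) A,
      α a b * e (-(θ * a * z)) * e (lam₁ * z + lam₂ * w) * F (z + b) (w + a))
      (4 * B * A * (2 * S + 1) / √K * b₀) := by
  have hK0 : 0 < K := by linarith
  have hB : 0 ≤ B := (norm_nonneg _).trans (hα 0 0)
  obtain ⟨Ω, _, κ, f, β, h1, h2, h3, h4⟩ := hF
  refine ⟨Ω, inferInstance, fun o => κ o + lam₂, fun o z => e (lam₁ * z) *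
    ∑ b ∈ Finset.Icc (-(S : ℤ)) S, (∑ a ∈ Finset.Icc (-(A : ℤ)) A,
      (α a b * e (κ o * a)) * e (-(θ * a * z))) * f o (z + b),
    fun o => 4 * B * A * (2 * S + 1) / √K * β o, fun z w => ?_, fun o t => ?_, fun o => ?_, ?_⟩
  · simp_rw [h1, Finset.mul_sum]
    have : ∀ b ∈ Finset.Icc (-(S : ℤ)) S, (∑ a ∈ Finset.Icc (-(A : ℤ)) A, ∑ o,
        α a b * e (-(θ * a * z)) * e (lam₁ * z + lam₂ * w) * (e (κ o * (w + a : ℤ)) * f o (z + b)))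
        = ∑ o, ∑ a ∈ Finset.Icc (-(A : ℤ)) A, α a b * e (-(θ * a * z)) * e (lam₁ * z + lam₂ * w) *
          (e (κ o * (w + a : ℤ)) * f o (z + b)) := fun b _ => Finset.sum_comm
    rw [Finset.sum_congr rfl this, Finset.sum_comm]
    refine Finset.sum_congr rfl fun o _ => Finset.sum_congr rfl fun b _ => ?_
    rw [Finset.sum_mul, Finset.mul_sum, Finset.mul_sum]
    refine Finset.sum_congr rfl fun a _ => ?_
    have e1 : e (κ o * (w + a : ℤ)) = e (κ o * w) * e (κ o * a) := by
      rw [← e_add]; congr 1; push_cast; ring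
    have e2 : e ((κ o + lam₂) * w) = e (κ o * w) * e (lam₂ * w) := by rw [← e_add]; ring_nf
    rw [e1, e2, e_add]; ring
  · simp only [norm_mul, norm_e, one_mul]
    refine (sum_norm_sq_step_le hK hA hL hθ (α := fun a b => α a b * e (κ o * a)) (B := B)
      (fun a b => by rw [norm_mul, norm_e, mul_one]; exact hα a b) (h2 o) t).trans ?_
    have h5 : (4 * B * A * (2 * S + 1) / √K * β o) ^ 2
        = 16 * B ^ 2 * A ^ 2 * (2 * S + 1) ^ 2 / K * β o ^ 2 := by
      rw [mul_pow, div_pow, Real.sq_sqrt hK0.le]; ring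
    rw [h5]
    gcongr
    norm_num
  · have := h3 o
    positivity
  · rw [← Finset.mul_sum]
    gcongr

end DiscreteRadon
end

noncomputable section
namespace DiscreteRadon

/-! ### Sums over words -/

/-- The box `[-P, P]^r × [-P, P]^r`. -/
def box (P r : ℕ) : Finset ((Fin r → ℤ) × (Fin r → ℤ)) :=
  Fintype.piFinset (fun _ : Fin r => Finset.Icc (-(P : ℤ)) P) ×ˢ
    Fintype.piFinset (fun _ : Fin r => Finset.Icc (-(P : ℤ)) P)

theorem mem_box {P r : ℕ} {z : (Fin r → ℤ) × (Fin r → ℤ)} :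
    z ∈ box P r ↔ (∀ i, |z.1 i| ≤ P) ∧ ∀ i, |z.2 i| ≤ P := by
  simp [box, Fintype.mem_piFinset, abs_le]

/-- The linear pairing of a frequency with a group element. -/
def pairing {d : ℕ} (θ : Y d → ℝ) (g : G0 d ℤ) : ℝ := ∑ l, θ l * g.coord l

/-- The abelian coordinates of a group element. -/
def ab {d : ℕ} (g : G0 d ℤ) (l : Z d) : ℤ := g.coord l.1

/-- The bilinear form measuring the failure of `pairing θ` to be additive. -/
def bil {d : ℕ} (θ : Y d → ℝ) (U X : Z d → ℤ) : ℝ :=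
  ∑ l : Y d, if h : l.1.2 = 0 then 0 else θ l * U ⟨l.left, rfl⟩ * X ⟨l.right h, rfl⟩

/-- The weights of a word. -/
def wordWeight {r : ℕ} (φ ψ : Fin r → ℤ → ℂ) (z : (Fin r → ℤ) × (Fin r → ℤ)) : ℂ :=
  ∏ i, φ i (z.1 i) * ψ i (z.2 i)

/-- The weighted exponential sum over words. -/
def wordSum {d r : ℕ} (s : Bool) (P : ℕ) (φ ψ : Fin r → ℤ → ℂ) (θ : Y d → ℝ) : ℂ :=
  ∑ z ∈ box P r, wordWeight φ ψ z * e (-pairing θ (word d s z.1 z.2))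

/-- The weighted exponential sum over words, with an additional linear phase. -/
def twistedSum {d r : ℕ} (s : Bool) (P : ℕ) (φ ψ : Fin r → ℤ → ℂ) (θ : Y d → ℝ) (U : Z d → ℤ) : ℂ :=
  ∑ z ∈ box P r, wordWeight φ ψ z *
    e (-pairing θ (word d s z.1 z.2) - bil θ U (ab (word d s z.1 z.2)))

variable {d : ℕ}

theorem ab_mul (g h : G0 d ℤ) : ab (g * h) = ab g + ab h := by
  funext l
  simp only [ab, Pi.add_apply]
  rw [G0.mul_coord, dif_pos l.2]

theorem pairing_mul (θ : Y d → ℝ) (g h : G0 d ℤ) :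
    pairing θ (g * h) = pairing θ g + pairing θ h + bil θ (ab g) (ab h) := by
  simp only [pairing, bil, ← Finset.sum_add_distrib]
  refine Finset.sum_congr rfl fun l _ => ?_
  rw [G0.mul_coord]
  split_ifs with hl
  · push_cast; ring
  · simp only [ab]; push_cast; ring

theorem bil_add_left (θ : Y d → ℝ) (U V X : Z d → ℤ) : bil θ (U + V) X = bil θ U X + bil θ V X := by
  simp only [bil, ← Finset.sum_add_distrib]
  refine Finset.sum_congr rfl fun l _ => ?_
  split_ifs with hl
  · simp
  · simp only [Pi.add_apply]; push_cast; ring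

theorem bil_add_right (θ : Y d → ℝ) (U V X : Z d → ℤ) : bil θ X (U + V) = bil θ X U + bil θ X V := by
  simp only [bil, ← Finset.sum_add_distrib]
  refine Finset.sum_congr rfl fun l _ => ?_
  split_ifs with hl
  · simp
  · simp only [Pi.add_apply]; push_cast; ring

theorem bil_smul_left (θ : Y d → ℝ) (c : ℤ) (U X : Z d → ℤ) : bil θ (c • U) X = c * bil θ U X := by
  simp only [bil, Finset.mul_sum]
  refine Finset.sum_congr rfl fun l _ => ?_
  split_ifs with hl
  · simp
  · simp only [Pi.smul_apply, smul_eq_mul]; push_cast; ring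

theorem bil_smul_right (θ : Y d → ℝ) (c : ℤ) (U X : Z d → ℤ) : bil θ U (c • X) = c * bil θ U X := by
  simp only [bil, Finset.mul_sum]
  refine Finset.sum_congr rfl fun l _ => ?_
  split_ifs with hl
  · simp
  · simp only [Pi.smul_apply, smul_eq_mul]; push_cast; ring

@[simp] theorem bil_zero_left (θ : Y d → ℝ) (X : Z d → ℤ) : bil θ 0 X = 0 := by
  simpa using bil_smul_left θ 0 0 X

@[simp] theorem bil_zero_right (θ : Y d → ℝ) (X : Z d → ℤ) : bil θ X 0 = 0 := by
  simpa using bil_smul_right θ 0 X 0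

theorem bil_single_left_single_right (θ : Y d → ℝ) (l : Y d) (hl : l.1.2 ≠ 0) :
    bil θ (Pi.single ⟨l.left, rfl⟩ 1) (Pi.single ⟨l.right hl, rfl⟩ 1) = θ l := by
  rw [bil, Finset.sum_eq_single l]
  · rw [dif_neg hl]; simp
  · intro m _ hm
    split_ifs with h
    · rfl
    · by_cases h1 : m.1.1 = l.1.1
      · have h2 : m.1.2 ≠ l.1.2 := fun h2 => hm (Subtype.ext (Prod.ext h1 h2))
        have : (⟨m.right h, rfl⟩ : Z d) ≠ ⟨l.right hl, rfl⟩ := by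
          intro h3
          exact h2 (congrArg (fun z : Z d => z.1.1.1) h3)
        rw [Pi.single_eq_of_ne this]; simp
      · have : (⟨m.left, rfl⟩ : Z d) ≠ ⟨l.left, rfl⟩ := by
          intro h3
          exact h1 (congrArg (fun z : Z d => z.1.1.1) h3)
        rw [Pi.single_eq_of_ne this]; simp
  · simp

theorem bil_single_eq_zero (θ : Y d → ℝ) (p t : Z d) (h : p.1.1.1 ≤ t.1.1.1) :
    bil θ (Pi.single p 1) (Pi.single t 1) = 0 := by
  refine Finset.sum_eq_zero fun m _ => ?_
  split_ifs with hm
  · rfl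
  · by_cases h1 : (⟨m.left, rfl⟩ : Z d) = p
    · have h2 : (⟨m.right hm, rfl⟩ : Z d) ≠ t := by
        rintro rfl
        subst h1
        have := (mem_pairs.1 m.2).1
        simp only [Y.left, Y.right] at h
        omega
      rw [Pi.single_eq_of_ne h2]; simp
    · rw [Pi.single_eq_of_ne h1]; simp

theorem twistedSum_zero_right {r : ℕ} (s : Bool) (P : ℕ) (φ ψ : Fin r → ℤ → ℂ) (θ : Y d → ℝ) :
    twistedSum s P φ ψ θ 0 = wordSum s P φ ψ θ := by
  simp [twistedSum, wordSum]

theorem twistedSum_of_length_zero (s : Bool) (P : ℕ) (φ ψ : Fin 0 → ℤ → ℂ) (θ : Y d → ℝ)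
    (U : Z d → ℤ) : twistedSum s P φ ψ θ U = 1 := by
  have h1 : ∀ x y : Fin 0 → ℤ, word d s x y = 1 := fun x y => by simp [word]
  have h2 : ab (1 : G0 d ℤ) = 0 := by funext l; simp [ab, G0.one_coord]
  have h3 : pairing θ (1 : G0 d ℤ) = 0 := by simp [pairing, G0.one_coord]
  have h4 : (box P 0).card = 1 := by simp [box]
  simp only [twistedSum, h1, h2, h3, bil_zero_right, wordWeight]
  simp [h4, e_zero]

theorem word_append {R : Type*} [CommRing R] (s : Bool) {m n : ℕ} (x₁ y₁ : Fin m → R)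
    (x₂ y₂ : Fin n → R) : word d s (Fin.append x₁ x₂) (Fin.append y₁ y₂)
      = word d s x₁ y₁ * word d s x₂ y₂ := by
  simp [word, List.ofFn_add]

theorem sum_box_add {P m n : ℕ} (F : (Fin (m + n) → ℤ) × (Fin (m + n) → ℤ) → ℂ) :
    ∑ z ∈ box P (m + n), F z
      = ∑ z ∈ box P m, ∑ w ∈ box P n, F (Fin.append z.1 w.1, Fin.append z.2 w.2) := by
  rw [← Finset.sum_product' (s := box P m) (t := box P n)
    (f := fun z w => F (Fin.append z.1 w.1, Fin.append z.2 w.2))]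
  symm
  refine Finset.sum_nbij' (fun p => (Fin.append p.1.1 p.2.1, Fin.append p.1.2 p.2.2))
    (fun z => ((fun i => z.1 (Fin.castAdd n i), fun i => z.2 (Fin.castAdd n i)),
      (fun i => z.1 (Fin.natAdd m i), fun i => z.2 (Fin.natAdd m i)))) ?_ ?_ ?_ ?_ ?_
  · rintro p hp
    rw [Finset.mem_product, mem_box, mem_box] at hp
    rw [mem_box]
    constructor
    · intro i; refine Fin.addCases (fun i => ?_) (fun i => ?_) i
      · simpa using hp.1.1 i
      · simpa using hp.2.1 i
    · intro i; refine Fin.addCases (fun i => ?_) (fun i => ?_) i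
      · simpa using hp.1.2 i
      · simpa using hp.2.2 i
  · rintro z hz
    rw [mem_box] at hz
    rw [Finset.mem_product, mem_box, mem_box]
    exact ⟨⟨fun i => hz.1 _, fun i => hz.2 _⟩, ⟨fun i => hz.1 _, fun i => hz.2 _⟩⟩
  · rintro p _; simp
  · rintro z _
    simp only
    ext i
    · exact congrFun (Fin.append_castAdd_natAdd (f := z.1)) i
    · exact congrFun (Fin.append_castAdd_natAdd (f := z.2)) i
  · rintro p _; rfl

theorem wordWeight_append {m n : ℕ} (φ ψ : Fin (m + n) → ℤ → ℂ) (z : (Fin m → ℤ) × (Fin m → ℤ))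
    (w : (Fin n → ℤ) × (Fin n → ℤ)) :
    wordWeight φ ψ (Fin.append z.1 w.1, Fin.append z.2 w.2)
      = wordWeight (fun i => φ (Fin.castAdd n i)) (fun i => ψ (Fin.castAdd n i)) z *
        wordWeight (fun i => φ (Fin.natAdd m i)) (fun i => ψ (Fin.natAdd m i)) w := by
  simp [wordWeight, Fin.prod_univ_add]

theorem twistedSum_append {m n : ℕ} (s : Bool) (P : ℕ) (φ ψ : Fin (m + n) → ℤ → ℂ) (θ : Y d → ℝ)
    (U : Z d → ℤ) : twistedSum s P φ ψ θ U = ∑ z ∈ box P m,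
      wordWeight (fun i => φ (Fin.castAdd n i)) (fun i => ψ (Fin.castAdd n i)) z *
      e (-pairing θ (word d s z.1 z.2) - bil θ U (ab (word d s z.1 z.2))) *
      twistedSum s P (fun i => φ (Fin.natAdd m i)) (fun i => ψ (Fin.natAdd m i)) θ
        (U + ab (word d s z.1 z.2)) := by
  rw [twistedSum, sum_box_add]
  refine Finset.sum_congr rfl fun z _ => ?_
  rw [twistedSum, Finset.mul_sum]
  refine Finset.sum_congr rfl fun w _ => ?_
  rw [wordWeight_append, word_append, pairing_mul, ab_mul, bil_add_left, bil_add_right]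
  have : -(pairing θ (word d s z.1 z.2) + pairing θ (word d s w.1 w.2) +
      bil θ (ab (word d s z.1 z.2)) (ab (word d s w.1 w.2))) -
      (bil θ U (ab (word d s z.1 z.2)) + bil θ U (ab (word d s w.1 w.2)))
      = (-pairing θ (word d s z.1 z.2) - bil θ U (ab (word d s z.1 z.2))) +
        (-pairing θ (word d s w.1 w.2) - (bil θ U (ab (word d s w.1 w.2)) +
          bil θ (ab (word d s z.1 z.2)) (ab (word d s w.1 w.2)))) := by ring
  rw [this, e_add]
  ring

theorem abs_ab_word_le (s : Bool) {N P : ℕ} {z : (Fin N → ℤ) × (Fin N → ℤ)} (hz : z ∈ box P N)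
    (l : Z d) : |ab (word d s z.1 z.2) l| ≤ 2 * N * P ^ l.1.1.1 := by
  rw [mem_box] at hz
  simp only [ab]
  rw [word_coord_Z]
  calc _ ≤ ∑ i, |(sgn s : ℤ) * (z.2 i ^ l.1.1.1 - z.1 i ^ l.1.1.1)| := Finset.abs_sum_le_sum_abs _ _
    _ ≤ ∑ i : Fin N, (2 * (P : ℤ) ^ l.1.1.1) := by
        refine Finset.sum_le_sum fun i _ => ?_
        have h1 : |(sgn s : ℤ)| = 1 := by cases s <;> simp [sgn]
        rw [abs_mul, h1, one_mul]
        have h2 : |z.2 i ^ l.1.1.1| ≤ (P : ℤ) ^ l.1.1.1 := by rw [abs_pow]; gcongr; exact hz.2 i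
        have h3 : |z.1 i ^ l.1.1.1| ≤ (P : ℤ) ^ l.1.1.1 := by rw [abs_pow]; gcongr; exact hz.1 i
        linarith [abs_sub (z.2 i ^ l.1.1.1) (z.1 i ^ l.1.1.1)]
    _ = _ := by rw [Finset.sum_const, Finset.card_univ, Fintype.card_fin, nsmul_eq_mul]; ring

/-- The amplitude with which the first block reaches given abelian coordinates. -/
def amplitude {N : ℕ} (s : Bool) (P : ℕ) (φ ψ : Fin N → ℤ → ℂ) (θ : Y d → ℝ) (X : Z d → ℤ) : ℂ :=
  ∑ z ∈ (box P N).filter fun z => ab (word d s z.1 z.2) = X,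
    wordWeight φ ψ z * e (-pairing θ (word d s z.1 z.2))

theorem norm_amplitude_le {N : ℕ} (s : Bool) {P : ℕ} {φ ψ : Fin N → ℤ → ℂ} {B : ℝ}
    (hφ : ∀ i n, ‖φ i n‖ ≤ B) (hψ : ∀ i n, ‖ψ i n‖ ≤ B) (θ : Y d → ℝ) (X : Z d → ℤ) :
    ‖amplitude s P φ ψ θ X‖ ≤ B ^ (2 * N) * ∫ t in unitCube (Z d), ‖weylSum P t‖ ^ (2 * N) := by
  have hB : 0 ≤ B ^ (2 * N) := (even_two_mul N).pow_nonneg B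
  calc _ ≤ ∑ z ∈ (box P N).filter fun z => ab (word d s z.1 z.2) = X, B ^ (2 * N) := by
        refine (norm_sum_le _ _).trans (Finset.sum_le_sum fun z _ => ?_)
        rw [norm_mul, norm_e, mul_one, wordWeight, norm_prod]
        calc _ ≤ ∏ i : Fin N, (B * B) := by
              refine Finset.prod_le_prod (fun _ _ => norm_nonneg _) fun i _ => ?_
              rw [norm_mul]
              exact mul_le_mul (hφ i _) (hψ i _) (norm_nonneg _) ((norm_nonneg _).trans (hφ i 0))
          _ = _ := by rw [Finset.prod_const, Finset.card_univ, Fintype.card_fin]; ring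
    _ ≤ _ := by
        rw [Finset.sum_const, nsmul_eq_mul, mul_comm]
        refine mul_le_mul_of_nonneg_left ?_ hB
        exact card_word_fiber_le s N P X

/-- The box containing the abelian coordinates of words of length `N`. -/
def abBox (d N P : ℕ) : Finset (Z d → ℤ) :=
  Fintype.piFinset fun l : Z d => Finset.Icc (-((2 * N * P ^ l.1.1.1 : ℕ) : ℤ)) (2 * N * P ^ l.1.1.1 : ℕ)

theorem twistedSum_append_eq_sum_abBox {m n : ℕ} (s : Bool) (P : ℕ) (φ ψ : Fin (m + n) → ℤ → ℂ)
    (θ : Y d → ℝ) (U : Z d → ℤ) : twistedSum s P φ ψ θ U = ∑ X ∈ abBox d m P,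
      amplitude s P (fun i => φ (Fin.castAdd n i)) (fun i => ψ (Fin.castAdd n i)) θ X *
      e (-bil θ U X) *
      twistedSum s P (fun i => φ (Fin.natAdd m i)) (fun i => ψ (Fin.natAdd m i)) θ (U + X) := by
  rw [twistedSum_append, ← Finset.sum_fiberwise_of_maps_to (s := box P m) (t := abBox d m P)
    (g := fun z => ab (word d s z.1 z.2))]
  · refine Finset.sum_congr rfl fun X _ => ?_
    rw [amplitude, Finset.sum_mul, Finset.sum_mul]
    refine Finset.sum_congr rfl fun z hz => ?_
    rw [(Finset.mem_filter.1 hz).2, sub_eq_add_neg, e_add]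
    ring
  · intro z hz
    rw [abBox, Fintype.mem_piFinset]
    intro l
    rw [Finset.mem_Icc, ← abs_le]
    push_cast
    exact abs_ab_word_le s hz l

end DiscreteRadon
end

noncomputable section
namespace DiscreteRadon

/-! ### Central frequencies -/

theorem sum_piFinset_Icc_split {ι : Type*} [Fintype ι] [DecidableEq ι] (R : ι → ℕ) {p t : ι}
    (hpt : p ≠ t) (f : (ι → ℤ) → ℂ) :
    ∑ X ∈ Fintype.piFinset (fun l => Finset.Icc (-(R l : ℤ)) (R l)), f X
      = ∑ c ∈ (Fintype.piFinset (fun l => Finset.Icc (-(R l : ℤ)) (R l))).filter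
          fun X => X p = 0 ∧ X t = 0,
        ∑ b ∈ Finset.Icc (-(R p : ℤ)) (R p), ∑ a ∈ Finset.Icc (-(R t : ℤ)) (R t),
          f (c + b • Pi.single p 1 + a • Pi.single t 1) := by
  simp_rw [← Finset.sum_product']
  symm
  refine Finset.sum_nbij' (fun q => q.1 + q.2.1 • Pi.single p 1 + q.2.2 • Pi.single t 1)
    (fun X => (Function.update (Function.update X p 0) t 0, X p, X t)) ?_ ?_ ?_ ?_ ?_
  · rintro ⟨c, b, a⟩ h
    simp only [Finset.mem_product, Finset.mem_filter, Fintype.mem_piFinset] at h ⊢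
    intro l
    by_cases h1 : l = p
    · subst h1; simpa [hpt, h.1.2.1] using h.2.1
    · by_cases h2 : l = t
      · subst h2; simpa [h1, h.1.2.2] using h.2.2
      · simpa [h1, h2] using h.1.1 l
  · intro X h
    simp only [Finset.mem_product, Finset.mem_filter, Fintype.mem_piFinset] at h ⊢
    refine ⟨⟨fun l => ?_, by simp [hpt], by simp⟩, h p, h t⟩
    by_cases h2 : l = t
    · subst h2; simp
    · by_cases h1 : l = p
      · subst h1; simp [h2]
      · simpa [h1, h2] using h l
  · rintro ⟨c, b, a⟩ h
    simp only [Finset.mem_product, Finset.mem_filter] at h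
    refine Prod.ext ?_ (Prod.ext ?_ ?_)
    · funext l
      by_cases h2 : l = t
      · subst h2; simp [h.1.2.2]
      · by_cases h1 : l = p
        · subst h1; simp [h2, h.1.2.1]
        · simp [h1, h2]
    · simp [hpt, h.1.2.1]
    · simp [hpt.symm, h.1.2.2]
  · intro X _
    funext l
    by_cases h2 : l = t
    · subst h2; simp [hpt.symm]
    · by_cases h1 : l = p
      · subst h1; simp [h2]
      · simp [h1, h2]
  · intro _ _; rfl

variable {d : ℕ}

/-- The points of `abBox` on which two coordinates vanish. -/
def abSlice (N P : ℕ) (p t : Z d) : Finset (Z d → ℤ) :=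
  (abBox d N P).filter fun X => X p = 0 ∧ X t = 0

theorem card_abBox_le {N P : ℕ} (hN : 1 ≤ N) (hP : 1 ≤ P) :
    ((abBox d N P).card : ℝ) ≤ (6 * N) ^ Fintype.card (Z d) * P ^ degZ d := by
  rw [abBox, Fintype.card_piFinset, degZ, ← Finset.prod_pow_eq_pow_sum, ← Finset.card_univ,
    ← Finset.prod_const, ← Finset.prod_mul_distrib]
  push_cast
  refine Finset.prod_le_prod (fun _ _ => by positivity) fun l _ => ?_
  have := card_Icc_le (P := 2 * N * P ^ l.1.1.1) (Nat.one_le_iff_ne_zero.2 (by positivity))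
  rw [deg_Z]
  push_cast at this
  refine this.trans (le_of_eq ?_)
  ring

theorem card_abSlice_mul_le {N P : ℕ} {p t : Z d} (hpt : p ≠ t) :
    ((abSlice N P p t).card : ℝ) * ((2 * N * P ^ t.1.1.1 : ℕ) *
      (2 * (2 * N * P ^ p.1.1.1 : ℕ) + 1)) ≤ (abBox d N P).card := by
  have h := sum_piFinset_Icc_split (fun l : Z d => 2 * N * P ^ l.1.1.1) hpt fun _ => 1
  simp only [Finset.sum_const, nsmul_eq_mul, mul_one, Int.card_Icc] at h
  have h1 : (abBox d N P).card = (abSlice N P p t).card *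
      ((2 * (2 * N * P ^ p.1.1.1) + 1) * (2 * (2 * N * P ^ t.1.1.1) + 1)) := by
    have h2 : ∀ n : ℕ, ((n : ℤ) + 1 - -(n : ℤ)).toNat = 2 * n + 1 := fun n => by omega
    simp only [h2] at h
    exact_mod_cast h
  rw [h1]
  push_cast
  refine mul_le_mul_of_nonneg_left ?_ (Nat.cast_nonneg _)
  rw [mul_comm]
  refine mul_le_mul_of_nonneg_left ?_ (by positivity)
  have : (0 : ℝ) ≤ 2 * N * P ^ t.1.1.1 := by positivity
  linarith

theorem bil_slice (θ : Y d → ℝ) (l : Y d) (hl : l.1.2 ≠ 0) (U c : Z d → ℤ) (z w a b : ℤ) :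
    bil θ (U + z • Pi.single ⟨l.left, rfl⟩ 1 + w • Pi.single ⟨l.right hl, rfl⟩ 1)
      (c + b • Pi.single ⟨l.left, rfl⟩ 1 + a • Pi.single ⟨l.right hl, rfl⟩ 1)
      = bil θ U (c + b • Pi.single ⟨l.left, rfl⟩ 1 + a • Pi.single ⟨l.right hl, rfl⟩ 1)
        + θ l * a * z + bil θ (Pi.single ⟨l.left, rfl⟩ 1) c * z
        + bil θ (Pi.single ⟨l.right hl, rfl⟩ 1) c * w := by
  have hlt := (mem_pairs.1 l.2).1
  simp only [bil_add_left, bil_add_right, bil_smul_left, bil_smul_right,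
    bil_single_left_single_right θ l hl]
  rw [bil_single_eq_zero θ ⟨l.left, rfl⟩ ⟨l.left, rfl⟩ le_rfl,
    bil_single_eq_zero θ ⟨l.right hl, rfl⟩ ⟨l.left, rfl⟩ hlt.le,
    bil_single_eq_zero θ ⟨l.right hl, rfl⟩ ⟨l.right hl, rfl⟩ le_rfl]
  ring

theorem atomic_twistedSum (s : Bool) {N P : ℕ} (θ : Y d → ℝ) (l : Y d) (hl : l.1.2 ≠ 0)
    {K B : ℝ} (hK : 1 ≤ K) (hA : 20 * K ^ 2 ≤ (2 * N * P ^ l.1.2 : ℕ))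
    (hL : 48 * K ^ 2 ≤ (2 * (2 * N * P ^ l.1.1) + 1 : ℕ))
    (hθ : FarFromRationals (θ l) K (2 * N * P ^ l.1.2) (2 * (2 * N * P ^ l.1.1) + 1))
    {T : ℝ} (hT : ((abBox d N P).card : ℝ) ≤ T) (M : ℕ) :
    ∀ r : ℕ, r = M * N → ∀ φ ψ : Fin r → ℤ → ℂ, (∀ i n, ‖φ i n‖ ≤ B) → (∀ i n, ‖ψ i n‖ ≤ B) →
    ∀ U : Z d → ℤ, Atomic (2 * (2 * N * P ^ l.1.1) + 1) (fun z w => twistedSum s P φ ψ θ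
      (U + z • Pi.single ⟨l.left, rfl⟩ 1 + w • Pi.single ⟨l.right hl, rfl⟩ 1))
      ((T * (4 * (B ^ (2 * N) * ∫ t in unitCube (Z d), ‖weylSum P t‖ ^ (2 * N)) / √K))
        ^ M * √(2 * (2 * N * P ^ l.1.1) + 1 : ℕ)) := by
  set A : ℕ := 2 * N * P ^ l.1.2 with hAdef
  set S : ℕ := 2 * N * P ^ l.1.1 with hSdef
  set I : ℝ := ∫ t in unitCube (Z d), ‖weylSum P t‖ ^ (2 * N) with hI
  set p : Z d := ⟨l.left, rfl⟩ with hp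
  set t : Z d := ⟨l.right hl, rfl⟩ with ht
  have hpt : p ≠ t := fun h => by
    have h1 := congrArg (fun z : Z d => z.1.1.1) h
    have := (mem_pairs.1 l.2).1
    simp only [hp, ht, Y.left, Y.right] at h1
    omega
  have hI0 : 0 ≤ I := MeasureTheory.integral_nonneg fun _ => by positivity
  have hB0 : 0 ≤ B ^ (2 * N) := (even_two_mul N).pow_nonneg B
  induction M with
  | zero =>
    intro r hr φ ψ _ _ U
    have hr : r = 0 := by simpa using hr
    subst hr
    refine ⟨Unit, inferInstance, fun _ => 0, fun _ _ => 1, fun _ => √(2 * S + 1 : ℕ),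
      fun z w => ?_, fun _ t => ?_, fun _ => Real.sqrt_nonneg _, ?_⟩
    · simp only [twistedSum_of_length_zero]; simp [e_zero]
    · rw [Real.sq_sqrt (by positivity)]; simp only [norm_one, one_pow, Finset.sum_const, Int.card_Ico,
        add_sub_cancel_left, Int.toNat_natCast, nsmul_eq_mul, mul_one, le_refl]
    · simp
  | succ M ih =>
    intro r hr φ ψ hφ hψ U
    have hr : r = N + M * N := by rw [hr]; ring
    subst hr
    have h1 : ∀ z w : ℤ, twistedSum s P φ ψ θ (U + z • Pi.single p 1 + w • Pi.single t 1)
        = ∑ c ∈ abSlice N P p t, ∑ b ∈ Finset.Icc (-(S : ℤ)) S, ∑ a ∈ Finset.Icc (-(A : ℤ)) A,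
          (amplitude s P (fun i => φ (Fin.castAdd (M * N) i)) (fun i => ψ (Fin.castAdd (M * N) i)) θ
            (c + b • Pi.single p 1 + a • Pi.single t 1) *
            e (-bil θ U (c + b • Pi.single p 1 + a • Pi.single t 1))) *
          e (-(θ l * a * z)) * e (-bil θ (Pi.single p 1) c * z + -bil θ (Pi.single t 1) c * w) *
          twistedSum s P (fun i => φ (Fin.natAdd N i)) (fun i => ψ (Fin.natAdd N i)) θ
            (U + c + (z + b) • Pi.single p 1 + (w + a) • Pi.single t 1) := by
      intro z w
      rw [twistedSum_append_eq_sum_abBox, abBox,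
        sum_piFinset_Icc_split (fun l : Z d => 2 * N * P ^ l.1.1.1) hpt]
      refine Finset.sum_congr rfl fun c _ => Finset.sum_congr rfl fun b _ =>
        Finset.sum_congr rfl fun a _ => ?_
      have h2 : U + z • Pi.single p 1 + w • Pi.single t 1 +
          (c + b • Pi.single p 1 + a • Pi.single t 1)
          = U + c + (z + b) • Pi.single p 1 + (w + a) • Pi.single t 1 := by
        rw [add_smul, add_smul]; abel
      rw [h2, bil_slice, neg_add, neg_add, neg_add, e_add, e_add, e_add, e_add,
        neg_mul, neg_mul]
      ring
    simp_rw [h1]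
    have hT0 : 0 ≤ T := (Nat.cast_nonneg _).trans hT
    set b₀ : ℝ := (T * (4 * (B ^ (2 * N) * I) / √K)) ^ M * √(2 * S + 1 : ℕ)
      with hb₀
    have hb₀0 : 0 ≤ b₀ := by positivity
    have h3 := Atomic.sum (abSlice N P p t) fun c _ => Atomic.step hK hA hL hθ
      (α := fun a b => amplitude s P (fun i => φ (Fin.castAdd (M * N) i))
        (fun i => ψ (Fin.castAdd (M * N) i)) θ (c + b • Pi.single p 1 + a • Pi.single t 1) *
            e (-bil θ U (c + b • Pi.single p 1 + a • Pi.single t 1)))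
      (B := B ^ (2 * N) * I) (fun a b => by
        rw [norm_mul, norm_e, mul_one]
        exact norm_amplitude_le s (fun i n => hφ _ n) (fun i n => hψ _ n) θ _)
      (ih _ rfl (fun i => φ (Fin.natAdd N i)) (fun i => ψ (Fin.natAdd N i)) (fun i n => hφ _ n)
        (fun i n => hψ _ n) (U + c)) (-bil θ (Pi.single p 1) c) (-bil θ (Pi.single t 1) c)
    refine h3.mono ?_
    rw [Finset.sum_const, nsmul_eq_mul]
    have h4 : ((abSlice N P p t).card * (A * (2 * S + 1)) : ℝ) ≤ T :=
      (card_abSlice_mul_le (N := N) (P := P) hpt).trans hT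
    generalize ((abSlice N P p t).card : ℝ) = T₁ at h4 ⊢
    calc _ = (T₁ * (A * (2 * S + 1) : ℝ)) * (4 * (B ^ (2 * N) * I) / √K) * b₀ := by ring
      _ ≤ T * (4 * (B ^ (2 * N) * I) / √K) * b₀ := by gcongr
      _ = _ := by rw [hb₀, pow_succ]; ring

theorem norm_wordSum_le_of_farFromRationals (s : Bool) {N P r : ℕ} (θ : Y d → ℝ) (l : Y d)
    (hl : l.1.2 ≠ 0) {K B : ℝ} (hK : 1 ≤ K) (hA : 20 * K ^ 2 ≤ (2 * N * P ^ l.1.2 : ℕ))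
    (hL : 48 * K ^ 2 ≤ (2 * (2 * N * P ^ l.1.1) + 1 : ℕ))
    (hθ : FarFromRationals (θ l) K (2 * N * P ^ l.1.2) (2 * (2 * N * P ^ l.1.1) + 1)) {M : ℕ}
    (hr : r = M * N) {T : ℝ} (hT : ((abBox d N P).card : ℝ) ≤ T) {φ ψ : Fin r → ℤ → ℂ} (hφ : ∀ i n, ‖φ i n‖ ≤ B) (hψ : ∀ i n, ‖ψ i n‖ ≤ B) :
    ‖wordSum s P φ ψ θ‖ ≤ (T *
      (4 * (B ^ (2 * N) * ∫ t in unitCube (Z d), ‖weylSum P t‖ ^ (2 * N)) / √K)) ^ M *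
      √(2 * (2 * N * P ^ l.1.1) + 1 : ℕ) := by
  have h := (atomic_twistedSum s θ l hl hK hA hL hθ hT M r hr φ ψ hφ hψ 0).norm_le (by omega) 0 0
  rw [← twistedSum_zero_right]
  simpa using h

set_option maxHeartbeats 1000000 in
/-- Either the sum over words is small, or the frequency is close to a rational in a given central
coordinate. -/
theorem norm_wordSum_le_or_central (d : ℕ) : ∃ C : ℕ, 1 ≤ C ∧ ∀ N M : ℕ, 1 ≤ N → ∃ C' : ℝ, 1 ≤ C' ∧
    ∀ (s : Bool) (P : ℕ) (K Lam : ℝ), 1 ≤ P → 1 ≤ K → 0 ≤ Lam → (P : ℝ) ^ degZ d ≤ K ^ (2 * N) →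
    48 * K ^ C ≤ P → ∀ φ ψ : Fin (M * N) → ℤ → ℂ, (∀ i n, ‖φ i n‖ ≤ Lam / P) →
    (∀ i n, ‖ψ i n‖ ≤ Lam / P) → ∀ (θ : Y d → ℝ) (l : Y d), l.1.2 ≠ 0 →
    ‖wordSum s P φ ψ θ‖ ≤ C' * P ^ d * Lam ^ (2 * (M * N)) * (K ^ M)⁻¹ ∨
    ∃ q : ℕ, 1 ≤ q ∧ q ≤ C * K ^ C ∧ ∃ a : ℤ, |q * θ l - a| ≤ C * K ^ C / P ^ deg l := by
  obtain ⟨C₀, hC₀, hint⟩ := integral_weylSum_pow_le d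
  refine ⟨40 + 12 * C₀, by omega, fun N M hN => ?_⟩
  set Q : ℝ := (6 * N) ^ Fintype.card (Z d) * (4 * 3 ^ (2 * N) * (C₀ + 1)) with hQ
  have hQ1 : 1 ≤ Q := by
    have h1 : (1 : ℝ) ≤ N := by exact_mod_cast hN
    have h2 : (1 : ℝ) ≤ (6 * N) ^ Fintype.card (Z d) := one_le_pow₀ (by linarith)
    have h3 : (1 : ℝ) ≤ 3 ^ (2 * N) := one_le_pow₀ (by norm_num)
    have h4 : (1 : ℝ) ≤ C₀ := by exact_mod_cast hC₀
    have h5 : (1 : ℝ) ≤ 4 * 3 ^ (2 * N) * (C₀ + 1) := by nlinarith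
    rw [hQ]; nlinarith
  refine ⟨Q ^ M * (6 * N), ?_, fun s P K Lam hP hK hLam hPK hKP φ ψ hφ hψ θ l hl => ?_⟩
  · have h1 : (1 : ℝ) ≤ N := by exact_mod_cast hN
    have := one_le_pow₀ (n := M) hQ1
    nlinarith
  have hP1 : (1 : ℝ) ≤ P := by exact_mod_cast hP
  have hN1 : (1 : ℝ) ≤ N := by exact_mod_cast hN
  have hK0 : 0 < K := by linarith
  have hl1 := mem_pairs.1 l.2
  have hC₀1 : (1 : ℝ) ≤ C₀ := by exact_mod_cast hC₀
  by_cases hθ : FarFromRationals (θ l) (K ^ (4 * C₀)) (2 * N * P ^ l.1.2) (2 * (2 * N * P ^ l.1.1) + 1)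
  · left
    have hK2 : 48 * (K ^ (4 * C₀)) ^ 2 ≤ P := by
      refine le_trans ?_ hKP
      rw [← pow_mul]
      gcongr
      omega
    have hPl : ∀ m : ℕ, m ≠ 0 → (P : ℝ) ≤ (2 * N * P ^ m : ℕ) := by
      intro m hm
      have : (P : ℝ) ≤ P ^ m := le_self_pow₀ hP1 hm
      push_cast
      nlinarith
    have h1 := norm_wordSum_le_of_farFromRationals s θ l hl (one_le_pow₀ hK)
      (le_trans (by have : 0 ≤ (K ^ (4 * C₀)) ^ 2 := by positivity
                    linarith) (hPl l.1.2 hl))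
      (le_trans hK2 ((hPl l.1.1 (by omega)).trans (by push_cast; nlinarith [pow_nonneg (by linarith : (0:ℝ) ≤ P) l.1.1])))
      hθ rfl (card_abBox_le hN hP) hφ hψ
    refine h1.trans ?_
    have h2 : ((6 * N) ^ Fintype.card (Z d) * P ^ degZ d) * (4 * ((Lam / P) ^ (2 * N) *
        ∫ t in unitCube (Z d), ‖weylSum P t‖ ^ (2 * N)) / √(K ^ (4 * C₀)))
        ≤ Q * Lam ^ (2 * N) * K⁻¹ := by
      have h3 : √(K ^ (4 * C₀)) = K ^ (2 * C₀) := by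
        rw [show 4 * C₀ = 2 * C₀ * 2 by ring, pow_mul, Real.sqrt_sq (by positivity)]
      have h4 : C₀ * K ^ C₀ / (P : ℝ) ^ degZ d + (K ^ (2 * N))⁻¹
          ≤ (C₀ + 1) * K ^ C₀ / (P : ℝ) ^ degZ d := by
        have h5 : (K ^ (2 * N))⁻¹ ≤ ((P : ℝ) ^ degZ d)⁻¹ := inv_anti₀ (by positivity) hPK
        have h6 : ((P : ℝ) ^ degZ d)⁻¹ ≤ K ^ C₀ / (P : ℝ) ^ degZ d := by
          rw [← one_div]; gcongr; exact one_le_pow₀ hK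
        calc _ ≤ C₀ * K ^ C₀ / (P : ℝ) ^ degZ d + K ^ C₀ / (P : ℝ) ^ degZ d := by
              gcongr; exact h5.trans h6
          _ = _ := by ring
      calc _ ≤ ((6 * N) ^ Fintype.card (Z d) * P ^ degZ d) * (4 * ((Lam / P) ^ (2 * N) *
            ((3 * P) ^ (2 * N) * ((C₀ + 1) * K ^ C₀ / (P : ℝ) ^ degZ d))) / √(K ^ (4 * C₀))) := by
            gcongr
            refine (hint N P hP K hK).trans ?_
            gcongr
        _ = Q * Lam ^ (2 * N) * (K ^ C₀)⁻¹ := by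
            rw [h3, hQ, two_mul C₀, pow_add K, div_pow, mul_pow 3]
            have : (P : ℝ) ≠ 0 := by positivity
            field_simp
        _ ≤ _ := by
            gcongr
            exact le_self_pow₀ hK (by omega)
    have h7 : √(2 * (2 * N * P ^ l.1.1) + 1 : ℕ) ≤ 6 * N * P ^ d := by
      refine Real.sqrt_le_iff.2 ⟨by positivity, ?_⟩
      have h8 : (P : ℝ) ^ l.1.1 ≤ P ^ d := pow_le_pow_right₀ hP1 hl1.2
      have h9 : (1 : ℝ) ≤ P ^ d := one_le_pow₀ hP1
      have h10 : (1 : ℝ) ≤ N * P ^ d := by nlinarith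
      push_cast
      calc (2 * (2 * N * P ^ l.1.1) + 1 : ℝ) ≤ 2 * (2 * N * P ^ d) + N * P ^ d := by gcongr
        _ ≤ (6 * N * P ^ d) ^ 2 := by nlinarith
    calc _ ≤ (Q * Lam ^ (2 * N) * K⁻¹) ^ M * (6 * N * P ^ d) := by
          have : 0 ≤ ∫ t in unitCube (Z d), ‖weylSum P t‖ ^ (2 * N) :=
            MeasureTheory.integral_nonneg fun _ => by positivity
          exact mul_le_mul (pow_le_pow_left₀ (by positivity) h2 M) h7 (Real.sqrt_nonneg _)
            (by positivity)
      _ = _ := by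
          rw [mul_pow, mul_pow, ← pow_mul, inv_pow, show 2 * N * M = 2 * (M * N) by ring]; ring
  · right
    unfold FarFromRationals at hθ
    push Not at hθ
    obtain ⟨q, a, hq1, hq, ha⟩ := hθ
    have hpow : K ^ (12 * C₀) ≤ K ^ (40 + 12 * C₀) := pow_le_pow_right₀ hK (by omega)
    have hpow2 : K ^ (4 * C₀) ≤ K ^ (12 * C₀) := pow_le_pow_right₀ hK (by omega)
    have hpow0 : 0 < K ^ (4 * C₀) := by positivity
    have hC : (40 : ℝ) ≤ ((40 + 12 * C₀ : ℕ) : ℝ) := by push_cast; linarith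
    refine ⟨q, hq1, ?_, a, ha.trans ?_⟩
    · nlinarith
    · rw [← pow_mul, show 4 * C₀ * 3 = 12 * C₀ by ring]
      have hden : (P : ℝ) ^ deg l ≤ ((2 * (2 * N * P ^ l.1.1) + 1 : ℕ) : ℝ) * (2 * N * P ^ l.1.2 : ℕ) := by
        rw [deg, pow_add]
        push_cast
        have h1 : (0 : ℝ) ≤ P ^ l.1.1 := by positivity
        have h2 : (0 : ℝ) ≤ P ^ l.1.2 := by positivity
        refine mul_le_mul ?_ ?_ h2 (by positivity) <;> nlinarith
      gcongr
end DiscreteRadon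
end

noncomputable section
namespace DiscreteRadon

/-! ### Multipliers for partial sums -/

/-- Multiplication by `f` increases the maximal partial sums over `S` by a factor at most `A`. -/
def IsMultiplier {ι : Type} [Fintype ι] (S : Finset (ι → ℤ)) (f : (ι → ℤ) → ℂ) (A : ℝ) : Prop :=
  0 ≤ A ∧ ∀ (h : (ι → ℤ) → ℂ) (M : ℝ),
    (∀ t : ι → ℤ, ‖∑ z ∈ S.filter (fun z => ∀ j, t j ≤ z j), h z‖ ≤ M) →
    ∀ t : ι → ℤ, ‖∑ z ∈ S.filter (fun z => ∀ j, t j ≤ z j), f z * h z‖ ≤ A * M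

section Multiplier

variable {ι : Type} [Fintype ι] {S : Finset (ι → ℤ)}

theorem isSize_isMultiplier (S : Finset (ι → ℤ)) : IsSize (IsMultiplier S) where
  nonneg h := h.1
  mono := fun h hA => ⟨h.1.trans hA, fun g M hM t =>
    (h.2 g M hM t).trans (mul_le_mul_of_nonneg_right hA ((norm_nonneg _).trans (hM t)))⟩
  zero := ⟨le_rfl, fun h M hM t => by simp⟩
  one := ⟨zero_le_one, fun h M hM t => by simpa using hM t⟩
  neg := fun h => ⟨h.1, fun g M hM t => by
    simp only [Pi.neg_apply, neg_mul, Finset.sum_neg_distrib, norm_neg]; exact h.2 g M hM t⟩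
  add := fun hf hg => ⟨add_nonneg hf.1 hg.1, fun g M hM t => by
    simp only [Pi.add_apply, add_mul, Finset.sum_add_distrib]
    exact (norm_add_le _ _).trans (add_le_add (hf.2 g M hM t) (hg.2 g M hM t))⟩
  mul := fun {f g A B} hf hg => ⟨mul_nonneg hf.1 hg.1, fun h M hM t => by
    simp only [Pi.mul_apply, mul_assoc]
    exact hf.2 (fun z => g z * h z) (B * M) (hg.2 h M hM) t⟩

theorem IsMultiplier.congr {f g : (ι → ℤ) → ℂ} {A : ℝ} (hf : IsMultiplier S f A)
    (h : ∀ z ∈ S, f z = g z) : IsMultiplier S g A :=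
  ⟨hf.1, fun k M hM t => by
    rw [Finset.sum_congr rfl fun z hz => by rw [← h z (Finset.mem_filter.1 hz).1]]
    exact hf.2 k M hM t⟩

theorem IsMultiplier.const (c : ℂ) : IsMultiplier S (fun _ => c) ‖c‖ :=
  ⟨norm_nonneg _, fun h M hM t => by
    rw [← Finset.mul_sum, norm_mul]; gcongr; exact hM t⟩

theorem IsMultiplier.sum {α : Type*} (O : Finset α) {f : α → (ι → ℤ) → ℂ} {A : α → ℝ}
    (h : ∀ a ∈ O, IsMultiplier S (f a) (A a)) : IsMultiplier S (∑ a ∈ O, f a) (∑ a ∈ O, A a) := by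
  classical
  induction O using Finset.induction_on with
  | empty => simpa using (isSize_isMultiplier S).zero
  | insert a O ha ih =>
    rw [Finset.sum_insert ha, Finset.sum_insert ha]
    exact (isSize_isMultiplier S).add (h a (by simp)) (ih fun b hb => h b (by simp [hb]))

theorem IsMultiplier.prod {α : Type*} (O : Finset α) {f : α → (ι → ℤ) → ℂ} {A : α → ℝ}
    (h : ∀ a ∈ O, IsMultiplier S (f a) (A a)) : IsMultiplier S (∏ a ∈ O, f a) (∏ a ∈ O, A a) := by
  classical
  induction O using Finset.induction_on with
  | empty => simpa using (isSize_isMultiplier S).one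
  | insert a O ha ih =>
    rw [Finset.prod_insert ha, Finset.prod_insert ha]
    exact (isSize_isMultiplier S).mul (h a (by simp)) (ih fun b hb => h b (by simp [hb]))

theorem IsMultiplier.indicator [DecidableEq ι] (j : ι) (u : ℤ) :
    IsMultiplier S (fun z => if u ≤ z j then 1 else 0) 1 :=
  ⟨zero_le_one, fun h M hM t => by
    rw [one_mul]
    refine le_trans (le_of_eq ?_) (hM (Function.update t j (max u (t j))))
    congr 1
    simp only [ite_mul, one_mul, zero_mul]
    rw [← Finset.sum_filter, Finset.filter_filter]
    refine Finset.sum_congr (Finset.filter_congr fun z _ => ?_) fun _ _ => rfl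
    constructor
    · rintro ⟨h2, h1⟩ i
      by_cases hi : i = j
      · subst hi; simp [h1, h2 i]
      · simpa [hi] using h2 i
    · intro h1
      have h2 := h1 j
      simp only [Function.update_self, max_le_iff] at h2
      refine ⟨fun i => ?_, h2.1⟩
      by_cases hi : i = j
      · subst hi; exact h2.2
      · simpa [hi] using h1 i⟩

/-- Functions of one coordinate, varying slowly over `S`, are multipliers. -/
theorem IsMultiplier.coord (g : ℤ → ℂ) (j : ι) {x₀ : ℤ} {L : ℕ} {B B' : ℝ}
    (hS : ∀ z ∈ S, x₀ ≤ z j ∧ z j ≤ x₀ + L) (hg : ‖g x₀‖ ≤ B)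
    (hg' : ∀ n, ‖g (n + 1) - g n‖ ≤ B') : IsMultiplier S (fun z => g (z j)) (B + L * B') := by
  classical
  have h1 : ∀ n : ℕ, n ≤ L → g (x₀ + n) = g x₀ + ∑ u ∈ Finset.range L,
      (g (x₀ + u + 1) - g (x₀ + u)) * (if x₀ + u + 1 ≤ x₀ + n then 1 else 0) := by
    intro n hn
    simp only [mul_ite, mul_one, mul_zero]
    rw [← Finset.sum_filter]
    have h2 : (Finset.range L).filter (fun u : ℕ => x₀ + (u : ℤ) + 1 ≤ x₀ + n) = Finset.range n := by
      ext u; simp only [Finset.mem_filter, Finset.mem_range]; omega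
    rw [h2]
    have := Finset.sum_range_sub (fun u : ℕ => g (x₀ + u)) n
    push_cast at this
    simp only [add_assoc] at this ⊢
    rw [this]; simp
  have h3 := (isSize_isMultiplier S).add ((isSize_isMultiplier S).mono (IsMultiplier.const (g x₀)) hg)
    (IsMultiplier.sum (Finset.range L) (fun u _ => (isSize_isMultiplier S).mul
      ((isSize_isMultiplier S).mono (IsMultiplier.const (g (x₀ + u + 1) - g (x₀ + u))) (hg' _))
      (IsMultiplier.indicator j (x₀ + u + 1))))
  simp only [mul_one, Finset.sum_const, Finset.card_range, nsmul_eq_mul] at h3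
  refine h3.congr fun z hz => ?_
  obtain ⟨h4, h5⟩ := hS z hz
  obtain ⟨n, hn⟩ := Int.eq_ofNat_of_zero_le (sub_nonneg.2 h4)
  have h6 : z j = x₀ + n := by omega
  rw [h6, h1 n (by omega)]
  simp [Finset.sum_apply, h6]

theorem IsMultiplier.exp {f : (ι → ℤ) → ℂ} {A : ℝ} (hf : IsMultiplier S f A) :
    IsMultiplier S (fun z => Complex.exp (f z)) (Real.exp A) := by
  have hpow : ∀ n : ℕ, IsMultiplier S (fun z => f z ^ n / n.factorial) (A ^ n / n.factorial) := by
    intro n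
    have h1 := (isSize_isMultiplier S).mul (IsMultiplier.prod (Finset.range n) fun _ _ => hf)
      (IsMultiplier.const (S := S) ((n.factorial : ℂ)⁻¹))
    simp only [Finset.prod_const, Finset.card_range, norm_inv, Complex.norm_natCast] at h1
    refine (h1.congr fun z _ => ?_)
    simp [div_eq_mul_inv]
  refine ⟨(Real.exp_pos A).le, fun h M hM t => ?_⟩
  have hM0 : 0 ≤ M := (norm_nonneg _).trans (hM t)
  have hsum : ∀ m : ℕ, ‖∑ z ∈ S.filter (fun z => ∀ j, t j ≤ z j),
      (∑ n ∈ Finset.range m, f z ^ n / n.factorial) * h z‖ ≤ Real.exp A * M := by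
    intro m
    have h2 := (IsMultiplier.sum (Finset.range m) fun n _ => hpow n).2 h M hM t
    simp only [Finset.sum_apply] at h2
    exact h2.trans (mul_le_mul_of_nonneg_right (Real.sum_le_exp_of_nonneg hf.1 m) hM0)
  refine le_of_tendsto (f := fun m : ℕ => ‖∑ z ∈ S.filter (fun z => ∀ j, t j ≤ z j),
      (∑ n ∈ Finset.range m, f z ^ n / n.factorial) * h z‖) (x := Filter.atTop) ?_
      (Filter.Eventually.of_forall hsum)
  refine Filter.Tendsto.norm (tendsto_finsetSum _ fun z _ => Filter.Tendsto.mul_const _ ?_)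
  have := (NormedSpace.expSeries_div_hasSum_exp (f z)).tendsto_sum_nat
  rwa [← Complex.exp_eq_exp_ℂ] at this

theorem IsMultiplier.norm_sum_le [DecidableEq ι] {T : ι → Finset ℤ} {f : (ι → ℤ) → ℂ} {A : ℝ}
    (hf : IsMultiplier (Fintype.piFinset T) f A) {h : ι → ℤ → ℂ} {M : ι → ℝ}
    (hM : ∀ j t, ‖∑ n ∈ (T j).filter (fun n => t ≤ n), h j n‖ ≤ M j)
    {x₀ : ι → ℤ} (hx₀ : ∀ j, ∀ n ∈ T j, x₀ j ≤ n) :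
    ‖∑ z ∈ Fintype.piFinset T, f z * ∏ j, h j (z j)‖ ≤ A * ∏ j, M j := by
  have h1 : ∀ t : ι → ℤ, (Fintype.piFinset T).filter (fun z => ∀ j, t j ≤ z j)
      = Fintype.piFinset fun j => (T j).filter fun n => t j ≤ n := by
    intro t; ext z
    simp only [Finset.mem_filter, Fintype.mem_piFinset]
    exact ⟨fun h j => ⟨h.1 j, h.2 j⟩, fun h => ⟨fun j => (h j).1, fun j => (h j).2⟩⟩
  have h2 := hf.2 (fun z => ∏ j, h j (z j)) (∏ j, M j) (fun t => by
    rw [h1, ← Finset.prod_univ_sum, norm_prod]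
    exact Finset.prod_le_prod (fun _ _ => norm_nonneg _) fun j _ => hM j _) x₀
  rwa [Finset.filter_true_of_mem fun z hz j => hx₀ j _ (Fintype.mem_piFinset.1 hz j)] at h2

end Multiplier

/-- The box, with the two groups of variables merged. -/
theorem sum_box_eq_sum_piFinset {P r : ℕ} (F : (Fin r → ℤ) × (Fin r → ℤ) → ℂ) :
    ∑ z ∈ box P r, F z = ∑ z ∈ Fintype.piFinset (fun _ : Fin r ⊕ Fin r => Finset.Icc (-(P : ℤ)) P),
      F (fun i => z (Sum.inl i), fun i => z (Sum.inr i)) := by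
  refine Finset.sum_nbij' (fun p => Sum.elim p.1 p.2)
    (fun z => (fun i => z (Sum.inl i), fun i => z (Sum.inr i))) ?_ ?_ ?_ ?_ ?_
  · intro p hp
    rw [mem_box] at hp
    rw [Fintype.mem_piFinset]
    rintro (i | i)
    · simpa [abs_le] using hp.1 i
    · simpa [abs_le] using hp.2 i
  · intro z hz
    rw [Fintype.mem_piFinset] at hz
    rw [mem_box]
    exact ⟨fun i => by simpa [abs_le] using hz (Sum.inl i), fun i => by simpa [abs_le] using hz (Sum.inr i)⟩
  · intro p _; rfl
  · intro z _; funext i; cases i <;> rfl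
  · intro p _; rfl

end DiscreteRadon
end

noncomputable section
namespace DiscreteRadon

/-! ### Frequencies with major central coordinates -/

variable {d : ℕ}

/-- The word attached to a point of the merged box. -/
def sumWord (d : ℕ) {R : Type*} [CommRing R] (s : Bool) {r : ℕ} (z : Fin r ⊕ Fin r → R) : G0 d R :=
  word d s (fun i => z (Sum.inl i)) fun i => z (Sum.inr i)

/-- The sign with which a variable enters the abelian coordinates. -/
def varSign (s : Bool) {r : ℕ} : Fin r ⊕ Fin r → ℤ := Sum.elim (fun _ => -sgn s) fun _ => sgn s

theorem varSign_eq (s : Bool) {r : ℕ} (j : Fin r ⊕ Fin r) :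
    (varSign s j : ℝ) = 1 ∨ (varSign s j : ℝ) = -1 := by
  rcases j with i | i <;> cases s <;> simp [varSign, sgn]

theorem sumWord_coord_map {R S : Type*} [CommRing R] [CommRing S] (f : R →+* S) (s : Bool)
    {r : ℕ} (z : Fin r ⊕ Fin r → R) (l : Y d) :
    (sumWord d s (fun j => f (z j))).coord l = f ((sumWord d s z).coord l) :=
  word_coord_map f s _ _ l

theorem dvd_sumWord_coord_sub (s : Bool) {r q : ℕ} {z b : Fin r ⊕ Fin r → ℤ}
    (h : ∀ j, (q : ℤ) ∣ z j - b j) (l : Y d) :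
    (q : ℤ) ∣ (sumWord d s z).coord l - (sumWord d s b).coord l := by
  rw [← ZMod.intCast_eq_intCast_iff_dvd_sub]
  have h1 : ∀ j, Int.castRingHom (ZMod q) (z j) = Int.castRingHom (ZMod q) (b j) := fun j =>
    ((ZMod.intCast_eq_intCast_iff_dvd_sub _ _ _).2 (h j)).symm
  have h2 := sumWord_coord_map (Int.castRingHom (ZMod q)) s z l
  have h3 := sumWord_coord_map (Int.castRingHom (ZMod q)) s b l
  simp only [h1] at h2
  rw [h3] at h2
  simpa using h2

theorem pairing_sumWord (θ : Y d → ℝ) (s : Bool) {r : ℕ} (z : Fin r ⊕ Fin r → ℤ) :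
    pairing θ (sumWord d s z) = (∑ j, varSign s j * ∑ l : Z d, θ l.1 * (z j : ℝ) ^ l.1.1.1)
      + ∑ l : {l : Y d // ¬ l.1.2 = 0}, θ l.1 * (sumWord d s z).coord l.1 := by
  rw [pairing, ← Fintype.sum_subtype_add_sum_subtype (fun l : Y d => l.1.2 = 0)]
  congr 1
  simp_rw [Finset.mul_sum]
  rw [Finset.sum_comm]
  refine Finset.sum_congr rfl fun l _ => ?_
  rw [sumWord, word_coord_Z, Fintype.sum_sum_type, ← Finset.sum_add_distrib]
  push_cast
  rw [Finset.mul_sum]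
  refine Finset.sum_congr rfl fun i _ => ?_
  simp only [varSign, Sum.elim_inl, Sum.elim_inr]
  push_cast
  ring

theorem exists_isMultiplier_sumWord (d r : ℕ) : ∃ c : ℝ, 0 ≤ c ∧ ∀ (s : Bool) (P L : ℕ), 1 ≤ P →
    L ≤ P → ∀ (S : Finset (Fin r ⊕ Fin r → ℤ)) (x₀ : Fin r ⊕ Fin r → ℤ), (∀ j, |x₀ j| ≤ 2 * P) →
    (∀ z ∈ S, ∀ j, x₀ j ≤ z j ∧ z j ≤ x₀ j + L) → ∀ l : Y d,
    IsMultiplier S (fun z => ((sumWord d s z).coord l : ℂ) - ((sumWord d s x₀).coord l : ℂ))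
      (c * P ^ deg l * (L / P)) := by
  obtain ⟨c, hc, h⟩ := exists_word_near d r
  refine ⟨c * 3 ^ (2 * d), by positivity, fun s P L hP hLP S x₀ hx₀ hS l => ?_⟩
  have hP0 : (0 : ℝ) < P := by exact_mod_cast hP
  have hLP' : (L : ℝ) ≤ P := by exact_mod_cast hLP
  have hnear : ∀ j, Near (IsMultiplier S) (3 * P) (L / (3 * P)) 1 1
      (fun z : Fin r ⊕ Fin r → ℤ => (z j : ℂ)) (fun _ => (x₀ j : ℂ)) := by
    intro j
    have h0 : ‖(x₀ j : ℂ)‖ ≤ 2 * P := by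
      rw [Complex.norm_intCast]; exact_mod_cast hx₀ j
    have h1 := IsMultiplier.coord (S := S) (fun n => (n : ℂ)) j (fun z hz => hS z hz j) h0
      (B' := 1) (fun n => by simp)
    have h2 := IsMultiplier.coord (S := S) (fun n => (n : ℂ) - x₀ j) j (fun z hz => hS z hz j)
      (B := 0) (by simp) (B' := 1) (fun n => by simp)
    refine ⟨(isSize_isMultiplier S).mono h1 (by linarith),
      (isSize_isMultiplier S).mono (IsMultiplier.const _) (by linarith),
      (isSize_isMultiplier S).mono h2 ?_⟩
    field_simp; simp
  have h3 := (h s (isSize_isMultiplier S) (by positivity : (0 : ℝ) ≤ 3 * P)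
    (by positivity : (0 : ℝ) ≤ L / (3 * P)) _ _ _ _ (fun i => hnear (Sum.inl i))
    (fun i => hnear (Sum.inr i)) l).2.2
  have hdeg : deg l ≤ 2 * d := by have := mem_pairs.1 l.2; simp only [deg]; omega
  refine ((isSize_isMultiplier S).mono h3 ?_).congr fun z _ => ?_
  · have h4 : (3 : ℝ) ^ deg l ≤ 3 ^ (2 * d) := pow_le_pow_right₀ (by norm_num) hdeg
    have h5 : (L : ℝ) / (3 * P) ≤ L / P := by gcongr; linarith
    rw [mul_pow]
    calc _ ≤ c * (3 ^ (2 * d) * P ^ deg l) * (L / P) := by gcongr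
      _ = _ := by ring
  · rw [Pi.sub_apply]
    congr 1
    · have h6 := sumWord_coord_map (Pi.evalRingHom (fun _ : Fin r ⊕ Fin r → ℤ => ℂ) z) s
        (fun j => fun z : Fin r ⊕ Fin r → ℤ => (z j : ℂ)) l
      have h7 := sumWord_coord_map (Int.castRingHom ℂ) s z l
      exact h6.symm.trans h7
    · have h6 := sumWord_coord_map (Pi.evalRingHom (fun _ : Fin r ⊕ Fin r → ℤ => ℂ) z) s
        (fun j => fun _ : Fin r ⊕ Fin r → ℤ => (x₀ j : ℂ)) l
      have h7 := sumWord_coord_map (Int.castRingHom ℂ) s x₀ l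
      exact h6.symm.trans h7

theorem exists_norm_cell_le (d r : ℕ) : ∃ c : ℝ, 1 ≤ c ∧ ∀ (s : Bool) (P L q : ℕ), 1 ≤ P → L ≤ P →
    1 ≤ q → ∀ (T : Fin r ⊕ Fin r → Finset ℤ) (x₀ b : Fin r ⊕ Fin r → ℤ), (∀ j, |x₀ j| ≤ 2 * P) →
    (∀ j, ∀ n ∈ T j, (q : ℤ) ∣ n - b j ∧ x₀ j ≤ n ∧ n ≤ x₀ j + L) →
    ∀ (W : Fin r ⊕ Fin r → ℤ → ℂ) (B : ℝ), (∀ j n, ‖W j n‖ ≤ B) →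
    (∀ j n, ‖W j (n + 1) - W j n‖ ≤ B / P) →
    ∀ (θ : Y d → ℝ) (a : Y d → ℤ), (∀ l : Y d, l.1.2 ≠ 0 → |θ l - a l / q| * P ^ deg l * (L / P) ≤ 1) →
    ∀ M : ℝ, (∀ j t, ‖∑ n ∈ (T j).filter (fun n => t ≤ n),
      e (-(varSign s j) * ∑ l : Z d, θ l.1 * (n : ℝ) ^ l.1.1.1)‖ ≤ M) →
    ‖∑ z ∈ Fintype.piFinset T, (∏ j, W j (z j)) * e (-pairing θ (sumWord d s z))‖
      ≤ c * B ^ (2 * r) * M ^ (2 * r) := by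
  obtain ⟨c, hc, hmul⟩ := exists_isMultiplier_sumWord d r
  set E₀ : ℝ := ∑ l : {l : Y d // ¬ l.1.2 = 0}, 2 * Real.pi * c with hE₀
  have hE₀0 : 0 ≤ E₀ := Finset.sum_nonneg fun _ _ => by positivity
  refine ⟨2 ^ (2 * r) * Real.exp E₀, ?_, fun s P L q hP hLP hq T x₀ b hx₀ hT W B hW hW' θ a hθ M hM => ?_⟩
  · have h1 := Real.one_le_exp hE₀0
    have h2 : (1 : ℝ) ≤ 2 ^ (2 * r) := one_le_pow₀ (by norm_num)
    nlinarith
  have hP0 : (0 : ℝ) < P := by exact_mod_cast hP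
  have hq0 : (0 : ℝ) < q := by exact_mod_cast hq
  have hLP' : (L : ℝ) ≤ P := by exact_mod_cast hLP
  set S := Fintype.piFinset T with hS
  have hS1 : ∀ z ∈ S, ∀ j, x₀ j ≤ z j ∧ z j ≤ x₀ j + L := fun z hz j =>
    (hT j _ (Fintype.mem_piFinset.1 hz j)).2
  set β : Y d → ℝ := fun l => θ l - a l / q with hβ
  -- the smooth factor
  set f : {l : Y d // ¬ l.1.2 = 0} → (Fin r ⊕ Fin r → ℤ) → ℂ := fun l z =>
    (-(2 * Real.pi * Complex.I * β l.1)) *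
      (((sumWord d s z).coord l.1 : ℂ) - ((sumWord d s x₀).coord l.1 : ℂ)) with hf
  have hf1 : IsMultiplier S (∑ l, f l) E₀ := by
    refine IsMultiplier.sum Finset.univ fun l _ => ?_
    have h1 := (isSize_isMultiplier S).mul
      (IsMultiplier.const (S := S) (-(2 * Real.pi * Complex.I * β l.1 : ℂ)))
      (hmul s P L hP hLP S x₀ hx₀ hS1 l.1)
    refine ((isSize_isMultiplier S).mono h1 ?_).congr fun z _ => rfl
    have h2 : ‖-(2 * Real.pi * Complex.I * β l.1 : ℂ)‖ = 2 * Real.pi * |β l.1| := by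
      simp [abs_of_pos Real.pi_pos]
    rw [h2]
    calc _ = 2 * Real.pi * c * (|β l.1| * P ^ deg l.1 * (L / P)) := by ring
      _ ≤ 2 * Real.pi * c * 1 := by gcongr; exact hθ l.1 l.2
      _ = _ := mul_one _
  have hW1 : ∀ j, IsMultiplier S (fun z => W j (z j)) (2 * B) := by
    intro j
    have hB : 0 ≤ B := (norm_nonneg _).trans (hW j 0)
    refine (isSize_isMultiplier S).mono (IsMultiplier.coord (W j) j (fun z hz => hS1 z hz j)
      (hW j _) (hW' j)) ?_
    have : L * (B / P) ≤ B := by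
      rw [mul_div_assoc', div_le_iff₀ hP0]; nlinarith
    linarith
  have hmain := (isSize_isMultiplier S).mul (IsMultiplier.prod Finset.univ fun j _ => hW1 j) hf1.exp
  set κ : ℂ := e (-∑ l : {l : Y d // ¬ l.1.2 = 0}, ((a l.1 / q) * (sumWord d s b).coord l.1
    + β l.1 * (sumWord d s x₀).coord l.1)) with hκ
  have hsplit : ∀ z ∈ S, (∏ j, W j (z j)) * e (-pairing θ (sumWord d s z))
      = κ * (((∏ j, fun z : Fin r ⊕ Fin r → ℤ => W j (z j)) * fun z => Complex.exp ((∑ l, f l) z)) z *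
        ∏ j, e (-(varSign s j) * ∑ l : Z d, θ l.1 * (z j : ℝ) ^ l.1.1.1)) := by
    intro z hz
    have h1 : ∀ l : {l : Y d // ¬ l.1.2 = 0}, e (-(θ l.1 * (sumWord d s z).coord l.1))
        = e (-((a l.1 / q) * (sumWord d s b).coord l.1 + β l.1 * (sumWord d s x₀).coord l.1)) *
          Complex.exp (f l z) := by
      intro l
      obtain ⟨m, hm⟩ := dvd_sumWord_coord_sub (d := d) s (z := z) (b := b)
        (fun j => (hT j _ (Fintype.mem_piFinset.1 hz j)).1) l.1
      have h2 : Complex.exp (f l z)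
          = e (-(β l.1 * ((sumWord d s z).coord l.1 - (sumWord d s x₀).coord l.1))) := by
        rw [e, hf]; congr 1; push_cast; ring
      have h3 : ((sumWord d s z).coord l.1 : ℝ) = (sumWord d s b).coord l.1 + q * m := by
        have : (sumWord d s z).coord l.1 = (sumWord d s b).coord l.1 + q * m := by omega
        rw [this]; push_cast; ring
      rw [h2, ← e_add, ← e_add_int _ (a l.1 * m)]
      congr 1
      simp only [hβ]
      rw [h3]; push_cast; field_simp; ring
    have h4 : κ = ∏ l : {l : Y d // ¬ l.1.2 = 0}, e (-((a l.1 / q) * (sumWord d s b).coord l.1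
        + β l.1 * (sumWord d s x₀).coord l.1)) := by
      rw [hκ, ← Finset.sum_neg_distrib, e_sum]
    rw [pairing_sumWord, neg_add, e_add, ← Finset.sum_neg_distrib, ← Finset.sum_neg_distrib,
      e_sum, e_sum, Finset.prod_congr rfl fun l _ => h1 l, Finset.prod_mul_distrib, ← h4,
      ← Complex.exp_sum, Pi.mul_apply, Finset.prod_apply,
      Finset.sum_apply]
    simp only [neg_mul]
    ring
  rw [Finset.sum_congr rfl hsplit, ← Finset.mul_sum, norm_mul, hκ, norm_e, one_mul]
  refine (hmain.norm_sum_le (h := fun j n => e (-(varSign s j) * ∑ l : Z d, θ l.1 * (n : ℝ) ^ l.1.1.1))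
    (M := fun _ => M) hM (fun j n hn => (hT j n hn).2.1)).trans (le_of_eq ?_)
  simp only [Finset.prod_const, Finset.card_univ, Fintype.card_sum, Fintype.card_fin, ← two_mul]
  ring

end DiscreteRadon
end

noncomputable section
namespace DiscreteRadon

variable {d : ℕ}

theorem sum_piFinset_fiberwise {ι α : Type*} [Fintype ι] [DecidableEq ι] [DecidableEq α]
    (I : Finset ℤ) (g : ℤ → α) (O : Finset α) (hg : ∀ n ∈ I, g n ∈ O) (F : (ι → ℤ) → ℂ) :
    ∑ z ∈ Fintype.piFinset (fun _ : ι => I), F z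
      = ∑ k ∈ Fintype.piFinset (fun _ : ι => O),
        ∑ z ∈ Fintype.piFinset (fun j => I.filter fun n => g n = k j), F z := by
  rw [← Finset.sum_fiberwise_of_maps_to (s := Fintype.piFinset (fun _ : ι => I))
    (t := Fintype.piFinset (fun _ : ι => O)) (g := fun z j => g (z j))]
  · refine Finset.sum_congr rfl fun k _ => Finset.sum_congr ?_ fun _ _ => rfl
    ext z
    simp only [Finset.mem_filter, Fintype.mem_piFinset]
    exact ⟨fun h j => ⟨h.1 j, congrFun h.2 j⟩, fun h => ⟨fun j => (h j).1, funext fun j => (h j).2⟩⟩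
  · intro z hz
    rw [Fintype.mem_piFinset] at hz ⊢
    exact fun j => hg _ (hz j)

/-- If the Weyl sum on a residue class in an interval is large, the coefficients are major. -/
theorem exists_major_of_residue_sum (d : ℕ) (hd : 1 ≤ d) : ∃ C : ℕ, 1 ≤ C ∧ ∀ (P : ℕ), 1 ≤ P →
    ∀ K : ℝ, 1 ≤ K → ∀ (q : ℕ), 1 ≤ q → ∀ (b u v : ℤ), -(P : ℤ) ≤ u → v ≤ P + 1 → ∀ (σ : ℤ),
    (σ : ℝ) = 1 ∨ (σ : ℝ) = -1 → ∀ θ : Z d → ℝ,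
    P / K ≤ ‖∑ n ∈ (Finset.Ico u v).filter (fun n => (q : ℤ) ∣ n - b),
      e (-σ * ∑ l : Z d, θ l * (n : ℝ) ^ l.1.1.1)‖ →
    ∃ q' : ℕ, 1 ≤ q' ∧ (q' : ℝ) ≤ C * K ^ C ∧ ∀ l : Z d,
      ∃ a : ℤ, |(q' * q : ℕ) * θ l - a| ≤ q * (C * K ^ C / (P : ℝ) ^ deg l.1) := by
  obtain ⟨C, hC, h⟩ := weyl_coeffs d
  refine ⟨C, hC, fun P hP K hK q hq b u v hu hv σ hσ θ hS => ?_⟩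
  have hq0 : (0 : ℝ) < q := by exact_mod_cast hq
  obtain ⟨c, hc⟩ := exists_norm_residue_le (fun n => e (-σ * ∑ l : Z d, θ l * (n : ℝ) ^ l.1.1.1))
    (Finset.Ico u v) hq b
  set f : Polynomial ℝ := Polynomial.C (-σ : ℝ) * phasePoly θ + Polynomial.C (c / q : ℝ) * Polynomial.X
    with hf
  have hdeg : f.natDegree ≤ d := by
    refine (Polynomial.natDegree_add_le _ _).trans (max_le ?_ ?_)
    · exact (Polynomial.natDegree_C_mul_le _ _).trans (phasePoly_natDegree θ)
    · exact (Polynomial.natDegree_C_mul_le _ _).trans (Polynomial.natDegree_X_le.trans hd)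
  obtain ⟨q', hq'1, hq', ha⟩ := h P hP K hK f hdeg u v hu hv (by
    refine (hS.trans hc).trans (le_of_eq ?_)
    congr 1
    refine Finset.sum_congr rfl fun n _ => ?_
    rw [← e_add, hf]
    simp only [Polynomial.eval_add, Polynomial.eval_mul, Polynomial.eval_C, Polynomial.eval_X,
      phasePoly_eval]
    congr 1; ring)
  refine ⟨q', hq'1, hq', fun l => ?_⟩
  obtain ⟨a, ha⟩ := ha _ (Z_bounds l).1 (Z_bounds l).2
  have hcoeff : f.coeff l.1.1.1 = -σ * θ l + (if l.1.1.1 = 1 then (c / q : ℝ) else 0) := by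
    rw [hf, Polynomial.coeff_add, Polynomial.coeff_C_mul, phasePoly_coeff, Polynomial.coeff_C_mul,
      Polynomial.coeff_X]
    simp [eq_comm]
  refine ⟨-σ * (q * a - (if l.1.1.1 = 1 then q' * c else 0)), ?_⟩
  have hσ2 : (σ : ℝ) * σ = 1 := by rcases hσ with h | h <;> rw [h] <;> norm_num
  have hσ3 : |(σ : ℝ)| = 1 := by rcases hσ with h | h <;> rw [h] <;> norm_num
  have key : ((q' * q : ℕ) : ℝ) * θ l - ((-σ * (q * a - (if l.1.1.1 = 1 then q' * c else 0)) : ℤ) : ℝ)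
      = -σ * (q * (q' * f.coeff l.1.1.1 - a)) := by
    rw [hcoeff]
    push_cast
    have : θ l = σ * σ * θ l := by rw [hσ2, one_mul]
    split_ifs
    · field_simp
      linear_combination (q' * q : ℝ) * this
    · linear_combination (q' * q : ℝ) * this
  rw [key, abs_mul, abs_neg, hσ3, one_mul, abs_mul, abs_of_pos hq0, deg_Z]
  gcongr

/-- Either the sum over words is small, or the frequency is major in the abelian coordinates. -/
theorem norm_wordSum_le_or_noncentral (d : ℕ) (hd : 1 ≤ d) : ∃ C : ℕ, 1 ≤ C ∧ ∀ r : ℕ,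
    ∃ C' : ℝ, 1 ≤ C' ∧ ∀ (s : Bool) (P : ℕ) (K B : ℝ), 1 ≤ K → 2 * K ≤ P →
    ∀ φ ψ : Fin r → ℤ → ℂ, (∀ i n, ‖φ i n‖ ≤ B) → (∀ i n, ‖ψ i n‖ ≤ B) →
    (∀ i n, ‖φ i (n + 1) - φ i n‖ ≤ B / P) → (∀ i n, ‖ψ i (n + 1) - ψ i n‖ ≤ B / P) →
    ∀ (θ : Y d → ℝ) (q : ℕ), 1 ≤ q → (q : ℝ) ≤ K →
    (∀ l : Y d, l.1.2 ≠ 0 → ∃ a : ℤ, |q * θ l - a| ≤ K / P ^ deg l) →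
    ‖wordSum s P φ ψ θ‖ ≤ C' * (B * P) ^ (2 * r) * (K ^ (2 * r))⁻¹ ∨
    ∃ q' : ℕ, 1 ≤ q' ∧ (q' : ℝ) ≤ C * K ^ C ∧ ∀ l : Z d,
      ∃ a : ℤ, |(q' * q : ℕ) * θ l.1 - a| ≤ C * K ^ C / (P : ℝ) ^ deg l.1 := by
  classical
  obtain ⟨C, hC, hres⟩ := exists_major_of_residue_sum d hd
  refine ⟨3 * C + 1, by omega, fun r => ?_⟩
  obtain ⟨c, hc, hcell⟩ := exists_norm_cell_le d r
  refine ⟨c * 10 ^ (2 * r), ?_, fun s P K B hK hKP φ ψ hφ hψ hφ' hψ' θ q hq hqK hcent => ?_⟩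
  · have : (1 : ℝ) ≤ 10 ^ (2 * r) := one_le_pow₀ (by norm_num)
    nlinarith
  have hP0 : (0 : ℝ) < P := by linarith
  have hP : 1 ≤ P := by exact_mod_cast hP0
  have hK0 : 0 < K := by linarith
  have hq0 : (0 : ℝ) < q := by exact_mod_cast hq
  have hq1 : (1 : ℝ) ≤ q := by exact_mod_cast hq
  have hPC : (C : ℝ) * K ^ (3 * C) ≤ (3 * C + 1 : ℕ) * K ^ (3 * C) := by gcongr; omega
  by_cases hmaj : ∃ q' : ℕ, 1 ≤ q' ∧ (q' : ℝ) ≤ C * (K ^ 3) ^ C ∧ ∀ l : Z d,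
      ∃ a : ℤ, |(q' * q : ℕ) * θ l.1 - a| ≤ q * (C * (K ^ 3) ^ C / (P : ℝ) ^ deg l.1)
  · right
    obtain ⟨q', h1, h2, h3⟩ := hmaj
    rw [← pow_mul] at h2
    refine ⟨q', h1, ?_, fun l => ?_⟩
    · refine h2.trans (hPC.trans ?_)
      gcongr
      omega
    · obtain ⟨a, ha⟩ := h3 l
      refine ⟨a, ha.trans ?_⟩
      rw [← pow_mul, mul_div_assoc']
      refine div_le_div_of_nonneg_right ?_ (by positivity)
      calc (q : ℝ) * (C * K ^ (3 * C)) ≤ K * ((3 * C + 1 : ℕ) * K ^ (3 * C)) := by gcongr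
        _ = (3 * C + 1 : ℕ) * K ^ (3 * C + 1) := by rw [pow_succ]; ring
  · left
    set L : ℕ := ⌊P / K⌋₊ with hL
    have hPK : 2 ≤ P / K := by rw [le_div_iff₀ hK0]; exact hKP
    have hLle : (L : ℝ) ≤ P / K := Nat.floor_le (by positivity)
    have hLge : P / K / 2 ≤ L := by
      have := Nat.lt_floor_add_one (P / K)
      rw [← hL] at this
      linarith
    have hL0 : (0 : ℝ) < L := by linarith
    have hL1 : 1 ≤ L := by exact_mod_cast hL0
    have hLP : L ≤ P := by
      have : (L : ℝ) ≤ P := hLle.trans (div_le_self hP0.le hK)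
      exact_mod_cast this
    set m : ℕ := P / L + 1 with hm
    set g : ℤ → ℤ × ℤ := fun n => (n % q, n / L) with hg
    set O : Finset (ℤ × ℤ) := Finset.Ico (0 : ℤ) q ×ˢ Finset.Icc (-(m : ℤ)) m with hO
    have hLz : (0 : ℤ) < L := by exact_mod_cast hL1
    have hPm : (P : ℤ) < L * m := by
      have := Nat.lt_mul_div_succ P (by omega : 0 < L)
      rw [hm]; exact_mod_cast this
    have hgO : ∀ n ∈ Finset.Icc (-(P : ℤ)) P, g n ∈ O := by
      intro n hn
      rw [Finset.mem_Icc] at hn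
      rw [hO, Finset.mem_product, Finset.mem_Ico, Finset.mem_Icc]
      refine ⟨⟨Int.emod_nonneg _ (by omega), Int.emod_lt_of_pos _ (by omega)⟩, ?_, ?_⟩
      · rw [Int.le_ediv_iff_mul_le hLz]; nlinarith
      · refine Int.lt_add_one_iff.1 ?_
        rw [Int.ediv_lt_iff_lt_mul hLz]; nlinarith
    choose! a ha using hcent
    have hθ : ∀ l : Y d, l.1.2 ≠ 0 → |θ l - a l / q| * P ^ deg l * (L / P) ≤ 1 := by
      intro l hl
      have h1 : |θ l - a l / q| ≤ K / P ^ deg l := by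
        have h2 : θ l - a l / q = (q * θ l - a l) / q := by field_simp
        rw [h2, abs_div, abs_of_pos hq0]
        exact (div_le_self (abs_nonneg _) hq1).trans (ha l hl)
      calc _ ≤ K / P ^ deg l * P ^ deg l * (P / K / P) := by gcongr
        _ = 1 := by field_simp
    set W : Fin r ⊕ Fin r → ℤ → ℂ := Sum.elim φ ψ with hW
    have hbox : wordSum s P φ ψ θ = ∑ z ∈ Fintype.piFinset
        (fun _ : Fin r ⊕ Fin r => Finset.Icc (-(P : ℤ)) P),
        (∏ j, W j (z j)) * e (-pairing θ (sumWord d s z)) := by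
      rw [wordSum, sum_box_eq_sum_piFinset]
      refine Finset.sum_congr rfl fun z _ => ?_
      rw [wordWeight, Finset.prod_mul_distrib, Fintype.prod_sum_type]
      rfl
    have hone : ∀ k ∈ O, ∀ (j : Fin r ⊕ Fin r) (t : ℤ),
        ‖∑ n ∈ ((Finset.Icc (-(P : ℤ)) P).filter fun n => g n = k).filter (fun n => t ≤ n),
          e (-(varSign s j) * ∑ l : Z d, θ l.1 * (n : ℝ) ^ l.1.1.1)‖ ≤ P / K ^ 3 := by
      intro k hk j t
      by_contra! hcon
      have hset : ((Finset.Icc (-(P : ℤ)) P).filter fun n => g n = k).filter (fun n => t ≤ n)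
          = (Finset.Ico (max (-(P : ℤ)) (max t (k.2 * L))) (min (P + 1) (k.2 * L + L))).filter
            fun n => (q : ℤ) ∣ n - k.1 := by
        rw [hO, Finset.mem_product, Finset.mem_Ico] at hk
        ext n
        simp only [Finset.mem_filter, Finset.mem_Icc, Finset.mem_Ico, hg, Prod.ext_iff, max_le_iff,
          lt_min_iff]
        have h1 : n % q = k.1 ↔ (q : ℤ) ∣ n - k.1 := by
          rw [← Int.emod_emod_of_dvd n (dvd_refl (q : ℤ)), ← Int.emod_eq_emod_iff_emod_sub_eq_zero.trans
            (Int.dvd_iff_emod_eq_zero).symm, Int.emod_emod_of_dvd n (dvd_refl (q : ℤ)),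
            Int.emod_eq_of_lt hk.1.1 hk.1.2]
        have h2 : n / L = k.2 ↔ k.2 * L ≤ n ∧ n < k.2 * L + L := by
          rw [Int.ediv_eq_iff_of_pos hLz]
        rw [h1, h2]
        constructor
        · rintro ⟨⟨⟨h3, h4⟩, h5, h6, h7⟩, h8⟩; exact ⟨⟨⟨h3, h8, h6⟩, by omega, h7⟩, h5⟩
        · rintro ⟨⟨⟨h3, h8, h6⟩, h4, h7⟩, h5⟩; exact ⟨⟨⟨h3, by omega⟩, h5, h6, h7⟩, h8⟩
      rw [hset] at hcon
      obtain ⟨q', h1, h2, h3⟩ := hres P hP (K ^ 3) (one_le_pow₀ hK) q hq k.1 _ _ (le_max_left _ _)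
        (min_le_left _ _) (varSign s j) (varSign_eq s j) (fun l => θ l.1) hcon.le
      exact hmaj ⟨q', h1, h2, h3⟩
    rw [hbox, sum_piFinset_fiberwise _ g O hgO]
    have hcell' : ∀ k ∈ Fintype.piFinset (fun _ : Fin r ⊕ Fin r => O),
        ‖∑ z ∈ Fintype.piFinset (fun j => (Finset.Icc (-(P : ℤ)) P).filter fun n => g n = k j),
          (∏ j, W j (z j)) * e (-pairing θ (sumWord d s z))‖
          ≤ c * B ^ (2 * r) * (P / K ^ 3) ^ (2 * r) := by
      intro k hk
      rw [Fintype.mem_piFinset] at hk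
      refine hcell s P L q hP hLP hq _ (fun j => (k j).2 * L) (fun j => (k j).1) (fun j => ?_)
        (fun j n hn => ?_) W B ?_ ?_ θ a hθ _ fun j t => hone _ (hk j) j t
      · have h1 := hk j
        rw [hO, Finset.mem_product, Finset.mem_Icc, ← abs_le] at h1
        rw [abs_mul, abs_of_pos hLz]
        have h2 : (L : ℤ) * m ≤ 2 * P := by
          have : L * (P / L) ≤ P := Nat.mul_div_le P L
          have : L * m ≤ 2 * P := by rw [hm, mul_add, mul_one]; omega
          exact_mod_cast this
        nlinarith [h1.2]
      · rw [Finset.mem_filter] at hn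
        rw [← hn.2]
        simp only [hg]
        refine ⟨Int.dvd_self_sub_emod, Int.ediv_mul_le _ hLz.ne', ?_⟩
        have := Int.lt_ediv_add_one_mul_self n hLz
        linarith
      · rintro (i | i) n
        · exact hφ i n
        · exact hψ i n
      · rintro (i | i) n
        · exact hφ' i n
        · exact hψ' i n
    have hcard : (O.card : ℝ) ≤ 10 * K ^ 2 := by
      have h1 : O.card = q * (2 * m + 1) := by
        rw [hO, Finset.card_product, Int.card_Ico, Int.card_Icc]
        congr 1 <;> omega
      have h2 : (m : ℝ) ≤ P / L + 1 := by
        rw [hm]; push_cast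
        gcongr
        exact Nat.cast_div_le
      have h3 : (1 : ℝ) ≤ P / L := by
        rw [le_div_iff₀ hL0, one_mul]; exact_mod_cast hLP
      have h4 : (P : ℝ) / L ≤ 2 * K := by
        rw [div_le_iff₀ hL0]
        have h5 : P / K / 2 * (2 * K) = P := by field_simp
        nlinarith
      rw [h1]; push_cast
      calc (q : ℝ) * (2 * m + 1) ≤ K * (10 * K) := by gcongr; linarith
        _ = _ := by ring
    refine (norm_sum_le _ _).trans ((Finset.sum_le_sum hcell').trans ?_)
    rw [Finset.sum_const, nsmul_eq_mul, Fintype.card_piFinset]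
    simp only [Finset.prod_const, Finset.card_univ, Fintype.card_sum, Fintype.card_fin, ← two_mul]
    push_cast
    have hB : 0 ≤ B ^ (2 * r) := (even_two_mul r).pow_nonneg B
    calc (O.card : ℝ) ^ (2 * r) * (c * B ^ (2 * r) * (P / K ^ 3) ^ (2 * r))
        ≤ (10 * K ^ 2) ^ (2 * r) * (c * B ^ (2 * r) * (P / K ^ 3) ^ (2 * r)) := by gcongr
      _ = c * 10 ^ (2 * r) * (B ^ (2 * r) * (K ^ 2 * (P / K ^ 3)) ^ (2 * r)) := by
          rw [mul_pow 10, mul_pow (K ^ 2)]; ring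
      _ = _ := by
          have : K ^ 2 * (P / K ^ 3) = P * K⁻¹ := by field_simp
          rw [this, mul_pow, inv_pow, mul_pow]; ring

end DiscreteRadon
end

noncomputable section
namespace DiscreteRadon

/-! ### The minor arc estimate -/

theorem exists_common_denominator {α : Type*} (O : Finset α) {θ e : α → ℝ} {Q : ℝ}
    (hQ : 1 ≤ Q)
    (h : ∀ l ∈ O, ∃ q : ℕ, 1 ≤ q ∧ q ≤ Q ∧ ∃ a : ℤ, |q * θ l - a| ≤ Q * e l) :
    ∃ q : ℕ, 1 ≤ q ∧ q ≤ Q ^ O.card ∧ ∀ l ∈ O, ∃ a : ℤ, |q * θ l - a| ≤ Q ^ O.card * (Q * e l) := by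
  classical
  induction O using Finset.induction_on with
  | empty => exact ⟨1, le_rfl, by simp, by simp⟩
  | insert b O hb ih =>
    obtain ⟨q, h1, h2, h3⟩ := ih fun l hl => h l (by simp [hl])
    obtain ⟨q', h1', h2', a', ha'⟩ := h b (by simp)
    have hQ0 : 0 < Q := by linarith
    rw [Finset.card_insert_of_notMem hb]
    refine ⟨q * q', Nat.mul_pos h1 h1', ?_, fun l hl => ?_⟩
    · push_cast; rw [pow_succ]; gcongr
    · rcases Finset.mem_insert.1 hl with rfl | hl
      · refine ⟨q * a', ?_⟩
        have : ((q * q' : ℕ) : ℝ) * θ l - ((q * a' : ℤ) : ℝ) = q * (q' * θ l - a') := by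
          push_cast; ring
        rw [this, abs_mul, abs_of_nonneg (Nat.cast_nonneg q)]
        have h4 : (q : ℝ) ≤ Q ^ (O.card + 1) := h2.trans (pow_le_pow_right₀ hQ (by omega))
        gcongr
      · obtain ⟨a, ha⟩ := h3 l hl
        refine ⟨q' * a, ?_⟩
        have : ((q * q' : ℕ) : ℝ) * θ l - ((q' * a : ℤ) : ℝ) = q' * (q * θ l - a) := by
          push_cast; ring
        rw [this, abs_mul, abs_of_nonneg (Nat.cast_nonneg q')]
        calc (q' : ℝ) * |q * θ l - a| ≤ Q * (Q ^ O.card * (Q * e l)) := by gcongr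
          _ = _ := by rw [pow_succ]; ring

theorem norm_wordSum_le_or_major (d : ℕ) (hd : 1 ≤ d) : ∃ C : ℕ, 1 ≤ C ∧ ∀ N M : ℕ, 1 ≤ N →
    ∃ C' : ℝ, 1 ≤ C' ∧ ∀ (s : Bool) (P : ℕ) (K Lam : ℝ), 1 ≤ K → 1 ≤ Lam → C * K ^ C ≤ P →
    (P : ℝ) ^ degZ d ≤ K ^ (2 * N) → ∀ φ ψ : Fin (M * N) → ℤ → ℂ,
    (∀ i n, ‖φ i n‖ ≤ Lam / P) → (∀ i n, ‖ψ i n‖ ≤ Lam / P) →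
    (∀ i n, ‖φ i (n + 1) - φ i n‖ ≤ Lam / P / P) → (∀ i n, ‖ψ i (n + 1) - ψ i n‖ ≤ Lam / P / P) →
    ∀ θ : Y d → ℝ, ‖wordSum s P φ ψ θ‖ ≤ C' * P ^ d * Lam ^ (2 * (M * N)) * (K ^ M)⁻¹ ∨
    ∃ q : ℕ, 1 ≤ q ∧ (q : ℝ) ≤ C * K ^ C ∧ ∀ l : Y d,
      ∃ a : ℤ, |q * θ l - a| ≤ C * K ^ C / (P : ℝ) ^ deg l := by
  obtain ⟨C₁, hC₁, hcent⟩ := norm_wordSum_le_or_central d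
  obtain ⟨C₂, hC₂, hnon⟩ := norm_wordSum_le_or_noncentral d hd
  set O : Finset (Y d) := Finset.univ.filter fun l => l.1.2 ≠ 0 with hO
  have hpoly : PolyBdd fun K => ((C₂ : ℝ) * ((C₁ * K ^ C₁) ^ (O.card + 1)) ^ C₂ +
      2 * (C₁ * K ^ C₁) ^ (O.card + 1) + 48 * K ^ C₁) * (C₁ * K ^ C₁) ^ (O.card + 1) := by
    have h1 : PolyBdd fun K => (C₁ * K ^ C₁ : ℝ) ^ (O.card + 1) :=
      ((PolyBdd.const _).mul (PolyBdd.id.pow _)).pow _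
    exact ((((PolyBdd.const _).mul (h1.pow _)).add ((PolyBdd.const _).mul h1)).add
      ((PolyBdd.const _).mul (PolyBdd.id.pow _))).mul h1
  obtain ⟨C, hC, hCb⟩ := hpoly.exists_le
  refine ⟨C, hC, fun N M hN => ?_⟩
  obtain ⟨C₁', hC₁', hcent⟩ := hcent N M hN
  obtain ⟨C₂', hC₂', hnon⟩ := hnon (M * N)
  refine ⟨C₁' + C₂', by linarith, fun s P K Lam hK hLam hKP hPK φ ψ hφ hψ hφ' hψ' θ => ?_⟩
  have hK0 : 0 < K := by linarith
  set Q : ℝ := C₁ * K ^ C₁ with hQ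
  have hC₁1 : (1 : ℝ) ≤ C₁ := by exact_mod_cast hC₁
  have hC₂1 : (1 : ℝ) ≤ C₂ := by exact_mod_cast hC₂
  have hQK : K ≤ Q := by
    have := le_self_pow₀ hK (by omega : C₁ ≠ 0)
    rw [hQ]; nlinarith
  have hQ1 : 1 ≤ Q := hK.trans hQK
  set K₂ : ℝ := Q ^ (O.card + 1) with hK₂
  have hK₂1 : 1 ≤ K₂ := one_le_pow₀ hQ1
  have hKK₂ : K ≤ K₂ := hQK.trans (le_self_pow₀ hQ1 (by omega))
  have hb := hCb K hK
  have hKC : 1 ≤ K ^ C₁ := one_le_pow₀ hK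
  have hT0 : 0 ≤ (C₂ : ℝ) * K₂ ^ C₂ := by positivity
  have hb1 : 48 * K ^ C₁ ≤ C * K ^ C := by
    refine le_trans ?_ hb
    nlinarith
  have hb2 : 2 * K₂ ≤ C * K ^ C := by
    refine le_trans ?_ hb
    nlinarith
  have hb3 : C₂ * K₂ ^ C₂ * K₂ ≤ C * K ^ C := by
    refine le_trans ?_ hb
    nlinarith
  have hP1 : (1 : ℝ) ≤ P := by linarith
  have hP : 1 ≤ P := by exact_mod_cast hP1
  have hP0 : (0 : ℝ) < P := by linarith
  by_cases hc : ∀ l ∈ O, ∃ q : ℕ, 1 ≤ q ∧ q ≤ Q ∧ ∃ a : ℤ, |q * θ l - a| ≤ Q * (1 / P ^ deg l)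
  · obtain ⟨q, hq1, hq, hqa⟩ := exists_common_denominator O hQ1 hc
    have hqK : (q : ℝ) ≤ K₂ := hq.trans (pow_le_pow_right₀ hQ1 (by omega))
    have hqa' : ∀ l : Y d, l.1.2 ≠ 0 → ∃ a : ℤ, |q * θ l - a| ≤ K₂ / P ^ deg l := by
      intro l hl
      obtain ⟨a, ha⟩ := hqa l (by simp [hO, hl])
      refine ⟨a, ha.trans (le_of_eq ?_)⟩
      rw [hK₂, pow_succ]; ring
    rcases hnon s P K₂ (Lam / P) hK₂1 (hb2.trans hKP) φ ψ hφ hψ hφ' hψ' θ q hq1 hqK hqa' with h | h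
    · left
      refine h.trans ?_
      have h1 : Lam / P * P = Lam := by field_simp
      have h2 : (K₂ ^ (2 * (M * N)))⁻¹ ≤ (K ^ M)⁻¹ := by
        refine inv_anti₀ (by positivity) ?_
        calc K ^ M ≤ K₂ ^ M := by gcongr
          _ ≤ _ := pow_le_pow_right₀ hK₂1 (by nlinarith)
      have h3 : (1 : ℝ) ≤ P ^ d := one_le_pow₀ hP1
      rw [h1]
      calc C₂' * Lam ^ (2 * (M * N)) * (K₂ ^ (2 * (M * N)))⁻¹
          ≤ (C₁' + C₂') * Lam ^ (2 * (M * N)) * (K ^ M)⁻¹ := by gcongr; linarith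
        _ = (C₁' + C₂') * 1 * Lam ^ (2 * (M * N)) * (K ^ M)⁻¹ := by ring
        _ ≤ _ := by gcongr
    · right
      obtain ⟨q', hq'1, hq', hq'a⟩ := h
      refine ⟨q' * q, Nat.mul_pos hq'1 hq1, ?_, fun l => ?_⟩
      · push_cast
        calc (q' : ℝ) * q ≤ (C₂ * K₂ ^ C₂) * K₂ := by gcongr
          _ ≤ _ := hb3
      · by_cases hl : l.1.2 = 0
        · obtain ⟨a, ha⟩ := hq'a ⟨l, hl⟩
          refine ⟨a, ha.trans ?_⟩
          refine div_le_div_of_nonneg_right (le_trans ?_ hb3) (by positivity)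
          nlinarith
        · obtain ⟨a, ha⟩ := hqa' l hl
          refine ⟨q' * a, ?_⟩
          have : ((q' * q : ℕ) : ℝ) * θ l - ((q' * a : ℤ) : ℝ) = q' * (q * θ l - a) := by
            push_cast; ring
          rw [this, abs_mul, abs_of_nonneg (Nat.cast_nonneg q')]
          calc (q' : ℝ) * |q * θ l - a| ≤ (C₂ * K₂ ^ C₂) * (K₂ / P ^ deg l) := by gcongr
            _ = C₂ * K₂ ^ C₂ * K₂ / P ^ deg l := by ring
            _ ≤ _ := div_le_div_of_nonneg_right hb3 (by positivity)
  · push Not at hc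
    obtain ⟨l, hl, hc⟩ := hc
    rcases hcent s P K Lam hP hK (by linarith) hPK (hb1.trans hKP) φ ψ hφ hψ θ l
      (by simpa [hO] using hl) with h | h
    · left
      refine h.trans ?_
      gcongr
      linarith
    · obtain ⟨q, h1, h2, a, h3⟩ := h
      exact absurd h3 (not_le.2 ((hc q h1 h2 a).trans_le' (le_of_eq (by ring))))

end DiscreteRadon
end

noncomputable section
namespace DiscreteRadon

open MeasureTheory

/-! ### Riemann sums -/

variable {d : ℕ}

theorem norm_prod_sub_prod_le {ι : Type*} (O : Finset ι) {a b : ι → ℝ} {B η : ℝ} (hB : 0 ≤ B)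
    (ha : ∀ i, |a i| ≤ B) (hb : ∀ i, |b i| ≤ B) (hab : ∀ i, |a i - b i| ≤ B * η) :
    |∏ i ∈ O, a i - ∏ i ∈ O, b i| ≤ O.card * B ^ O.card * η := by
  classical
  induction O using Finset.induction_on with
  | empty => simp
  | insert i O hi ih =>
    rw [Finset.prod_insert hi, Finset.prod_insert hi, Finset.card_insert_of_notMem hi]
    have h1 : a i * ∏ j ∈ O, a j - b i * ∏ j ∈ O, b j
        = (a i - b i) * ∏ j ∈ O, a j + b i * (∏ j ∈ O, a j - ∏ j ∈ O, b j) := by ring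
    have h2 : |∏ j ∈ O, a j| ≤ B ^ O.card := by
      rw [Finset.abs_prod, ← Finset.prod_const]
      exact Finset.prod_le_prod (fun _ _ => abs_nonneg _) fun j _ => ha j
    rw [h1]
    have hη : 0 ≤ B * η := (abs_nonneg _).trans (hab i)
    calc _ ≤ |a i - b i| * |∏ j ∈ O, a j| + |b i| * |∏ j ∈ O, a j - ∏ j ∈ O, b j| := by
          rw [← abs_mul, ← abs_mul]; exact abs_add_le _ _
      _ ≤ (B * η) * B ^ O.card + B * (O.card * B ^ O.card * η) := by
          gcongr
          · exact hab i
          · exact hb i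
      _ = _ := by push_cast; ring

/-- The continuous analogue of the summand of `wordSum`. -/
def wordFun {r : ℕ} (s : Bool) (W : Fin r ⊕ Fin r → ℝ → ℝ) (β : Y d → ℝ) (x : Fin r ⊕ Fin r → ℝ) : ℂ :=
  ((∏ j, W j (x j) : ℝ) : ℂ) * e (-∑ l, β l * (sumWord d s x).coord l)

theorem exists_norm_wordFun_sub_le (d r : ℕ) : ∃ C : ℝ, 1 ≤ C ∧ ∀ (s : Bool) (P t Q B : ℝ), 0 < P →
    0 ≤ t → 1 ≤ Q → ∀ W : Fin r ⊕ Fin r → ℝ → ℝ, (∀ j x, |W j x| ≤ B) →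
    (∀ j x y, |W j x - W j y| ≤ B / P * |x - y|) → ∀ β : Y d → ℝ, (∀ l, |β l| ≤ Q / P ^ deg l) →
    ∀ x y : Fin r ⊕ Fin r → ℝ, (∀ j, |x j| ≤ 4 * P) → (∀ j, |y j| ≤ 4 * P) → (∀ j, |x j - y j| ≤ t) →
    ‖wordFun s W β x - wordFun s W β y‖ ≤ C * B ^ (2 * r) * (t / P * Q) := by
  obtain ⟨c, hc, h⟩ := exists_abs_word_sub_le d r
  refine ⟨1 + 2 * r + ∑ l : Y d, 2 * Real.pi * (c * 4 ^ deg l), ?_, ?_⟩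
  · have : 0 ≤ ∑ l : Y d, 2 * Real.pi * (c * 4 ^ deg l) := Finset.sum_nonneg fun _ _ => by
      have := Real.pi_pos; positivity
    have : (0 : ℝ) ≤ r := Nat.cast_nonneg r
    linarith
  intro s P t Q B hP ht hQ W hW hW' β hβ x y hx hy hxy
  have hB2 : 0 ≤ B ^ (2 * r) := (even_two_mul r).pow_nonneg B
  have htP : 0 ≤ t / P := by positivity
  have h1 : |∏ j, W j (x j) - ∏ j, W j (y j)| ≤ 2 * r * B ^ (2 * r) * (t / P) := by
    rcases Nat.eq_zero_or_pos r with rfl | hr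
    · simp
    have hB : 0 ≤ B := (abs_nonneg _).trans (hW (Sum.inl ⟨0, hr⟩) 0)
    have := norm_prod_sub_prod_le Finset.univ hB (fun j => hW j (x j)) (fun j => hW j (y j))
      (η := t / P) (fun j => (hW' j _ _).trans (by
        have := hxy j
        calc B / P * |x j - y j| ≤ B / P * t := by gcongr
          _ = _ := by ring))
    simpa [Fintype.card_sum, ← two_mul] using this
  have h2 : |∏ j, W j (x j)| ≤ B ^ (2 * r) := by
    rw [Finset.abs_prod]
    refine (Finset.prod_le_prod (fun _ _ => abs_nonneg _) fun j _ => hW j (x j)).trans ?_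
    simp [Finset.prod_const, Fintype.card_sum, ← two_mul]
  have h3 : ‖e (-∑ l, β l * (sumWord d s x).coord l) - e (-∑ l, β l * (sumWord d s y).coord l)‖
      ≤ (∑ l : Y d, 2 * Real.pi * (c * 4 ^ deg l)) * (t / P * Q) := by
    refine (norm_e_sub_le _ _).trans ?_
    rw [neg_sub_neg, ← Finset.sum_sub_distrib, Finset.sum_mul, ]
    refine (mul_le_mul_of_nonneg_left (Finset.abs_sum_le_sum_abs _ _) (by positivity)).trans ?_
    rw [Finset.mul_sum]
    refine Finset.sum_le_sum fun l _ => ?_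
    have h4 := (h s (P := 4 * P) (lam := t / (4 * P)) (by positivity) (by positivity)
      (fun i => y (Sum.inl i)) (fun i => y (Sum.inr i)) (fun i => x (Sum.inl i))
      (fun i => x (Sum.inr i)) (fun i => hy _) (fun i => hy _) (fun i => hx _) (fun i => hx _)
      (fun i => by rw [abs_sub_comm, mul_div_cancel₀ _ (by positivity)]; exact hxy _)
      (fun i => by rw [abs_sub_comm, mul_div_cancel₀ _ (by positivity)]; exact hxy _) l).2
    rw [← mul_sub, abs_mul]
    calc 2 * Real.pi * (|β l| * |(sumWord d s y).coord l - (sumWord d s x).coord l|)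
        ≤ 2 * Real.pi * (Q / P ^ deg l * (c * (4 * P) ^ deg l * (t / P))) := by
          have := Real.pi_pos
          gcongr
          · exact hβ l
          · refine h4.trans ?_
            gcongr
            linarith
      _ = _ := by rw [mul_pow]; field_simp
  have h5 : wordFun s W β x - wordFun s W β y
      = ((∏ j, W j (x j) - ∏ j, W j (y j) : ℝ) : ℂ) * e (-∑ l, β l * (sumWord d s y).coord l)
        + ((∏ j, W j (x j) : ℝ) : ℂ) * (e (-∑ l, β l * (sumWord d s x).coord l)
          - e (-∑ l, β l * (sumWord d s y).coord l)) := by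
    simp only [wordFun]; push_cast; ring
  rw [h5]
  calc _ ≤ |∏ j, W j (x j) - ∏ j, W j (y j)| * 1 + |∏ j, W j (x j)| *
        ‖e (-∑ l, β l * (sumWord d s x).coord l) - e (-∑ l, β l * (sumWord d s y).coord l)‖ := by
        refine (norm_add_le _ _).trans (le_of_eq ?_)
        rw [norm_mul, norm_mul, norm_e, Complex.norm_real, Complex.norm_real, Real.norm_eq_abs,
          Real.norm_eq_abs]
    _ ≤ 2 * r * B ^ (2 * r) * (t / P) * Q + B ^ (2 * r) *
        ((∑ l : Y d, 2 * Real.pi * (c * 4 ^ deg l)) * (t / P * Q)) := by gcongr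
    _ ≤ _ := by
        have : 0 ≤ B ^ (2 * r) * (t / P * Q) := by positivity
        linarith

theorem integral_eq_sum_unitCube {ι : Type} [Fintype ι] {f : (ι → ℝ) → ℂ} (hf : Integrable f) {q : ℕ}
    (hq : 1 ≤ q) (O : Finset (ι → ℤ)) (hO : ∀ m ∉ O, ∀ x ∈ unitCube ι, f (fun i => q * (x i + m i)) = 0) :
    ((q : ℂ) ^ Fintype.card ι)⁻¹ * ∫ x, f x
      = ∑ m ∈ O, ∫ x in unitCube ι, f (fun i => q * (x i + m i)) := by
  have hq0 : (q : ℝ) ≠ 0 := by positivity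
  have h1 := hasSum_integral_unitCube (hf.comp_smul hq0)
  have h2 := (hasSum_sum_of_ne_finset_zero (s := O) (f := fun m : ι → ℤ =>
    ∫ x in unitCube ι, f ((q : ℝ) • (fun i => x i + m i))) fun m hm => by
      refine (setIntegral_congr_fun measurableSet_unitCube fun x hx => hO m hm x hx).trans ?_
      simp).unique h1
  rw [Measure.integral_comp_smul] at h2
  rw [Module.finrank_fintype_fun_eq_card, abs_of_nonneg (by positivity), Complex.real_smul] at h2
  push_cast at h2
  exact h2.symm

theorem sum_piFinset_residues {ι : Type*} [Fintype ι] [DecidableEq ι] {P q R : ℕ} (hq : 1 ≤ q)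
    (hR : P ≤ q * R) {F : (ι → ℤ) → ℂ} (hF : ∀ z, (∃ j, (P : ℤ) < |z j|) → F z = 0) :
    ∑ z ∈ Fintype.piFinset (fun _ : ι => Finset.Icc (-(P : ℤ)) P), F z
      = ∑ v ∈ Fintype.piFinset (fun _ : ι => Finset.Icc (1 : ℤ) q),
        ∑ m ∈ Fintype.piFinset (fun _ : ι => Finset.Icc (-((R + 1 : ℕ) : ℤ)) (R + 1 : ℕ)),
          F (fun j => v j + q * m j) := by
  have hqz : (0 : ℤ) < q := by exact_mod_cast hq
  have hRz : (P : ℤ) ≤ q * R := by exact_mod_cast hR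
  rw [Finset.sum_subset (s₂ := Fintype.piFinset (fun _ : ι =>
    Finset.Icc (1 + q * (-((R + 1 : ℕ) : ℤ))) (q + q * (R + 1 : ℕ))))]
  · rw [← Finset.sum_product']
    symm
    refine Finset.sum_nbij' (fun p j => p.1 j + q * p.2 j)
      (fun z => (fun j => (z j - 1) % q + 1, fun j => (z j - 1) / q)) ?_ ?_ ?_ ?_ ?_
    · intro p hp
      simp only [Finset.mem_product, Fintype.mem_piFinset, Finset.mem_Icc] at hp ⊢
      exact fun j => ⟨by have := hp.1 j; have := hp.2 j; nlinarith,
        by have := hp.1 j; have := hp.2 j; nlinarith⟩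
    · intro z hz
      simp only [Finset.mem_product, Fintype.mem_piFinset, Finset.mem_Icc] at hz ⊢
      refine ⟨fun j => ⟨?_, ?_⟩, fun j => ⟨?_, ?_⟩⟩
      · have := Int.emod_nonneg (z j - 1) hqz.ne'; omega
      · have := Int.emod_lt_of_pos (z j - 1) hqz; omega
      · rw [Int.le_ediv_iff_mul_le hqz]; have := hz j; nlinarith
      · rw [← Int.lt_add_one_iff, Int.ediv_lt_iff_lt_mul hqz]; have := hz j; nlinarith
    · intro p hp
      simp only [Finset.mem_product, Fintype.mem_piFinset, Finset.mem_Icc] at hp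
      have h1 : ∀ j, p.1 j + q * p.2 j - 1 = (p.1 j - 1) + q * p.2 j := fun j => by ring
      refine Prod.ext (funext fun j => ?_) (funext fun j => ?_)
      · simp only [h1, Int.add_mul_emod_self_left]
        rw [Int.emod_eq_of_lt (by have := hp.1 j; omega) (by have := hp.1 j; omega)]; ring
      · simp only [h1]
        rw [Int.add_mul_ediv_left _ _ hqz.ne',
          Int.ediv_eq_zero_of_lt (by have := hp.1 j; omega) (by have := hp.1 j; omega), zero_add]
    · intro z _
      funext j
      have := Int.emod_add_mul_ediv (z j - 1) q
      simp only
      linarith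
    · intro _ _; rfl
  · intro z hz
    simp only [Fintype.mem_piFinset, Finset.mem_Icc] at hz ⊢
    push_cast
    exact fun j => ⟨by have := hz j; nlinarith, by have := hz j; nlinarith⟩
  · intro z _ hz
    refine hF z ?_
    simp only [Fintype.mem_piFinset, Finset.mem_Icc, not_forall, ← abs_le, not_le] at hz
    exact hz

end DiscreteRadon
end

noncomputable section
namespace DiscreteRadon

open MeasureTheory

variable {d : ℕ}

theorem continuous_sumWord_coord (s : Bool) {r : ℕ} (l : Y d) :
    Continuous fun x : Fin r ⊕ Fin r → ℝ => (sumWord d s x).coord l := by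
  have hB : IsSize (R := (Fin r ⊕ Fin r → ℝ) → ℝ) fun f A => 0 ≤ A ∧ Continuous f :=
    { nonneg := fun h => h.1
      mono := fun h h' => ⟨h.1.trans h', h.2⟩
      zero := ⟨le_rfl, continuous_const⟩
      one := ⟨zero_le_one, continuous_const⟩
      neg := fun h => ⟨h.1, h.2.neg⟩
      add := fun h h' => ⟨add_nonneg h.1 h'.1, h.2.add h'.2⟩
      mul := fun h h' => ⟨mul_nonneg h.1 h'.1, h.2.mul h'.2⟩ }
  obtain ⟨c, _, h⟩ := exists_word_near d r
  have h1 : ∀ j : Fin r ⊕ Fin r, Near (R := (Fin r ⊕ Fin r → ℝ) → ℝ)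
      (fun f A => 0 ≤ A ∧ Continuous f) 1 1 1 1 (fun x => x j) (fun x => x j) := fun j =>
    ⟨⟨by norm_num, continuous_apply j⟩, ⟨by norm_num, continuous_apply j⟩,
      ⟨by norm_num, (continuous_apply j).sub (continuous_apply j)⟩⟩
  have h2 := (h s hB zero_le_one zero_le_one _ _ _ _ (fun i => h1 (Sum.inl i))
    (fun i => h1 (Sum.inr i)) l).1.2
  refine h2.congr fun x => ?_
  exact (sumWord_coord_map (Pi.evalRingHom (fun _ : Fin r ⊕ Fin r → ℝ => ℝ) x) s
    (fun j => fun x : Fin r ⊕ Fin r → ℝ => x j) l).symm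

theorem continuous_wordFun (s : Bool) {r : ℕ} {W : Fin r ⊕ Fin r → ℝ → ℝ} (hW : ∀ j, Continuous (W j)) :
    Continuous fun p : (Y d → ℝ) × (Fin r ⊕ Fin r → ℝ) => wordFun s W p.1 p.2 := by
  unfold wordFun
  refine Continuous.mul (Complex.continuous_ofReal.comp (continuous_finsetProd _ fun j _ =>
    (hW j).comp ((continuous_apply j).comp continuous_snd))) (continuous_e.comp
    (Continuous.neg (continuous_finsetSum _ fun l _ => Continuous.mul
      ((continuous_apply l).comp continuous_fst) ((continuous_sumWord_coord s l).comp continuous_snd))))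

theorem wordFun_eq_zero (s : Bool) {r : ℕ} {W : Fin r ⊕ Fin r → ℝ → ℝ} {P : ℝ}
    (hW : ∀ j x, P < |x| → W j x = 0) (β : Y d → ℝ) {x : Fin r ⊕ Fin r → ℝ} {j : Fin r ⊕ Fin r}
    (hx : P < |x j|) : wordFun s W β x = 0 := by
  rw [wordFun, Finset.prod_eq_zero (Finset.mem_univ j) (hW j _ hx)]; simp

theorem hasCompactSupport_wordFun (s : Bool) {r : ℕ} {W : Fin r ⊕ Fin r → ℝ → ℝ} {P : ℝ} (hP : 0 ≤ P)
    (hW : ∀ j x, P < |x| → W j x = 0) (β : Y d → ℝ) : HasCompactSupport (wordFun s W β) := by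
  refine HasCompactSupport.intro (isCompact_closedBall 0 P) fun x hx => ?_
  rw [mem_closedBall_zero_iff, pi_norm_le_iff_of_nonneg hP] at hx
  push Not at hx
  obtain ⟨j, hj⟩ := hx
  exact wordFun_eq_zero s hW β hj

theorem integrable_wordFun (s : Bool) {r : ℕ} {W : Fin r ⊕ Fin r → ℝ → ℝ} (hWc : ∀ j, Continuous (W j))
    {P : ℝ} (hP : 0 ≤ P) (hW : ∀ j x, P < |x| → W j x = 0) (β : Y d → ℝ) :
    Integrable (wordFun s W β) :=
  ((continuous_wordFun s hWc).comp (Continuous.prodMk_right β)).integrable_of_hasCompactSupport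
    (hasCompactSupport_wordFun s hP hW β)

theorem sum_product_piFinset_eq_sum_sum {I : Finset ℤ} {r : ℕ} (F : (Fin r → ℤ) → (Fin r → ℤ) → ℂ) :
    ∑ v ∈ Fintype.piFinset (fun _ : Fin r => I), ∑ w ∈ Fintype.piFinset (fun _ : Fin r => I), F v w
      = ∑ z ∈ Fintype.piFinset (fun _ : Fin r ⊕ Fin r => I),
        F (fun i => z (Sum.inl i)) (fun i => z (Sum.inr i)) := by
  rw [← Finset.sum_product']
  refine Finset.sum_nbij' (fun p => Sum.elim p.1 p.2)
    (fun z => (fun i => z (Sum.inl i), fun i => z (Sum.inr i))) ?_ ?_ ?_ ?_ ?_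
  · intro p hp
    simp only [Finset.mem_product, Fintype.mem_piFinset] at hp ⊢
    rintro (i | i)
    · exact hp.1 i
    · exact hp.2 i
  · intro z hz
    simp only [Finset.mem_product, Fintype.mem_piFinset] at hz ⊢
    exact ⟨fun i => hz _, fun i => hz _⟩
  · intro p _; rfl
  · intro z _; funext i; cases i <;> rfl
  · intro p _; rfl

/-- The exponential sum at `a / q + β` is approximated by an exponential sum modulo `q` times an
oscillatory integral. -/
theorem exists_norm_wordSum_sub_expSum_mul_le (d r : ℕ) : ∃ C : ℝ, 1 ≤ C ∧ ∀ (s : Bool) (P q : ℕ)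
    (Q B : ℝ), 1 ≤ q → q ≤ P → 1 ≤ Q → ∀ W : Fin r ⊕ Fin r → ℝ → ℝ, (∀ j x, |W j x| ≤ B) →
    (∀ j x y, |W j x - W j y| ≤ B / P * |x - y|) → (∀ j (x : ℝ), P < |x| → W j x = 0) →
    (∀ j, Continuous (W j)) → ∀ (a : Y d → ℕ) (β : Y d → ℝ), (∀ l, |β l| ≤ Q / P ^ deg l) →
    ‖wordSum s P (fun i n => (W (Sum.inl i) n : ℂ)) (fun i n => (W (Sum.inr i) n : ℂ))
        (fun l => a l / q + β l) - expSum (r := r) (word d s) q a * ∫ x, wordFun s W β x‖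
      ≤ C * (B * P) ^ (2 * r) * (q / P * Q) := by
  classical
  obtain ⟨C, hC, hlip⟩ := exists_norm_wordFun_sub_le d r
  refine ⟨C * 7 ^ (2 * r), ?_, fun s P q Q B hq hqP hQ W hW hW' hW0 hWc a β hβ => ?_⟩
  · have : (1 : ℝ) ≤ 7 ^ (2 * r) := one_le_pow₀ (by norm_num)
    nlinarith
  have hP : 1 ≤ P := hq.trans hqP
  have hP0 : (0 : ℝ) < P := by exact_mod_cast hP
  have hq0 : (0 : ℝ) < q := by exact_mod_cast hq
  have hqP' : (q : ℝ) ≤ P := by exact_mod_cast hqP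
  set R : ℕ := P / q + 1 with hR
  have hPR : P < q * R := Nat.lt_mul_div_succ P hq
  have hRP : q * R ≤ P + q := by
    have := Nat.mul_div_le P q
    rw [hR, mul_add, mul_one]; omega
  have hPR' : (P : ℝ) < q * R := by exact_mod_cast hPR
  have hRP' : (q : ℝ) * R ≤ P + q := by exact_mod_cast hRP
  set O : Finset (Fin r ⊕ Fin r → ℤ) := Fintype.piFinset
    (fun _ => Finset.Icc (-((R + 1 : ℕ) : ℤ)) (R + 1 : ℕ)) with hO
  set V : Finset (Fin r ⊕ Fin r → ℤ) := Fintype.piFinset (fun _ => Finset.Icc (1 : ℤ) q) with hV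
  set ζ : (Fin r ⊕ Fin r → ℤ) → ℂ := fun v => e (-∑ l, ((sumWord d s v).coord l : ℝ) * ((a l : ℝ) / q))
    with hζ
  have hcast : ∀ (z : Fin r ⊕ Fin r → ℤ) (l : Y d),
      (sumWord d s (fun j => (z j : ℝ))).coord l = ((sumWord d s z).coord l : ℝ) := fun z l =>
    sumWord_coord_map (Int.castRingHom ℝ) s z l
  have hsum : wordSum s P (fun i n => (W (Sum.inl i) n : ℂ)) (fun i n => (W (Sum.inr i) n : ℂ))
      (fun l => a l / q + β l) = ∑ v ∈ V, ζ v * ∑ m ∈ O, wordFun s W β (fun j => v j + q * m j) := by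
    rw [wordSum, sum_box_eq_sum_piFinset, sum_piFinset_residues hq hPR.le]
    · refine Finset.sum_congr rfl fun v _ => ?_
      rw [Finset.mul_sum]
      refine Finset.sum_congr rfl fun m _ => ?_
      have h1 : ∀ l : Y d, ∃ k : ℤ, (sumWord d s (fun j => v j + q * m j)).coord l
          = (sumWord d s v).coord l + q * k := by
        intro l
        obtain ⟨k, hk⟩ := dvd_sumWord_coord_sub (d := d) s (q := q) (z := fun j => v j + q * m j) (b := v)
          (fun j => by simp) l
        exact ⟨k, by omega⟩
      choose k hk using h1
      have h2 : e (-pairing (fun l => a l / q + β l) (sumWord d s (fun j => v j + q * m j)))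
          = ζ v * e (-∑ l, β l * (sumWord d s (fun j => (v j : ℝ) + q * m j)).coord l) := by
        rw [hζ]
        simp only
        rw [← e_add, ← e_add_int _ (∑ l, a l * k l)]
        congr 1
        push_cast
        rw [pairing, ← Finset.sum_neg_distrib, ← Finset.sum_neg_distrib, ← Finset.sum_neg_distrib,
          ← Finset.sum_add_distrib, ← Finset.sum_add_distrib]
        refine Finset.sum_congr rfl fun l _ => ?_
        have h3 := hcast (fun j => v j + q * m j) l
        push_cast at h3
        rw [h3, hk]
        push_cast
        field_simp
        ring
      rw [wordFun]
      have h4 : wordWeight (fun i (n : ℤ) => (W (Sum.inl i) n : ℂ)) (fun i n => (W (Sum.inr i) n : ℂ))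
          (fun i => v (Sum.inl i) + q * m (Sum.inl i), fun i => v (Sum.inr i) + q * m (Sum.inr i))
          = ((∏ j, W j (v j + q * m j) : ℝ) : ℂ) := by
        rw [wordWeight, Finset.prod_mul_distrib, Fintype.prod_sum_type]
        push_cast
        rfl
      rw [h4]
      change _ * e (-pairing (fun l => a l / q + β l) (sumWord d s (fun j => v j + q * m j))) = _
      rw [h2]; ring
    · rintro z ⟨j, hj⟩
      have hj' : (P : ℝ) < |(z j : ℝ)| := by exact_mod_cast hj
      rw [wordWeight, Finset.prod_mul_distrib]
      rcases j with i | i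
      · rw [Finset.prod_eq_zero (Finset.mem_univ i) (by rw [hW0 _ _ hj']; simp)]; simp
      · rw [Finset.prod_eq_zero (f := fun i => (W (Sum.inr i) (z (Sum.inr i)) : ℂ))
          (Finset.mem_univ i) (by rw [hW0 _ _ hj']; simp)]; simp
  have hint := integrable_wordFun (d := d) s hWc hP0.le hW0 β
  have hmO : ∀ m ∉ O, ∀ x ∈ unitCube (Fin r ⊕ Fin r),
      wordFun s W β (fun j => q * (x j + m j)) = 0 := by
    intro m hm x hx
    rw [hO, Fintype.mem_piFinset] at hm
    push Not at hm
    obtain ⟨j, hj⟩ := hm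
    have hxj := hx j trivial
    refine wordFun_eq_zero s hW0 β (j := j) ?_
    rw [Finset.mem_Icc, not_and_or, not_le, not_le] at hj
    simp only [Set.mem_Ico] at hxj
    rw [abs_mul, abs_of_pos hq0]
    refine hPR'.trans_le ?_
    gcongr
    rcases hj with hj | hj
    · have : (m j : ℝ) ≤ -((R + 1 : ℕ) : ℝ) - 1 := by exact_mod_cast Int.le_sub_one_iff.2 hj
      push_cast at this
      refine le_trans ?_ (neg_le_abs _)
      linarith
    · have : ((R + 1 : ℕ) : ℝ) + 1 ≤ m j := by exact_mod_cast hj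
      push_cast at this
      refine le_trans ?_ (le_abs_self _)
      linarith
  have hexp : expSum (r := r) (word d s) q a * ∫ x, wordFun s W β x = ∑ v ∈ V, ζ v * ∑ m ∈ O,
      ∫ x in unitCube (Fin r ⊕ Fin r), wordFun s W β (fun j => q * (x j + m j)) := by
    rw [← integral_eq_sum_unitCube hint hq O hmO, expSum, sum_product_piFinset_eq_sum_sum,
      ← Finset.sum_mul, Fintype.card_sum, Fintype.card_fin, ← two_mul, hζ, hV]
    simp only [sumWord]
    ring
  have hcube : ∀ (v m : Fin r ⊕ Fin r → ℤ), v ∈ V → m ∈ O →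
      ‖wordFun s W β (fun j => v j + q * m j) - ∫ x in unitCube (Fin r ⊕ Fin r),
        wordFun s W β (fun j => q * (x j + m j))‖ ≤ C * B ^ (2 * r) * (q / P * Q) := by
    intro v m hv hm
    have hcont : Continuous fun x : Fin r ⊕ Fin r → ℝ => wordFun s W β (fun j => q * (x j + m j)) :=
      ((continuous_wordFun s hWc).comp (Continuous.prodMk_right β)).comp (by fun_prop)
    have h1 : wordFun s W β (fun j => v j + q * m j)
        = ∫ x in unitCube (Fin r ⊕ Fin r), wordFun s W β (fun j => v j + q * m j) := by
      rw [setIntegral_const, measureReal_unitCube, one_smul]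
    rw [h1, ← integral_sub (integrableOn_unitCube continuous_const) (integrableOn_unitCube hcont)]
    refine norm_setIntegral_unitCube_le fun x hx => ?_
    have hvj : ∀ j, (1 : ℝ) ≤ v j ∧ (v j : ℝ) ≤ q := fun j => by
      have := Finset.mem_Icc.1 (Fintype.mem_piFinset.1 hv j)
      exact ⟨by exact_mod_cast this.1, by exact_mod_cast this.2⟩
    have hmj : ∀ j, -((R : ℝ) + 1) ≤ m j ∧ (m j : ℝ) ≤ R + 1 := fun j => by
      have := Finset.mem_Icc.1 (Fintype.mem_piFinset.1 hm j)
      exact ⟨by exact_mod_cast this.1, by exact_mod_cast this.2⟩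
    have hxj : ∀ j, 0 ≤ x j ∧ x j < 1 := fun j => hx j trivial
    have hqm : ∀ j, -(q * (R + 1) : ℝ) ≤ q * m j ∧ q * (m j : ℝ) ≤ q * (R + 1) := fun j =>
      ⟨by have := mul_le_mul_of_nonneg_left (hmj j).1 hq0.le; linarith,
        mul_le_mul_of_nonneg_left (hmj j).2 hq0.le⟩
    have hqx : ∀ j, 0 ≤ q * x j ∧ q * x j ≤ q := fun j =>
      ⟨mul_nonneg hq0.le (hxj j).1, by nlinarith [hxj j]⟩
    refine hlip s P q Q B hP0 hq0.le hQ W hW hW' β hβ _ _ (fun j => ?_) (fun j => ?_) (fun j => ?_)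
    · rw [abs_le]
      constructor <;> linarith [hvj j, hqm j]
    · rw [mul_add, abs_le]
      constructor <;> linarith [hqx j, hqm j]
    · rw [mul_add, add_sub_add_right_eq_sub, abs_le]
      constructor <;> linarith [hvj j, hqx j]
  rw [hsum, hexp, ← Finset.sum_sub_distrib]
  have hB2 : 0 ≤ B ^ (2 * r) := (even_two_mul r).pow_nonneg B
  have hterm : ∀ v ∈ V, ‖ζ v * ∑ m ∈ O, wordFun s W β (fun j => v j + q * m j) - ζ v * ∑ m ∈ O,
      ∫ x in unitCube (Fin r ⊕ Fin r), wordFun s W β (fun j => q * (x j + m j))‖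
      ≤ O.card * (C * B ^ (2 * r) * (q / P * Q)) := by
    intro v hv
    rw [← mul_sub, norm_mul, hζ, norm_e, one_mul, ← Finset.sum_sub_distrib, ← nsmul_eq_mul]
    exact (norm_sum_le _ _).trans (Finset.sum_le_card_nsmul _ _ _ fun m hm => hcube v m hv hm)
  have hcard : (V.card : ℝ) * O.card ≤ (7 * P) ^ (2 * r) := by
    rw [hV, hO, Fintype.card_piFinset, Fintype.card_piFinset]
    simp only [Finset.prod_const, Finset.card_univ, Fintype.card_sum, Fintype.card_fin, ← two_mul]
    push_cast
    rw [← mul_pow]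
    refine pow_le_pow_left₀ (by positivity) ?_ _
    have h1 : (Finset.Icc (1 : ℤ) q).card = q := by simp
    have h2 : (Finset.Icc (-((R : ℤ) + 1)) ((R : ℤ) + 1)).card = 2 * R + 3 := by
      rw [Int.card_Icc]; omega
    rw [h1, h2]; push_cast
    nlinarith
  calc _ ≤ V.card * (O.card * (C * B ^ (2 * r) * (q / P * Q))) := by
        rw [← nsmul_eq_mul (V.card)]
        exact (norm_sum_le _ _).trans (Finset.sum_le_card_nsmul _ _ _ hterm)
    _ = (V.card * O.card) * (C * B ^ (2 * r) * (q / P * Q)) := by ring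
    _ ≤ (7 * P) ^ (2 * r) * (C * B ^ (2 * r) * (q / P * Q)) := by gcongr
    _ = _ := by rw [mul_pow, mul_pow]; ring

end DiscreteRadon
end

noncomputable section
namespace DiscreteRadon

open MeasureTheory

/-! ### Convolution operators -/

variable {d : ℕ}

/-- Translation as a bounded operator. -/
abbrev transl (a : G0 d ℤ) : L2 d →L[ℂ] L2 d := (translate a).toContinuousLinearMap

theorem transl_mul (a b : G0 d ℤ) : transl (a * b) = transl a * transl b := by
  ext F g
  change F ((a * b)⁻¹ * g) = F (b⁻¹ * (a⁻¹ * g))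
  rw [mul_inv_rev, mul_assoc]

theorem transl_one : transl (1 : G0 d ℤ) = 1 := by
  ext F g
  change F (1⁻¹ * g) = F g
  rw [inv_one, one_mul]

theorem adjoint_transl (a : G0 d ℤ) : ContinuousLinearMap.adjoint (transl a) = transl a⁻¹ := by
  symm
  rw [ContinuousLinearMap.eq_adjoint_iff]
  intro F G
  have h1 : G = transl a⁻¹ (transl a G) := by
    change G = (transl a⁻¹ * transl a) G
    rw [← transl_mul, inv_mul_cancel, transl_one]; rfl
  conv_lhs => rw [h1]
  exact (translate a⁻¹).inner_map_map F (transl a G)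

theorem H_eq_sum {η₀ : ℝ → ℝ} (hη : IsCutoff η₀) (K : ℝ → ℝ) {j P : ℕ} (hP : 2 ^ (j + 2) ≤ P) :
    H d η₀ K j = ∑ n ∈ Finset.Icc (-(P : ℤ)) P, (dyadicKernel η₀ K j n : ℂ) • transl (A0 d n) := by
  refine finsum_eq_sum_of_support_subset _ fun n hn => ?_
  rw [Finset.coe_Icc, Set.mem_Icc, ← abs_le]
  by_contra h
  refine hn ?_
  have h1 : (2 : ℝ) ^ (j + 2) < |(n : ℝ)| := by
    have h2 : ((2 ^ (j + 2) : ℕ) : ℤ) < |n| := lt_of_le_of_lt (by exact_mod_cast hP) (not_le.1 h)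
    exact_mod_cast h2
  simp [dyadicKernel_eq_zero hη K j h1]

/-- An averaging operator along the curve, or along its inverse. -/
def curveOp (d : ℕ) (s : Bool) (P : ℕ) (φ : ℤ → ℂ) : L2 d →L[ℂ] L2 d :=
  ∑ n ∈ Finset.Icc (-(P : ℤ)) P, φ n • transl (signedA0 d s n)

theorem H_eq_curveOp {η₀ : ℝ → ℝ} (hη : IsCutoff η₀) (K : ℝ → ℝ) {j P : ℕ} (hP : 2 ^ (j + 2) ≤ P) :
    H d η₀ K j = curveOp d false P fun n => (dyadicKernel η₀ K j n : ℂ) := H_eq_sum hη K hP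

theorem adjoint_H_eq_curveOp {η₀ : ℝ → ℝ} (hη : IsCutoff η₀) (K : ℝ → ℝ) {j P : ℕ}
    (hP : 2 ^ (j + 2) ≤ P) : ContinuousLinearMap.adjoint (H d η₀ K j)
      = curveOp d true P fun n => (dyadicKernel η₀ K j n : ℂ) := by
  rw [H_eq_sum hη K hP, map_sum, curveOp]
  refine Finset.sum_congr rfl fun n _ => ?_
  rw [LinearIsometryEquiv.map_smulₛₗ, adjoint_transl]
  simp [signedA0]

theorem sum_box_succ {P r : ℕ} {M : Type*} [AddCommMonoid M]
    (F : (Fin (r + 1) → ℤ) × (Fin (r + 1) → ℤ) → M) :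
    ∑ z ∈ box P (r + 1), F z = ∑ a ∈ Finset.Icc (-(P : ℤ)) P, ∑ b ∈ Finset.Icc (-(P : ℤ)) P,
      ∑ w ∈ box P r, F (Fin.cons a w.1, Fin.cons b w.2) := by
  simp_rw [← Finset.sum_product']
  symm
  refine Finset.sum_nbij' (fun p => (Fin.cons p.1 p.2.2.1, Fin.cons p.2.1 p.2.2.2))
    (fun z => (z.1 0, z.2 0, fun i => z.1 i.succ, fun i => z.2 i.succ)) ?_ ?_ ?_ ?_ ?_
  · rintro ⟨a, b, w⟩ h
    simp only [Finset.mem_product, mem_box, Finset.mem_Icc, ← abs_le] at h ⊢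
    exact ⟨fun i => Fin.cases h.1 h.2.2.1 i, fun i => Fin.cases h.2.1 h.2.2.2 i⟩
  · rintro z h
    simp only [Finset.mem_product, mem_box, Finset.mem_Icc, ← abs_le] at h ⊢
    exact ⟨h.1 0, h.2 0, fun i => h.1 _, fun i => h.2 _⟩
  · rintro ⟨a, b, w⟩ _; simp
  · rintro z _
    simp only
    ext i <;> refine Fin.cases ?_ (fun i => ?_) i <;> simp
  · intro _ _; rfl

theorem prod_curveOp (s : Bool) (P : ℕ) {r : ℕ} (φ ψ : Fin r → ℤ → ℂ) :
    (List.ofFn fun i => curveOp d s P (φ i) * curveOp d (!s) P (ψ i)).prod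
      = ∑ z ∈ box P r, wordWeight φ ψ z • transl (word d s z.1 z.2) := by
  induction r with
  | zero =>
    have h1 : ∀ x y : Fin 0 → ℤ, word d s x y = 1 := fun x y => by simp [word]
    have h2 : (box P 0).card = 1 := by simp [box]
    simp [h1, wordWeight, transl_one, h2]
  | succ r ih =>
    rw [List.ofFn_succ, List.prod_cons, ih (fun i => φ i.succ) fun i => ψ i.succ, sum_box_succ]
    rw [curveOp, curveOp, Finset.sum_mul_sum, Finset.sum_mul]
    refine Finset.sum_congr rfl fun a _ => ?_
    rw [Finset.sum_mul]
    refine Finset.sum_congr rfl fun b _ => ?_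
    rw [Finset.mul_sum]
    refine Finset.sum_congr rfl fun w _ => ?_
    have h1 : word d s (Fin.cons a w.1) (Fin.cons b w.2)
        = signedA0 d s a * signedA0 d (!s) b * word d s w.1 w.2 := by
      simp [word, List.ofFn_succ]
    rw [h1, transl_mul, transl_mul, smul_mul_smul_comm, smul_mul_smul_comm]
    congr 1
    simp [wordWeight, Fin.prod_univ_succ]

/-- The convolution kernel of a product of averaging operators. -/
def wordKernel (d : ℕ) (s : Bool) (P : ℕ) {r : ℕ} (φ ψ : Fin r → ℤ → ℂ) (h : G0 d ℤ) : ℂ :=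
  open scoped Classical in ∑ z ∈ (box P r).filter fun z => word d s z.1 z.2 = h, wordWeight φ ψ z

theorem sum_smul_transl_apply {α : Type*} (O : Finset α) (c : α → ℂ) (γ : α → G0 d ℤ) (F : L2 d)
    (g : G0 d ℤ) : (∑ z ∈ O, c z • transl (γ z)) F g = ∑ z ∈ O, c z * F ((γ z)⁻¹ * g) := by
  rw [_root_.sum_apply, lp.coeFn_sum, Finset.sum_apply]
  rfl

theorem hasSum_fiberwise {α G : Type*} [DecidableEq G] (O : Finset α) (c : α → ℂ) (γ : α → G)
    (f : G → ℂ) : HasSum (fun h => (∑ z ∈ O.filter fun z => γ z = h, c z) * f h)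
      (∑ z ∈ O, c z * f (γ z)) := by
  have h1 : ∑ z ∈ O, c z * f (γ z)
      = ∑ h ∈ O.image γ, (∑ z ∈ O.filter fun z => γ z = h, c z) * f h := by
    rw [← Finset.sum_fiberwise_of_maps_to (t := O.image γ) (g := γ)
      fun z hz => Finset.mem_image_of_mem _ hz]
    refine Finset.sum_congr rfl fun h _ => ?_
    rw [Finset.sum_mul]
    refine Finset.sum_congr rfl fun z hz => ?_
    rw [← (Finset.mem_filter.1 hz).2]
  rw [h1]
  refine hasSum_sum_of_ne_finset_zero fun h hh => ?_
  rw [Finset.sum_eq_zero, zero_mul]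
  intro z hz
  rw [Finset.mem_filter] at hz
  exact absurd (Finset.mem_image.2 ⟨z, hz.1, hz.2⟩) hh

theorem hasSum_wordKernel_mul (s : Bool) (P : ℕ) {r : ℕ} (φ ψ : Fin r → ℤ → ℂ) (F : L2 d)
    (g : G0 d ℤ) : HasSum (fun h => wordKernel d s P φ ψ h * F (h⁻¹ * g))
      ((List.ofFn fun i => curveOp d s P (φ i) * curveOp d (!s) P (ψ i)).prod F g) := by
  classical
  rw [prod_curveOp, sum_smul_transl_apply]
  exact hasSum_fiberwise (box P r) (wordWeight φ ψ) (fun z => word d s z.1 z.2)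
    fun h => F (h⁻¹ * g)

theorem exists_abs_coord_le_of_wordKernel_ne_zero (d r : ℕ) : ∃ c : ℝ, 1 ≤ c ∧ ∀ (s : Bool) (P : ℕ)
    (φ ψ : Fin r → ℤ → ℂ) (h : G0 d ℤ), wordKernel d s P φ ψ h ≠ 0 →
    ∀ l, |(h.coord l : ℝ)| ≤ c * P ^ deg l := by
  classical
  obtain ⟨c, hc, hb⟩ := exists_abs_word_sub_le d r
  refine ⟨c + 1, by linarith, fun s P φ ψ h hh l => ?_⟩
  obtain ⟨z, hz, _⟩ := Finset.exists_ne_zero_of_sum_ne_zero hh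
  rw [Finset.mem_filter, mem_box] at hz
  have h1 : ∀ i, |(z.1 i : ℝ)| ≤ P := fun i => by exact_mod_cast hz.1.1 i
  have h2 : ∀ i, |(z.2 i : ℝ)| ≤ P := fun i => by exact_mod_cast hz.1.2 i
  have h3 := (hb s (P := P) (lam := 0) (by positivity) le_rfl _ _ _ _ h1 h2 h1 h2 (by simp) (by simp) l).1
  have h4 := word_coord_map (Int.castRingHom ℝ) s z.1 z.2 l
  simp only [eq_intCast] at h4
  rw [h4, hz.2] at h3
  refine h3.trans ?_
  gcongr
  linarith

theorem continuous_pairing_left (g : G0 d ℤ) : Continuous fun θ : Y d → ℝ => pairing θ g := by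
  unfold pairing; fun_prop

theorem continuous_wordSum (s : Bool) (P : ℕ) {r : ℕ} (φ ψ : Fin r → ℤ → ℂ) :
    Continuous fun θ : Y d → ℝ => wordSum s P φ ψ θ := by
  unfold wordSum
  exact continuous_finsetSum _ fun z _ => continuous_const.mul
    (continuous_e.comp (continuous_pairing_left _).neg)

theorem wordKernel_eq_integral (s : Bool) (P : ℕ) {r : ℕ} (φ ψ : Fin r → ℤ → ℂ) (h : G0 d ℤ) :
    wordKernel d s P φ ψ h = ∫ θ in unitCube (Y d), e (pairing θ h) * wordSum s P φ ψ θ := by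
  classical
  simp only [wordSum, Finset.mul_sum]
  rw [integral_finsetSum]
  · rw [wordKernel, Finset.sum_filter]
    refine Finset.sum_congr rfl fun z _ => ?_
    have h1 : ∀ θ : Y d → ℝ, e (pairing θ h) * (wordWeight φ ψ z * e (-pairing θ (word d s z.1 z.2)))
        = wordWeight φ ψ z * e (∑ l, ((h.coord l - (word d s z.1 z.2).coord l : ℤ) : ℝ) * θ l) := by
      intro θ
      rw [mul_left_comm, ← e_add]
      congr 2
      rw [pairing, pairing, ← sub_eq_add_neg, ← Finset.sum_sub_distrib]
      refine Finset.sum_congr rfl fun l _ => ?_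
      push_cast; ring
    simp_rw [h1]
    rw [integral_const_mul, integral_unitCube_e (fun l => h.coord l - (word d s z.1 z.2).coord l)]
    have h2 : word d s z.1 z.2 = h ↔ (fun l => h.coord l - (word d s z.1 z.2).coord l) = 0 := by
      constructor
      · rintro rfl; funext l; simp
      · intro h3; ext l; have := congrFun h3 l; simp only [Pi.zero_apply] at this; omega
    simp only [h2]
    split_ifs <;> simp
  · intro z _
    exact integrableOn_unitCube ((continuous_e.comp (continuous_pairing_left h)).mul
      (continuous_const.mul (continuous_e.comp (continuous_pairing_left _).neg)))

end DiscreteRadon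
end

noncomputable section
namespace DiscreteRadon

open MeasureTheory

/-! ### Bounds for the dyadic kernels -/

section Weights

variable {η₀ K : ℝ → ℝ}

theorem IsCutoff.exists_abs_deriv_le (hη : IsCutoff η₀) : ∃ M : ℝ, 0 ≤ M ∧ ∀ t, |deriv η₀ t| ≤ M := by
  have h1 : HasCompactSupport η₀ := HasCompactSupport.intro (isCompact_closedBall 0 2) fun x hx => by
    rw [mem_closedBall_zero_iff, Real.norm_eq_abs, not_le] at hx
    exact hη.eq_zero x hx
  have h2 : Continuous (deriv η₀) := hη.contDiff.continuous_deriv (by simp)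
  obtain ⟨M, hM⟩ := h1.deriv.exists_bound_of_continuous h2
  exact ⟨M, (norm_nonneg _).trans (hM 0), hM⟩

theorem IsCutoff.differentiable (hη : IsCutoff η₀) : Differentiable ℝ η₀ :=
  hη.contDiff.differentiable (by simp)

theorem hasDerivAt_eta_succ (hη : IsCutoff η₀) (j : ℕ) (t : ℝ) : HasDerivAt (eta η₀ (j + 1))
    (deriv η₀ (t / 2 ^ (j + 1)) * (1 / 2 ^ (j + 1)) - deriv η₀ (t / 2 ^ j) * (1 / 2 ^ j)) t := by
  have h : ∀ m : ℕ, HasDerivAt (fun t => η₀ (t / 2 ^ m)) (deriv η₀ (t / 2 ^ m) * (1 / 2 ^ m)) t :=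
    fun m => (hη.differentiable _).hasDerivAt.comp t ((hasDerivAt_id t).div_const _)
  exact (h _).sub (h _)

theorem continuous_eta (hη : IsCutoff η₀) (j : ℕ) : Continuous (eta η₀ j) := by
  cases j with
  | zero => exact hη.contDiff.continuous
  | succ j => exact continuous_iff_continuousAt.2 fun t => (hasDerivAt_eta_succ hη j t).continuousAt

theorem abs_eta_le (hη : IsCutoff η₀) (j : ℕ) (t : ℝ) : |eta η₀ j t| ≤ 1 := by
  have h : ∀ u, 0 ≤ η₀ u ∧ η₀ u ≤ 1 := fun u => hη.mem_Icc u
  cases j with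
  | zero => rw [eta, abs_of_nonneg (h t).1]; exact (h t).2
  | succ j => rw [eta, abs_le]; constructor <;> linarith [h (t / 2 ^ (j + 1)), h (t / 2 ^ j)]

theorem eta_succ_eq_zero_of_le (hη : IsCutoff η₀) (j : ℕ) {t : ℝ} (ht : |t| ≤ 2 ^ j) :
    eta η₀ (j + 1) t = 0 := by
  have h : ∀ m : ℕ, j ≤ m → |t / 2 ^ m| ≤ 1 := fun m hm => by
    rw [abs_div, abs_of_pos (by positivity : (0 : ℝ) < 2 ^ m), div_le_one (by positivity)]
    exact ht.trans (pow_le_pow_right₀ (by norm_num) hm)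
  rw [eta, hη.eq_one _ (h _ (by omega)), hη.eq_one _ (h _ le_rfl), sub_self]

theorem IsCalderonZygmund.abs_le (hK : IsCalderonZygmund K) {t a : ℝ} (ha : 0 < a) (ht : a ≤ 1 + |t|) :
    |K t| ≤ a⁻¹ ∧ |deriv K t| ≤ (a ^ 2)⁻¹ := by
  have h := hK.bound t
  have h1 : a * |K t| ≤ (1 + |t|) * |K t| := by gcongr
  have h2 : a ^ 2 * |deriv K t| ≤ (1 + |t|) ^ 2 * |deriv K t| := by gcongr
  have h3 : 0 ≤ a * |K t| := by positivity
  have h4 : 0 ≤ a ^ 2 * |deriv K t| := by positivity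
  constructor
  · rw [← one_div, le_div_iff₀ ha]; linarith
  · rw [← one_div, le_div_iff₀ (by positivity)]; linarith

theorem abs_mul_eta_le (hη : IsCutoff η₀) (hK : IsCalderonZygmund K) (j : ℕ) (t : ℝ) :
    |K t * eta η₀ j t| ≤ 2 * (2 ^ j)⁻¹ := by
  rw [abs_mul]
  cases j with
  | zero =>
    have h1 := (hK.abs_le (t := t) one_pos (by linarith [abs_nonneg t])).1
    have h2 := abs_eta_le hη 0 t
    norm_num at h1 ⊢
    nlinarith [abs_nonneg (K t), abs_nonneg (eta η₀ 0 t)]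
  | succ j =>
    by_cases ht : |t| ≤ 2 ^ j
    · rw [eta_succ_eq_zero_of_le hη j ht]; simp
    · have h1 := (hK.abs_le (t := t) (a := 2 ^ j) (by positivity) (by linarith)).1
      calc |K t| * |eta η₀ (j + 1) t| ≤ (2 ^ j)⁻¹ * 1 := by gcongr; exact abs_eta_le hη _ t
        _ = _ := by rw [pow_succ]; field_simp

theorem abs_integral_mul_eta_le (hη : IsCutoff η₀) (hK : IsCalderonZygmund K) (j : ℕ) :
    |∫ t, K t * eta η₀ j t| ≤ 8 := by
  have h1 : ∫ t, K t * eta η₀ j t = ∫ t in Set.Icc (-(2 : ℝ) ^ (j + 1)) (2 ^ (j + 1)), K t * eta η₀ j t := by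
    refine (setIntegral_eq_integral_of_forall_compl_eq_zero fun t ht => ?_).symm
    rw [Set.mem_Icc, ← _root_.abs_le, not_le] at ht
    rw [eta_eq_zero hη j ht, mul_zero]
  rw [h1, ← Real.norm_eq_abs]
  refine (norm_setIntegral_le_of_norm_le_const (C := 2 * (2 ^ j)⁻¹) (by simp)
    fun t _ => abs_mul_eta_le hη hK j t).trans (le_of_eq ?_)
  rw [Measure.real, Real.volume_Icc, ENNReal.toReal_ofReal (by
    have : (0 : ℝ) < 2 ^ (j + 1) := by positivity
    linarith), pow_succ]
  field_simp
  norm_num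

theorem integrable_mul_eta (hη : IsCutoff η₀) (hK : IsCalderonZygmund K) (j : ℕ) :
    Integrable fun t => K t * eta η₀ j t := by
  refine (hK.contDiff.continuous.mul (continuous_eta hη j)).integrable_of_hasCompactSupport ?_
  refine HasCompactSupport.intro (isCompact_closedBall 0 (2 ^ (j + 1))) fun x hx => ?_
  rw [mem_closedBall_zero_iff, Real.norm_eq_abs, not_le] at hx
  rw [Pi.mul_apply, eta_eq_zero hη j hx, mul_zero]

theorem abs_cconst_le (hη : IsCutoff η₀) (hK : IsCalderonZygmund K) (j : ℕ) :
    |cconst η₀ K j| ≤ 16 * |(∫ t, η₀ t)⁻¹| * j := by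
  have h1 : |∫ t, K t * ∑ k ∈ Finset.range j, eta η₀ k t| ≤ 8 * j := by
    simp_rw [Finset.mul_sum]
    rw [integral_finsetSum _ fun k _ => integrable_mul_eta hη hK k]
    refine (Finset.abs_sum_le_sum_abs _ _).trans
      ((Finset.sum_le_sum fun k _ => abs_integral_mul_eta_le hη hK k).trans (le_of_eq ?_))
    simp [mul_comm]
  rw [cconst, abs_mul, abs_mul, abs_two]
  calc _ ≤ 2 * (8 * j) * |(∫ t, η₀ t)⁻¹| := by gcongr
    _ = _ := by ring

theorem continuous_dyadicKernel (hη : IsCutoff η₀) (hK : IsCalderonZygmund K) (j : ℕ) :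
    Continuous (dyadicKernel η₀ K j) :=
  ((hK.contDiff.continuous.mul (continuous_eta hη j)).add
    (continuous_const.mul (continuous_eta hη j))).sub (continuous_const.mul (continuous_eta hη _))

theorem exists_abs_dyadicKernel_le (hη : IsCutoff η₀) : ∃ C : ℝ, 1 ≤ C ∧ ∀ K, IsCalderonZygmund K →
    ∀ j : ℕ, 1 ≤ j → (∀ t, |dyadicKernel η₀ K j t| ≤ C * (j + 1) / 2 ^ j) ∧
    ∀ t u, |dyadicKernel η₀ K j t - dyadicKernel η₀ K j u| ≤ C * (j + 1) / (2 ^ j) ^ 2 * |t - u| := by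
  obtain ⟨M, hM0, hM⟩ := hη.exists_abs_deriv_le
  set A : ℝ := 16 * |(∫ t, η₀ t)⁻¹| with hA
  have hA0 : 0 ≤ A := by positivity
  refine ⟨4 + 8 * M + 4 * A + 6 * A * M, by nlinarith, fun K hK j hj => ?_⟩
  have hj0 : (1 : ℝ) ≤ j := by exact_mod_cast hj
  set x : ℝ := (2 ^ j)⁻¹ with hx
  have hx0 : 0 < x := by positivity
  have hx2 : ((2 : ℝ) ^ (j + 1))⁻¹ = x / 2 := by rw [hx, pow_succ]; field_simp
  have hc1 : |cconst η₀ K j| ≤ A * (j + 1) := (abs_cconst_le hη hK j).trans (by gcongr; linarith)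
  have hc2 : |cconst η₀ K (j + 1)| ≤ A * (j + 1) := by
    have := abs_cconst_le hη hK (j + 1)
    push_cast at this
    exact this
  constructor
  · intro t
    rw [dyadicKernel, hx2]
    have e1 := abs_mul_eta_le hη hK j t
    have e2 := abs_eta_le hη j t
    have e3 := abs_eta_le hη (j + 1) t
    calc _ ≤ |K t * eta η₀ j t| + |cconst η₀ K j * x * eta η₀ j t|
          + |cconst η₀ K (j + 1) * (x / 2) * eta η₀ (j + 1) t| :=
          (abs_sub _ _).trans (by gcongr; exact abs_add_le _ _)
      _ ≤ 2 * x + (A * (j + 1)) * x * 1 + (A * (j + 1)) * (x / 2) * 1 := by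
          rw [abs_mul (_ * _), abs_mul (_ * _), abs_mul _ x, abs_mul _ (x / 2), abs_of_pos hx0,
            abs_of_pos (by positivity : 0 < x / 2)]
          gcongr
      _ = (2 + 3 / 2 * A * (j + 1)) * x := by ring
      _ ≤ ((4 + 8 * M + 4 * A + 6 * A * M) * (j + 1)) * x := by
          gcongr
          have : 0 ≤ A * M := by positivity
          have : 0 ≤ A * j := by positivity
          have : 0 ≤ A * M * j := by positivity
          have : 0 ≤ M * j := by positivity
          nlinarith
      _ = _ := by rw [hx]; ring
  · have hder : ∀ m : ℕ, 1 ≤ m → ∀ t, ∃ D, HasDerivAt (eta η₀ m) D t ∧ |D| ≤ 3 * M * (2 ^ m)⁻¹ := by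
      intro m hm t
      obtain ⟨m, rfl⟩ := Nat.exists_eq_add_of_le' hm
      refine ⟨_, hasDerivAt_eta_succ hη m t, ?_⟩
      calc _ ≤ |deriv η₀ (t / 2 ^ (m + 1)) * (1 / 2 ^ (m + 1))| + |deriv η₀ (t / 2 ^ m) * (1 / 2 ^ m)| :=
            abs_sub _ _
        _ ≤ M * (1 / 2 ^ (m + 1)) + M * (1 / 2 ^ m) := by
            rw [abs_mul, abs_mul, abs_of_pos (by positivity : (0 : ℝ) < 1 / 2 ^ (m + 1)),
              abs_of_pos (by positivity : (0 : ℝ) < 1 / 2 ^ m)]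
            gcongr
            · exact hM _
            · exact hM _
        _ = _ := by rw [pow_succ]; field_simp; ring
    have hmain : ∀ t, ∃ D, HasDerivAt (fun t => K t * eta η₀ j t) D t ∧ |D| ≤ (4 + 8 * M) * x ^ 2 := by
      intro t
      have hKd : HasDerivAt K (deriv K t) t :=
        (hK.contDiff.differentiable (by simp) t).hasDerivAt
      obtain ⟨D, hD, hDM⟩ := hder j hj t
      obtain ⟨i, rfl⟩ := Nat.exists_eq_add_of_le' hj
      by_cases ht : |t| < 2 ^ i
      · refine ⟨0, ?_, by simp; positivity⟩
        have h1 : (fun t => K t * eta η₀ (i + 1) t) =ᶠ[nhds t] fun _ => 0 := by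
          filter_upwards [(isOpen_lt continuous_abs continuous_const).mem_nhds ht] with u hu
          rw [eta_succ_eq_zero_of_le hη i (le_of_lt hu), mul_zero]
        exact (hasDerivAt_const t (0 : ℝ)).congr_of_eventuallyEq h1
      · refine ⟨_, hKd.mul hD, ?_⟩
        obtain ⟨h1, h2⟩ := hK.abs_le (t := t) (a := 2 ^ i) (by positivity) (by linarith)
        have h3 : ((2 : ℝ) ^ i)⁻¹ = 2 * x := by rw [hx, pow_succ]; field_simp
        have h4 : (((2 : ℝ) ^ i) ^ 2)⁻¹ = 4 * x ^ 2 := by rw [← inv_pow, h3]; ring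
        rw [h3] at h1
        rw [h4] at h2
        have h5 := abs_eta_le hη (i + 1) t
        calc _ ≤ |deriv K t| * |eta η₀ (i + 1) t| + |K t| * |D| := by
              rw [← abs_mul, ← abs_mul]; exact abs_add_le _ _
          _ ≤ 4 * x ^ 2 * 1 + 2 * x * (3 * M * x) := by gcongr
          _ ≤ _ := by nlinarith [mul_nonneg hM0 (sq_nonneg x)]
    have hall : ∀ t, ∃ D, HasDerivAt (dyadicKernel η₀ K j) D t ∧
        |D| ≤ (4 + 8 * M + 4 * A + 6 * A * M) * (j + 1) / (2 ^ j) ^ 2 := by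
      intro t
      obtain ⟨D, hD, hDb⟩ := hmain t
      obtain ⟨D₁, hD₁, hDb₁⟩ := hder j hj t
      obtain ⟨D₂, hD₂, hDb₂⟩ := hder (j + 1) (by omega) t
      refine ⟨_, (hD.add (hD₁.const_mul (cconst η₀ K j * (2 ^ j)⁻¹))).sub
        (hD₂.const_mul (cconst η₀ K (j + 1) * (2 ^ (j + 1))⁻¹)), ?_⟩
      rw [hx2] at hDb₂ ⊢
      rw [← hx] at hDb₁ ⊢
      calc _ ≤ |D| + |cconst η₀ K j * x * D₁| + |cconst η₀ K (j + 1) * (x / 2) * D₂| :=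
            (abs_sub _ _).trans (by gcongr; exact abs_add_le _ _)
        _ ≤ (4 + 8 * M) * x ^ 2 + (A * (j + 1)) * x * (3 * M * x)
            + (A * (j + 1)) * (x / 2) * (3 * M * (x / 2)) := by
            rw [abs_mul (_ * _), abs_mul (_ * _), abs_mul _ x, abs_mul _ (x / 2), abs_of_pos hx0,
              abs_of_pos (by positivity : 0 < x / 2)]
            gcongr
        _ = (4 + 8 * M + 15 / 4 * A * M * (j + 1)) * x ^ 2 := by ring
        _ ≤ ((4 + 8 * M + 4 * A + 6 * A * M) * (j + 1)) * x ^ 2 := by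
            gcongr
            have : 0 ≤ A * M := by positivity
            have : 0 ≤ A * j := by positivity
            have : 0 ≤ A * M * j := by positivity
            have : 0 ≤ M * j := by positivity
            nlinarith
        _ = _ := by rw [hx, inv_pow]; ring
    intro t u
    choose f hf hfb using hall
    have := Convex.norm_image_sub_le_of_norm_hasDerivWithin_le (f := dyadicKernel η₀ K j) (f' := f)
      (s := Set.univ) (x := u) (y := t) (fun v _ => (hf v).hasDerivWithinAt) (fun v _ => hfb v)
      convex_univ trivial trivial
    simpa using this

end Weights

end DiscreteRadon
end

noncomputable section
namespace DiscreteRadon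

open MeasureTheory

/-! ### Decomposition into major and minor arcs -/

variable {d : ℕ}

/-- A smooth bump function adapted to a box. -/
def bump (η₀ : ℝ → ℝ) (b : Y d → ℝ) (β : Y d → ℝ) : ℝ := ∏ l, η₀ (b l * β l)

section Bump

variable {η₀ : ℝ → ℝ} {b : Y d → ℝ}

theorem continuous_bump (hη : IsCutoff η₀) : Continuous (bump η₀ b) :=
  continuous_finsetProd _ fun l _ => hη.contDiff.continuous.comp
    (continuous_const.mul (continuous_apply l))

theorem bump_mem_Icc (hη : IsCutoff η₀) (β : Y d → ℝ) : bump η₀ b β ∈ Set.Icc (0 : ℝ) 1 :=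
  ⟨Finset.prod_nonneg fun _ _ => (hη.mem_Icc _).1,
    Finset.prod_le_one (fun _ _ => (hη.mem_Icc _).1) fun _ _ => (hη.mem_Icc _).2⟩

theorem abs_le_two_of_bump_ne_zero (hη : IsCutoff η₀) {β : Y d → ℝ} (h : bump η₀ b β ≠ 0) (l : Y d) :
    |b l * β l| ≤ 2 := by
  by_contra! hl
  exact h (Finset.prod_eq_zero (Finset.mem_univ l) (hη.eq_zero _ hl))

theorem bump_eq_one (hη : IsCutoff η₀) {β : Y d → ℝ} (h : ∀ l, |b l * β l| ≤ 1) : bump η₀ b β = 1 :=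
  Finset.prod_eq_one fun l _ => hη.eq_one _ (h l)

theorem bump_mem_box (hη : IsCutoff η₀) (hb : ∀ l, 0 < b l) {β : Y d → ℝ} (h : bump η₀ b β ≠ 0) :
    β ∈ Set.Icc (fun l => -(2 / b l)) (fun l => 2 / b l) := by
  have h1 : ∀ l, |β l| ≤ 2 / b l := fun l => by
    have := abs_le_two_of_bump_ne_zero hη h l
    rw [abs_mul, abs_of_pos (hb l)] at this
    rw [le_div_iff₀ (hb l)]; linarith
  exact ⟨fun l => (abs_le.1 (h1 l)).1, fun l => (abs_le.1 (h1 l)).2⟩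

theorem hasCompactSupport_bump (hη : IsCutoff η₀) (hb : ∀ l, 0 < b l) :
    HasCompactSupport (bump η₀ b) :=
  HasCompactSupport.intro (isCompact_Icc (a := fun l => -(2 / b l)) (b := fun l => 2 / b l))
    fun β hβ => by
      by_contra h
      exact hβ (bump_mem_box hη hb h)

theorem norm_integral_bump_mul_le (hη : IsCutoff η₀) (hb : ∀ l, 0 < b l) {f : (Y d → ℝ) → ℂ} {ρ : ℝ}
    (hf : ∀ β, (∀ l, |b l * β l| ≤ 2) → ‖f β‖ ≤ ρ) :
    ‖∫ β, (bump η₀ b β : ℂ) * f β‖ ≤ ρ * ∏ l, (4 / b l) := by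
  set S : Set (Y d → ℝ) := Set.Icc (fun l => -(2 / b l)) (fun l => 2 / b l) with hS
  have h1 : ∫ β, (bump η₀ b β : ℂ) * f β = ∫ β in S, (bump η₀ b β : ℂ) * f β := by
    refine (setIntegral_eq_integral_of_forall_compl_eq_zero fun β hβ => ?_).symm
    have : bump η₀ b β = 0 := by
      by_contra h
      exact hβ (bump_mem_box hη hb h)
    simp [this]
  have hρ : 0 ≤ ρ := (norm_nonneg _).trans (hf 0 (by simp))
  have hvol : volume.real S = ∏ l, (4 / b l) := by
    rw [hS, Measure.real, Real.volume_Icc_pi_toReal]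
    · exact Finset.prod_congr rfl fun l _ => by ring
    · intro l
      have := hb l
      have : 0 < 2 / b l := by positivity
      simp only; linarith
  rw [h1, ← hvol]
  refine norm_setIntegral_le_of_norm_le_const isCompact_Icc.measure_lt_top fun β hβ => ?_
  have h2 := bump_mem_Icc (b := b) hη β
  rw [norm_mul, Complex.norm_real, Real.norm_eq_abs, abs_of_nonneg h2.1]
  have h3 : ‖f β‖ ≤ ρ := hf β fun l => by
    rw [abs_mul, abs_of_pos (hb l), mul_comm, ← le_div_iff₀ (hb l), abs_le]
    exact ⟨hβ.1 l, hβ.2 l⟩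
  calc _ ≤ 1 * ρ := by gcongr; exact h2.2
    _ = ρ := one_mul _

end Bump

theorem mem_numerators {q : ℕ} {a : Y d → ℕ} :
    a ∈ numerators d q ↔ (∀ l, 1 ≤ a l ∧ a l ≤ q) ∧ Nat.gcd (Finset.univ.gcd a) q = 1 := by
  simp only [numerators, Finset.mem_filter, Fintype.mem_piFinset, Finset.mem_Icc]

theorem dvd_of_numerators {q q' : ℕ} {a : Y d → ℕ} (ha : a ∈ numerators d q) (h : ∀ l, q ∣ q' * a l) :
    q ∣ q' := by
  have h1 : q ∣ Finset.univ.gcd fun l => q' * a l := Finset.dvd_gcd fun l _ => h l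
  rw [Finset.gcd_mul_left] at h1
  simp only [normalize_eq] at h1
  have h2 : Nat.Coprime q (Finset.univ.gcd a) := Nat.Coprime.symm (mem_numerators.1 ha).2
  exact h2.dvd_of_dvd_mul_right h1

/-- Reduced fractions modulo integers that are close to each other coincide. -/
theorem fraction_unique {R q q' : ℕ} {b : Y d → ℝ} (hb : ∀ l, 4 * (R : ℝ) ^ 2 < b l) (hq : 1 ≤ q)
    (hqR : q ≤ R) (hq' : 1 ≤ q') (hqR' : q' ≤ R) {a a' : Y d → ℕ} (ha : a ∈ numerators d q)
    (ha' : a' ∈ numerators d q') {m m' : Y d → ℤ} {θ : Y d → ℝ}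
    (h : ∀ l, |b l * (θ l + m l - a l / q)| ≤ 2) (h' : ∀ l, |b l * (θ l + m' l - a' l / q')| ≤ 2) :
    m = m' ∧ q = q' ∧ a = a' := by
  have hq0 : (0 : ℝ) < q := by exact_mod_cast hq
  have hq0' : (0 : ℝ) < q' := by exact_mod_cast hq'
  have hqR1 : (q : ℝ) ≤ R := by exact_mod_cast hqR
  have hqR1' : (q' : ℝ) ≤ R := by exact_mod_cast hqR'
  have key : ∀ l, (q' : ℤ) * (q * m l - a l) = q * (q' * m' l - a' l) := by
    intro l
    have hb0 : 0 < b l := lt_of_le_of_lt (by positivity) (hb l)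
    have h1 : |(m l - a l / q : ℝ) - (m' l - a' l / q')| * b l ≤ 4 := by
      have h2 : b l * (θ l + m l - a l / q) - b l * (θ l + m' l - a' l / q')
          = ((m l - a l / q : ℝ) - (m' l - a' l / q')) * b l := by ring
      have h3 := abs_sub (b l * (θ l + m l - a l / q)) (b l * (θ l + m' l - a' l / q'))
      rw [h2, abs_mul, abs_of_pos hb0] at h3
      linarith [h l, h' l]
    have h2 : ((q' * (q * m l - a l) - q * (q' * m' l - a' l) : ℤ) : ℝ)
        = q * q' * ((m l - a l / q : ℝ) - (m' l - a' l / q')) := by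
      push_cast; field_simp
    have h3 : |((q' * (q * m l - a l) - q * (q' * m' l - a' l) : ℤ) : ℝ)| < 1 := by
      rw [h2, abs_mul, abs_of_pos (by positivity : (0 : ℝ) < q * q')]
      by_contra! hcon
      have h4 : (q : ℝ) * q' ≤ R ^ 2 := by rw [sq]; gcongr
      have h5 : b l ≤ q * q' * |(m l - a l / q : ℝ) - (m' l - a' l / q')| * b l := by
        nlinarith
      have h6 : q * q' * (|(m l - a l / q : ℝ) - (m' l - a' l / q')| * b l) ≤ R ^ 2 * 4 := by gcongr
      have := hb l
      nlinarith
    have h4 : |(q' : ℤ) * (q * m l - a l) - q * (q' * m' l - a' l)| < 1 := by exact_mod_cast h3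
    rw [Int.abs_lt_one_iff] at h4
    omega
  have hdvd : ∀ l, q ∣ q' * a l := by
    intro l
    have h1 : (q : ℤ) ∣ q' * a l := ⟨q' * m l - (q' * m' l - a' l), by linarith [key l]⟩
    exact_mod_cast h1
  have hdvd' : ∀ l, q' ∣ q * a' l := by
    intro l
    have h1 : (q' : ℤ) ∣ q * a' l := ⟨q * m' l - (q * m l - a l), by linarith [key l]⟩
    exact_mod_cast h1
  have hqq : q = q' := Nat.dvd_antisymm (dvd_of_numerators ha hdvd) (dvd_of_numerators ha' hdvd')
  subst hqq
  have hqz : (q : ℤ) ≠ 0 := by omega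
  have key2 : ∀ l, (q : ℤ) * (m l - m' l) = a l - a' l := by
    intro l
    have := mul_left_cancel₀ hqz (key l)
    linarith
  have h1 : ∀ l, m l = m' l := by
    intro l
    have h2 := (mem_numerators.1 ha).1 l
    have h3 := (mem_numerators.1 ha').1 l
    have h4 := key2 l
    have h5 : m l - m' l < 1 := by
      by_contra! hcon
      have : (q : ℤ) * 1 ≤ q * (m l - m' l) := mul_le_mul_of_nonneg_left hcon (by omega)
      omega
    have h6 : -1 < m l - m' l := by
      by_contra! hcon
      have : (q : ℤ) * (m l - m' l) ≤ q * (-1) := mul_le_mul_of_nonneg_left hcon (by omega)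
      omega
    omega
  refine ⟨funext h1, rfl, funext fun l => ?_⟩
  have h2 := key2 l
  rw [h1 l, sub_self, mul_zero] at h2
  omega

/-- A point close to a fraction is close to a reduced fraction, up to a small integer vector. -/
theorem exists_reduced_fraction {R : ℕ} {b : Y d → ℝ} (hb : ∀ l, 1 ≤ b l) {θ : Y d → ℝ}
    (hθ : θ ∈ unitCube (Y d))
    (h : ∃ q : ℕ, 1 ≤ q ∧ q ≤ R ∧ ∀ l, ∃ a : ℤ, |b l * (θ l - a / q)| ≤ 1) :
    ∃ m : Y d → ℤ, (∀ l, |m l| ≤ 2) ∧ ∃ q : ℕ, 1 ≤ q ∧ q ≤ R ∧ ∃ a ∈ numerators d q,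
      ∀ l, |b l * (θ l + m l - a l / q)| ≤ 1 := by
  classical
  have hex : ∃ q : ℕ, 1 ≤ q ∧ ∀ l, ∃ a : ℤ, |b l * (θ l - a / q)| ≤ 1 := by
    obtain ⟨q, h1, _, h2⟩ := h; exact ⟨q, h1, h2⟩
  obtain ⟨q₀, hq₀1, hq₀R, hq₀⟩ := h
  set q := Nat.find hex with hqdef
  obtain ⟨hq1, hq⟩ := Nat.find_spec hex
  have hqR : q ≤ R := (Nat.find_le ⟨hq₀1, hq₀⟩).trans hq₀R
  rw [← hqdef] at hq1 hq
  have hq0 : (0 : ℝ) < q := by exact_mod_cast hq1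
  have hqz : (0 : ℤ) < q := by exact_mod_cast hq1
  choose a ha using hq
  set α : Y d → ℕ := fun l => ((a l - 1) % q + 1).toNat with hα
  set k : Y d → ℤ := fun l => (a l - 1) / q with hk
  have hαz : ∀ l, (α l : ℤ) = (a l - 1) % q + 1 := fun l => by
    have := Int.emod_nonneg (a l - 1) hqz.ne'
    simp only [hα]; omega
  have hak : ∀ l, a l = α l + q * k l := fun l => by
    have := Int.emod_add_mul_ediv (a l - 1) q
    rw [hαz]; simp only [hk]; linarith
  have hαb : ∀ l, 1 ≤ α l ∧ α l ≤ q := fun l => by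
    have h1 := Int.emod_nonneg (a l - 1) hqz.ne'
    have h2 := Int.emod_lt_of_pos (a l - 1) hqz
    have := hαz l
    omega
  have haq : ∀ l, (a l : ℝ) / q = α l / q + k l := fun l => by
    have : (a l : ℝ) = α l + q * k l := by exact_mod_cast hak l
    rw [this]; field_simp
  refine ⟨fun l => -k l, fun l => ?_, q, hq1, hqR, α, mem_numerators.2 ⟨hαb, ?_⟩, fun l => ?_⟩
  · have h1 : |θ l - a l / q| ≤ 1 := by
      have := ha l
      rw [abs_mul, abs_of_pos (by linarith [hb l])] at this
      have h2 : 0 ≤ |θ l - a l / q| := abs_nonneg _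
      nlinarith [hb l]
    have h2 := hθ l trivial
    simp only [Set.mem_Ico] at h2
    rw [haq, abs_le] at h1
    have h3 : 0 ≤ (α l : ℝ) / q ∧ (α l : ℝ) / q ≤ 1 :=
      ⟨by positivity, by rw [div_le_one hq0]; exact_mod_cast (hαb l).2⟩
    have h4 : (-3 : ℝ) < k l ∧ (k l : ℝ) < 3 := ⟨by linarith, by linarith⟩
    have h5 : (-3 : ℤ) < k l ∧ k l < 3 := ⟨by exact_mod_cast h4.1, by exact_mod_cast h4.2⟩
    rw [abs_neg, abs_le]; omega
  · set D := Nat.gcd (Finset.univ.gcd α) q with hD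
    obtain ⟨q', hq'⟩ : D ∣ q := Nat.gcd_dvd_right _ _
    have hα' : ∀ l, D ∣ α l := fun l => (Nat.gcd_dvd_left _ _).trans (Finset.gcd_dvd (Finset.mem_univ l))
    choose α' hα' using hα'
    have hD0 : 0 < D := Nat.gcd_pos_of_pos_right _ (by omega)
    have hq'1 : 1 ≤ q' := by
      rcases Nat.eq_zero_or_pos q' with h0 | h0
      · rw [h0, mul_zero] at hq'; omega
      · exact h0
    have hle : q ≤ q' := Nat.find_le ⟨hq'1, fun l => ⟨α' l + q' * k l, by
      convert ha l using 4
      rw [haq, hα', hq']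
      have : (q' : ℝ) ≠ 0 := by positivity
      have : (D : ℝ) ≠ 0 := by positivity
      push_cast
      field_simp⟩⟩
    by_contra hne
    have : 2 ≤ D := by omega
    nlinarith
  · have h1 := ha l
    rw [haq] at h1
    push_cast
    rwa [show θ l + -(k l : ℝ) - α l / q = θ l - (α l / q + k l) by ring]

end DiscreteRadon
end

noncomputable section
namespace DiscreteRadon

open MeasureTheory

variable {d : ℕ}

/-- The reduced fractions with denominators at most `R`. -/
def fractions (d R : ℕ) : Finset (Σ _ : ℕ, Y d → ℕ) := (Finset.Icc 1 R).sigma fun q => numerators d q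

theorem mem_fractions {R : ℕ} {x : Σ _ : ℕ, Y d → ℕ} :
    x ∈ fractions d R ↔ (1 ≤ x.1 ∧ x.1 ≤ R) ∧ x.2 ∈ numerators d x.1 := by
  simp [fractions]

/-- The point of `(0, 1]^{Y_d}` given by a fraction. -/
def fracPoint (x : Σ _ : ℕ, Y d → ℕ) (l : Y d) : ℝ := (x.2 l : ℝ) / x.1

theorem fracPoint_mem {R : ℕ} {x : Σ _ : ℕ, Y d → ℕ} (hx : x ∈ fractions d R) (l : Y d) :
    0 ≤ fracPoint x l ∧ fracPoint x l ≤ 1 := by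
  rw [mem_fractions, mem_numerators] at hx
  have : (0 : ℝ) < x.1 := by exact_mod_cast hx.1.1
  refine ⟨by unfold fracPoint; positivity, ?_⟩
  rw [fracPoint, div_le_one this]
  exact_mod_cast (hx.2.1 l).2

theorem card_fractions_le (d R : ℕ) : ((fractions d R).card : ℝ) ≤ (R : ℝ) ^ (Fintype.card (Y d) + 1) := by
  rw [fractions, Finset.card_sigma]
  have h1 : ∀ q ∈ Finset.Icc 1 R, (numerators d q).card ≤ R ^ Fintype.card (Y d) := by
    intro q hq
    refine (Finset.card_filter_le _ _).trans ?_
    rw [Fintype.card_piFinset]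
    simp only [Nat.card_Icc, Nat.add_sub_cancel, Finset.prod_const, Finset.card_univ]
    gcongr
    exact (Finset.mem_Icc.1 hq).2
  have h2 := Finset.sum_le_card_nsmul _ _ _ h1
  simp only [Nat.card_Icc, Nat.add_sub_cancel, smul_eq_mul] at h2
  calc _ ≤ ((R * R ^ Fintype.card (Y d) : ℕ) : ℝ) := by exact_mod_cast h2
    _ = _ := by push_cast; ring

theorem sum_eq_zero_or_exists {α : Type*} (O : Finset α) (f : α → ℝ)
    (huniq : ∀ x ∈ O, ∀ y ∈ O, f x ≠ 0 → f y ≠ 0 → x = y) :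
    (∑ x ∈ O, f x = 0) ∨ ∃ x ∈ O, ∑ x ∈ O, f x = f x := by
  by_cases h : ∃ x ∈ O, f x ≠ 0
  · obtain ⟨x, hx, hfx⟩ := h
    right
    refine ⟨x, hx, Finset.sum_eq_single x (fun y hy hyx => ?_) fun h => absurd hx h⟩
    by_contra hfy
    exact hyx (huniq y hy x hx hfy hfx)
  · push Not at h
    left
    exact Finset.sum_eq_zero h

/-- The integer vectors with entries at most `2` in absolute value. -/
def smallVectors (d : ℕ) : Finset (Y d → ℤ) := Fintype.piFinset fun _ => Finset.Icc (-2) 2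

theorem mem_smallVectors {m : Y d → ℤ} : m ∈ smallVectors d ↔ ∀ l, |m l| ≤ 2 := by
  simp only [smallVectors, Fintype.mem_piFinset, Finset.mem_Icc, abs_le]

/-- The smooth cutoff to the periodic major arcs. -/
def arcCutoff (η₀ : ℝ → ℝ) (b : Y d → ℝ) (R : ℕ) (θ : Y d → ℝ) : ℝ :=
  ∑ m ∈ smallVectors d, ∑ x ∈ fractions d R, bump η₀ b fun l => θ l + m l - fracPoint x l

section Arcs

variable {η₀ : ℝ → ℝ} (hη : IsCutoff η₀) {b : Y d → ℝ} {R : ℕ}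
include hη

theorem arcCutoff_eq (hb : ∀ l, 4 * (R : ℝ) ^ 2 < b l) (θ : Y d → ℝ) :
    arcCutoff η₀ b R θ = 0 ∨ ∃ m ∈ smallVectors d, ∃ x ∈ fractions d R,
      arcCutoff η₀ b R θ = bump η₀ b fun l => θ l + m l - fracPoint x l := by
  rw [arcCutoff, ← Finset.sum_product']
  have huniq : ∀ x ∈ smallVectors d ×ˢ fractions d R, ∀ y ∈ smallVectors d ×ˢ fractions d R,
      (bump η₀ b fun l => θ l + x.1 l - fracPoint x.2 l) ≠ 0 →
      (bump η₀ b fun l => θ l + y.1 l - fracPoint y.2 l) ≠ 0 → x = y := by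
    rintro ⟨m, q, a⟩ hx ⟨m', q', a'⟩ hy h h'
    rw [Finset.mem_product, mem_fractions] at hx hy
    obtain ⟨rfl, rfl, rfl⟩ := fraction_unique hb hx.2.1.1 hx.2.1.2 hy.2.1.1 hy.2.1.2 hx.2.2 hy.2.2
      (fun l => abs_le_two_of_bump_ne_zero hη h l) (fun l => abs_le_two_of_bump_ne_zero hη h' l)
    rfl
  rcases sum_eq_zero_or_exists _ _ huniq with h | ⟨⟨m, x⟩, hx, h⟩
  · left; exact h
  · rw [Finset.mem_product] at hx
    exact Or.inr ⟨m, hx.1, x, hx.2, h⟩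

theorem abs_one_sub_arcCutoff_le (hb : ∀ l, 4 * (R : ℝ) ^ 2 < b l) (θ : Y d → ℝ) :
    |1 - arcCutoff η₀ b R θ| ≤ 1 := by
  rcases arcCutoff_eq hη hb θ with h | ⟨m, _, x, _, h⟩
  · rw [h]; simp
  · have := bump_mem_Icc (b := b) hη fun l => θ l + m l - fracPoint x l
    rw [h, abs_le]
    constructor <;> linarith [this.1, this.2]

theorem arcCutoff_eq_one (hb : ∀ l, 4 * (R : ℝ) ^ 2 < b l) (hb1 : ∀ l, 1 ≤ b l) {θ : Y d → ℝ}
    (hθ : θ ∈ unitCube (Y d))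
    (h : ∃ q : ℕ, 1 ≤ q ∧ q ≤ R ∧ ∀ l, ∃ a : ℤ, |b l * (θ l - a / q)| ≤ 1) :
    arcCutoff η₀ b R θ = 1 := by
  obtain ⟨m, hm, q, hq1, hqR, a, ha, hma⟩ := exists_reduced_fraction hb1 hθ h
  have hbump : (bump η₀ b fun l => θ l + m l - fracPoint ⟨q, a⟩ l) = 1 := bump_eq_one hη hma
  have hterm : 1 ≤ arcCutoff η₀ b R θ := by
    rw [← hbump, arcCutoff, ← Finset.sum_product']
    exact Finset.single_le_sum (s := smallVectors d ×ˢ fractions d R) (a := (m, ⟨q, a⟩))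
      (f := fun p : (Y d → ℤ) × (Σ _ : ℕ, Y d → ℕ) =>
        bump η₀ b fun l => θ l + p.1 l - fracPoint p.2 l) (fun p _ => (bump_mem_Icc hη _).1)
      (Finset.mem_product.2 ⟨mem_smallVectors.2 hm, mem_fractions.2 ⟨⟨hq1, hqR⟩, ha⟩⟩)
  rcases arcCutoff_eq hη hb θ with h' | ⟨m', _, x', _, h'⟩
  · linarith
  · refine le_antisymm ?_ hterm
    rw [h']
    exact (bump_mem_Icc hη _).2

theorem continuous_arcCutoff : Continuous (arcCutoff η₀ b R) := by
  unfold arcCutoff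
  refine continuous_finsetSum _ fun m _ => continuous_finsetSum _ fun x _ => ?_
  exact (continuous_bump hη).comp (by fun_prop)

/-- Unfolding the integral against the major arc cutoff. -/
theorem integral_mul_arcCutoff (hb1 : ∀ l, 2 < b l) {S : (Y d → ℝ) → ℂ} (hS : Continuous S)
    (hper : ∀ θ (m : Y d → ℤ), S (fun l => θ l + m l) = S θ) :
    ∫ θ in unitCube (Y d), (arcCutoff η₀ b R θ : ℂ) * S θ
      = ∑ x ∈ fractions d R, ∫ β, (bump η₀ b β : ℂ) * S fun l => fracPoint x l + β l := by
  have hb0 : ∀ l, 0 < b l := fun l => by linarith [hb1 l]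
  have hcont : ∀ x : Σ _ : ℕ, Y d → ℕ,
      Continuous fun θ : Y d → ℝ => ((bump η₀ b fun l => θ l - fracPoint x l : ℝ) : ℂ) * S θ := fun x =>
    (Complex.continuous_ofReal.comp ((continuous_bump hη).comp (by fun_prop))).mul hS
  have hint : ∀ x, Integrable
      fun θ : Y d → ℝ => ((bump η₀ b fun l => θ l - fracPoint x l : ℝ) : ℂ) * S θ := by
    intro x
    refine (hcont x).integrable_of_hasCompactSupport ?_
    have h1 : HasCompactSupport fun θ : Y d → ℝ => bump η₀ b fun l => θ l - fracPoint x l :=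
      (hasCompactSupport_bump hη hb0).comp_homeomorph (Homeomorph.subRight (fracPoint x))
    have h2 : HasCompactSupport fun θ : Y d → ℝ => ((bump η₀ b fun l => θ l - fracPoint x l : ℝ) : ℂ) :=
      h1.comp_left (g := fun t : ℝ => (t : ℂ)) (by simp)
    exact h2.mul_right
  have h1 : ∀ x ∈ fractions d R,
      ∑ m ∈ smallVectors d, ∫ θ in unitCube (Y d),
        ((bump η₀ b fun l => θ l + m l - fracPoint x l : ℝ) : ℂ) * S θ
        = ∫ β, (bump η₀ b β : ℂ) * S fun l => fracPoint x l + β l := by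
    intro x hx
    have h2 := hasSum_integral_unitCube (hint x)
    simp only [hper] at h2
    have h3 : ∀ m ∉ smallVectors d, ∫ θ in unitCube (Y d),
        ((bump η₀ b fun l => θ l + m l - fracPoint x l : ℝ) : ℂ) * S θ = 0 := fun m hm => by
        rw [mem_smallVectors] at hm
        push Not at hm
        obtain ⟨l, hl⟩ := hm
        refine setIntegral_eq_zero_of_forall_eq_zero fun θ hθ => ?_
        have h4 : (bump η₀ b fun l => θ l + m l - fracPoint x l) = 0 := by
          by_contra hne
          have h5 := abs_le_two_of_bump_ne_zero hη hne l
          have h6 := hθ l trivial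
          have h7 := fracPoint_mem hx l
          simp only [Set.mem_Ico] at h6
          rw [abs_mul, abs_of_pos (hb0 l)] at h5
          have h8 : (1 : ℝ) ≤ |θ l + m l - fracPoint x l| := by
            rcases abs_cases (m l) with ⟨h9, _⟩ | ⟨h9, _⟩
            · have : (3 : ℝ) ≤ m l := by exact_mod_cast (by omega : 3 ≤ m l)
              refine le_trans ?_ (le_abs_self _); linarith
            · have : (m l : ℝ) ≤ -3 := by exact_mod_cast (by omega : m l ≤ -3)
              refine le_trans ?_ (neg_le_abs _); linarith
          nlinarith [hb1 l]
        simp [h4]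
    rw [(hasSum_sum_of_ne_finset_zero h3).unique h2, ← integral_add_left_eq_self _ (fracPoint x)]
    refine integral_congr_ae (Filter.Eventually.of_forall fun β => ?_)
    simp only [Pi.add_apply, add_sub_cancel_left]
    rfl
  rw [← Finset.sum_congr rfl h1, Finset.sum_comm]
  have h2 : ∀ θ, (arcCutoff η₀ b R θ : ℂ) * S θ = ∑ m ∈ smallVectors d, ∑ x ∈ fractions d R,
      ((bump η₀ b fun l => θ l + m l - fracPoint x l : ℝ) : ℂ) * S θ := by
    intro θ
    rw [arcCutoff]; push_cast
    rw [Finset.sum_mul]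
    simp_rw [Finset.sum_mul]
  have hI : ∀ m x, IntegrableOn (fun θ : Y d → ℝ =>
      ((bump η₀ b fun l => θ l + (m : Y d → ℤ) l - fracPoint x l : ℝ) : ℂ) * S θ) (unitCube (Y d)) :=
    fun m x => integrableOn_unitCube
      ((Complex.continuous_ofReal.comp ((continuous_bump hη).comp (by fun_prop))).mul hS)
  simp_rw [h2]
  rw [integral_finsetSum _ fun m _ => integrable_finsetSum _ fun x _ => hI m x]
  exact Finset.sum_congr rfl fun m _ => integral_finsetSum _ fun x _ => hI m x

/-- The Fourier coefficient of `S` is approximated by the contribution of the major arcs. -/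
theorem norm_fourierCoeff_sub_major_le (hb : ∀ l, 4 * (R : ℝ) ^ 2 < b l) (hb1 : ∀ l, 2 < b l)
    {S I : (Y d → ℝ) → ℂ} (hS : Continuous S) (hI : Continuous I)
    (hper : ∀ θ (m : Y d → ℤ), S (fun l => θ l + m l) = S θ) {A ρ : ℝ} (hA : 0 ≤ A) (hρ : 0 ≤ ρ)
    (hminor : ∀ θ, ‖S θ‖ ≤ A ∨ ∃ q : ℕ, 1 ≤ q ∧ q ≤ R ∧ ∀ l, ∃ a : ℤ, |b l * (θ l - a / q)| ≤ 1)
    {E : (Σ _ : ℕ, Y d → ℕ) → ℂ} (hmajor : ∀ x ∈ fractions d R, ∀ β, (∀ l, |b l * β l| ≤ 2) →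
      ‖S (fun l => fracPoint x l + β l) - E x * I β‖ ≤ ρ) (h : G0 d ℤ) :
    ‖(∫ θ in unitCube (Y d), e (pairing θ h) * S θ) - ∑ x ∈ fractions d R,
      e (pairing (fracPoint x) h) * E x * ∫ β, (bump η₀ b β : ℂ) * (e (pairing β h) * I β)‖
      ≤ A + (R : ℝ) ^ (Fintype.card (Y d) + 1) * (ρ * ∏ l, (4 / b l)) := by
  have hb0 : ∀ l, 0 < b l := fun l => by linarith [hb1 l]
  have hpc : Continuous fun θ : Y d → ℝ => e (pairing θ h) :=
    continuous_e.comp (continuous_pairing_left h)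
  have hpadd : ∀ θ β : Y d → ℝ, pairing (fun l => θ l + β l) h = pairing θ h + pairing β h := by
    intro θ β
    simp only [pairing, add_mul, Finset.sum_add_distrib]
  have hper' : ∀ θ (m : Y d → ℤ), e (pairing (fun l => θ l + m l) h) * S (fun l => θ l + m l)
      = e (pairing θ h) * S θ := by
    intro θ m
    rw [hper, hpadd, e_add]
    have : pairing (fun l => (m l : ℝ)) h = ((∑ l, m l * h.coord l : ℤ) : ℝ) := by
      rw [pairing]; push_cast; rfl
    rw [this, e_int, mul_one]
  set F : (Y d → ℝ) → ℂ := fun θ => e (pairing θ h) * S θ with hF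
  have hFc : Continuous F := hpc.mul hS
  have hunfold := integral_mul_arcCutoff hη (R := R) (S := F) hb1 hFc hper'
  have hacc : Continuous fun θ => (arcCutoff η₀ b R θ : ℂ) :=
    Complex.continuous_ofReal.comp (continuous_arcCutoff hη)
  have h1 : ‖(∫ θ in unitCube (Y d), F θ) - ∫ θ in unitCube (Y d), (arcCutoff η₀ b R θ : ℂ) * F θ‖ ≤ A := by
    rw [← integral_sub (f := F) (g := fun θ => (arcCutoff η₀ b R θ : ℂ) * F θ)
      (integrableOn_unitCube hFc) (integrableOn_unitCube (hacc.mul hFc))]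
    refine norm_setIntegral_unitCube_le fun θ hθ => ?_
    have h2 : F θ - (arcCutoff η₀ b R θ : ℂ) * F θ = ((1 - arcCutoff η₀ b R θ : ℝ) : ℂ) * F θ := by
      push_cast; ring
    rw [h2, norm_mul, Complex.norm_real, Real.norm_eq_abs, hF, norm_mul, norm_e, one_mul]
    rcases hminor θ with h3 | h3
    · calc _ ≤ 1 * A := by gcongr; exact abs_one_sub_arcCutoff_le hη hb θ
        _ = A := one_mul _
    · rw [arcCutoff_eq_one hη hb (fun l => by linarith [hb1 l]) hθ h3]
      simpa using hA
  have h2 : ‖(∫ θ in unitCube (Y d), (arcCutoff η₀ b R θ : ℂ) * F θ) - ∑ x ∈ fractions d R,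
      e (pairing (fracPoint x) h) * E x * ∫ β, (bump η₀ b β : ℂ) * (e (pairing β h) * I β)‖
      ≤ (R : ℝ) ^ (Fintype.card (Y d) + 1) * (ρ * ∏ l, (4 / b l)) := by
    rw [hunfold, ← Finset.sum_sub_distrib]
    have h3 : ∀ x ∈ fractions d R, ‖(∫ β, (bump η₀ b β : ℂ) * (e (pairing (fun l => fracPoint x l + β l) h) *
        S fun l => fracPoint x l + β l)) - e (pairing (fracPoint x) h) * E x *
          ∫ β, (bump η₀ b β : ℂ) * (e (pairing β h) * I β)‖ ≤ ρ * ∏ l, (4 / b l) := by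
      intro x hx
      have hbc : HasCompactSupport fun β : Y d → ℝ => (bump η₀ b β : ℂ) :=
        (hasCompactSupport_bump hη hb0).comp_left (g := fun t : ℝ => (t : ℂ)) (by simp)
      have hbcont : Continuous fun β : Y d → ℝ => (bump η₀ b β : ℂ) :=
        Complex.continuous_ofReal.comp (continuous_bump hη)
      have hshift : Continuous fun β : Y d → ℝ => fun l => fracPoint x l + β l := by fun_prop
      rw [← integral_const_mul, ← integral_sub]
      · have h4 : ∀ β, (bump η₀ b β : ℂ) * (e (pairing (fun l => fracPoint x l + β l) h) *
            S fun l => fracPoint x l + β l) - e (pairing (fracPoint x) h) * E x *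
              ((bump η₀ b β : ℂ) * (e (pairing β h) * I β))
            = (bump η₀ b β : ℂ) * (e (pairing (fun l => fracPoint x l + β l) h) *
              (S (fun l => fracPoint x l + β l) - E x * I β)) := by
          intro β
          rw [hpadd, e_add]; ring
        simp_rw [h4]
        refine norm_integral_bump_mul_le hη hb0 fun β hβ => ?_
        rw [norm_mul, norm_e, one_mul]
        exact hmajor x hx β hβ
      · exact (hbcont.mul ((hpc.comp hshift).mul (hS.comp hshift))).integrable_of_hasCompactSupport
          hbc.mul_right
      · refine Integrable.const_mul ?_ _
        exact (hbcont.mul (hpc.mul hI)).integrable_of_hasCompactSupport hbc.mul_right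
    refine (norm_sum_le _ _).trans ((Finset.sum_le_card_nsmul _ _ _ h3).trans ?_)
    rw [nsmul_eq_mul]
    have : 0 ≤ ρ * ∏ l, (4 / b l) := mul_nonneg hρ (Finset.prod_nonneg fun l _ => by
      have := hb0 l; positivity)
    exact mul_le_mul_of_nonneg_right (card_fractions_le d R) this
  calc _ ≤ _ := norm_sub_le_norm_sub_add_norm_sub _ (∫ θ in unitCube (Y d), (arcCutoff η₀ b R θ : ℂ) * F θ) _
    _ ≤ _ := add_le_add h1 h2

end Arcs

end DiscreteRadon
end

noncomputable section
namespace DiscreteRadon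

open MeasureTheory

/-! ### The major arc kernel -/

variable {d : ℕ}

theorem wordSum_add_int (s : Bool) (P : ℕ) {r : ℕ} (φ ψ : Fin r → ℤ → ℂ) (θ : Y d → ℝ) (m : Y d → ℤ) :
    wordSum s P φ ψ (fun l => θ l + m l) = wordSum s P φ ψ θ := by
  refine Finset.sum_congr rfl fun z _ => ?_
  rw [← e_add_int (-pairing θ _) (-∑ l, m l * (word d s z.1 z.2).coord l)]
  congr 2
  simp only [pairing, add_mul, Finset.sum_add_distrib]
  push_cast; ring

theorem continuous_integral_wordFun (s : Bool) {r : ℕ} {W : Fin r ⊕ Fin r → ℝ → ℝ}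
    (hWc : ∀ j, Continuous (W j)) {P : ℝ} (hP : 0 ≤ P) (hW : ∀ j x, P < |x| → W j x = 0) :
    Continuous fun β : Y d → ℝ => ∫ x, wordFun s W β x := by
  have h1 : ∀ β : Y d → ℝ, ∫ x, wordFun s W β x = ∫ x in Metric.closedBall 0 P, wordFun s W β x := by
    intro β
    refine (setIntegral_eq_integral_of_forall_compl_eq_zero fun x hx => ?_).symm
    rw [mem_closedBall_zero_iff, pi_norm_le_iff_of_nonneg hP] at hx
    push Not at hx
    obtain ⟨j, hj⟩ := hx
    exact wordFun_eq_zero s hW β hj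
  simp_rw [h1]
  exact continuous_parametric_integral_of_continuous (continuous_wordFun s hWc)
    (isCompact_closedBall 0 P)

/-- The weights in the merged variables. -/
def mergedKernel (η₀ K : ℝ → ℝ) {r : ℕ} (j k : Fin r → ℕ) : Fin r ⊕ Fin r → ℝ → ℝ :=
  Sum.elim (fun i => dyadicKernel η₀ K (j i)) fun i => dyadicKernel η₀ K (k i)

theorem oscIntegral_eq (s : Bool) (η₀ K : ℝ → ℝ) (ε J : ℝ) {r : ℕ} (j k : Fin r → ℕ) (h : G0 d ℤ) :
    oscIntegral (word d s) η₀ K ε J j k h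
      = ∫ β : Y d → ℝ, (bump η₀ (fun l => (2 : ℝ) ^ (J * (deg l - 2 * ε))) β : ℂ) *
        (e (pairing β h) * ∫ x, wordFun s (mergedKernel η₀ K j k) β x) := by
  rw [oscIntegral]
  congr 1
  funext β
  rw [← (volume_measurePreserving_sumPiEquivProdPi fun _ : Fin r ⊕ Fin r => ℝ).integral_comp'
    (g := fun p : (Fin r → ℝ) × (Fin r → ℝ) =>
      ((∏ l, η₀ ((2 : ℝ) ^ (J * (deg l - 2 * ε)) * β l) : ℝ) : ℂ) * (Gfun η₀ K j k p.1 p.2 : ℂ) *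
      e (∑ l, ((h.coord l : ℝ) - (word d s p.1 p.2).coord l) * β l)),
    ← integral_const_mul, ← integral_const_mul]
  congr 1
  funext x
  have h1 : e (∑ l, ((h.coord l : ℝ) - (sumWord d s x).coord l) * β l)
      = e (pairing β h) * e (-∑ l, β l * (sumWord d s x).coord l) := by
    rw [← e_add, pairing, ← sub_eq_add_neg, ← Finset.sum_sub_distrib]
    congr 1
    exact Finset.sum_congr rfl fun l _ => by ring
  have h2 : Gfun η₀ K j k (fun i => x (Sum.inl i)) (fun i => x (Sum.inr i))
      = ∏ i, mergedKernel η₀ K j k i (x i) := by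
    rw [Gfun, Finset.prod_mul_distrib, Fintype.prod_sum_type]; rfl
  change ((∏ l, η₀ ((2 : ℝ) ^ (J * (deg l - 2 * ε)) * β l) : ℝ) : ℂ) *
    (Gfun η₀ K j k (fun i => x (Sum.inl i)) (fun i => x (Sum.inr i)) : ℂ) *
    e (∑ l, ((h.coord l : ℝ) - (sumWord d s x).coord l) * β l) = _
  rw [h1, h2, wordFun, bump]
  ring

theorem majorArc_eq (s : Bool) (η₀ K : ℝ → ℝ) (ε J : ℝ) {r : ℕ} (j k : Fin r → ℕ) (h : G0 d ℤ) :
    majorArc (word d s) (word d s) η₀ K ε J j k h = (cutoffTilde η₀ (J + ε * J) h : ℂ) *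
      ∑ x ∈ fractions d ⌊(2 : ℝ) ^ (3 * (d : ℝ) ^ 2 * ε * J)⌋₊, e (pairing (fracPoint x) h) *
        expSum (r := r) (word d s) x.1 x.2 *
        ∫ β : Y d → ℝ, (bump η₀ (fun l => (2 : ℝ) ^ (J * (deg l - 2 * ε))) β : ℂ) *
        (e (pairing β h) * ∫ x, wordFun s (mergedKernel η₀ K j k) β x) := by
  have h1 : ∑ q ∈ Finset.Icc 1 ⌊(2 : ℝ) ^ (3 * (d : ℝ) ^ 2 * ε * J)⌋₊, ∑ a ∈ numerators d q,
      e (∑ l, (h.coord l : ℝ) * ((a l : ℝ) / q)) * expSum (r := r) (word d s) q a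
      = ∑ x ∈ fractions d ⌊(2 : ℝ) ^ (3 * (d : ℝ) ^ 2 * ε * J)⌋₊, e (pairing (fracPoint x) h) *
        expSum (r := r) (word d s) x.1 x.2 := by
    rw [fractions, Finset.sum_sigma]
    refine Finset.sum_congr rfl fun q _ => Finset.sum_congr rfl fun a _ => ?_
    rw [pairing, Finset.sum_congr rfl fun l _ => mul_comm (h.coord l : ℝ) ((a l : ℝ) / q)]
    rfl
  rw [majorArc, oscIntegral_eq, h1, mul_assoc, Finset.sum_mul]

theorem cutoffTilde_mem_Icc {η₀ : ℝ → ℝ} (hη : IsCutoff η₀) (lam : ℝ) (h : G0 d ℤ) :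
    cutoffTilde η₀ lam h ∈ Set.Icc (0 : ℝ) 1 :=
  ⟨Finset.prod_nonneg fun _ _ => (hη.mem_Icc _).1,
    Finset.prod_le_one (fun _ _ => (hη.mem_Icc _).1) fun _ _ => (hη.mem_Icc _).2⟩

theorem cutoffTilde_eq_one {η₀ : ℝ → ℝ} (hη : IsCutoff η₀) {lam : ℝ} {h : G0 d ℤ}
    (hh : ∀ l, |(h.coord l : ℝ)| ≤ 2 ^ (lam * deg l)) : cutoffTilde η₀ lam h = 1 :=
  Finset.prod_eq_one fun l _ => hη.eq_one _ (by
    rw [abs_div, abs_of_pos (by positivity : (0 : ℝ) < 2 ^ (lam * deg l)), div_le_one (by positivity)]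
    exact hh l)

theorem abs_coord_le_of_cutoffTilde_ne_zero {η₀ : ℝ → ℝ} (hη : IsCutoff η₀) {lam : ℝ} {h : G0 d ℤ}
    (hh : cutoffTilde η₀ lam h ≠ 0) (l : Y d) : |(h.coord l : ℝ)| ≤ 2 * 2 ^ (lam * deg l) := by
  by_contra! hl
  refine hh (Finset.prod_eq_zero (Finset.mem_univ l) (hη.eq_zero _ ?_))
  rwa [abs_div, abs_of_pos (by positivity : (0 : ℝ) < 2 ^ (lam * deg l)), lt_div_iff₀ (by positivity)]

/-- Functions on the group vanishing outside a box are summable. -/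
theorem summable_of_support_box {f : G0 d ℤ → ℂ} {X : Y d → ℝ} (hX : ∀ l, 1 ≤ X l) {A : ℝ} (hA : 0 ≤ A)
    (hf : ∀ h, ‖f h‖ ≤ A) (hsupp : ∀ h, f h ≠ 0 → ∀ l, |(h.coord l : ℝ)| ≤ X l) :
    Summable (fun h => ‖f h‖) ∧ ∑' h, ‖f h‖ ≤ (∏ l, 3 * X l) * A := by
  classical
  set B : Finset (Y d → ℤ) := Fintype.piFinset fun l => Finset.Icc (-⌊X l⌋) ⌊X l⌋ with hB
  set O : Finset (G0 d ℤ) := B.image fun c => ⟨c⟩ with hO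
  have h0 : ∀ h ∉ O, ‖f h‖ = 0 := by
    intro h hh
    rw [norm_eq_zero]
    by_contra hne
    refine hh (Finset.mem_image.2 ⟨h.coord, ?_, rfl⟩)
    rw [hB, Fintype.mem_piFinset]
    intro l
    have h1 := abs_le.1 (hsupp h hne l)
    rw [Finset.mem_Icc]
    refine ⟨?_, Int.le_floor.2 h1.2⟩
    rw [neg_le, Int.le_floor]
    push_cast
    linarith [h1.1]
  have hcard : (O.card : ℝ) ≤ ∏ l, 3 * X l := by
    have h1 : (O.card : ℝ) ≤ B.card := by exact_mod_cast Finset.card_image_le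
    refine h1.trans ?_
    rw [hB, Fintype.card_piFinset]
    push_cast
    refine Finset.prod_le_prod (fun _ _ => by positivity) fun l _ => ?_
    have h2 : 1 ≤ ⌊X l⌋ := Int.le_floor.2 (by simpa using hX l)
    have h3 : (((Finset.Icc (-⌊X l⌋) ⌊X l⌋).card : ℤ) : ℝ) ≤ 3 * ⌊X l⌋ := by
      rw [Int.card_Icc]
      exact_mod_cast (by omega : ((⌊X l⌋ + 1 - -⌊X l⌋).toNat : ℤ) ≤ 3 * ⌊X l⌋)
    have h4 := Int.floor_le (X l)
    push_cast at h3
    linarith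
  refine ⟨summable_of_ne_finset_zero h0, ?_⟩
  rw [tsum_eq_sum h0]
  refine (Finset.sum_le_card_nsmul _ _ _ fun h _ => hf h).trans ?_
  rw [nsmul_eq_mul]
  gcongr

/-- The error after restricting the approximation of the kernel to a box. -/
theorem summable_norm_sub_cutoff {η₀ : ℝ → ℝ} (hη : IsCutoff η₀) {lam : ℝ} (hlam : 0 ≤ lam)
    {κ T : G0 d ℤ → ℂ} {A : ℝ} (hA : ∀ h, ‖κ h - T h‖ ≤ A)
    (hκ : ∀ h, κ h ≠ 0 → ∀ l, |(h.coord l : ℝ)| ≤ 2 ^ (lam * deg l)) :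
    Summable (fun h => ‖κ h - (cutoffTilde η₀ lam h : ℂ) * T h‖) ∧
      ∑' h, ‖κ h - (cutoffTilde η₀ lam h : ℂ) * T h‖ ≤ (∏ l : Y d, 6 * (2 : ℝ) ^ (lam * deg l)) * A := by
  have h1 := summable_of_support_box (f := fun h => κ h - (cutoffTilde η₀ lam h : ℂ) * T h)
    (X := fun l => 2 * 2 ^ (lam * deg l)) (A := A) (fun l => by
      have : (1 : ℝ) ≤ 2 ^ (lam * deg l) := Real.one_le_rpow (by norm_num) (by positivity)
      linarith) ((norm_nonneg _).trans (hA 1)) (fun h => ?_) (fun h hh l => ?_)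
  · refine ⟨h1.1, h1.2.trans (le_of_eq ?_)⟩
    congr 1
    exact Finset.prod_congr rfl fun l _ => by ring
  · by_cases hκh : κ h = 0
    · have h2 := cutoffTilde_mem_Icc hη lam h
      have h3 := hA h
      rw [hκh, zero_sub, norm_neg] at h3
      rw [hκh, zero_sub, norm_neg, norm_mul, Complex.norm_real, Real.norm_eq_abs, abs_of_nonneg h2.1]
      calc _ ≤ 1 * ‖T h‖ := by gcongr; exact h2.2
        _ ≤ A := by rw [one_mul]; exact h3
    · rw [cutoffTilde_eq_one hη (hκ h hκh)]
      simpa using hA h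
  · by_cases hκh : κ h = 0
    · refine abs_coord_le_of_cutoffTilde_ne_zero hη (fun h0 => hh ?_) l
      rw [hκh, h0]; simp
    · have := hκ h hκh l
      have : (0 : ℝ) ≤ 2 ^ (lam * deg l) := by positivity
      linarith

end DiscreteRadon
end

noncomputable section
namespace DiscreteRadon

open MeasureTheory

/-! ### The choice of the parameters -/

variable {d : ℕ}

theorem exists_parameters (hd : 1 ≤ d) {C Z : ℕ} (hC : 1 ≤ C) (hZ : 1 ≤ Z) {T X : ℝ} (hT : 1 ≤ T)
    (hX : 1 ≤ X) : ∃ Cbar₀ : ℝ, 0 < Cbar₀ ∧ ∀ Cbar : ℝ, Cbar₀ ≤ Cbar → ∀ (ε : ℝ) (r : ℕ),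
      (∃ s : ℕ, r = 2 ^ s) → ε = Cbar⁻¹ * ((10 * (d : ℝ)) ^ 10)⁻¹ →
      (10 * (d : ℝ)) ^ 10 ≤ -2 * Cbar + r * ε / (2 * Cbar) →
      0 < ε ∧ ε * X ≤ 1 ∧ X ≤ r ∧ ∃ N M : ℕ, 1 ≤ N ∧ r = M * N ∧ Z ≤ ε / (2 * C) * N ∧
        T ≤ M * (ε / (2 * C)) := by
  set G : ℝ := (10 * (d : ℝ)) ^ 10 with hG
  have hd' : (1 : ℝ) ≤ d := by exact_mod_cast hd
  have hG1 : 1 ≤ G := one_le_pow₀ (by linarith)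
  have hC' : (1 : ℝ) ≤ C := by exact_mod_cast hC
  have hZ' : (1 : ℝ) ≤ Z := by exact_mod_cast hZ
  refine ⟨X + 2 * T * C ^ 2 * Z * G, by positivity, fun B hB ε r ⟨s, hr⟩ hε h => ?_⟩
  have hBX : X ≤ B := le_trans (le_add_of_nonneg_right (by positivity)) hB
  have hBT : 2 * T * C ^ 2 * Z * G ≤ B := le_trans (le_add_of_nonneg_left (by positivity)) hB
  have hB0 : 0 < B := by linarith
  have hε0 : 0 < ε := by rw [hε]; positivity
  have hεB : ε * (B * G) = 1 := by rw [hε]; field_simp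
  have hε1 : ε * X ≤ 1 := by
    rw [← hεB]; gcongr
    nlinarith
  have hε2 : ε ≤ 1 := by nlinarith
  have h1 : 4 * B ^ 2 ≤ r * ε := by
    have h2 : 2 * B ≤ r * ε / (2 * B) := by linarith
    rw [le_div_iff₀ (by positivity)] at h2
    linarith
  have hXr : X ≤ r := by
    have : (r : ℝ) * ε ≤ r := by
      have : (0 : ℝ) ≤ r := by positivity
      nlinarith
    nlinarith
  refine ⟨hε0, hε1, hXr, ?_⟩
  set δ : ℝ := ε / (2 * C) with hδ
  have hδ0 : 0 < δ := by positivity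
  have hδ1 : δ ≤ 1 := by rw [hδ, div_le_one (by positivity)]; linarith
  obtain ⟨n, hn1, hn2⟩ := exists_nat_pow_near (x := Z / δ) (y := 2)
    (by rw [le_div_iff₀ hδ0]; linarith) (by norm_num)
  have hZN : (Z : ℝ) ≤ δ * 2 ^ (n + 1) := by
    rw [div_lt_iff₀ hδ0] at hn2; linarith
  have hNZ : δ * 2 ^ (n + 1) ≤ 2 * Z := by
    rw [le_div_iff₀ hδ0] at hn1; rw [pow_succ]; linarith
  have hmain : T * 2 ^ (n + 1) ≤ r * δ := by
    have h3 : T * (δ * 2 ^ (n + 1)) ≤ T * (2 * Z) := by gcongr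
    have h4 : T * (2 * Z) ≤ r * δ * δ := by
      have h5 : r * δ * δ = (r * ε) * ε / (4 * C ^ 2) := by rw [hδ]; field_simp; ring
      rw [h5, le_div_iff₀ (by positivity)]
      have h6 : 4 * B ^ 2 * ε ≤ r * ε * ε := by gcongr
      have h7 : 4 * B ^ 2 * ε * G = 4 * B := by
        calc _ = 4 * B * (ε * (B * G)) := by ring
          _ = _ := by rw [hεB, mul_one]
      have h8 : T * (2 * Z) * (4 * C ^ 2) * G ≤ 4 * B ^ 2 * ε * G := by rw [h7]; linarith
      exact (le_of_mul_le_mul_right h8 (by linarith)).trans h6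
    have h9 : T * 2 ^ (n + 1) * δ ≤ r * δ * δ := by linarith
    exact le_of_mul_le_mul_right h9 hδ0
  have hns : n + 1 ≤ s := by
    have h3 : (2 : ℝ) ^ (n + 1) ≤ 2 ^ s := by
      have h4 : (r : ℝ) = 2 ^ s := by rw [hr]; push_cast; rfl
      rw [h4] at hmain
      have h5 : (2 : ℝ) ^ s * δ ≤ 2 ^ s := mul_le_of_le_one_right (by positivity) hδ1
      have h6 : (2 : ℝ) ^ (n + 1) ≤ T * 2 ^ (n + 1) := le_mul_of_one_le_left (by positivity) hT
      linarith
    exact (pow_le_pow_iff_right₀ (by norm_num)).1 h3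
  refine ⟨2 ^ (n + 1), 2 ^ (s - (n + 1)), Nat.one_le_two_pow, ?_, by push_cast; exact hZN, ?_⟩
  · rw [hr, ← pow_add]; congr 1; omega
  · have h3 : (r : ℝ) = 2 ^ (s - (n + 1)) * 2 ^ (n + 1) := by
      rw [hr, ← pow_add]; push_cast; congr 1; omega
    rw [h3, mul_right_comm] at hmain
    push_cast
    exact le_of_mul_le_mul_right hmain (by positivity)

theorem eventually_mul_le_two_rpow (A : ℝ) {c : ℝ} (hc : 0 < c) :
    ∀ᶠ J : ℝ in Filter.atTop, A * (J + 1) ≤ 2 ^ (c * J) := by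
  have h1 := isLittleO_pow_exp_pos_mul_atTop 1 (mul_pos (Real.log_pos one_lt_two) hc)
  have h2 := h1.bound (c := (2 * (|A| + 1))⁻¹) (by positivity)
  filter_upwards [h2, Filter.eventually_ge_atTop 1] with J h3 hJ
  rw [pow_one, Real.norm_eq_abs, abs_of_nonneg (by linarith), Real.norm_eq_abs,
    abs_of_pos (Real.exp_pos _), inv_mul_eq_div, le_div_iff₀ (by positivity)] at h3
  rw [Real.rpow_def_of_pos two_pos, ← mul_assoc]
  have h4 := le_abs_self A
  nlinarith [abs_nonneg A]

theorem eventually_le_two_rpow (A : ℝ) {c : ℝ} (hc : 0 < c) :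
    ∀ᶠ J : ℝ in Filter.atTop, A ≤ 2 ^ (c * J) := by
  filter_upwards [eventually_mul_le_two_rpow |A| hc, Filter.eventually_ge_atTop 0] with J h hJ
  nlinarith [abs_nonneg A, le_abs_self A]

/-- The integer scale of the kernels with index at most `J`. -/
def scale (J : ℝ) : ℕ := 2 ^ (⌊J⌋₊ + 2)

theorem two_rpow_le_scale (J : ℝ) : (2 : ℝ) ^ J ≤ scale J := by
  rw [scale, Nat.cast_pow, Nat.cast_ofNat, ← Real.rpow_natCast]
  refine Real.rpow_le_rpow_of_exponent_le one_le_two ?_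
  push_cast
  linarith [Nat.lt_floor_add_one J]

theorem scale_le {J : ℝ} (hJ : 0 ≤ J) : (scale J : ℝ) ≤ 4 * 2 ^ J := by
  have h1 : (4 : ℝ) * 2 ^ J = 2 ^ (J + 2) := by
    rw [Real.rpow_add two_pos, Real.rpow_two]; norm_num [mul_comm]
  rw [scale, Nat.cast_pow, Nat.cast_ofNat, ← Real.rpow_natCast, h1]
  refine Real.rpow_le_rpow_of_exponent_le one_le_two ?_
  push_cast
  linarith [Nat.floor_le hJ]

theorem two_pow_le_scale {J : ℝ} {j : ℕ} (hj : (j : ℝ) ≤ J) : 2 ^ (j + 2) ≤ scale J :=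
  Nat.pow_le_pow_right two_pos (by have := Nat.le_floor hj; omega)

theorem eventually_abs_dyadicKernel_le {η₀ : ℝ → ℝ} (hη : IsCutoff η₀) {κ : ℝ} (hκ : 0 < κ)
    (hκ1 : κ ≤ 1 / 2) : ∀ᶠ J : ℝ in Filter.atTop, ∀ K, IsCalderonZygmund K → ∀ j : ℕ,
      (j : ℝ) ∈ Set.Icc (J * (1 - κ)) J →
      (∀ t, |dyadicKernel η₀ K j t| ≤ 2 ^ (3 * κ * J) / scale J) ∧
      (∀ t u, |dyadicKernel η₀ K j t - dyadicKernel η₀ K j u|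
        ≤ 2 ^ (3 * κ * J) / scale J / scale J * |t - u|) ∧
      ∀ t : ℝ, scale J < |t| → dyadicKernel η₀ K j t = 0 := by
  obtain ⟨C, hC, hb⟩ := exists_abs_dyadicKernel_le hη
  filter_upwards [eventually_mul_le_two_rpow (16 * C) hκ, Filter.eventually_ge_atTop 2]
    with J hJ hJ2 K hK j hj
  have hj1 : 1 ≤ j := by
    have : (0 : ℝ) < j := by nlinarith [hj.1]
    exact_mod_cast this
  obtain ⟨h1, h2⟩ := hb K hK j hj1
  have hs0 : (0 : ℝ) < scale J := lt_of_lt_of_le (by positivity) (two_rpow_le_scale J)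
  have hs := scale_le (by linarith : 0 ≤ J)
  have hCj : 16 * (C * (j + 1)) ≤ 2 ^ (κ * J) := by
    have := hj.2
    nlinarith
  have hpow : (scale J : ℝ) ≤ 4 * 2 ^ (κ * J) * 2 ^ j := by
    refine hs.trans ?_
    rw [mul_assoc, ← Real.rpow_natCast, ← Real.rpow_add two_pos]
    gcongr
    · norm_num
    · linarith [hj.1]
  have hu : (1 : ℝ) ≤ 2 ^ (κ * J) := Real.one_le_rpow one_le_two (by positivity)
  have h3 : (2 : ℝ) ^ (3 * κ * J) = (2 ^ (κ * J)) ^ 3 := by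
    rw [← Real.rpow_mul_natCast two_pos.le]; congr 1; push_cast; ring
  have hC0 : 0 ≤ C * (j + 1) := by positivity
  set u : ℝ := 2 ^ (κ * J) with hu'
  refine ⟨fun t => (h1 t).trans ?_, fun t v => (h2 t v).trans ?_, fun t ht => ?_⟩
  · rw [h3, div_le_div_iff₀ (by positivity) hs0]
    calc C * (j + 1) * scale J ≤ (u / 16) * (4 * u * 2 ^ j) := by gcongr; linarith
      _ ≤ u ^ 3 * 2 ^ j := by
        rw [show u / 16 * (4 * u * 2 ^ j) = (u ^ 2 / 4) * 2 ^ j by ring]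
        gcongr
        nlinarith [sq_nonneg u]
  · refine mul_le_mul_of_nonneg_right ?_ (abs_nonneg _)
    rw [h3, div_div, div_le_div_iff₀ (by positivity) (by positivity)]
    calc C * (j + 1) * (scale J * scale J) ≤ (u / 16) * ((4 * u * 2 ^ j) * (4 * u * 2 ^ j)) := by
          gcongr; linarith
      _ = u ^ 3 * (2 ^ j) ^ 2 := by ring
  · refine dyadicKernel_eq_zero hη K j (lt_of_le_of_lt ?_ ht)
    exact_mod_cast two_pow_le_scale hj.2

theorem deg_pos (l : Y d) : 1 ≤ deg l := by
  have := mem_pairs.1 l.2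
  unfold deg; omega

theorem deg_le_two_mul (l : Y d) : deg l ≤ 2 * d := by
  have := mem_pairs.1 l.2
  unfold deg; omega

end DiscreteRadon
end

noncomputable section
namespace DiscreteRadon

open MeasureTheory

/-! ### The error term -/

variable {d : ℕ}

/-- The homogeneous dimension of the group. -/
def homDim (d : ℕ) : ℕ := ∑ l : Y d, deg l

theorem prod_mul_rpow_deg (A a : ℝ) : ∏ l : Y d, A * (2 : ℝ) ^ (a * deg l)
    = A ^ Fintype.card (Y d) * 2 ^ (a * homDim d) := by
  rw [Finset.prod_mul_distrib, Finset.prod_const, Finset.card_univ,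
    ← Real.rpow_sum_of_pos two_pos, ← Finset.mul_sum, homDim, Nat.cast_sum]

/-- The upper bound for `ε⁻¹` and for the number of factors. -/
def paramBound (d : ℕ) : ℝ :=
  28 + 12 * (d : ℝ) ^ 2 * (Fintype.card (Y d) + 2) + 4 * Fintype.card (Y d) + 2 * homDim d

/-- The kernels of the products of operators at scale `J`. -/
def productKernel (d : ℕ) (s : Bool) (η₀ K : ℝ → ℝ) (J : ℝ) {r : ℕ} (j k : Fin r → ℕ) : G0 d ℤ → ℂ :=
  wordKernel d s (scale J) (fun i n => (dyadicKernel η₀ K (j i) n : ℂ))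
    fun i n => (dyadicKernel η₀ K (k i) n : ℂ)

theorem scale_pow_le {J : ℝ} (hJ : 0 ≤ J) (n : ℕ) : (scale J : ℝ) ^ n ≤ 4 ^ n * 2 ^ (J * n) := by
  rw [Real.rpow_mul_natCast two_pos.le, ← mul_pow]
  exact pow_le_pow_left₀ (by positivity) (scale_le hJ) n

theorem scale_pow_deg_le {J : ℝ} (hJ : 0 ≤ J) (l : Y d) :
    (scale J : ℝ) ^ deg l ≤ 16 ^ d * 2 ^ (J * deg l) := by
  refine (scale_pow_le hJ _).trans ?_
  gcongr
  rw [show (16 : ℝ) = 4 ^ 2 by norm_num, ← pow_mul]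
  exact pow_le_pow_right₀ (by norm_num) (deg_le_two_mul l)

theorem le_scale_pow_deg {J : ℝ} (l : Y d) : (2 : ℝ) ^ (J * deg l) ≤ scale J ^ deg l := by
  rw [Real.rpow_mul_natCast two_pos.le]
  exact pow_le_pow_left₀ (by positivity) (two_rpow_le_scale J) _

theorem paramBound_consequences {ε : ℝ} (hε : 0 < ε) (h : ε * paramBound d ≤ 1) :
    ε ≤ 1 / 28 ∧ (d : ℝ) ^ 2 * ε ≤ 1 / 24 ∧
    homDim d * ε + 3 * d ^ 2 * ε * (Fintype.card (Y d) + 2) + 2 * ε + 2 * ε * Fintype.card (Y d)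
      ≤ 1 / 2 := by
  have h1 : 0 ≤ (d : ℝ) ^ 2 * ε := by positivity
  have h2 : 0 ≤ (Fintype.card (Y d) : ℝ) * ε := by positivity
  have h3 : 0 ≤ (homDim d : ℝ) * ε := by positivity
  have h4 : 0 ≤ (d : ℝ) ^ 2 * ε * Fintype.card (Y d) := by positivity
  rw [paramBound] at h
  refine ⟨?_, ?_, ?_⟩ <;> nlinarith

set_option maxHeartbeats 1000000 in
theorem eventually_norm_productKernel_sub_le (d : ℕ) (hd : 1 ≤ d) : ∃ C : ℕ, 1 ≤ C ∧
    ∀ (N M : ℕ), 1 ≤ N → ∀ ε κ : ℝ, 0 < ε → ε * paramBound d ≤ 1 → 0 < κ → κ ≤ 1 / 2 →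
    degZ d ≤ ε / (2 * C) * N → ∀ (s : Bool) {η₀ : ℝ → ℝ}, IsCutoff η₀ →
    ∃ A : ℝ, 0 ≤ A ∧ ∀ᶠ J : ℝ in Filter.atTop, ∀ K, IsCalderonZygmund K → ∀ j k : Fin (M * N) → ℕ,
      (∀ i, (j i : ℝ) ∈ Set.Icc (J * (1 - κ)) J) → (∀ i, (k i : ℝ) ∈ Set.Icc (J * (1 - κ)) J) →
      ∀ h : G0 d ℤ, ‖productKernel d s η₀ K J j k h -
        ∑ x ∈ fractions d ⌊(2 : ℝ) ^ (3 * (d : ℝ) ^ 2 * ε * J)⌋₊, e (pairing (fracPoint x) h) *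
        expSum (r := M * N) (word d s) x.1 x.2 *
        ∫ β : Y d → ℝ, (bump η₀ (fun l => (2 : ℝ) ^ (J * (deg l - 2 * ε))) β : ℂ) *
        (e (pairing β h) * ∫ x, wordFun s (mergedKernel η₀ K j k) β x)‖
      ≤ A * 2 ^ (J * (6 * κ * (M * N) + d - M * (ε / (2 * C)))) +
        A * 2 ^ (J * (6 * κ * (M * N) + 3 * d ^ 2 * ε * (Fintype.card (Y d) + 2) - 1 + 2 * ε -
          homDim d + 2 * ε * Fintype.card (Y d))) := by
  obtain ⟨C, hC, hmin⟩ := norm_wordSum_le_or_major d hd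
  refine ⟨C, hC, fun N M hN ε κ hε hεX hκ hκ1 hZ s η₀ hη => ?_⟩
  obtain ⟨C', hC', hmin⟩ := hmin N M hN
  obtain ⟨CR, hCR, hmaj⟩ := exists_norm_wordSum_sub_expSum_mul_le d (M * N)
  obtain ⟨hε1, hε2, -⟩ := paramBound_consequences hε hεX
  have hC0 : (1 : ℝ) ≤ C := by exact_mod_cast hC
  refine ⟨C' * 4 ^ d + CR * (2 * 16 ^ d) * 4 ^ Fintype.card (Y d), by positivity, ?_⟩
  filter_upwards [eventually_abs_dyadicKernel_le hη hκ hκ1, Filter.eventually_ge_atTop 5,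
    eventually_le_two_rpow C (half_pos hε)] with J hW hJ hJC K hK j k hj hk h
  have hJ0 : 0 ≤ J := by linarith
  set P : ℕ := scale J with hP
  have hP0 : (0 : ℝ) < P := lt_of_lt_of_le (by positivity) (two_rpow_le_scale J)
  set δ : ℝ := ε / (2 * C) with hδ
  have hδ0 : 0 < δ := by positivity
  set Lam : ℝ := 2 ^ (3 * κ * J) with hLam
  have hLam1 : 1 ≤ Lam := Real.one_le_rpow one_le_two (by positivity)
  set W := mergedKernel η₀ K j k with hWdef
  have hWb : ∀ i, (∀ t, |W i t| ≤ Lam / P) ∧ (∀ t u, |W i t - W i u| ≤ Lam / P / P * |t - u|) ∧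
      ∀ t : ℝ, P < |t| → W i t = 0 := by
    rintro (i | i)
    · exact hW K hK (j i) (hj i)
    · exact hW K hK (k i) (hk i)
  have hWc : ∀ i, Continuous (W i) := by
    rintro (i | i) <;> exact continuous_dyadicKernel hη hK _
  have hstep : ∀ i (n : ℤ), ‖(W i ((n + 1 : ℤ) : ℝ) : ℂ) - W i n‖ ≤ Lam / P / P := by
    intro i n
    rw [← Complex.ofReal_sub, Complex.norm_real, Real.norm_eq_abs]
    refine ((hWb i).2.1 _ _).trans (le_of_eq ?_)
    push_cast
    rw [add_sub_cancel_left, abs_one, mul_one]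
  have hsize : ∀ i (n : ℤ), ‖(W i n : ℂ)‖ ≤ Lam / P := by
    intro i n
    rw [Complex.norm_real]
    exact (hWb i).1 n
  -- the polynomial scale
  have hK1 : C * ((2 : ℝ) ^ (δ * J)) ^ C ≤ 2 ^ (ε * J) := by
    have h1 : ((2 : ℝ) ^ (δ * J)) ^ C = 2 ^ (ε / 2 * J) := by
      rw [← Real.rpow_mul_natCast two_pos.le, hδ]; congr 1; field_simp
    rw [h1, show ε * J = ε / 2 * J + ε / 2 * J by ring, Real.rpow_add two_pos]
    gcongr
  have hK2 : C * ((2 : ℝ) ^ (δ * J)) ^ C ≤ P := by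
    refine hK1.trans (le_trans ?_ (two_rpow_le_scale J))
    refine Real.rpow_le_rpow_of_exponent_le one_le_two ?_
    nlinarith
  have hK3 : (P : ℝ) ^ degZ d ≤ ((2 : ℝ) ^ (δ * J)) ^ (2 * N) := by
    have h1 : (P : ℝ) ≤ 2 ^ (2 * J) := by
      refine (scale_le hJ0).trans ?_
      rw [show (4 : ℝ) = 2 ^ (2 : ℝ) by norm_num, ← Real.rpow_add two_pos]
      exact Real.rpow_le_rpow_of_exponent_le one_le_two (by linarith)
    refine (pow_le_pow_left₀ hP0.le h1 _).trans ?_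
    rw [← Real.rpow_mul_natCast two_pos.le, ← Real.rpow_mul_natCast two_pos.le]
    refine Real.rpow_le_rpow_of_exponent_le one_le_two ?_
    push_cast
    nlinarith
  set R : ℕ := ⌊(2 : ℝ) ^ (3 * (d : ℝ) ^ 2 * ε * J)⌋₊ with hR
  have hRle : (R : ℝ) ≤ 2 ^ (3 * (d : ℝ) ^ 2 * ε * J) := Nat.floor_le (by positivity)
  have hd' : (1 : ℝ) ≤ d := by exact_mod_cast hd
  have hdd : (1 : ℝ) ≤ (d : ℝ) ^ 2 := one_le_pow₀ hd'
  have hRP : R ≤ P := by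
    have : (R : ℝ) ≤ P := by
      refine hRle.trans (le_trans ?_ (two_rpow_le_scale J))
      refine Real.rpow_le_rpow_of_exponent_le one_le_two ?_
      nlinarith
    exact_mod_cast this
  set b : Y d → ℝ := fun l => (2 : ℝ) ^ (J * (deg l - 2 * ε)) with hb
  have hdeg : ∀ l : Y d, (1 : ℝ) ≤ deg l := fun l => by exact_mod_cast deg_pos l
  have hb0 : ∀ l, 0 < b l := fun l => by positivity
  have hbR : ∀ l, 4 * (R : ℝ) ^ 2 < b l := by
    intro l
    calc 4 * (R : ℝ) ^ 2 ≤ 4 * (2 ^ (3 * (d : ℝ) ^ 2 * ε * J)) ^ 2 := by gcongr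
      _ = 2 ^ (2 + 3 * (d : ℝ) ^ 2 * ε * J * (2 : ℕ)) := by
        rw [Real.rpow_add two_pos, Real.rpow_mul_natCast two_pos.le]; norm_num
      _ < b l := by
        refine Real.rpow_lt_rpow_of_exponent_lt one_lt_two ?_
        have h1 := hdeg l
        push_cast
        nlinarith
  have hb2 : ∀ l, 2 < b l := by
    intro l
    refine lt_of_eq_of_lt (Real.rpow_one 2).symm (Real.rpow_lt_rpow_of_exponent_lt one_lt_two ?_)
    have h1 := hdeg l
    nlinarith
  set Q : ℝ := 2 * 16 ^ d * 2 ^ (2 * ε * J) with hQ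
  have hQ1 : 1 ≤ Q := by
    have h1 : (1 : ℝ) ≤ 2 ^ (2 * ε * J) := Real.one_le_rpow one_le_two (by positivity)
    have h2 : (1 : ℝ) ≤ 16 ^ d := one_le_pow₀ (by norm_num)
    nlinarith
  set Am : ℝ := C' * P ^ d * Lam ^ (2 * (M * N)) * (((2 : ℝ) ^ (δ * J)) ^ M)⁻¹ with hAm
  set ρ : ℝ := CR * (Lam / P * P) ^ (2 * (M * N)) * (R / P * Q) with hρ
  have hLamP : Lam / P * P = Lam := div_mul_cancel₀ _ hP0.ne'
  have hmain := norm_fourierCoeff_sub_major_le (d := d) hη (R := R) (b := b) hbR hb2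
    (S := wordSum s P (fun i n => (W (Sum.inl i) n : ℂ)) fun i n => (W (Sum.inr i) n : ℂ))
    (I := fun β => ∫ x, wordFun s W β x) (continuous_wordSum s P _ _)
    (continuous_integral_wordFun s hWc hP0.le fun i => (hWb i).2.2)
    (wordSum_add_int s P _ _) (A := Am) (ρ := ρ) (by positivity) (by positivity) ?_
    (E := fun x => expSum (r := M * N) (word d s) x.1 x.2) ?_ h
  · rw [← wordKernel_eq_integral] at hmain
    refine hmain.trans (add_le_add ?_ ?_)
    · have h1 : Lam ^ (2 * (M * N)) = 2 ^ (J * (6 * κ * (M * N))) := by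
        rw [hLam, ← Real.rpow_mul_natCast two_pos.le]; congr 1; push_cast; ring
      have h2 : (((2 : ℝ) ^ (δ * J)) ^ M)⁻¹ = 2 ^ (J * (-(M * δ))) := by
        rw [← Real.rpow_mul_natCast two_pos.le, ← Real.rpow_neg two_pos.le]; congr 1; ring
      calc Am ≤ C' * (4 ^ d * 2 ^ (J * d)) * 2 ^ (J * (6 * κ * (M * N))) * 2 ^ (J * (-(M * δ))) := by
            rw [hAm, h1, h2]
            gcongr
            exact scale_pow_le hJ0 d
        _ = C' * 4 ^ d * 2 ^ (J * (6 * κ * (M * N) + d - M * δ)) := by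
            rw [show J * (6 * κ * (M * N) + d - M * δ)
              = J * d + J * (6 * κ * (M * N)) + J * (-(M * δ)) by ring,
              Real.rpow_add two_pos, Real.rpow_add two_pos]
            ring
        _ ≤ _ := by
            gcongr
            exact le_add_of_nonneg_right (by positivity)
    · have h1 : (Lam / P * P) ^ (2 * (M * N)) = 2 ^ (J * (6 * κ * (M * N))) := by
        rw [hLamP, hLam, ← Real.rpow_mul_natCast two_pos.le]; congr 1; push_cast; ring
      have h2 : ∏ l, 4 / b l
          = 4 ^ Fintype.card (Y d) * 2 ^ (J * (-homDim d + 2 * ε * Fintype.card (Y d))) := by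
        have h3 : ∀ l : Y d, 4 / b l = 4 * 2 ^ (2 * ε * J) * 2 ^ (-J * deg l) := by
          intro l
          rw [hb, mul_assoc, ← Real.rpow_add two_pos, div_eq_mul_inv, ← Real.rpow_neg two_pos.le]
          congr 2; ring
        rw [Finset.prod_congr rfl fun l _ => h3 l, prod_mul_rpow_deg, mul_pow,
          ← Real.rpow_mul_natCast two_pos.le, mul_assoc, ← Real.rpow_add two_pos]
        congr 2; ring
      have h4 : (R : ℝ) / P ≤ 2 ^ (J * (3 * (d : ℝ) ^ 2 * ε - 1)) := by
        rw [div_le_iff₀ hP0]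
        calc (R : ℝ) ≤ 2 ^ (3 * (d : ℝ) ^ 2 * ε * J) := hRle
          _ = 2 ^ (J * (3 * (d : ℝ) ^ 2 * ε - 1)) * 2 ^ J := by
            rw [← Real.rpow_add two_pos]; congr 1; ring
          _ ≤ _ := by gcongr; exact two_rpow_le_scale J
      have h5 : (R : ℝ) ^ (Fintype.card (Y d) + 1)
          ≤ 2 ^ (J * (3 * (d : ℝ) ^ 2 * ε * (Fintype.card (Y d) + 1))) := by
        refine (pow_le_pow_left₀ (by positivity) hRle _).trans (le_of_eq ?_)
        rw [← Real.rpow_mul_natCast two_pos.le]; congr 1; push_cast; ring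
      have h6 : Q = 2 * 16 ^ d * 2 ^ (J * (2 * ε)) := by rw [hQ, mul_comm J]
      rw [hρ, h1, h2, h6]
      calc _ ≤ 2 ^ (J * (3 * (d : ℝ) ^ 2 * ε * (Fintype.card (Y d) + 1))) *
            (CR * 2 ^ (J * (6 * κ * (M * N))) * (2 ^ (J * (3 * (d : ℝ) ^ 2 * ε - 1)) *
            (2 * 16 ^ d * 2 ^ (J * (2 * ε)))) *
            (4 ^ Fintype.card (Y d) * 2 ^ (J * (-homDim d + 2 * ε * Fintype.card (Y d))))) := by
            gcongr
        _ = CR * (2 * 16 ^ d) * 4 ^ Fintype.card (Y d) * 2 ^ (J * (6 * κ * (M * N) +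
            3 * d ^ 2 * ε * (Fintype.card (Y d) + 2) - 1 + 2 * ε -
            homDim d + 2 * ε * Fintype.card (Y d))) := by
            rw [show J * (6 * κ * (M * N) + 3 * d ^ 2 * ε * (Fintype.card (Y d) + 2) - 1 + 2 * ε -
              homDim d + 2 * ε * Fintype.card (Y d))
              = J * (3 * (d : ℝ) ^ 2 * ε * (Fintype.card (Y d) + 1)) + J * (6 * κ * (M * N)) +
                J * (3 * (d : ℝ) ^ 2 * ε - 1) + J * (2 * ε) +
                J * (-homDim d + 2 * ε * Fintype.card (Y d)) by ring,
              Real.rpow_add two_pos, Real.rpow_add two_pos, Real.rpow_add two_pos,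
              Real.rpow_add two_pos]
            ring
        _ ≤ _ := by
            gcongr
            exact le_add_of_nonneg_left (by positivity)
  · intro θ
    refine (hmin s P (2 ^ (δ * J)) Lam (Real.one_le_rpow one_le_two (by positivity)) hLam1 hK2 hK3 _ _
      (fun i => hsize _) (fun i => hsize _) (fun i => hstep _) (fun i => hstep _) θ).imp id ?_
    rintro ⟨q, hq1, hq, ha⟩
    have hq0 : (1 : ℝ) ≤ q := by exact_mod_cast hq1
    refine ⟨q, hq1, Nat.le_floor ((hq.trans hK1).trans ?_), fun l => ?_⟩
    · refine Real.rpow_le_rpow_of_exponent_le one_le_two ?_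
      gcongr
      nlinarith
    · obtain ⟨a, ha⟩ := ha l
      refine ⟨a, ?_⟩
      have h1 : θ l - a / q = (q * θ l - a) / q := by field_simp
      rw [h1, abs_mul, abs_of_pos (hb0 l), abs_div, abs_of_nonneg (by linarith : (0 : ℝ) ≤ q)]
      have h2 : |q * θ l - a| / q ≤ 2 ^ (ε * J) / 2 ^ (J * deg l) := by
        refine (div_le_self (abs_nonneg _) hq0).trans (ha.trans ?_)
        gcongr
        exact le_scale_pow_deg l
      calc _ ≤ b l * (2 ^ (ε * J) / 2 ^ (J * deg l)) := by gcongr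
        _ = 2 ^ (-(ε * J)) := by
          rw [hb, ← Real.rpow_sub two_pos, ← Real.rpow_add two_pos]; congr 1; ring
        _ ≤ 1 := Real.rpow_le_one_of_one_le_of_nonpos one_le_two (by nlinarith)
  · intro x hx β hβ
    have hx' := (mem_fractions.1 hx).1
    refine (hmaj s P x.1 Q (Lam / P) hx'.1 (hx'.2.trans hRP) hQ1 W (fun i => (hWb i).1)
      (fun i => (hWb i).2.1) (fun i => (hWb i).2.2) hWc x.2 β fun l => ?_).trans ?_
    · have h1 := hβ l
      rw [abs_mul, abs_of_pos (hb0 l), ← le_div_iff₀' (hb0 l)] at h1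
      refine h1.trans ?_
      rw [div_le_div_iff₀ (hb0 l) (by positivity)]
      calc 2 * (P : ℝ) ^ deg l ≤ 2 * (16 ^ d * 2 ^ (J * deg l)) := by
            gcongr; exact scale_pow_deg_le hJ0 l
        _ = Q * b l := by
          rw [hQ, hb, mul_assoc (2 * 16 ^ d : ℝ), ← Real.rpow_add two_pos, ← mul_assoc]
          congr 2; ring
    · rw [hρ]
      have : (x.1 : ℝ) ≤ R := by exact_mod_cast hx'.2
      gcongr

end DiscreteRadon
end

noncomputable section
namespace DiscreteRadon

open MeasureTheory

variable {d : ℕ}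

theorem le_paramBound : 28 ≤ paramBound d := by
  have : (0 : ℝ) ≤ 12 * (d : ℝ) ^ 2 * (Fintype.card (Y d) + 2) + 4 * Fintype.card (Y d) +
    2 * homDim d := by positivity
  rw [paramBound]
  linarith

theorem eventually_productKernel_support (d r : ℕ) {ε : ℝ} (hε : 0 < ε) : ∀ᶠ J : ℝ in Filter.atTop,
    ∀ (s : Bool) (η₀ K : ℝ → ℝ) (j k : Fin r → ℕ) (h : G0 d ℤ), productKernel d s η₀ K J j k h ≠ 0 →
      ∀ l, |(h.coord l : ℝ)| ≤ 2 ^ ((J + ε * J) * deg l) := by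
  obtain ⟨c, hc, hsupp⟩ := exists_abs_coord_le_of_wordKernel_ne_zero d r
  filter_upwards [eventually_le_two_rpow (c * 4) hε, Filter.eventually_ge_atTop 0]
    with J hJ hJ0 s η₀ K j k h hh l
  calc |(h.coord l : ℝ)| ≤ c * scale J ^ deg l := hsupp s (scale J) _ _ h hh l
    _ ≤ c ^ deg l * (4 ^ deg l * 2 ^ (J * deg l)) := by
      gcongr
      · exact le_self_pow₀ hc (by have := deg_pos l; omega)
      · exact scale_pow_le hJ0 _
    _ = (c * 4) ^ deg l * 2 ^ (J * deg l) := by ring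
    _ ≤ (2 ^ (ε * J)) ^ deg l * 2 ^ (J * deg l) := by gcongr
    _ = 2 ^ ((J + ε * J) * deg l) := by
      rw [← Real.rpow_mul_natCast two_pos.le, ← Real.rpow_add two_pos]; congr 1; ring

theorem exists_summable_error (d : ℕ) (hd : 1 ≤ d) : ∃ C : ℕ, 1 ≤ C ∧
    ∀ (N M : ℕ), 1 ≤ N → ∀ ε κ : ℝ, 0 < ε → ε * paramBound d ≤ 1 → paramBound d ≤ (M * N : ℕ) →
    κ * ((M * N : ℕ) : ℝ) ^ 2 = 1 → degZ d ≤ ε / (2 * C) * N →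
    2 * homDim d + d + 7 ≤ M * (ε / (2 * C)) → ∀ (s : Bool) {η₀ : ℝ → ℝ}, IsCutoff η₀ →
    ∃ A : ℝ, ∀ᶠ J : ℝ in Filter.atTop, ∀ K, IsCalderonZygmund K → ∀ j k : Fin (M * N) → ℕ,
      (∀ i, (j i : ℝ) ∈ Set.Icc (J * (1 - κ)) J) → (∀ i, (k i : ℝ) ∈ Set.Icc (J * (1 - κ)) J) →
      Summable (fun h => ‖productKernel d s η₀ K J j k h
        - majorArc (word d s) (word d s) η₀ K ε J j k h‖) ∧
      ∑' h, ‖productKernel d s η₀ K J j k h - majorArc (word d s) (word d s) η₀ K ε J j k h‖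
        ≤ A * 2 ^ (-J / 4) := by
  obtain ⟨C, hC, hmain⟩ := eventually_norm_productKernel_sub_le d hd
  refine ⟨C, hC, fun N M hN ε κ hε hεX hX hκ hZ hT s η₀ hη => ?_⟩
  set r : ℝ := ((M * N : ℕ) : ℝ) with hr
  have hr24 : 28 ≤ r := le_paramBound.trans hX
  have hκ0 : 0 < κ := by
    by_contra! h0
    nlinarith [sq_nonneg r]
  have hκr : κ * r * r = 1 := by rw [← hκ]; ring
  have hκr1 : κ * r ≤ 1 / 28 := by nlinarith [mul_pos hκ0 (by linarith : 0 < r)]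
  obtain ⟨hε1, hε2, hε3⟩ := paramBound_consequences hε hεX
  obtain ⟨A, hA, hbd⟩ := hmain N M hN ε κ hε hεX hκ0 (by nlinarith) hZ s hη
  refine ⟨6 ^ Fintype.card (Y d) * (A + A), ?_⟩
  filter_upwards [hbd, eventually_productKernel_support d (M * N) hε, Filter.eventually_ge_atTop 0]
    with J hbd hsupp hJ K hK j k hj hk
  have h1 := summable_norm_sub_cutoff hη (lam := J + ε * J) (by positivity)
    (hbd K hK j k hj hk) (hsupp s η₀ K j k)
  simp only [majorArc_eq]
  refine ⟨h1.1, h1.2.trans ?_⟩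
  have hcast : (M : ℝ) * N = r := by rw [hr]; push_cast; rfl
  rw [prod_mul_rpow_deg, hcast, mul_assoc ((6 : ℝ) ^ Fintype.card (Y d)) (2 ^ _),
    mul_assoc ((6 : ℝ) ^ Fintype.card (Y d)) (A + A)]
  gcongr _ * ?_
  rw [mul_add, add_mul A A, mul_left_comm (2 ^ _) A, mul_left_comm (2 ^ _) A,
    ← Real.rpow_add two_pos, ← Real.rpow_add two_pos]
  have hD : (homDim d : ℝ) * ε ≤ homDim d := mul_le_of_le_one_right (by positivity) (by linarith)
  gcongr
  · norm_num
  · nlinarith [mul_nonneg hJ (by linarith : 0 ≤ M * (ε / (2 * C)) - (2 * homDim d + d + 7 : ℝ)),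
      mul_nonneg hJ (by linarith : (0 : ℝ) ≤ homDim d - homDim d * ε),
      mul_nonneg hJ (by linarith : 0 ≤ 1 / 28 - κ * r)]
  · norm_num
  · nlinarith [mul_nonneg hJ (by linarith : 0 ≤ 1 / 28 - κ * r), mul_nonneg hJ (by linarith :
      0 ≤ 1 / 2 - (homDim d * ε + 3 * d ^ 2 * ε * (Fintype.card (Y d) + 2) + 2 * ε +
        2 * ε * Fintype.card (Y d)))]

theorem hasSum_productKernel_true {η₀ : ℝ → ℝ} (hη : IsCutoff η₀) (K : ℝ → ℝ) {J : ℝ} {r : ℕ}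
    {j k : Fin r → ℕ} (hj : ∀ i, (j i : ℝ) ≤ J) (hk : ∀ i, (k i : ℝ) ≤ J) (F : L2 d) (g : G0 d ℤ) :
    HasSum (fun h => productKernel d true η₀ K J j k h * F (h⁻¹ * g)) (prodHstarH d η₀ K j k F g) := by
  have h1 : prodHstarH d η₀ K j k = _ := congrArg (fun f => (List.ofFn f).prod) (funext fun i => by
    rw [adjoint_H_eq_curveOp hη K (two_pow_le_scale (hj i)),
      H_eq_curveOp hη K (two_pow_le_scale (hk i))])
  rw [h1]
  exact hasSum_wordKernel_mul true (scale J) _ _ F g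

theorem hasSum_productKernel_false {η₀ : ℝ → ℝ} (hη : IsCutoff η₀) (K : ℝ → ℝ) {J : ℝ} {r : ℕ}
    {j k : Fin r → ℕ} (hj : ∀ i, (j i : ℝ) ≤ J) (hk : ∀ i, (k i : ℝ) ≤ J) (F : L2 d) (g : G0 d ℤ) :
    HasSum (fun h => productKernel d false η₀ K J j k h * F (h⁻¹ * g))
      (prodHHstar d η₀ K j k F g) := by
  have h1 : prodHHstar d η₀ K j k = _ := congrArg (fun f => (List.ofFn f).prod) (funext fun i => by
    rw [adjoint_H_eq_curveOp hη K (two_pow_le_scale (hk i)),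
      H_eq_curveOp hη K (two_pow_le_scale (hj i))])
  rw [h1]
  exact hasSum_wordKernel_mul false (scale J) _ _ F g

theorem one_le_degZ (hd : 1 ≤ d) : 1 ≤ degZ d := by
  have h : ((1, 0) : ℕ × ℕ) ∈ pairs d := mem_pairs.2 ⟨Nat.zero_lt_one, hd⟩
  exact (Finset.single_le_sum (f := fun l : Z d => deg l.1) (fun _ _ => Nat.zero_le _)
    (Finset.mem_univ (⟨⟨(1, 0), h⟩, rfl⟩ : Z d)))

end DiscreteRadon
end

theorem mainTheorem7 (d : ℕ) (hd : 1 ≤ d) :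
    ∃ Cbar₀ : ℝ, 0 < Cbar₀ ∧ ∀ Cbar : ℝ, Cbar₀ ≤ Cbar →
      ∀ (ε κ : ℝ) (r : ℕ), (∃ s : ℕ, r = 2 ^ s) →
        ε = Cbar⁻¹ * ((10 * (d : ℝ)) ^ 10)⁻¹ →
        (10 * (d : ℝ)) ^ 10 ≤ -2 * Cbar + r * ε / (2 * Cbar) →
        κ * (r : ℝ) ^ 2 = 1 →
      ∀ η₀ : ℝ → ℝ, DiscreteRadon.IsCutoff η₀ →
      ∃ C₁ C₂ : ℝ, ∀ K : ℝ → ℝ, DiscreteRadon.IsCalderonZygmund K →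
        ∀ J : ℝ, C₁ ≤ J →
        ∀ j k : Fin r → ℕ,
          (∀ i, (j i : ℝ) ∈ Set.Icc (J * (1 - κ)) J) →
          (∀ i, (k i : ℝ) ∈ Set.Icc (J * (1 - κ)) J) →
        ∃ E Etilde : DiscreteRadon.G0 d ℤ → ℂ,
          Summable (fun h => ‖E h‖) ∧ Summable (fun h => ‖Etilde h‖) ∧
          (∑' h, ‖E h‖) + (∑' h, ‖Etilde h‖) ≤ C₂ * (2 : ℝ) ^ (-J / 4) ∧
          (∀ (F : DiscreteRadon.L2 d) (g : DiscreteRadon.G0 d ℤ),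
            HasSum
              (fun h => (DiscreteRadon.majorKernel d η₀ K ε J j k h + E h) * F (h⁻¹ * g))
              (DiscreteRadon.prodHstarH d η₀ K j k F g)) ∧
          (∀ (F : DiscreteRadon.L2 d) (g : DiscreteRadon.G0 d ℤ),
            HasSum
              (fun h => (DiscreteRadon.majorKernelTilde d η₀ K ε J j k h + Etilde h) *
                F (h⁻¹ * g))
              (DiscreteRadon.prodHHstar d η₀ K j k F g)) := by
  obtain ⟨C, hC, herr⟩ := DiscreteRadon.exists_summable_error d hd
  obtain ⟨B, hB, hpar⟩ := DiscreteRadon.exists_parameters hd hC (DiscreteRadon.one_le_degZ hd)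
    (T := 2 * DiscreteRadon.homDim d + d + 7) (X := DiscreteRadon.paramBound d)
    (by have : (0 : ℝ) ≤ 2 * DiscreteRadon.homDim d + d := by positivity
        linarith)
    (le_trans (by norm_num) DiscreteRadon.le_paramBound)
  refine ⟨B, hB, fun Cbar hCbar ε κ r hr hε hrε hκ η₀ hη => ?_⟩
  obtain ⟨hε0, hεX, hX, N, M, hN, rfl, hZ, hT⟩ := hpar Cbar hCbar ε r hr hε hrε
  have hev := fun s => herr N M hN ε κ hε0 hεX hX hκ hZ hT s hη
  obtain ⟨A, hA⟩ := hev true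
  obtain ⟨A', hA'⟩ := hev false
  obtain ⟨C₁, hC₁⟩ := Filter.eventually_atTop.1 (hA.and hA')
  refine ⟨C₁, A + A', fun K hK J hJ j k hj hk => ?_⟩
  obtain ⟨h1, h2⟩ := hC₁ J hJ
  obtain ⟨h1s, h1⟩ := h1 K hK j k hj hk
  obtain ⟨h2s, h2⟩ := h2 K hK j k hj hk
  refine ⟨_, _, h1s, h2s, ?_, fun F g => ?_, fun F g => ?_⟩
  · rw [add_mul]
    exact add_le_add h1 h2
  · convert DiscreteRadon.hasSum_productKernel_true hη K (fun i => (hj i).2) (fun i => (hk i).2) F g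
      using 3
    exact add_sub_cancel _ _
  · convert DiscreteRadon.hasSum_productKernel_false hη K (fun i => (hj i).2) (fun i => (hk i).2) F g
      using 3
    exact add_sub_cancel _ _
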